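/- **Setting.** Let $m\ge 3$ be an integer, let $b_m^*$ be the unique solution in $(0,1)$ of $1+b^m-\frac{1-b^2}{2}m=0$, let $b\in(0,b_m^*)$ and $\alpha\in(0,1)$. Write $\mathbb T$ for the unit circle, $e_n(w)=\operatorname{Im}(\overline w^{\,n})$, $b_1=1$, $b_2=b$. Let $$X_m=\Big\{f=(f_1,f_2)\in C^{1+\alpha}(\mathbb T)^2:\ f(w)=\sum_{n\ge1}A_n\overline w^{\,nm-1},\ A_n\in\mathbb R^2\Big\}.$$ For $\lambda\in\mathbb R$ and $f\in X_m$ put $\Phi_j(w)=b_jw+f_j(w)$ and $G=(G_1,G_2)$, $$G_j(\lambda,f)(w)=\operatorname{Im}\Big\{\big((1-\lambda)\overline{\Phi_j(w)}+I(\Phi_j(w))\big)\,w\,\Phi_j'(w)\Big\},$$ $$I(z)=\frac1{2i\pi}\int_{\mathbb T}\frac{\overline z-\overline{\Phi_1(\xi)}}{z-\Phi_1(\xi)}\Phi_1'(\xi)\,d\xi-\frac1{2i\pi}\int_{\mathbb T}\frac{\overline z-\overline{\Phi_2(\xi)}}{z-\Phi_2(\xi)}\Phi_2'(\xi)\,d\xi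 .$$ Let $\partial_fG(\lambda,f)h=\frac{d}{d\tau}G(\lambda,f+\tau h)|_{\tau=0}$, $$M_n(\lambda)=\begin{pmatrix} n\lambda-1-nb^2& b^{n+1}\\ -b^n& b(n\lambda-n+1)\end{pmatrix},\qquad \lambda_m^\pm=\frac{1+b^2}{2}\pm\frac1m\sqrt{\Delta_m},\qquad \Delta_m=\Big(\frac{1-b^2}2m-1\Big)^2-b^{2m}.$$ Fix one of the two signs, and put $$v_m(w)=\begin{pmatrix}\frac{m\lambda_m^\pm-m+1}{b^{m-1}}\\ 1\end{pmatrix}\overline w^{\,m-1},\qquad \widehat{\mathbb W}_m=\frac{1}{\sqrt{(m\lambda_m^\pm-m+1)^2+b^{2m}}}\begin{pmatrix}m\lambda_m^\pm-m+1\\ -b^m\end{pmatrix},\qquad \mathbb W_m=\widehat{\mathbb W}_m e_m,$$ let $\mathcal X_m\subset X_m$ be the closed subspace of all $h\in X_m$ of the form $h=\sum_{n\ge2}A_n\overline w^{\,nm-1}+a\binom10\overline w^{\,m-1}$ ($A_n\in\mathbb R^2$, $a\in\mathbb R$), so that $X_m=\langle v_m\rangle\oplus\mathcal X_m$, and let $Q\big(\sum_{n\ge1}B_ne_{nm}\big)=\langle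 B_1,\widehat{\mathbb W}_m\rangle\,\mathbb W_m$. **Statement.** (0) Near $(\lambda_m^\pm,0,0)$ in $\mathbb R\times\langle v_m\rangle\times\mathcal X_m$ the solutions of $(\mathrm{Id}-Q)\,G(\lambda,g+k)=0$ are exactly the points of the graph $k=\varphi(\lambda,g)$ of a map $\varphi:\mathbb R\times\langle v_m\rangle\to\mathcal X_m$ that is smooth near $(\lambda_m^\pm,0)$; and $\det M_{2m}(\lambda_m^\pm)\neq0$. For any such $\varphi$, the reduced bifurcation function $$F_2(\lambda,t)=\int_0^1Q\,\partial_fG\big(\lambda,stv_m+\varphi(\lambda,stv_m)\big)\big(v_m+\partial_g\varphi(\lambda,stv_m)v_m\big)\,ds\ \in\langle\mathbb W_m\rangle$$ is of class $C^2$ near $(\lambda_m^\pm,0)$, and: 1. $\partial_tF_2(\lambda_m^\pm,0)=0$. 2. $\displaystyle\partial_\lambda F_2(\lambda_m^\pm,0)=\frac{m[(m\lambda_m^\pm-m+1)^2-b^{2m}]}{b^{m-1}[(m\lambda_m^\pm-m+1)^2+b^{2m}]^{1/2}}\,\mathbb W_m$. 3. $\displaystyle\partial_{\lambda\lambda}F_2(\lambda_m^\pm,0)=\frac{4m^2b^{1-m}(m\lambda_m^\pm-m+1)^3}{[(m\lambda_m^\pm-m+1)^2+b^{2m}]^{3/2}}\,\mathbb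 W_m$. 4. $\displaystyle\partial_{tt}F_2(\lambda_m^\pm,0)=-m(m-1)b^{3-3m}\frac{\big(b^{2m-2}-(m\lambda_m^\pm-m+1)^2\big)^2}{[(m\lambda_m^\pm-m+1)^2+b^{2m}]^{1/2}}\,\mathbb W_m+\widetilde\beta_m\mathcal K_m\,\mathbb W_m$, where $$\mathcal K_m=\frac{b^{1-m}(m\lambda_m^\pm-1)(m\lambda_m^\pm-m+1)^2+(1-2m)(m\lambda_m^\pm-m+1)b^{m+1}+mb^{3m-1}}{[(m\lambda_m^\pm-m+1)^2+b^{2m}]^{1/2}}\,(2\lambda_m^\pm m-2m+1),$$ $$\widetilde\beta_m=-\frac{2bm\big(b^m-b^{2-m}(m\lambda_m^\pm-m+1)\big)^2}{\det M_{2m}(\lambda_m^\pm)} .$$ 5. $\partial_\lambda\partial_tF_2(\lambda_m^\pm,0)=0$. -/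

import Mathlib

open Set Filter Topology MeasureTheory
open scoped NNReal ContDiff ComplexConjugate

noncomputable section

namespace VStates

/-! ### Hölder spaces on the unit circle -/

/-- Hölder exponents `α ∈ (0, 1)`. -/
abbrev HolderExp : Type := {α : ℝ≥0 // 0 < α ∧ α < 1}

section Holder

variable (E : Type) [NormedAddCommGroup E] [NormedSpace ℝ E]

/-- Continuous functions on the circle that are Hölder continuous of exponent `α` for the
chordal distance `|τ - w|`. -/
def holderSubmodule (α : HolderExp) : Submodule ℝ C(Circle, E) where
  carrier := {f | MemHolder α.1 (f : Circle → E)}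
  zero_mem' := memHolder_zero
  add_mem' hf hg := hf.add hg
  smul_mem' _ _ hf := hf.smul

/-- The space `C^α(𝕋; E)`. -/
def CHolder (α : HolderExp) : Type := ↥(holderSubmodule E α)

variable {E} {α : HolderExp}

instance : AddCommGroup (CHolder E α) := inferInstanceAs (AddCommGroup ↥(holderSubmodule E α))

instance : Module ℝ (CHolder E α) := inferInstanceAs (Module ℝ ↥(holderSubmodule E α))

/-- The underlying continuous function. -/
def CHolder.toC : CHolder E α →ₗ[ℝ] C(Circle, E) := (holderSubmodule E α).subtype

instance : CoeFun (CHolder E α) fun _ => Circle → E := ⟨fun f w => f.toC w⟩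

theorem CHolder.memHolder (f : CHolder E α) : MemHolder α.1 (f.toC : Circle → E) := f.2

/-- The Hölder norm: sup norm plus Hölder seminorm. -/
instance : Norm (CHolder E α) := ⟨fun f => ‖f.toC‖ + (nnHolderNorm α.1 (f.toC : Circle → E) : ℝ)⟩

theorem CHolder.norm_def (f : CHolder E α) :
    ‖f‖ = ‖f.toC‖ + (nnHolderNorm α.1 (f.toC : Circle → E) : ℝ) := rfl

theorem CHolder.core : NormedSpace.Core ℝ (CHolder E α) where
  norm_nonneg f := by rw [CHolder.norm_def]; positivity
  norm_smul c f := by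
    have h := f.memHolder.nnHolderNorm_smul c
    have h' : nnHolderNorm α.1 ((c • f).toC : Circle → E) =
        ‖c‖₊ * nnHolderNorm α.1 (f.toC : Circle → E) := by
      rw [← h]; simp
    rw [CHolder.norm_def, CHolder.norm_def, h', map_smul, norm_smul]
    push_cast
    ring
  norm_triangle f g := by
    have h := f.memHolder.nnHolderNorm_add_le g.memHolder
    have h' : nnHolderNorm α.1 ((f + g).toC : Circle → E) ≤
        nnHolderNorm α.1 (f.toC : Circle → E) + nnHolderNorm α.1 (g.toC : Circle → E) := by
      refine le_trans (le_of_eq ?_) h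
      simp
    have h'' : (nnHolderNorm α.1 ((f + g).toC : Circle → E) : ℝ) ≤
        nnHolderNorm α.1 (f.toC : Circle → E) + nnHolderNorm α.1 (g.toC : Circle → E) := by
      exact_mod_cast h'
    have h3 := norm_add_le f.toC g.toC
    rw [CHolder.norm_def, CHolder.norm_def, CHolder.norm_def]
    rw [map_add] at *
    linarith
  norm_eq_zero_iff f := by
    constructor
    · intro h
      rw [CHolder.norm_def] at h
      have h1 : ‖f.toC‖ = 0 := by
        have := norm_nonneg f.toC
        have h2 : (0 : ℝ) ≤ (nnHolderNorm α.1 (f.toC : Circle → E) : ℝ) := NNReal.coe_nonneg _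
        linarith
      exact Subtype.ext (norm_eq_zero.1 h1)
    · rintro rfl
      rw [CHolder.norm_def, map_zero, ContinuousMap.coe_zero, nnHolderNorm_zero]
      simp

instance : NormedAddCommGroup (CHolder E α) := NormedAddCommGroup.ofCore CHolder.core

instance : NormedSpace ℝ (CHolder E α) := NormedSpace.ofCore CHolder.core

end Holder

/-- The complex derivative `df/dw` along the unit circle, `f'(w) = ∂_θ f(e^{iθ} w)|_{θ=0} / (i w)`. -/
def circleDeriv (f : Circle → ℂ) (w : Circle) : ℂ :=
  deriv (fun θ : ℝ => f (Circle.exp θ * w)) 0 / (Complex.I * (w : ℂ))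

/-- Differentiability along the circle. -/
def CircleDifferentiable (f : Circle → ℂ) : Prop :=
  ∀ w : Circle, DifferentiableAt ℝ (fun θ : ℝ => f (Circle.exp θ * w)) 0

theorem circleDeriv_add {f g : Circle → ℂ} (hf : CircleDifferentiable f)
    (hg : CircleDifferentiable g) : circleDeriv (f + g) = circleDeriv f + circleDeriv g := by
  funext w
  simp only [circleDeriv, Pi.add_apply]
  rw [deriv_fun_add (hf w) (hg w), add_div]

theorem circleDeriv_smul {f : Circle → ℂ} (c : ℝ) (hf : CircleDifferentiable f) :
    circleDeriv (c • f) = c • circleDeriv f := by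
  funext w
  simp only [circleDeriv, Pi.smul_apply]
  rw [deriv_fun_const_smul c (hf w), smul_div_assoc]

theorem circleDeriv_zero : circleDeriv 0 = 0 := by
  funext w
  simp [circleDeriv]

/-- Functions of class `C^1` on the circle whose derivative is Hölder continuous of exponent `α`. -/
def holderOneSubmodule (α : HolderExp) : Submodule ℝ C(Circle, ℂ) where
  carrier := {f | CircleDifferentiable f ∧ Continuous (circleDeriv f) ∧
    MemHolder α.1 (circleDeriv f)}
  zero_mem' := by
    refine ⟨fun w => ?_, ?_, ?_⟩
    · simp
    · rw [ContinuousMap.coe_zero, circleDeriv_zero]; exact continuous_zero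
    · rw [ContinuousMap.coe_zero, circleDeriv_zero]; exact memHolder_zero
  add_mem' {f g} hf hg := by
    refine ⟨fun w => (hf.1 w).add (hg.1 w), ?_, ?_⟩
    · rw [ContinuousMap.coe_add, circleDeriv_add hf.1 hg.1]; exact hf.2.1.add hg.2.1
    · rw [ContinuousMap.coe_add, circleDeriv_add hf.1 hg.1]; exact hf.2.2.add hg.2.2
  smul_mem' c f hf := by
    refine ⟨fun w => (hf.1 w).const_smul c, ?_, ?_⟩
    · rw [ContinuousMap.coe_smul, circleDeriv_smul c hf.1]; exact hf.2.1.const_smul c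
    · rw [ContinuousMap.coe_smul, circleDeriv_smul c hf.1]; exact hf.2.2.smul

/-- The space `C^{1+α}(𝕋; ℂ)`. -/
def C1Holder (α : HolderExp) : Type := ↥(holderOneSubmodule α)

section

variable {α : HolderExp}

instance : AddCommGroup (C1Holder α) := inferInstanceAs (AddCommGroup ↥(holderOneSubmodule α))

instance : Module ℝ (C1Holder α) := inferInstanceAs (Module ℝ ↥(holderOneSubmodule α))

/-- The underlying continuous function. -/
def C1Holder.toC : C1Holder α →ₗ[ℝ] C(Circle, ℂ) := (holderOneSubmodule α).subtype

instance : CoeFun (C1Holder α) fun _ => Circle → ℂ := ⟨fun f w => f.toC w⟩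

theorem C1Holder.mem (f : C1Holder α) : CircleDifferentiable f.toC ∧
    Continuous (circleDeriv f.toC) ∧ MemHolder α.1 (circleDeriv f.toC) := f.2

/-- The derivative as a map `C^{1+α} → C^α`. -/
def C1Holder.derivL : C1Holder α →ₗ[ℝ] CHolder ℂ α where
  toFun f := (⟨⟨circleDeriv f.toC, f.mem.2.1⟩, f.mem.2.2⟩ : ↥(holderSubmodule ℂ α))
  map_add' f g := by
    refine Subtype.ext (ContinuousMap.ext fun w => ?_)
    exact congrFun (circleDeriv_add f.mem.1 g.mem.1) w
  map_smul' c f := by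
    refine Subtype.ext (ContinuousMap.ext fun w => ?_)
    exact congrFun (circleDeriv_smul c f.mem.1) w

/-- The norm of `C^{1+α}`: `‖f‖_∞ + ‖f'‖_{C^α}`. -/
instance : Norm (C1Holder α) := ⟨fun f => ‖f.toC‖ + ‖C1Holder.derivL f‖⟩

theorem C1Holder.norm_def (f : C1Holder α) : ‖f‖ = ‖f.toC‖ + ‖C1Holder.derivL f‖ := rfl

theorem C1Holder.core : NormedSpace.Core ℝ (C1Holder α) where
  norm_nonneg f := by rw [C1Holder.norm_def]; positivity
  norm_smul c f := by
    rw [C1Holder.norm_def, C1Holder.norm_def, map_smul, map_smul, norm_smul, norm_smul]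
    ring
  norm_triangle f g := by
    rw [C1Holder.norm_def, C1Holder.norm_def, C1Holder.norm_def, map_add, map_add]
    have h1 := norm_add_le f.toC g.toC
    have h2 := norm_add_le (C1Holder.derivL f) (C1Holder.derivL g)
    linarith
  norm_eq_zero_iff f := by
    constructor
    · intro h
      rw [C1Holder.norm_def] at h
      have h1 : ‖f.toC‖ = 0 := by
        have := norm_nonneg f.toC
        have h2 := norm_nonneg (C1Holder.derivL f)
        linarith
      exact Subtype.ext (norm_eq_zero.1 h1)
    · rintro rfl
      rw [C1Holder.norm_def, map_zero, map_zero]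
      simp

instance : NormedAddCommGroup (C1Holder α) := NormedAddCommGroup.ofCore C1Holder.core

instance : NormedSpace ℝ (C1Holder α) := NormedSpace.ofCore C1Holder.core

end

/-! ### The spaces `X_m`, `𝒳_m` and trigonometric functions -/

/-- `f(w) = ∑_{n ≥ 1} a_n w̄^{nm-1}`, the coefficient `a_n` being `a (n - 1)`. -/
def IsSeries (m : ℕ) (a : ℕ → ℝ) (f : Circle → ℂ) : Prop :=
  ∀ w : Circle, HasSum (fun n : ℕ => (a n : ℂ) * conj (w : ℂ) ^ ((n + 1) * m - 1)) (f w)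

theorem IsSeries.add {m : ℕ} {a a' : ℕ → ℝ} {f f' : Circle → ℂ} (h : IsSeries m a f)
    (h' : IsSeries m a' f') : IsSeries m (a + a') (f + f') := by
  intro w
  have := (h w).add (h' w)
  simpa [add_mul] using this

theorem IsSeries.smul {m : ℕ} {a : ℕ → ℝ} {f : Circle → ℂ} (c : ℝ) (h : IsSeries m a f) :
    IsSeries m (c • a) (c • f) := by
  intro w
  have := (h w).mul_left (c : ℂ)
  simpa [mul_assoc] using this

theorem IsSeries.zero (m : ℕ) : IsSeries m 0 0 := by
  intro w
  simp [hasSum_zero]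

/-- The space `X_m`: pairs `f = ∑_{n ≥ 1} A_n w̄^{nm-1}`, `A_n ∈ ℝ²`, of class `C^{1+α}`.
The two components are indexed by `0, 1 : Fin 2`. -/
def X (m : ℕ) (α : HolderExp) : Submodule ℝ (Fin 2 → C1Holder α) where
  carrier := {f | ∃ a : Fin 2 → ℕ → ℝ, ∀ j, IsSeries m (a j) (f j).toC}
  zero_mem' := ⟨0, fun _ => IsSeries.zero m⟩
  add_mem' := by
    rintro f g ⟨a, ha⟩ ⟨a', ha'⟩
    exact ⟨a + a', fun j => (ha j).add (ha' j)⟩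
  smul_mem' := by
    rintro c f ⟨a, ha⟩
    exact ⟨c • a, fun j => (ha j).smul c⟩

/-- The complement `𝒳_m` of the kernel line: those
`h = ∑_{n ≥ 2} A_n w̄^{nm-1} + a (1, 0) w̄^{m-1}` in `X_m`. -/
def XCompl (m : ℕ) (α : HolderExp) : Submodule ℝ (X m α) where
  carrier := {f | ∃ a : Fin 2 → ℕ → ℝ, a 1 0 = 0 ∧ ∀ j, IsSeries m (a j) (f.1 j).toC}
  zero_mem' := ⟨0, rfl, fun _ => IsSeries.zero m⟩
  add_mem' := by
    rintro f g ⟨a, h0, ha⟩ ⟨a', h0', ha'⟩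
    exact ⟨a + a', by simp [h0, h0'], fun j => (ha j).add (ha' j)⟩
  smul_mem' := by
    rintro c f ⟨a, h0, ha⟩
    exact ⟨c • a, by simp [h0], fun j => (ha j).smul c⟩

theorem norm_conj_pow_sub_le (k : ℕ) (w z : Circle) :
    ‖conj (w : ℂ) ^ k - conj (z : ℂ) ^ k‖ ≤ k * ‖(w : ℂ) - z‖ := by
  induction k with
  | zero => simp
  | succ k ih =>
    have e : conj (w : ℂ) ^ (k + 1) - conj (z : ℂ) ^ (k + 1) =
        conj (w : ℂ) * (conj (w : ℂ) ^ k - conj (z : ℂ) ^ k) +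
          conj ((w : ℂ) - z) * conj (z : ℂ) ^ k := by
      rw [map_sub]; ring
    rw [e]
    refine (norm_add_le _ _).trans ?_
    rw [norm_mul, norm_mul, norm_pow, RCLike.norm_conj, RCLike.norm_conj, RCLike.norm_conj,
      Circle.norm_coe, Circle.norm_coe]
    push_cast
    rw [one_pow]
    linarith

theorem lipschitz_memHolder {E : Type} [NormedAddCommGroup E] (α : HolderExp) {f : Circle → E}
    {K : ℝ≥0} (h : LipschitzWith K f) : MemHolder α.1 f :=
  (holderWith_one.2 h).memHolder.of_le α.2.2.le

theorem lipschitz_conj_pow (k : ℕ) :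
    LipschitzWith k fun w : Circle => conj (w : ℂ) ^ k :=
  LipschitzWith.of_dist_le_mul fun w z => by
    have hd : dist w z = ‖(w : ℂ) - z‖ := dist_eq_norm (w : ℂ) z
    rw [dist_eq_norm, hd]
    simpa using norm_conj_pow_sub_le k w z

theorem hasDerivAt_conj_pow (k : ℕ) (w : Circle) :
    HasDerivAt (fun θ : ℝ => conj ((Circle.exp θ * w : Circle) : ℂ) ^ k)
      (-(k * Complex.I) * conj (w : ℂ) ^ k) 0 := by
  have e : (fun θ : ℝ => conj ((Circle.exp θ * w : Circle) : ℂ) ^ k) =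
      fun θ : ℝ => Complex.exp ((θ : ℂ) * -(k * Complex.I)) * conj (w : ℂ) ^ k := by
    funext θ
    rw [Circle.coe_mul, map_mul, mul_pow, Circle.coe_exp, ← Complex.exp_conj, ← Complex.exp_nat_mul]
    congr 2
    simp
    ring
  rw [e]
  have h := (((Complex.ofRealCLM.hasDerivAt (x := (0 : ℝ))).mul_const
    (-(k * Complex.I))).cexp).mul_const (conj (w : ℂ) ^ k)
  simpa using h

theorem circleDeriv_conj_pow (k : ℕ) :
    circleDeriv (fun w : Circle => conj (w : ℂ) ^ k) =
      (-(k : ℝ)) • fun w : Circle => conj (w : ℂ) ^ (k + 1) := by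
  funext w
  rw [circleDeriv, (hasDerivAt_conj_pow k w).deriv, div_eq_iff
    (mul_ne_zero Complex.I_ne_zero (Circle.coe_ne_zero w))]
  have h : conj (w : ℂ) * (w : ℂ) = 1 := by
    rw [mul_comm, Complex.mul_conj, Circle.normSq_coe, Complex.ofReal_one]
  simp only [Pi.smul_apply, Complex.real_smul, pow_succ]
  push_cast
  linear_combination (-(k : ℂ) * Complex.I * conj (w : ℂ) ^ k) * (-h)

/-- The function `w̄^k` as an element of `C^{1+α}`. -/
def conjPow (α : HolderExp) (k : ℕ) : C1Holder α :=
  (⟨⟨fun w => conj (w : ℂ) ^ k, (lipschitz_conj_pow k).continuous⟩,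
    fun w => (hasDerivAt_conj_pow k w).differentiableAt,
    by
      rw [ContinuousMap.coe_mk, circleDeriv_conj_pow]
      exact (lipschitz_conj_pow (k + 1)).continuous.const_smul _,
    by
      rw [ContinuousMap.coe_mk, circleDeriv_conj_pow]
      exact (lipschitz_memHolder α (lipschitz_conj_pow (k + 1))).smul⟩ :
    ↥(holderOneSubmodule α))

/-- The function `e_n(w) = Im (w̄^n)`. -/
def eFun (n : ℕ) (w : Circle) : ℝ := (conj (w : ℂ) ^ n).im

theorem lipschitz_eFun (n : ℕ) : LipschitzWith n (eFun n) :=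
  LipschitzWith.of_dist_le_mul fun w z => by
    have hd : dist w z = ‖(w : ℂ) - z‖ := dist_eq_norm (w : ℂ) z
    rw [Real.dist_eq, hd]
    refine le_trans ?_ (by simpa using norm_conj_pow_sub_le n w z)
    rw [eFun, eFun, ← Complex.sub_im]
    exact Complex.abs_im_le_norm _

/-- The function `e_n` as an element of `C^α(𝕋; ℝ)`. -/
def eHolder (α : HolderExp) (n : ℕ) : CHolder ℝ α :=
  (⟨⟨eFun n, (lipschitz_eFun n).continuous⟩, lipschitz_memHolder α (lipschitz_eFun n)⟩ :
    ↥(holderSubmodule ℝ α))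

/-! ### The functional `G` -/

/-- The mean value `⨍ f(τ) dτ = (1 / (2 i π)) ∫_𝕋 f(τ) dτ` (complex integration over the circle). -/
def circleMean (f : Circle → ℂ) : ℂ :=
  (2 * (Real.pi : ℂ) * Complex.I)⁻¹ *
    ∫ θ in (0 : ℝ)..2 * Real.pi, f (Circle.exp θ) * (Complex.I * (Circle.exp θ : ℂ))

/-- The radii `b_1 = 1`, `b_2 = b`. -/
def radius (b : ℝ) : Fin 2 → ℝ := ![1, b]

variable {m : ℕ} {α : HolderExp}

/-- The boundary parametrization `Φ_j(w) = b_j w + f_j(w)`. -/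
def Phi (b : ℝ) (f : X m α) (j : Fin 2) (w : Circle) : ℂ :=
  (radius b j : ℂ) * (w : ℂ) + f.1 j w

/-- `⨍ (z̄ - Φ_i(ξ)‾) / (z - Φ_i(ξ)) Φ_i'(ξ) dξ`. -/
def cauchyTerm (b : ℝ) (f : X m α) (i : Fin 2) (z : ℂ) : ℂ :=
  circleMean fun ξ => (conj z - conj (Phi b f i ξ)) / (z - Phi b f i ξ) * circleDeriv (Phi b f i) ξ

/-- `G_j(λ, f)(w) = Im {((1 - λ) Φ_j(w)‾ + I(Φ_j(w))) w Φ_j'(w)}`, with `I` the difference of the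
contributions of the outer and of the inner boundary. -/
def G (b lam : ℝ) (f : X m α) (j : Fin 2) (w : Circle) : ℝ :=
  (((1 - (lam : ℂ)) * conj (Phi b f j w) +
      (cauchyTerm b f 0 (Phi b f j w) - cauchyTerm b f 1 (Phi b f j w))) *
    (w : ℂ) * circleDeriv (Phi b f j) w).im

/-- The partial derivative `∂_f G(λ, f) h = d/dτ G(λ, f + τ h)|_{τ = 0}`. -/
def dG (b lam : ℝ) (f h : X m α) (j : Fin 2) (w : Circle) : ℝ :=
  deriv (fun τ : ℝ => G b lam (f + τ • h) j w) 0

/-! ### Eigenvalues, kernel, cokernel, projection -/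

/-- The matrix `M_n(λ)` of the linearized operator on the mode `e_n`. -/
def M (b : ℝ) (n : ℕ) (lam : ℝ) : Matrix (Fin 2) (Fin 2) ℝ :=
  !![n * lam - 1 - n * b ^ 2, b ^ (n + 1); -b ^ n, b * (n * lam - n + 1)]

/-- The discriminant `Δ_m(b)`. -/
def Delta (m : ℕ) (b : ℝ) : ℝ := ((1 - b ^ 2) / 2 * m - 1) ^ 2 - b ^ (2 * m)

/-- The eigenvalue `λ_m^+`. -/
def lamPlus (m : ℕ) (b : ℝ) : ℝ := (1 + b ^ 2) / 2 + 1 / m * √(Delta m b)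

/-- The eigenvalue `λ_m^-`. -/
def lamMinus (m : ℕ) (b : ℝ) : ℝ := (1 + b ^ 2) / 2 - 1 / m * √(Delta m b)

/-- The components of the kernel vector, `((m λ - m + 1) / b^{m-1}, 1)`. -/
def vCoeff (m : ℕ) (b lam0 : ℝ) : Fin 2 → ℝ := ![(m * lam0 - m + 1) / b ^ (m - 1), 1]

/-- The kernel element `v_m(w) = ((m λ - m + 1) / b^{m-1}, 1) w̄^{m-1}`. -/
def v (m : ℕ) (α : HolderExp) (b lam0 : ℝ) : X m α :=
  ⟨fun j => vCoeff m b lam0 j • conjPow α (m - 1), by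
    refine ⟨fun j n => if n = 0 then vCoeff m b lam0 j else 0, fun j w => ?_⟩
    have hval : (vCoeff m b lam0 j • conjPow α (m - 1)).toC w =
        (vCoeff m b lam0 j : ℂ) * conj (w : ℂ) ^ (m - 1) := by
      rw [map_smul, ContinuousMap.smul_apply, Complex.real_smul]
      rfl
    rw [hval]
    convert hasSum_ite_eq (0 : ℕ) ((vCoeff m b lam0 j : ℂ) * conj (w : ℂ) ^ (m - 1)) using 1
    funext n
    rcases eq_or_ne n 0 with rfl | hn
    · simp
    · simp [hn]⟩

/-- The unit vector `Ŵ_m` proportional to `(m λ - m + 1, -b^m)`. -/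
def WHat (m : ℕ) (b lam0 : ℝ) : Fin 2 → ℝ :=
  (√((m * lam0 - m + 1) ^ 2 + b ^ (2 * m)))⁻¹ • ![m * lam0 - m + 1, -b ^ m]

/-- `𝕎_m = Ŵ_m e_m`, an element of `C^α(𝕋; ℝ)²`. -/
def W (m : ℕ) (α : HolderExp) (b lam0 : ℝ) : Fin 2 → CHolder ℝ α :=
  fun j => WHat m b lam0 j • eHolder α m

/-- The line `⟨v_m⟩ ⊆ X_m`. -/
abbrev KerLine (m : ℕ) (α : HolderExp) (b lam0 : ℝ) : Submodule ℝ (X m α) :=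
  Submodule.span ℝ {v m α b lam0}

/-- The line `⟨𝕎_m⟩`. -/
abbrev WLine (m : ℕ) (α : HolderExp) (b lam0 : ℝ) : Submodule ℝ (Fin 2 → CHolder ℝ α) :=
  Submodule.span ℝ {W m α b lam0}

/-- `v_m` as an element of the line it spans. -/
def vLine (m : ℕ) (α : HolderExp) (b lam0 : ℝ) : KerLine m α b lam0 :=
  ⟨v m α b lam0, Submodule.mem_span_singleton_self _⟩

/-- `𝕎_m` as an element of the line it spans. -/
def WGen (m : ℕ) (α : HolderExp) (b lam0 : ℝ) : WLine m α b lam0 :=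
  ⟨W m α b lam0, Submodule.mem_span_singleton_self _⟩

/-- The coefficient `B_n` of `e_n` in a real function `∑ B_n e_n` on the circle (its Fourier
coefficient `(1/π) ∫ h e_n dθ`). -/
def eCoeff (n : ℕ) (h : Circle → ℝ) : ℝ :=
  Real.pi⁻¹ * ∫ θ in (0 : ℝ)..2 * Real.pi, h (Circle.exp θ) * eFun n (Circle.exp θ)

/-- The projection `Q h = ⟨B_1, Ŵ_m⟩ 𝕎_m` for `h = ∑_{n ≥ 1} B_n e_{nm}`. -/
def Q (m : ℕ) (α : HolderExp) (b lam0 : ℝ) (h : Fin 2 → Circle → ℝ) : WLine m α b lam0 :=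
  (∑ j, eCoeff m (h j) * WHat m b lam0 j) • WGen m α b lam0

/-! ### Lyapunov-Schmidt reduction at `(λ_0, 0)` -/

/-- `F_1(λ, g, k) = (Id - Q) G(λ, g + k)` for `g ∈ ⟨v_m⟩` and `k ∈ 𝒳_m`. -/
def F1 (b lam0 lam : ℝ) (g : KerLine m α b lam0) (k : XCompl m α) (j : Fin 2) (w : Circle) : ℝ :=
  G b lam ((g : X m α) + (k : X m α)) j w -
    (Q m α b lam0 (G b lam ((g : X m α) + (k : X m α)))).1 j w

/-- `φ` is a smooth local parametrization `k = φ(λ, g)` of the solutions of `F_1(λ, g, k) = 0`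
near `(λ_0, 0, 0)`. -/
def IsLocalParam (b lam0 : ℝ) (φ : ℝ × KerLine m α b lam0 → XCompl m α) : Prop :=
  (∀ᶠ p in 𝓝 ((lam0, 0) : ℝ × KerLine m α b lam0), ContDiffAt ℝ ∞ φ p) ∧
  ∀ᶠ q in 𝓝 ((lam0, 0, 0) : ℝ × KerLine m α b lam0 × XCompl m α),
    (F1 b lam0 q.1 q.2.1 q.2.2 = 0 ↔ q.2.2 = φ (q.1, q.2.1))

/-- `∂_g φ(λ, g) v_m`. -/
def dgφ (b lam0 : ℝ) (φ : ℝ × KerLine m α b lam0 → XCompl m α) (lam : ℝ)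
    (g : KerLine m α b lam0) : XCompl m α :=
  fderiv ℝ (fun g' : KerLine m α b lam0 => φ (lam, g')) g (vLine m α b lam0)

/-- The reduced bifurcation function
`F_2(λ, t) = ∫_0^1 Q ∂_f G(λ, s t v_m + φ(λ, s t v_m)) (v_m + ∂_g φ(λ, s t v_m) v_m) ds`. -/
def F2 (b lam0 : ℝ) (φ : ℝ × KerLine m α b lam0 → XCompl m α) (lam t : ℝ) : WLine m α b lam0 :=
  ∫ s in (0 : ℝ)..1,
    Q m α b lam0
      (dG b lam
        ((((s * t) • vLine m α b lam0 : KerLine m α b lam0) : X m α) + (φ (lam, (s * t) • vLine m α b lam0) : X m α))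
        (v m α b lam0 + (dgφ b lam0 φ lam ((s * t) • vLine m α b lam0) : X m α)))

/-! ### The constants in the second order coefficient -/

/-- The constant `β̃_m`. -/
def betaTilde (m : ℕ) (b lam0 : ℝ) : ℝ :=
  -(2 * b * m * (b ^ m - b ^ (2 - (m : ℤ)) * (m * lam0 - m + 1)) ^ 2) / (M b (2 * m) lam0).det

/-- The constant `𝒦_m`. -/
def calK (m : ℕ) (b lam0 : ℝ) : ℝ :=
  (b ^ (1 - (m : ℤ)) * (m * lam0 - 1) * (m * lam0 - m + 1) ^ 2 +
      (1 - 2 * m) * (m * lam0 - m + 1) * b ^ (m + 1) + m * b ^ (3 * (m : ℤ) - 1)) /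
    ((m * lam0 - m + 1) ^ 2 + b ^ (2 * m)) ^ (1 / 2 : ℝ) *
  (2 * lam0 * m - 2 * m + 1)

end VStates

end

open VStates

open Set Filter Topology MeasureTheory
open scoped NNReal ContDiff ComplexConjugate

noncomputable section

namespace VStates

/-! ### A weighted Wiener algebra in two variables -/

/-! The functional `G` is never shown to be smooth on C^{1+α}. The equations are solved in a smaller
sequence space where everything is analytic, and a separate uniqueness argument shows that the
Hölder space contains no further solutions near the trivial one.

Analytic part. For f in X_m the functions w̄ Φ_j(w), w times the conjugate of Φ_j(w), and Φ_j'(w)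
depend on u = w^m only, and with ξ = wη the Cauchy kernel becomes a function of u and η. If ∑ k²
|a_k| is finite, all of them lie in a Banach algebra of Laurent series in u and η with weight 1 +
|n| on u^n; on a single boundary the singular factor 1 - η cancels between numerator and
denominator. At f = 0 the denominators are 1, b, 1 - bη and b - η, all invertible, so the
transported functional `GW` is analytic (`contDiffAt_GW`), and `G_iota` identifies it with `G`. Its
linearization is block diagonal with blocks M_{km}(λ)/k (`fderiv_GW`). At the eigenvalue only the
block k = 1 is singular, and |det M_{km}| is at least c k² for k ≥ 2 (`exists_det_bound`). Adding to
the projected equation the condition that the amplitude along v_m equals t makes the linearization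
invertible, and the implicit function theorem yields an analytic branch χ(λ, t) (`exists_chi`).

Uniqueness part. Pointwise on the circle, G(λ, f) - G(λ, f') differs from the linearization applied
to f - f' by at most ε times an integral of values, derivatives and divided differences of f - f'
(`eventually_abs_G_sub_le`). In L² this is O(ε) times the H¹ norm of f - f'. The linearization acts
on Fourier modes through M_{km} and is bounded below by the H¹ norm on 𝒳_m (`exists_mode_bound`).
Hence two small solutions whose difference lies in 𝒳_m coincide (`eventually_unique`), and every
admissible φ agrees near the bifurcation point with the one built from χ (`eventuallyEq_phiChi`).

Coefficients. Let H(λ, t) be the component of G along 𝕎_m on the branch. Then F_2 is ∫ ∂_t H(λ, st)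
ds times 𝕎_m, that is, H/t (`F2_eq`, `redH_eq_mul`). An explicit curve, t(a(λ), 1) on the mode m
plus t²(A, C) on the mode 2m, is chosen so that G along it equals ρ(λ) t 𝕎_m + O(t³). Since the
component along 𝕎_m annihilates the range of the linearization, H on the true branch and on this
curve differ by at most ε times the cubic residual (`IsChi.abs_ell_sub_redH_le`). Therefore H(λ, t)
= ρ(λ) t + O(t³), and H = κ t³ + o(t³) at the eigenvalue. The required derivatives are ρ', ρ'' and
2κ, and the two that vanish express the absence of a t² term. The number κ comes from third order
expansions of the averaged Cauchy kernels (`hasJet_GW_zero`, `hasJet_GW_one`). -/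

/-- Laurent polynomials in two variables `u, η` with real coefficients. -/
def LaurentPoly : Type := AddMonoidAlgebra ℝ (ℤ × ℤ)

namespace LaurentPoly

instance : CommRing LaurentPoly := inferInstanceAs (CommRing (AddMonoidAlgebra ℝ (ℤ × ℤ)))

instance : Algebra ℝ LaurentPoly := inferInstanceAs (Algebra ℝ (AddMonoidAlgebra ℝ (ℤ × ℤ)))

/-- The coefficients. -/
def coeff (x : LaurentPoly) : ℤ × ℤ →₀ ℝ := AddMonoidAlgebra.coeff x

/-- The monomial `c u^n η^j`, `p = (n, j)`. -/
def single (p : ℤ × ℤ) (c : ℝ) : LaurentPoly := AddMonoidAlgebra.single p c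

/-- The weight `1 + |n|` of the monomial `u^n η^j`. -/
def wt (p : ℤ × ℤ) : ℝ := 1 + |(p.1 : ℝ)|

theorem wt_pos (p : ℤ × ℤ) : 0 < wt p := by unfold wt; positivity

/-- The inequality 1 + |n + n'| ≤ (1 + |n|)(1 + |n'|) makes the weighted norm submultiplicative.
Powers of η carry no weight, since η is only ever averaged out. -/
theorem wt_add_le (p q : ℤ × ℤ) : wt (p + q) ≤ wt p * wt q := by
  unfold wt
  have := abs_add_le (p.1 : ℝ) q.1
  have h1 := abs_nonneg (p.1 : ℝ)
  have h2 := abs_nonneg (q.1 : ℝ)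
  rw [Prod.fst_add]
  push_cast
  nlinarith

/-- The weighted `ℓ¹` norm. -/
def wnorm (x : LaurentPoly) : ℝ := x.coeff.sum fun p c => |c| * wt p

theorem wnorm_eq (x : LaurentPoly) {s : Finset (ℤ × ℤ)} (hs : x.coeff.support ⊆ s) :
    wnorm x = ∑ p ∈ s, |x.coeff p| * wt p :=
  Finsupp.sum_of_support_subset _ hs _ (by simp)

theorem coeff_add (x y : LaurentPoly) : (x + y).coeff = x.coeff + y.coeff := rfl

theorem coeff_smul (c : ℝ) (x : LaurentPoly) : (c • x).coeff = c • x.coeff := rfl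

theorem coeff_single (p : ℤ × ℤ) (c : ℝ) : (single p c).coeff = Finsupp.single p c := rfl

theorem wnorm_add_le (x y : LaurentPoly) : wnorm (x + y) ≤ wnorm x + wnorm y := by
  classical
  rw [wnorm_eq x (s := x.coeff.support ∪ y.coeff.support) Finset.subset_union_left,
    wnorm_eq y (s := x.coeff.support ∪ y.coeff.support) Finset.subset_union_right,
    wnorm_eq (x + y) (s := x.coeff.support ∪ y.coeff.support) Finsupp.support_add,
    ← Finset.sum_add_distrib]
  refine Finset.sum_le_sum fun p _ => ?_
  rw [← add_mul, coeff_add, Finsupp.add_apply]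
  exact mul_le_mul_of_nonneg_right (abs_add_le _ _) (wt_pos p).le

theorem wnorm_smul_le (c : ℝ) (x : LaurentPoly) : wnorm (c • x) ≤ |c| * wnorm x := by
  rw [wnorm_eq x subset_rfl, wnorm_eq (c • x) (s := x.coeff.support) Finsupp.support_smul,
    Finset.mul_sum]
  refine Finset.sum_le_sum fun p _ => ?_
  rw [coeff_smul, Finsupp.smul_apply, smul_eq_mul, abs_mul, mul_assoc]

theorem wnorm_single (p : ℤ × ℤ) (c : ℝ) : wnorm (single p c) = |c| * wt p := by
  rw [wnorm, coeff_single, Finsupp.sum_single_index]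
  simp

instance : SeminormedAddCommGroup LaurentPoly :=
  AddGroupSeminorm.toSeminormedAddCommGroup
    { toFun := wnorm
      map_zero' := Finsupp.sum_zero_index
      add_le' := wnorm_add_le
      neg' := fun x => by
        have h : ∀ y : LaurentPoly, wnorm (-y) ≤ wnorm y := fun y => by
          have := wnorm_smul_le (-1) y
          simpa using this
        exact le_antisymm (h x) (by simpa using h (-x)) }

theorem norm_def (x : LaurentPoly) : ‖x‖ = wnorm x := rfl

theorem single_mul_single (p q : ℤ × ℤ) (c d : ℝ) :
    single p c * single q d = single (p + q) (c * d) :=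
  AddMonoidAlgebra.single_mul_single p q c d

theorem smul_single (c : ℝ) (p : ℤ × ℤ) (d : ℝ) : c • single p d = single p (c * d) :=
  AddMonoidAlgebra.smul_single' c p d

theorem sum_single (x : LaurentPoly) : ∑ p ∈ x.coeff.support, single p (x.coeff p) = x :=
  AddMonoidAlgebra.sum_coeff_single x

theorem norm_mul_le' (x y : LaurentPoly) : ‖x * y‖ ≤ ‖x‖ * ‖y‖ := by
  conv_lhs => rw [← sum_single x, ← sum_single y, Finset.sum_mul_sum]
  refine (norm_sum_le _ _).trans ?_
  rw [norm_def x, norm_def y, wnorm_eq x subset_rfl, wnorm_eq y subset_rfl, Finset.sum_mul_sum]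
  refine Finset.sum_le_sum fun p _ => (norm_sum_le _ _).trans (Finset.sum_le_sum fun q _ => ?_)
  rw [single_mul_single, norm_def, wnorm_single, abs_mul]
  calc |x.coeff p| * |y.coeff q| * wt (p + q)
      ≤ |x.coeff p| * |y.coeff q| * (wt p * wt q) := by gcongr; exact wt_add_le p q
    _ = _ := by ring

instance : SeminormedCommRing LaurentPoly :=
  { (inferInstance : SeminormedAddCommGroup LaurentPoly),
    (inferInstance : CommRing LaurentPoly) with
    norm_mul_le := norm_mul_le' }

instance : NormedAlgebra ℝ LaurentPoly where
  norm_smul_le c x := wnorm_smul_le c x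

end LaurentPoly

/-- The completion of the Laurent polynomials in the weighted `ℓ¹` norm. -/
abbrev Wiener : Type := UniformSpace.Completion LaurentPoly

namespace Wiener

/-- The monomial `u^n η^j`. -/
def e (n j : ℤ) : Wiener := ((LaurentPoly.single (n, j) 1 : LaurentPoly) : Wiener)

theorem norm_e (n j : ℤ) : ‖e n j‖ = 1 + |(n : ℝ)| := by
  rw [e, UniformSpace.Completion.norm_coe, LaurentPoly.norm_def, LaurentPoly.wnorm_single]
  simp [LaurentPoly.wt]

theorem e_mul (n j n' j' : ℤ) : e n j * e n' j' = e (n + n') (j + j') := by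
  rw [e, e, ← UniformSpace.Completion.coe_mul, LaurentPoly.single_mul_single, mul_one]
  rfl

theorem e_zero : e 0 0 = 1 := rfl

theorem coe_single (p : ℤ × ℤ) (c : ℝ) :
    ((LaurentPoly.single p c : LaurentPoly) : Wiener) = c • e p.1 p.2 := by
  rw [e, ← UniformSpace.Completion.coe_smul]
  rw [LaurentPoly.smul_single, mul_one]

variable {F : Type*} [NormedAddCommGroup F] [NormedSpace ℝ F]

/-- Finite combinations of monomials are dense in the completion, so a closed additive property need
only be tested on multiples of monomials. -/
theorem induction_e {P : Wiener → Prop} (hc : IsClosed {x | P x}) (h0 : P 0)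
    (ha : ∀ x y, P x → P y → P (x + y)) (he : ∀ (c : ℝ) n j, P (c • e n j)) (x : Wiener) : P x := by
  induction x using UniformSpace.Completion.induction_on with
  | hp => exact hc
  | ih x =>
    rw [← LaurentPoly.sum_single x]
    have h : ∀ s : Finset (ℤ × ℤ),
        P ((∑ p ∈ s, LaurentPoly.single p (x.coeff p) : LaurentPoly) : Wiener) := by
      intro s
      induction s using Finset.induction_on with
      | empty => simpa [UniformSpace.Completion.coe_zero] using h0
      | insert p s hp ih =>
        rw [Finset.sum_insert hp, UniformSpace.Completion.coe_add]
        refine ha _ _ ?_ ih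
        rw [coe_single]
        exact he _ _ _
    exact h _

theorem ext_e {f g : Wiener →L[ℝ] F} (h : ∀ n j, f (e n j) = g (e n j)) : f = g := by
  ext x
  induction x using induction_e with
  | hc => exact isClosed_eq f.continuous g.continuous
  | h0 => simp
  | ha x y hx hy => rw [map_add, map_add, hx, hy]
  | he c n j => rw [map_smul, map_smul, h]

/-- The linear map on Laurent polynomials with prescribed values on monomials. -/
def liftLP (y : ℤ → ℤ → F) : LaurentPoly →ₗ[ℝ] F where
  toFun x := x.coeff.sum fun p c => c • y p.1 p.2
  map_add' x x' := by
    rw [LaurentPoly.coeff_add]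
    exact Finsupp.sum_add_index' (by simp) (fun _ _ _ => add_smul _ _ _)
  map_smul' c x := by
    rw [LaurentPoly.coeff_smul, Finsupp.sum_smul_index (by simp), RingHom.id_apply, Finsupp.smul_sum]
    simp only [mul_smul]

theorem liftLP_norm_le {y : ℤ → ℤ → F} {C : ℝ} (h : ∀ n j, ‖y n j‖ ≤ C * (1 + |(n : ℝ)|))
    (x : LaurentPoly) : ‖liftLP y x‖ ≤ C * ‖x‖ := by
  rw [LaurentPoly.norm_def, LaurentPoly.wnorm_eq x subset_rfl, Finset.mul_sum]
  refine (norm_sum_le _ _).trans (Finset.sum_le_sum fun p _ => ?_)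
  rw [norm_smul, Real.norm_eq_abs]
  calc |x.coeff p| * ‖y p.1 p.2‖ ≤ |x.coeff p| * (C * (1 + |(p.1 : ℝ)|)) := by gcongr; exact h _ _
    _ = _ := by unfold LaurentPoly.wt; ring

theorem liftLP_single (y : ℤ → ℤ → F) (n j : ℤ) : liftLP y (LaurentPoly.single (n, j) 1) = y n j := by
  change ((LaurentPoly.single (n, j) 1).coeff.sum fun p c => c • y p.1 p.2) = _
  rw [LaurentPoly.coeff_single, Finsupp.sum_single_index] <;> simp

/-- In a weighted ℓ¹ norm a linear map is bounded as soon as the images of the monomials are bounded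
by their weights; it then extends to the completion by density. -/
theorem exists_lift [CompleteSpace F] {y : ℤ → ℤ → F} {C : ℝ}
    (h : ∀ n j, ‖y n j‖ ≤ C * (1 + |(n : ℝ)|)) :
    ∃ f : Wiener →L[ℝ] F, ∀ n j, f (e n j) = y n j := by
  let g : LaurentPoly →L[ℝ] F := (liftLP y).mkContinuous C (liftLP_norm_le h)
  refine ⟨g.extend (UniformSpace.Completion.toComplL : LaurentPoly →L[ℝ] Wiener), fun n j => ?_⟩
  have := g.extend_eq (e := (UniformSpace.Completion.toComplL : LaurentPoly →L[ℝ] Wiener))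
    (UniformSpace.Completion.denseRange_coe)
    (UniformSpace.Completion.isUniformInducing_coe LaurentPoly) (LaurentPoly.single (n, j) 1)
  exact this.trans (liftLP_single y n j)

/-- The continuous linear map with prescribed values on the monomials. -/
def lift [CompleteSpace F] (y : ℤ → ℤ → F) (C : ℝ)
    (h : ∀ n j, ‖y n j‖ ≤ C * (1 + |(n : ℝ)|)) : Wiener →L[ℝ] F :=
  (exists_lift h).choose

theorem lift_e [CompleteSpace F] {y : ℤ → ℤ → F} {C : ℝ}
    (h : ∀ n j, ‖y n j‖ ≤ C * (1 + |(n : ℝ)|)) (n j : ℤ) : lift y C h (e n j) = y n j :=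
  (exists_lift h).choose_spec n j

/-- A continuous linear map to a normed algebra which is multiplicative on monomials is
multiplicative. -/
theorem map_mul_of_e {B : Type*} [NormedRing B] [NormedAlgebra ℝ B] (f : Wiener →L[ℝ] B)
    (h : ∀ n j n' j', f (e (n + n') (j + j')) = f (e n j) * f (e n' j')) (x y : Wiener) :
    f (x * y) = f x * f y := by
  induction x using induction_e with
  | hc => exact isClosed_eq (by fun_prop) (by fun_prop)
  | h0 => simp
  | ha x x' hx hx' => rw [add_mul, map_add, map_add, hx, hx', add_mul]
  | he c n j =>
    induction y using induction_e with
    | hc => exact isClosed_eq (by fun_prop) (by fun_prop)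
    | h0 => simp
    | ha x x' hx hx' => rw [mul_add, map_add, map_add, hx, hx', mul_add]
    | he c' n' j' =>
      rw [smul_mul_smul_comm, e_mul, map_smul, map_smul, map_smul, h, smul_mul_smul_comm]

/-- The unit circle character `(u, η) ↦ u^n η^j`. -/
def torusChar (n j : ℤ) : C(Circle × Circle, ℂ) :=
  ⟨fun p => ((p.1 ^ n * p.2 ^ j : Circle) : ℂ),
    (show Continuous fun z : Circle => (z : ℂ) by fun_prop).comp
      ((continuous_fst.zpow n).mul (continuous_snd.zpow j))⟩

theorem norm_torusChar_le (n j : ℤ) : ‖torusChar n j‖ ≤ 1 := by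
  rw [ContinuousMap.norm_le _ zero_le_one]
  intro p
  simp only [torusChar, ContinuousMap.coe_mk, Circle.norm_coe, le_refl]

/-- Evaluation of an element of the algebra as a function on the torus. -/
def ev : Wiener →L[ℝ] C(Circle × Circle, ℂ) :=
  lift torusChar 1 fun n j => (norm_torusChar_le n j).trans (by
    have := abs_nonneg (n : ℝ); linarith)

theorem ev_e (n j : ℤ) : ev (e n j) = torusChar n j := lift_e _ n j

theorem ev_e_apply (n j : ℤ) (u η : Circle) :
    ev (e n j) (u, η) = (u : ℂ) ^ n * (η : ℂ) ^ j := by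
  rw [ev_e]
  simp [torusChar]

theorem ev_mul (x y : Wiener) : ev (x * y) = ev x * ev y := by
  refine map_mul_of_e ev (fun n j n' j' => ?_) x y
  ext p
  simp only [ev_e, torusChar, ContinuousMap.coe_mk, ContinuousMap.mul_apply, ← Circle.coe_mul]
  rw [zpow_add, zpow_add, mul_mul_mul_comm]

theorem ev_one : ev 1 = 1 := by
  rw [← e_zero, ev_e]
  ext p
  simp [torusChar]

theorem ev_smul_one (c : ℝ) (p : Circle × Circle) : ev (c • 1) p = c := by
  rw [map_smul, ev_one]
  simp

theorem ev_inverse {x : Wiener} (hx : IsUnit x) (p : Circle × Circle) :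
    ev (Ring.inverse x) p = (ev x p)⁻¹ := by
  have h : ev x p * ev (Ring.inverse x) p = 1 := by
    rw [← ContinuousMap.mul_apply, ← ev_mul, Ring.mul_inverse_cancel _ hx, ev_one]
    rfl
  exact eq_inv_of_mul_eq_one_right h

end Wiener


/-! ### The space `ℓ¹` -/

/-- The space `ℓ¹(ℕ)`. -/
abbrev Ell1 : Type := lp (fun _ : ℕ => ℝ) 1

namespace Ell1

variable {F : Type*} [NormedAddCommGroup F] [NormedSpace ℝ F]

/-- The unit vectors. -/
def δ (n : ℕ) : Ell1 := lp.single 1 n 1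

theorem norm_δ (n : ℕ) : ‖δ n‖ = 1 := by
  rw [δ, lp.norm_single zero_lt_one, norm_one]

theorem δ_apply (n k : ℕ) : (δ n : ℕ → ℝ) k = if k = n then 1 else 0 := by
  rw [δ, lp.single_apply]
  simp [Pi.single_apply]

theorem hasSum_δ (x : Ell1) : HasSum (fun n => x n • δ n) x := by
  have h := lp.hasSum_single (p := 1) (by simp) x
  convert h using 2 with n
  rw [δ, ← lp.single_smul, smul_eq_mul, mul_one]

theorem hasSum_map (L : Ell1 →L[ℝ] F) (x : Ell1) : HasSum (fun n => x n • L (δ n)) (L x) := by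
  simpa using (hasSum_δ x).mapL L

theorem ext_δ {f g : Ell1 →L[ℝ] F} (h : ∀ n, f (δ n) = g (δ n)) : f = g := by
  ext x
  refine (hasSum_map f x).unique ?_
  simpa only [h] using hasSum_map g x

theorem norm_eq (x : Ell1) : ‖x‖ = ∑' n, |x n| := by
  rw [lp.norm_eq_tsum_rpow (by simp)]
  simp

theorem summable_abs (x : Ell1) : Summable fun n => |x n| := by
  have := (lp.memℓp x).summable (by simp)
  simpa using this

theorem hasSum_norm (x : Ell1) : HasSum (fun n => |x n|) ‖x‖ := by
  rw [norm_eq]; exact (summable_abs x).hasSum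

theorem summable_smul [CompleteSpace F] {y : ℕ → F} {C : ℝ} (h : ∀ n, ‖y n‖ ≤ C) (x : Ell1) :
    Summable fun n => x n • y n := by
  refine Summable.of_norm_bounded ((summable_abs x).mul_right C) fun n => ?_
  rw [norm_smul, Real.norm_eq_abs]
  exact mul_le_mul_of_nonneg_left (h n) (abs_nonneg _)

theorem exists_sum [CompleteSpace F] {y : ℕ → F} {C : ℝ} (h : ∀ n, ‖y n‖ ≤ C) :
    ∃ L : Ell1 →L[ℝ] F, ∀ n, L (δ n) = y n := by
  let L₀ : Ell1 →ₗ[ℝ] F :=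
    { toFun := fun x => ∑' n, x n • y n
      map_add' := fun x x' => by
        rw [← (summable_smul h x).tsum_add (summable_smul h x')]
        exact tsum_congr fun n => by rw [lp.coeFn_add, Pi.add_apply, add_smul]
      map_smul' := fun c x => by
        rw [RingHom.id_apply, ← (summable_smul h x).tsum_const_smul]
        exact tsum_congr fun n => by rw [lp.coeFn_smul, Pi.smul_apply, smul_eq_mul, mul_smul] }
  refine ⟨L₀.mkContinuous C fun x => ?_, fun n => ?_⟩
  · have h1 : HasSum (fun n => C * |x n|) (C * ‖x‖) := (hasSum_norm x).mul_left C
    refine tsum_of_norm_bounded h1 fun n => ?_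
    rw [norm_smul, Real.norm_eq_abs, mul_comm]
    exact mul_le_mul_of_nonneg_right (h n) (abs_nonneg _)
  · change ∑' k, (δ n : ℕ → ℝ) k • y k = y n
    rw [tsum_eq_single n]
    · simp [δ_apply]
    · intro k hk
      simp [δ_apply, hk]

open Classical in
/-- The continuous linear map on `ℓ¹` with prescribed bounded values on the unit vectors. -/
def sum [CompleteSpace F] (y : ℕ → F) : Ell1 →L[ℝ] F :=
  -- Unbounded families receive the value 0; the lemmas that evaluate `sum` all assume a bound.
  if h : ∃ C : ℝ, ∀ n, ‖y n‖ ≤ C then (exists_sum h.choose_spec).choose else 0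

theorem sum_δ [CompleteSpace F] {y : ℕ → F} {C : ℝ} (h : ∀ n, ‖y n‖ ≤ C) (n : ℕ) :
    sum y (δ n) = y n := by
  have h' : ∃ C : ℝ, ∀ n, ‖y n‖ ≤ C := ⟨C, h⟩
  rw [sum, dif_pos h']
  exact (exists_sum h'.choose_spec).choose_spec n

theorem hasSum_sum [CompleteSpace F] {y : ℕ → F} {C : ℝ} (h : ∀ n, ‖y n‖ ≤ C) (x : Ell1) :
    HasSum (fun n => x n • y n) (sum y x) := by
  simpa only [sum_δ h] using hasSum_map (sum y) x

end Ell1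

/-! ### The functional on the Wiener algebra -/

namespace Wiener

theorem one_add_le (k : ℕ) : 1 + |((k + 1 : ℕ) : ℝ)| ≤ 2 * ((k : ℝ) + 1) ^ 2 := by
  rw [abs_of_nonneg (by positivity)]
  push_cast
  nlinarith [(Nat.cast_nonneg k : (0 : ℝ) ≤ k)]

/-- The series `∑ x_n / k² y_k` with `k = n + 1`. -/
def ser (y : ℕ → Wiener) : Ell1 →L[ℝ] Wiener :=
  Ell1.sum fun n => (((n : ℝ) + 1) ^ 2)⁻¹ • y (n + 1)

theorem ser_bound {y : ℕ → Wiener} {C : ℝ} (h : ∀ n : ℕ, ‖y (n + 1)‖ ≤ C * ((n : ℝ) + 1) ^ 2)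
    (n : ℕ) : ‖(((n : ℝ) + 1) ^ 2)⁻¹ • y (n + 1)‖ ≤ C := by
  rw [norm_smul, norm_inv, norm_pow, Real.norm_of_nonneg (by positivity), inv_mul_le_iff₀
    (by positivity), mul_comm]
  exact h n

theorem ser_δ {y : ℕ → Wiener} {C : ℝ} (h : ∀ n : ℕ, ‖y (n + 1)‖ ≤ C * ((n : ℝ) + 1) ^ 2) (n : ℕ) :
    ser y (Ell1.δ n) = (((n : ℝ) + 1) ^ 2)⁻¹ • y (n + 1) :=
  Ell1.sum_δ (ser_bound h) n

theorem hasSum_ev_ser {y : ℕ → Wiener} {C : ℝ} (h : ∀ n : ℕ, ‖y (n + 1)‖ ≤ C * ((n : ℝ) + 1) ^ 2)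
    (x : Ell1) (p : Circle × Circle) :
    HasSum (fun n => ((x n * (((n : ℝ) + 1) ^ 2)⁻¹ : ℝ) : ℂ) * ev (y (n + 1)) p)
      (ev (ser y x) p) := by
  have h1 := (Ell1.hasSum_sum (ser_bound h) x).mapL ev
  have h2 := h1.mapL (ContinuousMap.evalCLM ℝ p)
  change HasSum _ ((ContinuousMap.evalCLM ℝ p) (ev (ser y x))) at h2
  rw [ContinuousMap.evalCLM_apply] at h2
  convert h2 using 2 with n
  simp [mul_assoc]

variable (m : ℕ)

/-- The monomials `u^k`. -/
def yS (k : ℕ) : Wiener := e k 0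
/-- The monomials `u^{-k}`. -/
def ySb (k : ℕ) : Wiener := e (-k) 0
/-- The monomials of the derivative. -/
def yD (k : ℕ) : Wiener := (-((k : ℝ) * m - 1)) • e (-k) 0
/-- The monomials `Z^k`, `Z = u η^m`. -/
def ySZ (k : ℕ) : Wiener := e k (k * m : ℕ)
/-- The monomials `Z^{-k}`. -/
def ySbZ (k : ℕ) : Wiener := e (-k) (-(k * m : ℕ))
/-- The monomials of the derivative at `Z`. -/
def yDZ (k : ℕ) : Wiener := (-((k : ℝ) * m - 1)) • e (-k) (-(k * m : ℕ))
/-- The divided differences of the monomials. -/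
def yq (k : ℕ) : Wiener := -∑ l ∈ Finset.Icc 1 (k * m - 1), e (-k) (-(l : ℤ))
/-- The conjugate divided differences of the monomials. -/
def yqs (k : ℕ) : Wiener := -∑ l ∈ Finset.Icc 1 (k * m - 1), e k (l : ℤ)

theorem yS_bound (n : ℕ) : ‖yS (n + 1)‖ ≤ 2 * ((n : ℝ) + 1) ^ 2 := by
  rw [yS, norm_e]; exact one_add_le n

theorem ySb_bound (n : ℕ) : ‖ySb (n + 1)‖ ≤ 2 * ((n : ℝ) + 1) ^ 2 := by
  rw [ySb, norm_e, Int.cast_neg, abs_neg]; exact one_add_le n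

theorem ySZ_bound (n : ℕ) : ‖ySZ m (n + 1)‖ ≤ 2 * ((n : ℝ) + 1) ^ 2 := by
  rw [ySZ, norm_e]; exact one_add_le n

theorem ySbZ_bound (n : ℕ) : ‖ySbZ m (n + 1)‖ ≤ 2 * ((n : ℝ) + 1) ^ 2 := by
  rw [ySbZ, norm_e, Int.cast_neg, abs_neg]; exact one_add_le n

/-- Differentiating w̄^{km-1} costs a factor of order k, and the weight of u^{-k} costs another.
This quadratic growth is the reason why the coordinates on ℓ¹ are k² a_k rather than a_k. -/
theorem D_factor_bound (n : ℕ) (j : ℤ) :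
    ‖(-(((n + 1 : ℕ) : ℝ) * m - 1)) • e (-(n + 1 : ℕ)) j‖ ≤ (2 * (m + 1)) * ((n : ℝ) + 1) ^ 2 := by
  rw [norm_smul, norm_e, Int.cast_neg, abs_neg, Real.norm_eq_abs, abs_neg]
  have h1 : |((n + 1 : ℕ) : ℝ) * m - 1| ≤ ((n : ℝ) + 1) * (m + 1) := by
    rw [abs_le]
    push_cast
    constructor <;> nlinarith [(Nat.cast_nonneg n : (0 : ℝ) ≤ n), (Nat.cast_nonneg m : (0 : ℝ) ≤ m)]
  have h2 : 1 + |(((n + 1 : ℕ) : ℤ) : ℝ)| ≤ 2 * ((n : ℝ) + 1) := by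
    rw [abs_of_nonneg (by positivity)]
    push_cast
    nlinarith [(Nat.cast_nonneg n : (0 : ℝ) ≤ n)]
  calc _ ≤ (((n : ℝ) + 1) * (m + 1)) * (2 * ((n : ℝ) + 1)) := by gcongr
    _ = _ := by ring

theorem yD_bound (n : ℕ) : ‖yD m (n + 1)‖ ≤ (2 * (m + 1)) * ((n : ℝ) + 1) ^ 2 :=
  D_factor_bound m n 0

theorem yDZ_bound (n : ℕ) : ‖yDZ m (n + 1)‖ ≤ (2 * (m + 1)) * ((n : ℝ) + 1) ^ 2 :=
  D_factor_bound m n _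

/-- The divided difference of a monomial of degree km - 1 is a sum of km - 1 monomials, each of norm
1 + k, so it grows quadratically just as the derivative does. -/
theorem sum_bound (n : ℕ) (f : ℕ → Wiener) (hf : ∀ l, ‖f l‖ = 1 + |((n + 1 : ℕ) : ℝ)|) :
    ‖-∑ l ∈ Finset.Icc 1 ((n + 1) * m - 1), f l‖ ≤ (2 * (m + 1)) * ((n : ℝ) + 1) ^ 2 := by
  rw [norm_neg]
  refine (norm_sum_le _ _).trans ?_
  simp only [hf, Finset.sum_const, Nat.card_Icc, nsmul_eq_mul]
  have h1 : (((n + 1) * m - 1 + 1 - 1 : ℕ) : ℝ) ≤ ((n : ℝ) + 1) * (m + 1) := by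
    have : (n + 1) * m - 1 + 1 - 1 ≤ (n + 1) * (m + 1) := by rw [mul_add]; omega
    exact_mod_cast this
  have h2 : 1 + |((n + 1 : ℕ) : ℝ)| ≤ 2 * ((n : ℝ) + 1) := by
    rw [abs_of_nonneg (by positivity)]
    push_cast
    nlinarith [(Nat.cast_nonneg n : (0 : ℝ) ≤ n)]
  calc _ ≤ (((n : ℝ) + 1) * (m + 1)) * (2 * ((n : ℝ) + 1)) := by gcongr
    _ = _ := by ring

theorem yq_bound (n : ℕ) : ‖yq m (n + 1)‖ ≤ (2 * (m + 1)) * ((n : ℝ) + 1) ^ 2 :=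
  sum_bound m n _ fun l => by rw [norm_e, Int.cast_neg, abs_neg]; rfl

theorem yqs_bound (n : ℕ) : ‖yqs m (n + 1)‖ ≤ (2 * (m + 1)) * ((n : ℝ) + 1) ^ 2 :=
  sum_bound m n _ fun l => by rw [norm_e]; rfl

variable (b : ℝ)

/-- `w Φ_j(w)‾` as a function of `u = w^m`. -/
def wS (j : Fin 2) (x : Fin 2 → Ell1) : Wiener := radius b j • 1 + ser yS (x j)
/-- `w̄ Φ_j(w)`. -/
def wSb (j : Fin 2) (x : Fin 2 → Ell1) : Wiener := radius b j • 1 + ser ySb (x j)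
/-- `Φ_j'(w)`. -/
def wD (j : Fin 2) (x : Fin 2 → Ell1) : Wiener := radius b j • 1 + ser (yD m) (x j)
/-- `ξ Φ_j(ξ)‾`, `ξ = w η`. -/
def wSZ (j : Fin 2) (x : Fin 2 → Ell1) : Wiener := radius b j • 1 + ser (ySZ m) (x j)
/-- `ξ̄ Φ_j(ξ)`. -/
def wSbZ (j : Fin 2) (x : Fin 2 → Ell1) : Wiener := radius b j • 1 + ser (ySbZ m) (x j)
/-- `Φ_j'(ξ)`. -/
def wDZ (j : Fin 2) (x : Fin 2 → Ell1) : Wiener := radius b j • 1 + ser (yDZ m) (x j)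
/-- The divided difference of `Φ_j`. -/
def wq (j : Fin 2) (x : Fin 2 → Ell1) : Wiener := radius b j • 1 + ser (yq m) (x j)
/-- The conjugate divided difference of `Φ_j`. -/
def wqs (j : Fin 2) (x : Fin 2 → Ell1) : Wiener := radius b j • 1 + ser (yqs m) (x j)

/-- The denominator of the Cauchy kernel. -/
def wDen (j i : Fin 2) (x : Fin 2 → Ell1) : Wiener :=
  if j = i then wq m b j x else wSb b j x - e 0 1 * wSbZ m b i x

/-- The numerator of the Cauchy kernel. -/
def wNum (j i : Fin 2) (x : Fin 2 → Ell1) : Wiener :=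
  if j = i then -wqs m b j x else e 0 1 * wS b j x - wSZ m b i x

/-- The Cauchy kernel. -/
def wT (j i : Fin 2) (x : Fin 2 → Ell1) : Wiener :=
  wNum m b j i x * Ring.inverse (wDen m b j i x) * wDZ m b i x

/-- The value of `R` on monomials. -/
def yR (n j : ℤ) : Ell1 := if j = 0 then (-(n : ℝ)) • Ell1.δ (n.natAbs - 1) else 0

/-- The factor n in front of the n-th mode is what the weight 1 + |n| pays for. -/
theorem yR_bound (n j : ℤ) : ‖yR n j‖ ≤ 1 * (1 + |(n : ℝ)|) := by
  unfold yR
  split_ifs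
  · rw [norm_smul, Ell1.norm_δ, norm_neg, Real.norm_eq_abs]; linarith
  · rw [norm_zero]; positivity

/-- The coefficients, multiplied by `k`, of the functions `e_{km}` in the imaginary part of the mean
over `η`. -/
def R : Wiener →L[ℝ] Ell1 := lift yR 1 yR_bound

/-- The mode k sits at index k - 1. For n = 0 the truncated subtraction points at index 0, which is
harmless because the factor n vanishes. -/
theorem R_e (n j : ℤ) :
    R (e n j) = if j = 0 then (-(n : ℝ)) • Ell1.δ (n.natAbs - 1) else 0 := lift_e yR_bound n j

/-- The product under the mean. -/
def wP (p : ℝ × (Fin 2 → Ell1)) (j : Fin 2) : Wiener :=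
  ((1 - p.1) • wS b j p.2 + (wT m b j 0 p.2 - wT m b j 1 p.2)) * wD m b j p.2

/-- The functional `G` in the coordinates of `ℓ¹`. -/
def GW (p : ℝ × (Fin 2 → Ell1)) (j : Fin 2) : Ell1 := R (wP m b p j)

variable {m b}

theorem isUnit_e (n j : ℤ) : IsUnit (e n j) :=
  IsUnit.of_mul_eq_one (e (-n) (-j)) (by rw [e_mul, add_neg_cancel, add_neg_cancel, e_zero])

theorem norm_e_zero (j : ℤ) : ‖e 0 j‖ = 1 := by rw [norm_e]; simp

theorem isUnit_one_sub {b : ℝ} (hb : b ∈ Ioo (0 : ℝ) 1) (j : ℤ) : IsUnit (1 - b • e 0 j) := by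
  refine isUnit_one_sub_of_norm_lt_one ?_
  rw [norm_smul, norm_e_zero, mul_one, Real.norm_of_nonneg hb.1.le]
  exact hb.2

/-- At the trivial solution the four denominators are 1, b, 1 - bη and b - η = -η(1 - bη⁻¹). The
last two are inverted by a Neumann series, as b < 1 and η has norm 1. -/
theorem isUnit_wDen_zero (hb : b ∈ Ioo (0 : ℝ) 1) (j i : Fin 2) : IsUnit (wDen m b j i 0) := by
  have h1 : ∀ {c : ℝ}, c ≠ 0 → IsUnit (c • (1 : Wiener)) := fun hc =>
    IsUnit.of_mul_eq_one ((_ : ℝ)⁻¹ • (1 : Wiener)) (by rw [smul_mul_smul_comm, mul_inv_cancel₀ hc]; simp)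
  fin_cases j <;> fin_cases i
  · simp [wDen, wq, radius]
  · have := isUnit_one_sub hb 1
    simpa [wDen, wSb, wSbZ, radius] using this
  · have h2 := (isUnit_e 0 1).neg.mul (isUnit_one_sub hb (-1))
    have h3 : -e 0 1 * (1 - b • e 0 (-1)) = b • 1 - e 0 1 := by
      rw [mul_sub, mul_one, neg_mul, mul_smul_comm, e_mul]
      simp only [add_zero, add_neg_cancel, e_zero]
      abel
    rw [h3] at h2
    simpa [wDen, wSb, wSbZ, radius] using h2
  · simpa [wDen, wq, radius] using h1 hb.1.ne'

theorem contDiff_affine {n : WithTop ℕ∞} (c : ℝ) (L : Ell1 →L[ℝ] Wiener) (j : Fin 2) :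
    ContDiff ℝ n fun x : Fin 2 → Ell1 => c • (1 : Wiener) + L (x j) :=
  contDiff_const.add (L.contDiff.comp (contDiff_apply ℝ Ell1 j))

theorem contDiff_wDen {n : WithTop ℕ∞} (j i : Fin 2) : ContDiff ℝ n (wDen m b j i) := by
  unfold wDen
  split_ifs
  · exact contDiff_affine _ _ _
  · exact (contDiff_affine _ _ _).sub (contDiff_const.mul (contDiff_affine _ _ _))

theorem contDiff_wNum {n : WithTop ℕ∞} (j i : Fin 2) : ContDiff ℝ n (wNum m b j i) := by
  unfold wNum
  split_ifs
  · exact (contDiff_affine _ _ _).neg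
  · exact (contDiff_const.mul (contDiff_affine _ _ _)).sub (contDiff_affine _ _ _)

theorem contDiffAt_wT {n : WithTop ℕ∞} {x : Fin 2 → Ell1} {j i : Fin 2}
    (h : IsUnit (wDen m b j i x)) : ContDiffAt ℝ n (wT m b j i) x := by
  obtain ⟨v, hv⟩ := h
  have h1 : ContDiffAt ℝ n (fun y => Ring.inverse (wDen m b j i y)) x := by
    refine ContDiffAt.comp x (g := Ring.inverse) ?_ (contDiff_wDen j i).contDiffAt
    rw [← hv]
    exact contDiffAt_ringInverse ℝ v
  exact ((contDiff_wNum j i).contDiffAt.mul h1).mul (contDiff_affine _ _ _).contDiffAt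

/-- `GW` is assembled from continuous linear maps, products and the ring inverse, which is analytic
at units. No singular integral enters, and analyticity (n = ω) is included. -/
theorem contDiffAt_GW {n : WithTop ℕ∞} {p : ℝ × (Fin 2 → Ell1)}
    (h : ∀ j i, IsUnit (wDen m b j i p.2)) : ContDiffAt ℝ n (GW m b) p := by
  refine contDiffAt_pi.2 fun j => ?_
  refine R.contDiff.contDiffAt.comp p ?_
  refine ContDiffAt.mul (ContDiffAt.add (ContDiffAt.fun_smul ?_ ?_) (ContDiffAt.sub ?_ ?_)) ?_
  · exact contDiffAt_const.sub contDiffAt_fst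
  · exact ((contDiff_affine _ _ _).contDiffAt).comp p contDiffAt_snd
  · exact (contDiffAt_wT (h j 0)).comp p contDiffAt_snd
  · exact (contDiffAt_wT (h j 1)).comp p contDiffAt_snd
  · exact ((contDiff_affine _ _ _).contDiffAt).comp p contDiffAt_snd

theorem eventually_isUnit (hb : b ∈ Ioo (0 : ℝ) 1) :
    ∀ᶠ x in 𝓝 (0 : Fin 2 → Ell1), ∀ j i, IsUnit (wDen m b j i x) := by
  refine eventually_all.2 fun j => eventually_all.2 fun i => ?_
  have h := (contDiff_wDen (m := m) (b := b) (n := 0) j i).continuous.continuousAt (x := 0)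
  exact h.eventually_mem (Units.isOpen.mem_nhds (isUnit_wDen_zero hb j i))

/-! ### The mean over the torus -/

/-- The mean over `η` of a function on the torus. -/
def torusMean (u : Circle) : C(Circle × Circle, ℂ) →L[ℝ] ℂ :=
  LinearMap.mkContinuous
    { toFun := fun f => (2 * Real.pi : ℂ)⁻¹ * ∫ s in (-Real.pi)..Real.pi, f (u, Circle.exp s)
      map_add' := fun f g => by
        rw [← mul_add, ← intervalIntegral.integral_add]
        · rfl
        · exact (Continuous.intervalIntegrable (by fun_prop) _ _)
        · exact (Continuous.intervalIntegrable (by fun_prop) _ _)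
      map_smul' := fun c f => by
        simp only [ContinuousMap.smul_apply, RingHom.id_apply, Complex.real_smul,
          intervalIntegral.integral_const_mul]
        ring } 1 fun f => by
    have h := intervalIntegral.norm_integral_le_of_norm_le_const (a := -Real.pi) (b := Real.pi)
      (f := fun s => f (u, Circle.exp s)) (C := ‖f‖) fun s _ => f.norm_coe_le_norm _
    rw [sub_neg_eq_add, abs_of_pos (by positivity)] at h
    change ‖(2 * Real.pi : ℂ)⁻¹ * ∫ s in (-Real.pi)..Real.pi, f (u, Circle.exp s)‖ ≤ _
    rw [norm_mul, norm_inv]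
    have h2 : ‖(2 * Real.pi : ℂ)‖ = 2 * Real.pi := by
      simp [abs_of_pos Real.pi_pos]
    rw [h2, one_mul, inv_mul_le_iff₀ (by positivity)]
    linarith

theorem torusMean_apply (u : Circle) (f : C(Circle × Circle, ℂ)) :
    torusMean u f = (2 * Real.pi : ℂ)⁻¹ * ∫ s in (-Real.pi)..Real.pi, f (u, Circle.exp s) := rfl

theorem integral_exp_zpow (j : ℤ) :
    ∫ s in (-Real.pi)..Real.pi, ((Circle.exp s : Circle) : ℂ) ^ j =
      if j = 0 then (2 * Real.pi : ℂ) else 0 := by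
  split_ifs with h
  · subst h
    simp
    ring
  · have hc : (j : ℂ) * Complex.I ≠ 0 := mul_ne_zero (by exact_mod_cast h) Complex.I_ne_zero
    have h1 := integral_exp_mul_complex (a := -Real.pi) (b := Real.pi) hc
    have h2 : ∀ s : ℝ, ((Circle.exp s : Circle) : ℂ) ^ j = Complex.exp (j * Complex.I * s) := by
      intro s
      rw [Circle.coe_exp, ← Complex.exp_int_mul]
      congr 1; ring
    simp only [h2, h1]
    rw [div_eq_zero_iff, sub_eq_zero]
    left
    rw [Complex.exp_eq_exp_iff_exists_int]
    exact ⟨j, by push_cast; ring⟩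

theorem torusMean_ev_e (u : Circle) (n j : ℤ) :
    torusMean u (ev (e n j)) = if j = 0 then (u : ℂ) ^ n else 0 := by
  rw [torusMean_apply]
  simp only [ev_e_apply, intervalIntegral.integral_const_mul, integral_exp_zpow]
  split_ifs
  · field_simp
  · simp

/-- The function `∑ z_n / k e_{km}`, `k = n + 1`. -/
def outFun (m : ℕ) (w : Circle) : Ell1 →L[ℝ] ℝ :=
  Ell1.sum fun n => ((n : ℝ) + 1)⁻¹ * eFun ((n + 1) * m) w

theorem abs_eFun_le (n : ℕ) (w : Circle) : |eFun n w| ≤ 1 := by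
  rw [eFun]
  refine (Complex.abs_im_le_norm _).trans ?_
  rw [norm_pow, RCLike.norm_conj, Circle.norm_coe, one_pow]

theorem outFun_bound (m : ℕ) (w : Circle) (n : ℕ) :
    ‖((n : ℝ) + 1)⁻¹ * eFun ((n + 1) * m) w‖ ≤ 1 := by
  rw [norm_mul, norm_inv, Real.norm_of_nonneg (by positivity : (0 : ℝ) ≤ n + 1)]
  have h1 : ((n : ℝ) + 1)⁻¹ ≤ 1 := inv_le_one_of_one_le₀ (by linarith [(Nat.cast_nonneg n : (0:ℝ) ≤ n)])
  exact mul_le_one₀ h1 (norm_nonneg _) (abs_eFun_le _ _)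

theorem hasSum_outFun (m : ℕ) (w : Circle) (z : Ell1) :
    HasSum (fun n => z n * (((n : ℝ) + 1)⁻¹ * eFun ((n + 1) * m) w)) (outFun m w z) :=
  Ell1.hasSum_sum (outFun_bound m w) z

theorem outFun_δ (m : ℕ) (w : Circle) (n : ℕ) :
    outFun m w (Ell1.δ n) = ((n : ℝ) + 1)⁻¹ * eFun ((n + 1) * m) w :=
  Ell1.sum_δ (outFun_bound m w) n

/-- Both sides are continuous and linear in `a`, so monomials suffice. The mean kills η^j for j ≠ 0,
and the imaginary part of u^{±k} is ∓e_{km}. The factor k put in by `R` is divided out again in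
`outFun`. -/
theorem im_torusMean_ev (m : ℕ) (w : Circle) (a : Wiener) :
    (torusMean (w ^ m) (ev a)).im = outFun m w (R a) := by
  have h : Complex.imCLM.comp ((torusMean (w ^ m)).comp ev) = (outFun m w).comp R := by
    refine ext_e fun n j => ?_
    rw [ContinuousLinearMap.comp_apply, ContinuousLinearMap.comp_apply,
      ContinuousLinearMap.comp_apply, torusMean_ev_e, R_e, Complex.imCLM_apply]
    split_ifs with hj
    · rw [map_smul, outFun_δ, smul_eq_mul]
      obtain ⟨k, rfl | rfl⟩ := n.eq_nat_or_neg
      · rcases Nat.eq_zero_or_pos k with rfl | hk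
        · simp
        obtain ⟨k, rfl⟩ : ∃ l, k = l + 1 := ⟨k - 1, by omega⟩
        have h1 : ((k : ℝ) + 1) ≠ 0 := by positivity
        simp only [Int.natAbs_natCast, Nat.add_sub_cancel]
        rw [eFun, ← map_pow, Complex.conj_im, Circle.coe_pow, zpow_natCast, ← pow_mul, mul_comm m]
        push_cast
        field_simp
      · rcases Nat.eq_zero_or_pos k with rfl | hk
        · simp
        obtain ⟨k, rfl⟩ : ∃ l, k = l + 1 := ⟨k - 1, by omega⟩
        have h1 : ((k : ℝ) + 1) ≠ 0 := by positivity
        simp only [Int.natAbs_neg, Int.natAbs_natCast, Nat.add_sub_cancel]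
        rw [eFun, ← Circle.coe_inv_eq_conj, Circle.coe_pow, zpow_neg, zpow_natCast, ← pow_mul,
          mul_comm m, Circle.coe_inv, inv_pow]
        push_cast
        field_simp
    · simp
  exact congrArg (fun L => L a) h

end Wiener


/-! ### The embedding of `ℓ¹` into `X_m` -/

theorem hasDerivAt_circle_zero {f : Circle → ℂ} (hf : CircleDifferentiable f) (w : Circle) :
    HasDerivAt (fun θ : ℝ => f (Circle.exp θ * w)) (circleDeriv f w * (Complex.I * w)) 0 := by
  have h := (hf w).hasDerivAt
  rwa [circleDeriv, div_mul_cancel₀ _ (mul_ne_zero Complex.I_ne_zero (Circle.coe_ne_zero w))]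

theorem hasDerivAt_circle {f : Circle → ℂ} (hf : CircleDifferentiable f) (w : Circle) (θ : ℝ) :
    HasDerivAt (fun θ : ℝ => f (w * Circle.exp θ))
      (circleDeriv f (w * Circle.exp θ) * (Complex.I * (w * Circle.exp θ))) θ := by
  have h := hasDerivAt_circle_zero hf (w * Circle.exp θ)
  rw [← sub_self θ] at h
  have h2 := h.comp_sub_const θ θ
  have e : (fun x : ℝ => f (Circle.exp (x - θ) * (w * Circle.exp θ))) =
      fun x : ℝ => f (w * Circle.exp x) := by
    funext x
    rw [mul_left_comm, ← Circle.exp_add, sub_add_cancel]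
  rw [e] at h2
  simpa using h2

theorem circleDeriv_eq {f : Circle → ℂ} {w : Circle} {c : ℂ}
    (h : HasDerivAt (fun θ : ℝ => f (Circle.exp θ * w)) (c * (Complex.I * w)) 0) :
    circleDeriv f w = c := by
  rw [circleDeriv, h.deriv,
    mul_div_cancel_right₀ _ (mul_ne_zero Complex.I_ne_zero (Circle.coe_ne_zero w))]

theorem hasDerivAt_circle_id (w : Circle) (c : ℂ) :
    HasDerivAt (fun θ : ℝ => c * ((Circle.exp θ * w : Circle) : ℂ)) (c * (Complex.I * w)) 0 := by
  have e : (fun θ : ℝ => c * ((Circle.exp θ * w : Circle) : ℂ)) =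
      fun θ : ℝ => c * (Complex.exp ((θ : ℂ) * Complex.I) * (w : ℂ)) := by
    funext θ
    rw [Circle.coe_mul, Circle.coe_exp]
  rw [e]
  have h := ((((Complex.ofRealCLM.hasDerivAt (x := (0 : ℝ))).mul_const
    Complex.I).cexp).mul_const (w : ℂ)).const_mul c
  simpa using h

theorem circleDeriv_Phi {m : ℕ} {α : HolderExp} (b : ℝ) (f : X m α) (j : Fin 2) (w : Circle) :
    circleDeriv (Phi b f j) w = radius b j + circleDeriv (f.1 j).toC w := by
  refine circleDeriv_eq ?_
  rw [add_mul]
  exact (hasDerivAt_circle_id w (radius b j)).add (hasDerivAt_circle_zero (f.1 j).mem.1 w)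

/-- The substitution ξ = w e^{is} moves the singular point ξ = w to s = 0, and periodicity allows
any period of integration. -/
theorem circleMean_eq (f : Circle → ℂ) (w : Circle) :
    circleMean f = (2 * Real.pi : ℂ)⁻¹ * ∫ s in (-Real.pi)..Real.pi,
      f (w * Circle.exp s) * ((w : ℂ) * Circle.exp s) := by
  let g : ℝ → ℂ := fun θ => f (Circle.exp θ) * (Circle.exp θ : ℂ)
  have hg : Function.Periodic g (2 * Real.pi) := fun θ => by
    simp only [g, Circle.exp_add_two_pi]
  have h1 : circleMean f = (2 * Real.pi : ℂ)⁻¹ * ∫ θ in (0 : ℝ)..2 * Real.pi, g θ := by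
    rw [circleMean]
    have e : ∀ θ : ℝ, f (Circle.exp θ) * (Complex.I * (Circle.exp θ : ℂ)) = Complex.I * g θ :=
      fun θ => by simp only [g]; ring
    simp only [e, intervalIntegral.integral_const_mul]
    have := Complex.I_ne_zero
    field_simp
  have h2 : ∀ s : ℝ, f (w * Circle.exp s) * ((w : ℂ) * Circle.exp s) = g (s + Complex.arg w) := by
    intro s
    have : Circle.exp (s + Complex.arg w) = w * Circle.exp s := by
      rw [Circle.exp_add, Circle.exp_arg, mul_comm]
    simp only [g, this, Circle.coe_mul]
  simp only [h2]
  rw [h1, intervalIntegral.integral_comp_add_right g (Complex.arg w)]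
  have h3 := hg.intervalIntegral_add_eq 0 (-Real.pi + Complex.arg w)
  rw [zero_add] at h3
  rw [h3, show -Real.pi + Complex.arg w + 2 * Real.pi = Real.pi + Complex.arg w by ring]

/-- The kernel of the Cauchy-type integral. -/
def kern {m : ℕ} {α : HolderExp} (b : ℝ) (f : X m α) (j i : Fin 2) (w ξ : Circle) : ℂ :=
  (conj (Phi b f j w) - conj (Phi b f i ξ)) / (Phi b f j w - Phi b f i ξ) *
    circleDeriv (Phi b f i) ξ * ξ

/-- The integrand of `G`. -/
def integrandG {m : ℕ} {α : HolderExp} (b lam : ℝ) (f : X m α) (j : Fin 2) (w ξ : Circle) : ℂ :=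
  ((1 - (lam : ℂ)) * conj (Phi b f j w) + (kern b f j 0 w ξ - kern b f j 1 w ξ)) * w *
    circleDeriv (Phi b f j) w

theorem G_eq {m : ℕ} {α : HolderExp} (b lam : ℝ) (f : X m α) (j : Fin 2) (w : Circle)
    (h : ∀ i, IntervalIntegrable (fun s => kern b f j i w (w * Circle.exp s)) volume
      (-Real.pi) Real.pi) :
    G b lam f j w = ((2 * Real.pi : ℂ)⁻¹ * ∫ s in (-Real.pi)..Real.pi,
      integrandG b lam f j w (w * Circle.exp s)).im := by
  have hc : ∀ i, cauchyTerm b f i (Phi b f j w) = (2 * Real.pi : ℂ)⁻¹ *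
      ∫ s in (-Real.pi)..Real.pi, kern b f j i w (w * Circle.exp s) := fun i => by
    rw [cauchyTerm, circleMean_eq _ w]
    rfl
  rw [G, hc, hc]
  congr 1
  unfold integrandG
  simp only [mul_assoc _ (w : ℂ)]
  rw [intervalIntegral.integral_mul_const, intervalIntegral.integral_add (by simp) ((h 0).sub (h 1)),
    intervalIntegral.integral_sub (h 0) (h 1), intervalIntegral.integral_const]
  have hpi : (Real.pi : ℂ) ≠ 0 := by exact_mod_cast Real.pi_ne_zero
  rw [Complex.real_smul]
  push_cast
  field_simp
  ring

section Embedding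

variable (m : ℕ)

/-- The coefficient of `w̄^{km-1}`, `k = n + 1`, of the element with coordinates `x`. -/
def acoef (x : Ell1) (n : ℕ) : ℝ := x n * (((n : ℝ) + 1) ^ 2)⁻¹

theorem abs_acoef_mul_le (x : Ell1) (n : ℕ) {C : ℝ} {t : ℝ}
    (h : t ≤ C * ((n : ℝ) + 1) ^ 2) : |acoef x n| * t ≤ |x n| * C := by
  rw [acoef, abs_mul, abs_inv, abs_of_nonneg (by positivity : (0 : ℝ) ≤ ((n : ℝ) + 1) ^ 2), mul_assoc]
  refine mul_le_mul_of_nonneg_left ?_ (abs_nonneg _)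
  rw [inv_mul_le_iff₀ (by positivity), mul_comm]
  exact h

theorem exponent_le (n : ℕ) : (((n + 1) * m - 1 : ℕ) : ℝ) ≤ m * ((n : ℝ) + 1) := by
  have h : (n + 1) * m - 1 ≤ m * (n + 1) := by rw [mul_comm]; omega
  exact_mod_cast h

theorem exponent_add_one_le (n : ℕ) (hm : 1 ≤ m) :
    (((n + 1) * m - 1 : ℕ) : ℝ) + 1 = m * ((n : ℝ) + 1) := by
  have h : (n + 1) * m - 1 + 1 = m * (n + 1) := by
    rw [mul_comm (n + 1) m]
    have : 1 ≤ m * (n + 1) := Nat.mul_pos hm (Nat.succ_pos n)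
    omega
  exact_mod_cast h

/-- The terms of the series. -/
def iotaTerm (x : Ell1) (n : ℕ) (w : Circle) : ℂ :=
  (acoef x n : ℂ) * conj (w : ℂ) ^ ((n + 1) * m - 1)

/-- The terms of the derivative of the series. -/
def iotaDerTerm (x : Ell1) (n : ℕ) (w : Circle) : ℂ :=
  (acoef x n : ℂ) * (-(((n + 1) * m - 1 : ℕ) : ℂ) * conj (w : ℂ) ^ ((n + 1) * m - 1 + 1))

theorem norm_conj_pow (w : Circle) (k : ℕ) : ‖conj (w : ℂ) ^ k‖ = 1 := by
  rw [norm_pow, RCLike.norm_conj, Circle.norm_coe, one_pow]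

theorem norm_iotaTerm_le (x : Ell1) (n : ℕ) (w : Circle) : ‖iotaTerm m x n w‖ ≤ |x n| := by
  rw [iotaTerm, norm_mul, norm_conj_pow, Complex.norm_real, Real.norm_eq_abs]
  have := abs_acoef_mul_le x n (C := 1) (t := 1) (by
    nlinarith [(Nat.cast_nonneg n : (0 : ℝ) ≤ n)])
  simpa using this

theorem norm_iotaDerTerm_le (x : Ell1) (n : ℕ) (w : Circle) : ‖iotaDerTerm m x n w‖ ≤ |x n| * m := by
  rw [iotaDerTerm, norm_mul, norm_mul, norm_conj_pow, Complex.norm_real, Real.norm_eq_abs, norm_neg,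
    mul_one, Complex.norm_natCast]
  refine abs_acoef_mul_le x n ((exponent_le m n).trans ?_)
  have h0 : (0 : ℝ) ≤ n := Nat.cast_nonneg n
  have : ((n : ℝ) + 1) ≤ ((n : ℝ) + 1) ^ 2 := by nlinarith
  gcongr

theorem summable_iotaTerm (x : Ell1) (w : Circle) : Summable fun n => iotaTerm m x n w :=
  Summable.of_norm_bounded (Ell1.summable_abs x) fun n => norm_iotaTerm_le m x n w

theorem summable_iotaDerTerm (x : Ell1) (w : Circle) : Summable fun n => iotaDerTerm m x n w :=
  Summable.of_norm_bounded ((Ell1.summable_abs x).mul_right _) fun n => norm_iotaDerTerm_le m x n w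

/-- The function `∑ a_n w̄^{km-1}`. -/
def iotaFun (x : Ell1) (w : Circle) : ℂ := ∑' n, iotaTerm m x n w

/-- Its derivative. -/
def iotaDer (x : Ell1) (w : Circle) : ℂ := ∑' n, iotaDerTerm m x n w

theorem norm_iotaFun_le (x : Ell1) (w : Circle) : ‖iotaFun m x w‖ ≤ ‖x‖ :=
  tsum_of_norm_bounded (Ell1.hasSum_norm x) fun n => norm_iotaTerm_le m x n w

theorem norm_iotaDer_le (x : Ell1) (w : Circle) : ‖iotaDer m x w‖ ≤ ‖x‖ * m :=
  tsum_of_norm_bounded ((Ell1.hasSum_norm x).mul_right _) fun n => norm_iotaDerTerm_le m x n w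

/-- Termwise differentiation is allowed because (km - 1)|a_k| ≤ m|x_n| with x summable, where k = n
+ 1. -/
theorem hasDerivAt_iotaFun (x : Ell1) (w : Circle) :
    HasDerivAt (fun θ : ℝ => iotaFun m x (Circle.exp θ * w)) (iotaDer m x w * (Complex.I * w)) 0 := by
  have key := hasDerivAt_tsum (𝕜 := ℝ) (u := fun n => |x n| * m)
    (g := fun n θ => iotaTerm m x n (Circle.exp θ * w))
    (g' := fun n θ => iotaDerTerm m x n (Circle.exp θ * w) *
      (Complex.I * ((Circle.exp θ * w : Circle) : ℂ)))
    ((Ell1.summable_abs x).mul_right _) (fun n θ => ?_) (fun n θ => ?_) (y₀ := 0)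
    (summable_iotaTerm m x _) 0
  · rw [tsum_mul_right] at key
    simpa [iotaFun, iotaDer] using key
  · have hd : CircleDifferentiable (iotaTerm m x n) := fun w =>
      ((hasDerivAt_conj_pow ((n + 1) * m - 1) w).const_mul (acoef x n : ℂ)).differentiableAt
    have h1 := hasDerivAt_circle hd w θ
    have h2 : circleDeriv (iotaTerm m x n) = iotaDerTerm m x n := by
      funext z
      refine circleDeriv_eq ?_
      have h3 := (hasDerivAt_conj_pow ((n + 1) * m - 1) z).const_mul (acoef x n : ℂ)
      refine h3.congr_deriv ?_
      have h4 : conj (z : ℂ) * (z : ℂ) = 1 := by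
        rw [mul_comm, Complex.mul_conj, Circle.normSq_coe, Complex.ofReal_one]
      simp only [iotaDerTerm, pow_succ]
      linear_combination ((acoef x n : ℂ) * (((n + 1) * m - 1 : ℕ) : ℂ) * Complex.I *
        conj (z : ℂ) ^ ((n + 1) * m - 1)) * h4
    rw [h2] at h1
    simp only [mul_comm w, mul_comm (w : ℂ)] at h1
    simpa only [Circle.coe_mul] using h1
  · rw [norm_mul, norm_mul, Complex.norm_I, Circle.norm_coe, mul_one, mul_one]
    exact norm_iotaDerTerm_le m x n _

theorem circleDeriv_iotaFun (x : Ell1) : circleDeriv (iotaFun m x) = iotaDer m x :=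
  funext fun w => circleDeriv_eq (hasDerivAt_iotaFun m x w)

theorem lipschitz_of_terms {x : Ell1} {F : ℕ → Circle → ℂ} {C : ℝ≥0}
    (hs : ∀ w, Summable fun n => F n w)
    (h : ∀ n w z, ‖F n w - F n z‖ ≤ |x n| * (C * ‖(w : ℂ) - z‖)) :
    LipschitzWith (‖x‖₊ * C) fun w => ∑' n, F n w :=
  LipschitzWith.of_dist_le_mul fun w z => by
    have hd : dist w z = ‖(w : ℂ) - z‖ := dist_eq_norm (w : ℂ) z
    rw [dist_eq_norm, hd, ← (hs w).tsum_sub (hs z)]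
    refine (tsum_of_norm_bounded ((Ell1.hasSum_norm x).mul_right _) fun n => h n w z).trans ?_
    rw [NNReal.coe_mul, coe_nnnorm, mul_assoc]

theorem lipschitz_iotaFun (x : Ell1) : LipschitzWith (‖x‖₊ * m) (iotaFun m x) := by
  refine lipschitz_of_terms (summable_iotaTerm m x) fun n w z => ?_
  rw [iotaTerm, iotaTerm, ← mul_sub, norm_mul, Complex.norm_real, Real.norm_eq_abs, ← mul_assoc]
  calc _ ≤ |acoef x n| * ((((n + 1) * m - 1 : ℕ) : ℝ) * ‖(w : ℂ) - z‖) := by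
        refine mul_le_mul_of_nonneg_left ?_ (abs_nonneg _)
        exact norm_conj_pow_sub_le _ w z
    _ = |acoef x n| * (((n + 1) * m - 1 : ℕ) : ℝ) * ‖(w : ℂ) - z‖ := by ring
    _ ≤ _ := by
        refine mul_le_mul_of_nonneg_right ?_ (norm_nonneg _)
        refine abs_acoef_mul_le x n ((exponent_le m n).trans ?_)
        have h0 : (0 : ℝ) ≤ n := Nat.cast_nonneg n
        have : ((n : ℝ) + 1) ≤ ((n : ℝ) + 1) ^ 2 := by nlinarith
        rw [NNReal.coe_natCast]
        gcongr

variable {m}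

/-- The coefficients a_k absorb two powers of the degree, so the derivative is even Lipschitz. Hence
the same sequence space embeds in C^{1+α} for every α in (0, 1). -/
theorem lipschitz_iotaDer (hm : 1 ≤ m) (x : Ell1) :
    LipschitzWith (‖x‖₊ * (m ^ 2 : ℕ)) (iotaDer m x) := by
  refine lipschitz_of_terms (summable_iotaDerTerm m x) fun n w z => ?_
  rw [iotaDerTerm, iotaDerTerm, ← mul_sub, ← mul_sub, norm_mul, norm_mul, Complex.norm_real,
    Real.norm_eq_abs, norm_neg, Complex.norm_natCast, ← mul_assoc, ← mul_assoc]
  calc _ ≤ |acoef x n| * (((n + 1) * m - 1 : ℕ) : ℝ) *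
        ((((n + 1) * m - 1 + 1 : ℕ) : ℝ) * ‖(w : ℂ) - z‖) := by
        refine mul_le_mul_of_nonneg_left ?_ (mul_nonneg (abs_nonneg _) (Nat.cast_nonneg _))
        exact norm_conj_pow_sub_le _ w z
    _ = |acoef x n| * ((((n + 1) * m - 1 : ℕ) : ℝ) * (((n + 1) * m - 1 + 1 : ℕ) : ℝ)) *
        ‖(w : ℂ) - z‖ := by ring
    _ ≤ _ := by
        refine mul_le_mul_of_nonneg_right ?_ (norm_nonneg _)
        refine abs_acoef_mul_le x n ?_
        rw [NNReal.coe_natCast]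
        have h1 := exponent_le m n
        have h2 := exponent_add_one_le m n hm
        have h3 : (0 : ℝ) ≤ m * ((n : ℝ) + 1) := by positivity
        push_cast at *
        rw [h2]
        nlinarith

variable {α : HolderExp}

/-- The circle has chordal diameter 2, so the Hölder constant is at most K 2^{1-α} ≤ 2K. -/
theorem nnHolderNorm_le_of_lipschitz {E : Type} [NormedAddCommGroup E] (α : HolderExp)
    {f : Circle → E} {K : ℝ≥0} (h : LipschitzWith K f) : nnHolderNorm α.1 f ≤ 2 * K := by
  have h1 : HolderWith (K * 2 ^ ((1 : ℝ) - α.1 : ℝ)) α.1 f := by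
    have := (holderWith_one.2 h).of_le (s := α.1) (D := 2) (fun w z => ?_) α.2.2.le
    · exact_mod_cast this
    · rw [edist_dist, ENNReal.ofReal_le_iff_le_toReal (by simp)]
      have hd : dist w z = ‖(w : ℂ) - z‖ := dist_eq_norm (w : ℂ) z
      rw [hd]
      refine (norm_sub_le _ _).trans ?_
      rw [Circle.norm_coe, Circle.norm_coe]
      norm_num
  refine h1.nnholderNorm_le.trans ?_
  rw [mul_comm]
  gcongr
  calc (2 : ℝ≥0) ^ ((1 : ℝ) - α.1 : ℝ) ≤ 2 ^ (1 : ℝ) := by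
        refine NNReal.rpow_le_rpow_of_exponent_le one_le_two ?_
        have : (0 : ℝ) ≤ α.1 := α.1.2
        linarith
    _ = 2 := NNReal.rpow_one 2

/-- The element `∑ a_n w̄^{km-1}` of `C^{1+α}`. -/
def iotaC1 (hm : 1 ≤ m) (α : HolderExp) (x : Ell1) : C1Holder α :=
  (⟨⟨iotaFun m x, (lipschitz_iotaFun m x).continuous⟩,
    fun w => (hasDerivAt_iotaFun m x w).differentiableAt,
    by
      rw [ContinuousMap.coe_mk, circleDeriv_iotaFun]
      exact (lipschitz_iotaDer hm x).continuous,
    by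
      rw [ContinuousMap.coe_mk, circleDeriv_iotaFun]
      exact lipschitz_memHolder α (lipschitz_iotaDer hm x)⟩ :
    ↥(holderOneSubmodule α))

theorem iotaC1_derivL (hm : 1 ≤ m) (x : Ell1) :
    ((C1Holder.derivL (iotaC1 hm α x)).toC : Circle → ℂ) = iotaDer m x :=
  circleDeriv_iotaFun m x

theorem norm_iotaC1_le (hm : 1 ≤ m) (x : Ell1) :
    ‖iotaC1 hm α x‖ ≤ (1 + m + 2 * m ^ 2) * ‖x‖ := by
  rw [C1Holder.norm_def, CHolder.norm_def, iotaC1_derivL]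
  have h1 : ‖(iotaC1 hm α x).toC‖ ≤ ‖x‖ :=
    (ContinuousMap.norm_le _ (norm_nonneg _)).2 fun w => norm_iotaFun_le m x w
  have h2 : ‖(C1Holder.derivL (iotaC1 hm α x)).toC‖ ≤ ‖x‖ * m :=
    (ContinuousMap.norm_le _ (by positivity)).2 fun w => by
      rw [iotaC1_derivL]; exact norm_iotaDer_le m x w
  have h3 := nnHolderNorm_le_of_lipschitz α (lipschitz_iotaDer hm x)
  have h4 : (nnHolderNorm α.1 (iotaDer m x) : ℝ) ≤ 2 * (‖x‖ * m ^ 2) := by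
    exact_mod_cast h3
  linarith

theorem acoef_add (x y : Ell1) (n : ℕ) : acoef (x + y) n = acoef x n + acoef y n := by
  rw [acoef, lp.coeFn_add, Pi.add_apply, add_mul]; rfl

theorem acoef_smul (c : ℝ) (x : Ell1) (n : ℕ) : acoef (c • x) n = c * acoef x n := by
  rw [acoef, lp.coeFn_smul, Pi.smul_apply, smul_eq_mul, mul_assoc]; rfl

/-- The embedding of `ℓ¹` into `C^{1+α}`. -/
def iotaL (hm : 1 ≤ m) (α : HolderExp) : Ell1 →L[ℝ] C1Holder α :=
  LinearMap.mkContinuous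
    { toFun := iotaC1 hm α
      map_add' := fun x y => by
        refine Subtype.ext (ContinuousMap.ext fun w => ?_)
        change ∑' n, iotaTerm m (x + y) n w = ∑' n, iotaTerm m x n w + ∑' n, iotaTerm m y n w
        rw [← (summable_iotaTerm m x w).tsum_add (summable_iotaTerm m y w)]
        refine tsum_congr fun n => ?_
        simp only [iotaTerm, acoef_add]
        push_cast
        ring
      map_smul' := fun c x => by
        refine Subtype.ext (ContinuousMap.ext fun w => ?_)
        change ∑' n, iotaTerm m (c • x) n w = (c : ℂ) * ∑' n, iotaTerm m x n w
        rw [← tsum_mul_left]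
        refine tsum_congr fun n => ?_
        simp only [iotaTerm, acoef_smul]
        push_cast
        ring } (1 + m + 2 * m ^ 2) (norm_iotaC1_le hm)

theorem isSeries_iotaFun (x : Ell1) : IsSeries m (acoef x) (iotaFun m x) := fun w =>
  (summable_iotaTerm m x w).hasSum

/-- The embedding of `ℓ¹ × ℓ¹` into `X_m`. -/
def iota (hm : 1 ≤ m) (α : HolderExp) : (Fin 2 → Ell1) →L[ℝ] X m α :=
  (ContinuousLinearMap.pi fun j => (iotaL hm α).comp (ContinuousLinearMap.proj j)).codRestrict
    (X m α) fun x => ⟨fun j => acoef (x j), fun j => isSeries_iotaFun (x j)⟩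

theorem iota_toC (hm : 1 ≤ m) (x : Fin 2 → Ell1) (j : Fin 2) :
    (((iota hm α x).1 j).toC : Circle → ℂ) = iotaFun m (x j) := rfl

end Embedding


/-! ### The functional `G` on the image of the embedding -/

section EvalG

open Wiener

variable {m : ℕ} {α : HolderExp} {b : ℝ}

theorem hasSum_of_eq {f g : ℕ → ℂ} {a : ℂ} (hg : HasSum g a) (h : ∀ n, f n = g n) : HasSum f a :=
  (funext h : f = g) ▸ hg

theorem conj_mul_self (w : Circle) : conj (w : ℂ) * w = 1 := by
  rw [mul_comm, Complex.mul_conj, Circle.normSq_coe, Complex.ofReal_one]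

theorem coe_zpow_neg (w : Circle) (k : ℕ) : ((w ^ m : Circle) : ℂ) ^ (-(k : ℤ)) =
    conj (w : ℂ) ^ (k * m) := by
  rw [zpow_neg, zpow_natCast, Circle.coe_pow, ← pow_mul, mul_comm, ← inv_pow,
    ← Circle.coe_inv, Circle.coe_inv_eq_conj]

theorem coe_zpow_pos (w : Circle) (k : ℕ) : ((w ^ m : Circle) : ℂ) ^ (k : ℤ) =
    (w : ℂ) ^ (k * m) := by
  rw [zpow_natCast, Circle.coe_pow, ← pow_mul, mul_comm]

theorem coe_zpow_neg' (η : Circle) (k : ℕ) : (η : ℂ) ^ (-(k : ℤ)) = conj (η : ℂ) ^ k := by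
  rw [zpow_neg, zpow_natCast, ← inv_pow, ← Circle.coe_inv, Circle.coe_inv_eq_conj]

theorem hasSum_iotaFun (x : Ell1) (w : Circle) :
    HasSum (fun n => (acoef x n : ℂ) * conj (w : ℂ) ^ ((n + 1) * m - 1)) (iotaFun m x w) :=
  isSeries_iotaFun x w

theorem hasSum_conj_iotaFun (x : Ell1) (w : Circle) :
    HasSum (fun n => (acoef x n : ℂ) * (w : ℂ) ^ ((n + 1) * m - 1)) (conj (iotaFun m x w)) := by
  have h := (hasSum_iotaFun (m := m) x w).mapL Complex.conjCLE.toContinuousLinearMap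
  simpa using h

theorem exponent_succ (hm : 1 ≤ m) (n : ℕ) : (n + 1) * m - 1 + 1 = (n + 1) * m :=
  Nat.sub_add_cancel (Nat.mul_pos (Nat.succ_pos n) hm)

theorem Phi_iota (hm : 1 ≤ m) (x : Fin 2 → Ell1) (j : Fin 2) (w : Circle) :
    Phi b (iota hm α x) j w = radius b j * w + iotaFun m (x j) w := rfl

theorem circleDeriv_Phi_iota (hm : 1 ≤ m) (x : Fin 2 → Ell1) (j : Fin 2) (w : Circle) :
    circleDeriv (Phi b (iota hm α x) j) w = radius b j + iotaDer m (x j) w := by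
  rw [circleDeriv_Phi, iota_toC, circleDeriv_iotaFun]

theorem ev_radius (y : Wiener) (j : Fin 2) (p : Circle × Circle) :
    ev (radius b j • 1 + y) p = radius b j + ev y p := by
  rw [map_add, ContinuousMap.add_apply, ev_smul_one]

theorem ev_wS (hm : 1 ≤ m) (x : Fin 2 → Ell1) (j : Fin 2) (w η : Circle) :
    ev (wS b j x) (w ^ m, η) = w * conj (Phi b (iota hm α x) j w) := by
  have h : ev (ser yS (x j)) (w ^ m, η) = w * conj (iotaFun m (x j) w) := by
    refine (hasSum_ev_ser yS_bound (x j) (w ^ m, η)).unique ?_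
    refine hasSum_of_eq
      ((hasSum_conj_iotaFun (m := m) (x j) w).mul_left (w : ℂ)) fun n => ?_
    rw [show yS (n + 1) = e (n + 1 : ℕ) 0 from rfl, ev_e_apply, coe_zpow_pos, zpow_zero, mul_one, ← exponent_succ hm n, Nat.add_sub_cancel, pow_succ, acoef]
    ring_nf
  rw [wS, ev_radius, h, Phi_iota, map_add, map_mul, Complex.conj_ofReal]
  linear_combination (-(radius b j : ℂ)) * conj_mul_self w

theorem ev_wSb (hm : 1 ≤ m) (x : Fin 2 → Ell1) (j : Fin 2) (w η : Circle) :
    ev (wSb b j x) (w ^ m, η) = conj (w : ℂ) * Phi b (iota hm α x) j w := by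
  have h : ev (ser ySb (x j)) (w ^ m, η) = conj (w : ℂ) * iotaFun m (x j) w := by
    refine (hasSum_ev_ser ySb_bound (x j) (w ^ m, η)).unique ?_
    refine hasSum_of_eq
      ((hasSum_iotaFun (m := m) (x j) w).mul_left (conj (w : ℂ))) fun n => ?_
    rw [show ySb (n + 1) = e (-(n + 1 : ℕ)) 0 from rfl, ev_e_apply, coe_zpow_neg, zpow_zero, mul_one, ← exponent_succ hm n, Nat.add_sub_cancel, pow_succ, acoef]
    ring_nf
  rw [wSb, ev_radius, h, Phi_iota]
  linear_combination (-(radius b j : ℂ)) * conj_mul_self w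

theorem ev_wD (hm : 1 ≤ m) (x : Fin 2 → Ell1) (j : Fin 2) (w η : Circle) :
    ev (wD m b j x) (w ^ m, η) = circleDeriv (Phi b (iota hm α x) j) w := by
  have h : ev (ser (yD m) (x j)) (w ^ m, η) = iotaDer m (x j) w := by
    refine (hasSum_ev_ser (yD_bound m) (x j) (w ^ m, η)).unique ?_
    convert (show HasSum _ (iotaDer m (x j) w) from (summable_iotaDerTerm m (x j) w).hasSum) using 2 with n
    rw [yD, map_smul, ContinuousMap.smul_apply, ev_e_apply, coe_zpow_neg, zpow_zero, mul_one,
      iotaDerTerm, exponent_succ hm n, acoef, Nat.cast_sub (Nat.mul_pos (Nat.succ_pos n) hm),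
      Complex.real_smul]
    push_cast
    ring
  rw [wD, ev_radius, h, circleDeriv_Phi_iota]

theorem zpow_torus_pos (w η : Circle) (k : ℕ) :
    ((w ^ m : Circle) : ℂ) ^ (k : ℤ) * (η : ℂ) ^ ((k * m : ℕ) : ℤ) =
      ((w * η : Circle) : ℂ) ^ (k * m) := by
  rw [coe_zpow_pos, zpow_natCast, Circle.coe_mul, mul_pow]

theorem zpow_torus_neg (w η : Circle) (k : ℕ) :
    ((w ^ m : Circle) : ℂ) ^ (-(k : ℤ)) * (η : ℂ) ^ (-((k * m : ℕ) : ℤ)) =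
      conj ((w * η : Circle) : ℂ) ^ (k * m) := by
  rw [coe_zpow_neg, coe_zpow_neg', Circle.coe_mul, map_mul, mul_pow]

theorem ev_wSZ (hm : 1 ≤ m) (x : Fin 2 → Ell1) (j : Fin 2) (w η : Circle) :
    ev (wSZ m b j x) (w ^ m, η) =
      ((w * η : Circle) : ℂ) * conj (Phi b (iota hm α x) j (w * η)) := by
  have h : ev (ser (ySZ m) (x j)) (w ^ m, η) =
      ((w * η : Circle) : ℂ) * conj (iotaFun m (x j) (w * η)) := by
    refine (hasSum_ev_ser (ySZ_bound m) (x j) (w ^ m, η)).unique ?_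
    refine hasSum_of_eq
      ((hasSum_conj_iotaFun (m := m) (x j) (w * η)).mul_left ((w * η : Circle) : ℂ)) fun n => ?_
    rw [show ySZ m (n + 1) = e (n + 1 : ℕ) ((n + 1) * m : ℕ) from rfl, ev_e_apply, zpow_torus_pos, ← exponent_succ hm n, Nat.add_sub_cancel, pow_succ, acoef]
    ring_nf
  rw [wSZ, ev_radius, h, Phi_iota, map_add, map_mul, Complex.conj_ofReal]
  linear_combination (-(radius b j : ℂ)) * conj_mul_self (w * η)

theorem ev_wSbZ (hm : 1 ≤ m) (x : Fin 2 → Ell1) (j : Fin 2) (w η : Circle) :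
    ev (wSbZ m b j x) (w ^ m, η) =
      conj ((w * η : Circle) : ℂ) * Phi b (iota hm α x) j (w * η) := by
  have h : ev (ser (ySbZ m) (x j)) (w ^ m, η) =
      conj ((w * η : Circle) : ℂ) * iotaFun m (x j) (w * η) := by
    refine (hasSum_ev_ser (ySbZ_bound m) (x j) (w ^ m, η)).unique ?_
    refine hasSum_of_eq
      ((hasSum_iotaFun (m := m) (x j) (w * η)).mul_left (conj ((w * η : Circle) : ℂ))) fun n => ?_
    rw [show ySbZ m (n + 1) = e (-(n + 1 : ℕ)) (-((n + 1) * m : ℕ)) from rfl, ev_e_apply, zpow_torus_neg, ← exponent_succ hm n, Nat.add_sub_cancel, pow_succ, acoef]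
    ring_nf
  rw [wSbZ, ev_radius, h, Phi_iota]
  linear_combination (-(radius b j : ℂ)) * conj_mul_self (w * η)

theorem ev_wDZ (hm : 1 ≤ m) (x : Fin 2 → Ell1) (j : Fin 2) (w η : Circle) :
    ev (wDZ m b j x) (w ^ m, η) = circleDeriv (Phi b (iota hm α x) j) (w * η) := by
  have h : ev (ser (yDZ m) (x j)) (w ^ m, η) = iotaDer m (x j) (w * η) := by
    refine (hasSum_ev_ser (yDZ_bound m) (x j) (w ^ m, η)).unique ?_
    convert (show HasSum _ (iotaDer m (x j) (w * η)) from
      (summable_iotaDerTerm m (x j) (w * η)).hasSum) using 2 with n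
    rw [yDZ, map_smul, ContinuousMap.smul_apply, ev_e_apply, zpow_torus_neg,
      iotaDerTerm, exponent_succ hm n, acoef, Nat.cast_sub (Nat.mul_pos (Nat.succ_pos n) hm),
      Complex.real_smul]
    push_cast
    ring
  rw [wDZ, ev_radius, h, circleDeriv_Phi_iota]

theorem geom_Icc (z : ℂ) (K : ℕ) (hz : z ≠ 0) :
    (1 - z) * ∑ l ∈ Finset.Icc 1 K, z ^ (-(l : ℤ)) = z ^ (-(K : ℤ)) - 1 := by
  induction K with
  | zero => simp
  | succ K ih =>
    rw [Finset.sum_Icc_succ_top (by omega), mul_add, ih]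
    have h : z ^ (-(K : ℤ)) = z * z ^ (-((K + 1 : ℕ) : ℤ)) := by
      rw [mul_comm, ← zpow_add_one₀ hz]
      congr 1
      push_cast
      ring
    rw [h]
    ring

/-- The difference of the monomials w̄^{km-1} at w and wη is w̄^{km-1}(1 - η^{-(km-1)}), which a
geometric sum divides by 1 - η. The quotient is a finite sum and stays meaningful at η = 1. -/
theorem ev_wq (hm : 1 ≤ m) (x : Fin 2 → Ell1) (j : Fin 2) (w η : Circle) :
    (1 - (η : ℂ)) * ev (wq m b j x) (w ^ m, η) =
      conj (w : ℂ) * (Phi b (iota hm α x) j w - Phi b (iota hm α x) j (w * η)) := by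
  have h : (1 - (η : ℂ)) * ev (ser (yq m) (x j)) (w ^ m, η) =
      conj (w : ℂ) * (iotaFun m (x j) w - iotaFun m (x j) (w * η)) := by
    refine ((hasSum_ev_ser (yq_bound m) (x j) (w ^ m, η)).mul_left _).unique ?_
    refine hasSum_of_eq (((hasSum_iotaFun (m := m) (x j) w).sub
      (hasSum_iotaFun (m := m) (x j) (w * η))).mul_left (conj (w : ℂ))) fun n => ?_
    have h1 := geom_Icc (η : ℂ) ((n + 1) * m - 1) (Circle.coe_ne_zero η)
    have h2 : ev (yq m (n + 1)) (w ^ m, η) = -(conj (w : ℂ) ^ ((n + 1) * m) *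
        ∑ l ∈ Finset.Icc 1 ((n + 1) * m - 1), (η : ℂ) ^ (-(l : ℤ))) := by
      rw [yq, map_neg, map_sum, ContinuousMap.neg_apply, ContinuousMap.sum_apply, Finset.mul_sum]
      simp only [ev_e_apply, coe_zpow_neg]
    rw [h2, Circle.coe_mul, map_mul, mul_pow, ← coe_zpow_neg' η, ← acoef]
    have h3 : conj (w : ℂ) ^ ((n + 1) * m) = conj (w : ℂ) * conj (w : ℂ) ^ ((n + 1) * m - 1) := by
      rw [← pow_succ', exponent_succ hm]
    rw [h3]
    linear_combination (-(acoef (x j) n : ℂ) * conj (w : ℂ) *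
      conj (w : ℂ) ^ ((n + 1) * m - 1)) * h1
  rw [wq, ev_radius, mul_add, h, Phi_iota, Phi_iota, Circle.coe_mul]
  linear_combination (-(radius b j : ℂ) * (1 - (η : ℂ))) * conj_mul_self w

theorem ev_wqs_eq_conj (x : Fin 2 → Ell1) (j : Fin 2) (u η : Circle) :
    ev (wqs m b j x) (u, η) = conj (ev (wq m b j x) (u, η)) := by
  have h : ev (ser (yqs m) (x j)) (u, η) = conj (ev (ser (yq m) (x j)) (u, η)) := by
    refine (hasSum_ev_ser (yqs_bound m) (x j) (u, η)).unique ?_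
    have h1 := (hasSum_ev_ser (yq_bound m) (x j) (u, η)).mapL Complex.conjCLE.toContinuousLinearMap
    simp only [ContinuousLinearEquiv.coe_coe, Complex.conjCLE_apply, map_mul,
      Complex.conj_ofReal] at h1
    convert h1 using 3 with n
    rw [yqs, yq, map_neg, map_neg, map_sum, map_sum, ContinuousMap.neg_apply,
      ContinuousMap.neg_apply, ContinuousMap.sum_apply, ContinuousMap.sum_apply, map_neg, map_sum]
    congr 1
    refine Finset.sum_congr rfl fun l _ => ?_
    rw [ev_e_apply, ev_e_apply, map_mul, map_zpow₀, map_zpow₀, ← Circle.coe_inv_eq_conj,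
      ← Circle.coe_inv_eq_conj, Circle.coe_inv, Circle.coe_inv, inv_zpow, inv_zpow, zpow_neg,
      zpow_neg, inv_inv, inv_inv]
  rw [wqs, wq, ev_radius, ev_radius, h, map_add, Complex.conj_ofReal]

/-- Multiplying the numerator of the kernel by ξ and the denominator by w̄ turns both into functions
of w^m and η. On one boundary the factor 1 - η cancels because (1 - η̄)η = -(1 - η), leaving minus
the conjugate divided difference over the divided difference. The point η = 1 is excluded because
`kern` is 0/0 = 0 there. -/
theorem ev_wT (hm : 1 ≤ m) {x : Fin 2 → Ell1} (j i : Fin 2) (hx : IsUnit (wDen m b j i x))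
    (w : Circle) {η : Circle} (hη : (η : ℂ) ≠ 1) :
    ev (wT m b j i x) (w ^ m, η) = kern b (iota hm α x) j i w (w * η) * w := by
  have hne : ev (wDen m b j i x) (w ^ m, η) ≠ 0 := by
    intro h0
    have h : ev (wDen m b j i x * Ring.inverse (wDen m b j i x)) (w ^ m, η) = 1 := by
      rw [Ring.mul_inverse_cancel _ hx, ev_one]; rfl
    rw [ev_mul, ContinuousMap.mul_apply, h0, zero_mul] at h
    exact zero_ne_one h
  rw [wT, ev_mul, ev_mul, ContinuousMap.mul_apply, ContinuousMap.mul_apply, ev_inverse hx,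
    ev_wDZ (α := α) hm, kern]
  have hw := Circle.coe_ne_zero w
  have hcw : conj (w : ℂ) ≠ 0 := by simp
  have hη1 : 1 - (η : ℂ) ≠ 0 := sub_ne_zero.2 (Ne.symm hη)
  have key : ev (wNum m b j i x) (w ^ m, η) * (Phi b (iota hm α x) j w -
      Phi b (iota hm α x) i (w * η)) = ev (wDen m b j i x) (w ^ m, η) *
      (conj (Phi b (iota hm α x) j w) - conj (Phi b (iota hm α x) i (w * η))) *
      ((w * η : Circle) : ℂ) * w := by
    by_cases hji : j = i
    · subst hji
      rw [wNum, wDen, if_pos rfl, if_pos rfl, map_neg, ContinuousMap.neg_apply, ev_wqs_eq_conj]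
      have h1 := ev_wq (α := α) (b := b) hm x j w η
      have h2 := congrArg conj h1
      rw [map_mul, map_mul, map_sub, map_sub, map_one, Complex.conj_conj] at h2
      have h3 := conj_mul_self w
      have h4 := conj_mul_self η
      have hcη1 : 1 - conj (η : ℂ) ≠ 0 := by
        intro h
        apply hη1
        have := congrArg conj h
        simpa using this
      rw [← mul_right_inj' hη1, ← mul_right_inj' hcη1, Circle.coe_mul]
      set q := ev (wq m b j x) (w ^ m, η)
      set P := Phi b (iota hm α x) j w - Phi b (iota hm α x) j (w * η)
      set P' := conj (Phi b (iota hm α x) j w) - conj (Phi b (iota hm α x) j (w * η))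
      linear_combination (-(1 - (η : ℂ)) * P) * h2 +
        (-(1 - conj (η : ℂ)) * P' * w * w * η) * h1 +
        (-(1 - conj (η : ℂ)) * P' * P * w * η) * h3 + (w * P' * P) * h4
    · have h1 := ev_wS (α := α) (b := b) hm x j w η
      have h2 := ev_wSb (α := α) (b := b) hm x j w η
      have h3 := ev_wSZ (α := α) (b := b) hm x i w η
      have h4 := ev_wSbZ (α := α) (b := b) hm x i w η
      have h5 := conj_mul_self w
      have h6 := conj_mul_self η
      rw [wNum, wDen, if_neg hji, if_neg hji, map_sub, map_sub, ContinuousMap.sub_apply,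
        ContinuousMap.sub_apply, ev_mul, ev_mul, ContinuousMap.mul_apply, ContinuousMap.mul_apply,
        ev_e_apply, zpow_zero, zpow_one, one_mul, h1, h2, h3, h4, Circle.coe_mul, map_mul]
      set P1 := Phi b (iota hm α x) j w
      set P2 := Phi b (iota hm α x) i (w * η)
      linear_combination (-(w : ℂ) * η * (conj P1 - conj P2) * (P1 - (η : ℂ) * conj (η : ℂ) * P2)) * h5 +
        (w : ℂ) * η * (conj P1 - conj P2) * P2 * h6
  have hne2 : Phi b (iota hm α x) j w - Phi b (iota hm α x) i (w * η) ≠ 0 := by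
    by_cases hji : j = i
    · subst hji
      rw [wDen, if_pos rfl] at hne
      intro h
      have h1 := ev_wq (α := α) (b := b) hm x j w η
      rw [h, mul_zero] at h1
      exact (mul_ne_zero hη1 hne) h1
    · rw [wDen, if_neg hji, map_sub, ContinuousMap.sub_apply, ev_mul, ContinuousMap.mul_apply,
        ev_e_apply, zpow_zero, zpow_one, one_mul, ev_wSb (α := α) hm, ev_wSbZ (α := α) hm,
        Circle.coe_mul, map_mul] at hne
      intro h
      apply hne
      linear_combination conj (w : ℂ) * h - conj (w : ℂ) *
        Phi b (iota hm α x) i (w * η) * conj_mul_self η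
  field_simp
  linear_combination circleDeriv (Phi b (iota hm α x) i) (w * η) * key

theorem coe_exp_ne_one {s : ℝ} (h1 : s ∈ Set.uIoc (-Real.pi) Real.pi) (h2 : s ≠ 0) :
    ((Circle.exp s : Circle) : ℂ) ≠ 1 := by
  intro h
  rw [Set.uIoc_of_le (by linarith [Real.pi_pos])] at h1
  have h3 := Circle.arg_exp h1.1 h1.2
  rw [h, Complex.arg_one] at h3
  exact h2 h3.symm

theorem G_iota (hm : 1 ≤ m) {x : Fin 2 → Ell1} (hx : ∀ j i, IsUnit (wDen m b j i x)) (lam : ℝ)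
    (j : Fin 2) (w : Circle) :
    G b lam (iota hm α x) j w = outFun m w (GW m b (lam, x) j) := by
  -- The kernel formula can fail only at ξ = w, that is s = 0, a null set for the integral.
  have hae : ∀ᵐ s : ℝ, s ≠ 0 := by simp [ae_iff]
  have hk : ∀ i, ∀ᵐ s : ℝ, s ∈ Set.uIoc (-Real.pi) Real.pi →
      conj (w : ℂ) * ev (wT m b j i x) (w ^ m, Circle.exp s) =
      kern b (iota hm α x) j i w (w * Circle.exp s) := fun i => by
    filter_upwards [hae] with s hs hs'
    rw [ev_wT (α := α) hm j i (hx j i) w (coe_exp_ne_one hs' hs)]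
    linear_combination kern b (iota hm α x) j i w (w * Circle.exp s) * conj_mul_self w
  rw [G_eq]
  · rw [GW, ← im_torusMean_ev, torusMean_apply]
    congr 2
    refine intervalIntegral.integral_congr_ae ?_
    filter_upwards [hae] with s hs hs'
    have hs1 := coe_exp_ne_one hs' hs
    rw [wP, ev_mul, ContinuousMap.mul_apply, map_add, ContinuousMap.add_apply, map_sub,
      ContinuousMap.sub_apply, map_smul, ContinuousMap.smul_apply, ev_wT (α := α) hm j 0 (hx j 0) w hs1,
      ev_wT (α := α) hm j 1 (hx j 1) w hs1, ev_wS (α := α) hm, ev_wD (α := α) hm, integrandG,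
      Complex.real_smul]
    push_cast
    ring
  · intro i
    have hc : IntervalIntegrable (fun s => conj (w : ℂ) * ev (wT m b j i x) (w ^ m, Circle.exp s))
        volume (-Real.pi) Real.pi := Continuous.intervalIntegrable (by fun_prop) _ _
    exact hc.congr_ae ((ae_restrict_iff' measurableSet_uIoc).2 (hk i))

end EvalG


/-! ### Third order Taylor expansions along curves -/

open Asymptotics in
/-- `f(t) = p₀ + t p₁ + t² p₂ + t³ p₃ + O(t⁴)` as `t → 0`. -/
def HasJet {E : Type*} [NormedAddCommGroup E] [NormedSpace ℝ E] (f : ℝ → E) (p₀ p₁ p₂ p₃ : E) :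
    Prop :=
  (fun t => f t - (p₀ + t • p₁ + t ^ 2 • p₂ + t ^ 3 • p₃)) =O[𝓝 0] fun t : ℝ => t ^ 4

namespace HasJet

open Asymptotics

variable {E F : Type*} [NormedAddCommGroup E] [NormedSpace ℝ E] [NormedAddCommGroup F]
  [NormedSpace ℝ F]

theorem of_eq {f : ℝ → E} {p₀ p₁ p₂ p₃ : E}
    (h : ∀ t, f t = p₀ + t • p₁ + t ^ 2 • p₂ + t ^ 3 • p₃) : HasJet f p₀ p₁ p₂ p₃ := by
  refine (isBigO_zero _ _).congr_left fun t => ?_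
  rw [h, sub_self]

theorem congr {f g : ℝ → E} {p₀ p₁ p₂ p₃ : E} (h : HasJet f p₀ p₁ p₂ p₃) (hfg : f =ᶠ[𝓝 0] g) :
    HasJet g p₀ p₁ p₂ p₃ :=
  IsBigO.congr' h (hfg.mono fun t ht => by simp only [ht]) EventuallyEq.rfl

theorem add {f g : ℝ → E} {p₀ p₁ p₂ p₃ q₀ q₁ q₂ q₃ : E} (hf : HasJet f p₀ p₁ p₂ p₃)
    (hg : HasJet g q₀ q₁ q₂ q₃) :
    HasJet (fun t => f t + g t) (p₀ + q₀) (p₁ + q₁) (p₂ + q₂) (p₃ + q₃) := by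
  refine (IsBigO.add hf hg).congr_left fun t => ?_
  simp only [smul_add]
  abel

theorem map (L : E →L[ℝ] F) {f : ℝ → E} {p₀ p₁ p₂ p₃ : E} (hf : HasJet f p₀ p₁ p₂ p₃) :
    HasJet (fun t => L (f t)) (L p₀) (L p₁) (L p₂) (L p₃) := by
  refine ((L.isBigO_comp _ _).trans hf).congr_left fun t => ?_
  simp

theorem const_smul (c : ℝ) {f : ℝ → E} {p₀ p₁ p₂ p₃ : E} (hf : HasJet f p₀ p₁ p₂ p₃) :
    HasJet (fun t => c • f t) (c • p₀) (c • p₁) (c • p₂) (c • p₃) :=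
  hf.map (c • ContinuousLinearMap.id ℝ E)

theorem neg {f : ℝ → E} {p₀ p₁ p₂ p₃ : E} (hf : HasJet f p₀ p₁ p₂ p₃) :
    HasJet (fun t => -f t) (-p₀) (-p₁) (-p₂) (-p₃) :=
  hf.map (-ContinuousLinearMap.id ℝ E)

theorem sub {f g : ℝ → E} {p₀ p₁ p₂ p₃ q₀ q₁ q₂ q₃ : E} (hf : HasJet f p₀ p₁ p₂ p₃)
    (hg : HasJet g q₀ q₁ q₂ q₃) :
    HasJet (fun t => f t - g t) (p₀ - q₀) (p₁ - q₁) (p₂ - q₂) (p₃ - q₃) := by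
  simpa only [sub_eq_add_neg] using hf.add hg.neg

theorem isBigO_poly (p₀ p₁ p₂ p₃ : E) :
    (fun t : ℝ => p₀ + t • p₁ + t ^ 2 • p₂ + t ^ 3 • p₃) =O[𝓝 0] fun _ => (1 : ℝ) := by
  have : ContinuousAt (fun t : ℝ => p₀ + t • p₁ + t ^ 2 • p₂ + t ^ 3 • p₃) 0 := by fun_prop
  exact this.isBigO_one ℝ

theorem pow_isBigO_one : (fun t : ℝ => t ^ 4) =O[𝓝 0] fun _ => (1 : ℝ) := by
  have : ContinuousAt (fun t : ℝ => t ^ 4) 0 := by fun_prop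
  exact this.isBigO_one ℝ

theorem isBigO_one {f : ℝ → E} {p₀ p₁ p₂ p₃ : E} (hf : HasJet f p₀ p₁ p₂ p₃) :
    f =O[𝓝 0] fun _ => (1 : ℝ) := by
  have h := (IsBigO.trans hf pow_isBigO_one).add (isBigO_poly p₀ p₁ p₂ p₃)
  simpa using h

variable {A : Type*} [NormedCommRing A] [NormedAlgebra ℝ A]

theorem mul {f g : ℝ → A} {p₀ p₁ p₂ p₃ q₀ q₁ q₂ q₃ : A} (hf : HasJet f p₀ p₁ p₂ p₃)
    (hg : HasJet g q₀ q₁ q₂ q₃) :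
    HasJet (fun t => f t * g t) (p₀ * q₀) (p₀ * q₁ + p₁ * q₀) (p₀ * q₂ + p₁ * q₁ + p₂ * q₀)
      (p₀ * q₃ + p₁ * q₂ + p₂ * q₁ + p₃ * q₀) := by
  have h1 := IsBigO.mul hf hg.isBigO_one
  have h2 := (isBigO_poly p₀ p₁ p₂ p₃).mul hg
  have h3 : (fun t : ℝ => t ^ 4 • ((p₁ * q₃ + p₂ * q₂ + p₃ * q₁) + t • (p₂ * q₃ + p₃ * q₂) +
      t ^ 2 • (p₃ * q₃) + t ^ 3 • (0 : A))) =O[𝓝 0] fun t : ℝ => t ^ 4 * 1 :=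
    (isBigO_refl (fun t : ℝ => t ^ 4) (𝓝 0)).smul (isBigO_poly _ _ _ _)
  simp only [mul_one, one_mul] at h1 h2 h3
  refine ((h1.add h2).add h3).congr_left fun t => ?_
  simp only [Algebra.smul_def, map_pow]
  ring

/-- The listed coefficients are those of the inverse of the polynomial p modulo t⁴. So f times the
candidate is 1 + O(t⁴), and multiplying by the inverse of f, which stays bounded near 0, gives the
expansion. -/
theorem inverse [CompleteSpace A] {f : ℝ → A} {p₀ p₁ p₂ p₃ g : A} (hf : HasJet f p₀ p₁ p₂ p₃)
    (hg : g * p₀ = 1) :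
    HasJet (fun t => Ring.inverse (f t)) g (-(g * p₁ * g))
      (-(g * (p₁ * -(g * p₁ * g) + p₂ * g)))
      (-(g * (p₁ * -(g * (p₁ * -(g * p₁ * g) + p₂ * g)) + p₂ * -(g * p₁ * g) + p₃ * g))) := by
  have hu : IsUnit p₀ := IsUnit.of_mul_eq_one g (by rw [mul_comm, hg])
  have h0 : Tendsto f (𝓝 0) (𝓝 p₀) := by
    have h1 : (fun t : ℝ => t ^ 4) =o[𝓝 0] fun _ => (1 : ℝ) := by
      rw [isLittleO_one_iff]
      have : ContinuousAt (fun t : ℝ => t ^ 4) 0 := by fun_prop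
      simpa using this.tendsto
    have h2 := (IsBigO.trans_isLittleO hf h1)
    rw [isLittleO_one_iff] at h2
    have h3 : ContinuousAt (fun t : ℝ => p₀ + t • p₁ + t ^ 2 • p₂ + t ^ 3 • p₃) 0 := by fun_prop
    simpa using h2.add h3.tendsto
  have hev : ∀ᶠ t in 𝓝 0, IsUnit (f t) := h0.eventually (Units.isOpen.mem_nhds hu)
  obtain ⟨v, rfl⟩ := hu
  have hinv : (fun t => Ring.inverse (f t)) =O[𝓝 0] fun _ => (1 : ℝ) :=
    ((NormedRing.inverse_continuousAt v).tendsto.comp h0).isBigO_one ℝ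
  set q₁ := -(g * p₁ * g) with hq1
  set q₂ := -(g * (p₁ * q₁ + p₂ * g)) with hq2
  set q₃ := -(g * (p₁ * q₂ + p₂ * q₁ + p₃ * g)) with hq3
  have hq : HasJet (fun t : ℝ => g + t • q₁ + t ^ 2 • q₂ + t ^ 3 • q₃) g q₁ q₂ q₃ :=
    of_eq fun t => rfl
  have hm := hf.mul hq
  have e1 : (v : A) * q₁ + p₁ * g = 0 := by
    rw [hq1]; linear_combination (-(p₁ * g)) * hg
  have e2 : (v : A) * q₂ + p₁ * q₁ + p₂ * g = 0 := by
    rw [hq2]; linear_combination (-(p₁ * q₁ + p₂ * g)) * hg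
  have e3 : (v : A) * q₃ + p₁ * q₂ + p₂ * q₁ + p₃ * g = 0 := by
    rw [hq3]; linear_combination (-(p₁ * q₂ + p₂ * q₁ + p₃ * g)) * hg
  have hm' : (fun t : ℝ => f t * (g + t • q₁ + t ^ 2 • q₂ + t ^ 3 • q₃) - 1)
      =O[𝓝 0] fun t : ℝ => t ^ 4 := by
    refine IsBigO.congr_left hm fun t => ?_
    rw [e1, e2, e3, mul_comm (v : A) g, hg]
    simp
  have h4 := (hinv.mul hm').neg_left
  simp only [one_mul] at h4
  refine h4.congr' (hev.mono fun t ht => ?_) EventuallyEq.rfl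
  have h5 := Ring.inverse_mul_cancel _ ht
  simp only
  linear_combination (-(g + t • q₁ + t ^ 2 • q₂ + t ^ 3 • q₃)) * h5

end HasJet

namespace Wiener

/-! ### Means of monomials -/

theorem avg_bound (n j : ℤ) : ‖if j = 0 then e n 0 else (0 : Wiener)‖ ≤ 1 * (1 + |(n : ℝ)|) := by
  split_ifs
  · rw [norm_e, one_mul]
  · rw [norm_zero]; positivity

/-- The mean over `η`. -/
def avg : Wiener →L[ℝ] Wiener := lift (fun n j => if j = 0 then e n 0 else 0) 1 avg_bound

theorem avg_e (n j : ℤ) : avg (e n j) = if j = 0 then e n 0 else 0 := lift_e avg_bound n j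

theorem avg_e_mul (n : ℤ) (x : Wiener) : avg (e n 0 * x) = e n 0 * avg x := by
  have h : avg.comp (ContinuousLinearMap.mul ℝ Wiener (e n 0)) =
      (ContinuousLinearMap.mul ℝ Wiener (e n 0)).comp avg := by
    refine ext_e fun n' j => ?_
    rw [ContinuousLinearMap.comp_apply, ContinuousLinearMap.comp_apply,
      ContinuousLinearMap.mul_apply', ContinuousLinearMap.mul_apply', e_mul, zero_add, avg_e, avg_e]
    split_ifs with hj
    · rw [e_mul, add_zero]
    · rw [mul_zero]
  exact congrArg (fun L => L x) h

theorem R_avg (x : Wiener) : R (avg x) = R x := by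
  have h : R.comp avg = R := by
    refine ext_e fun n j => ?_
    rw [ContinuousLinearMap.comp_apply, avg_e, R_e]
    split_ifs with hj
    · rw [R_e, if_pos rfl]
    · rw [map_zero]
  exact congrArg (fun L => L x) h

theorem norm_avg_e_mul_le (n j : ℤ) (x : Wiener) :
    ‖avg (e n j * x)‖ ≤ ‖avg‖ * ((1 + |(n : ℝ)|) * ‖x‖) := by
  refine (ContinuousLinearMap.le_opNorm _ _).trans ?_
  gcongr
  exact (norm_mul_le _ _).trans (by rw [norm_e])

/-- Iteration gives v_j = b^N v_{j+N}, a bounded quantity times b^N, which tends to 0. This replaces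
expanding the inverses as geometric series. -/
theorem eq_zero_of_shift {E : Type*} [NormedAddCommGroup E] [NormedSpace ℝ E] {b : ℝ}
    (hb : b ∈ Ioo (0 : ℝ) 1) {v : ℕ → E} {C : ℝ} (hC : ∀ j, ‖v j‖ ≤ C)
    (h : ∀ j, v j = b • v (j + 1)) (j : ℕ) : v j = 0 := by
  have h1 : ∀ N, v j = b ^ N • v (j + N) := by
    intro N
    induction N with
    | zero => simp
    | succ N ih => rw [ih, h (j + N), smul_smul, pow_succ, add_assoc]
  have h2 : ∀ N : ℕ, ‖v j‖ ≤ b ^ N * C := fun N => by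
    rw [h1 N, norm_smul, Real.norm_of_nonneg (pow_nonneg hb.1.le N)]
    exact mul_le_mul_of_nonneg_left (hC _) (pow_nonneg hb.1.le N)
  have h3 : Tendsto (fun N : ℕ => b ^ N * C) atTop (𝓝 (0 * C)) :=
    (tendsto_pow_atTop_nhds_zero_of_lt_one hb.1.le hb.2).mul_const C
  rw [zero_mul] at h3
  exact norm_le_zero_iff.1 (ge_of_tendsto' h3 h2)

section Outer

variable {b : ℝ} (hb : b ∈ Ioo (0 : ℝ) 1) {g : Wiener} (hg : g * (1 - b • e 0 1) = 1)

-- The relation g = 1 + bη g, for g = (1 - bη)⁻¹, multiplied by u^n η^j g^r and averaged.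
include hg in
theorem outer_rec (n j : ℤ) (r : ℕ) :
    avg (e n j * g ^ (r + 1)) = avg (e n j * g ^ r) + b • avg (e n (j + 1) * g ^ (r + 1)) := by
  rw [← map_smul, ← map_add]
  congr 1
  have h : e n (j + 1) = e n j * e 0 1 := by rw [e_mul, add_zero]
  rw [h, ← mul_smul_comm, pow_succ]
  simp only [Algebra.smul_def] at hg ⊢
  linear_combination (e n j * g ^ r) * hg

-- The function g^r is a power series in η, so multiplying by a positive power of η leaves no
-- constant term. In the induction on r the recurrence becomes v_j = b v_{j+1} for a bounded
-- sequence, whence v = 0.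
include hb hg in
theorem outer_pos (n : ℤ) (r : ℕ) {j : ℤ} (hj : 0 < j) : avg (e n j * g ^ r) = 0 := by
  induction r generalizing j with
  | zero => rw [pow_zero, mul_one, avg_e, if_neg hj.ne']
  | succ r ih =>
    obtain ⟨k, rfl⟩ : ∃ k : ℕ, j = k + 1 := ⟨(j - 1).toNat, by omega⟩
    refine eq_zero_of_shift hb (v := fun k : ℕ => avg (e n ((k : ℤ) + 1) * g ^ (r + 1)))
      (fun k => norm_avg_e_mul_le n _ _) (fun k => ?_) k
    rw [outer_rec hg n ((k : ℤ) + 1) r, ih (by omega), zero_add]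
    push_cast
    rfl

-- This is the coefficient of η^p in (1 - bη)^{-(s+1)}. The recurrence in p and s is Pascal's rule.
include hb hg in
theorem outer_neg (n : ℤ) (s p : ℕ) : avg (e n (-(p : ℤ)) * g ^ (s + 1)) =
    (((p + s).choose s : ℝ) * b ^ p) • e n 0 := by
  induction s generalizing p with
  | zero =>
    induction p with
    | zero =>
      rw [outer_rec hg, outer_pos hb hg n (0 + 1) (j := -((0 : ℕ) : ℤ) + 1) (by simp), pow_zero,
        mul_one, avg_e]
      simp
    | succ p ih =>
      rw [outer_rec hg, show (-((p + 1 : ℕ) : ℤ) + 1) = -(p : ℤ) by push_cast; ring, ih, pow_zero,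
        mul_one, avg_e, if_neg (by push_cast; omega), smul_smul]
      simp only [add_zero, Nat.choose_zero_right, zero_add]
      congr 1
      push_cast
      ring
  | succ s ihs =>
    induction p with
    | zero =>
      rw [outer_rec hg, outer_pos hb hg n (s + 1 + 1) (j := -((0 : ℕ) : ℤ) + 1) (by simp), ihs]
      simp
    | succ p ih =>
      rw [outer_rec hg, show (-((p + 1 : ℕ) : ℤ) + 1) = -(p : ℤ) by push_cast; ring, ih, ihs,
        smul_smul, ← add_smul]
      congr 1
      have h : (p + 1 + (s + 1)).choose (s + 1) = (p + 1 + s).choose s + (p + (s + 1)).choose (s + 1) := by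
        rw [show p + 1 + (s + 1) = (p + 1 + s) + 1 by ring, Nat.choose_succ_succ,
          show p + 1 + s = p + (s + 1) by ring]
      rw [h]
      push_cast
      ring

end Outer

section Inner

variable {b : ℝ} (hb : b ∈ Ioo (0 : ℝ) 1) {g : Wiener} (hg : g * (b • 1 - e 0 1) = 1)

-- The relation ηg = bg - 1, for g = (b - η)⁻¹, multiplied by u^n η^j g^r and averaged.
include hg in
theorem inner_rec (n j : ℤ) (r : ℕ) :
    avg (e n (j + 1) * g ^ (r + 1)) =
      b • avg (e n j * g ^ (r + 1)) - avg (e n j * g ^ r) := by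
  rw [← map_smul, ← map_sub]
  congr 1
  have h : e n (j + 1) = e n j * e 0 1 := by rw [e_mul, add_zero]
  rw [h, ← mul_smul_comm, pow_succ]
  simp only [Algebra.smul_def] at hg ⊢
  linear_combination (-(e n j * g ^ r)) * hg

-- Since b < 1, the inverse of b - η expands in negative powers of η starting with -η⁻¹. Thus g^r
-- starts at η^{-r}, and η^j g^r has no constant term when j < r.
include hb hg in
theorem inner_neg (n : ℤ) (r : ℕ) {j : ℤ} (hj : j < r) : avg (e n j * g ^ r) = 0 := by
  induction r generalizing j with
  | zero =>
    rw [pow_zero, mul_one, avg_e, if_neg]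
    have : j < 0 := by simpa using hj
    exact this.ne
  | succ r ih =>
    obtain ⟨k, rfl⟩ : ∃ k : ℕ, j = r - k := ⟨(r - j).toNat, by push_cast at hj; omega⟩
    refine eq_zero_of_shift hb (v := fun k : ℕ => avg (e n ((r : ℤ) - k) * g ^ (r + 1)))
      (fun k => norm_avg_e_mul_le n _ _) (fun k => ?_) k
    rw [show (r : ℤ) - k = (r - (k + 1 : ℕ)) + 1 by push_cast; ring, inner_rec hg,
      ih (by push_cast; omega), sub_zero]

-- The identity (b - η)^{-r} = (-1)^r η^{-r}(1 - bη⁻¹)^{-r} reduces this to the binomial series,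
-- with r = s + 1.
include hb hg in
theorem inner_pos (n : ℤ) (s p : ℕ) : avg (e n ((p : ℤ) + s + 1) * g ^ (s + 1)) =
    ((-1) ^ (s + 1) * ((p + s).choose s : ℝ) * b ^ p) • e n 0 := by
  induction s generalizing p with
  | zero =>
    induction p with
    | zero =>
      rw [inner_rec hg, inner_neg hb hg n _ (by simp), pow_zero, mul_one, avg_e]
      simp
    | succ p ih =>
      rw [inner_rec hg, pow_zero, mul_one, avg_e, if_neg (by push_cast; omega),
        show ((p + 1 : ℕ) : ℤ) + (0 : ℕ) = (p : ℤ) + (0 : ℕ) + 1 by push_cast; ring, ih, smul_smul,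
        sub_zero]
      simp only [add_zero, Nat.choose_zero_right, zero_add]
      congr 1
      push_cast
      ring
  | succ s ihs =>
    induction p with
    | zero =>
      rw [inner_rec hg, inner_neg hb hg n _ (by push_cast; omega), 
        show ((0 : ℕ) : ℤ) + (s + 1 : ℕ) = (0 : ℕ) + (s : ℤ) + 1 by push_cast; ring, ihs]
      simp [pow_succ]
    | succ p ih =>
      rw [inner_rec hg, show ((p + 1 : ℕ) : ℤ) + (s + 1 : ℕ) = (p : ℤ) + (s + 1 : ℕ) + 1 by
        push_cast; ring, ih, show (p : ℤ) + (s + 1 : ℕ) + 1 = (p + 1 : ℕ) + (s : ℤ) + 1 by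
        push_cast; ring, ihs, smul_smul, ← sub_smul]
      congr 1
      have h : (p + 1 + (s + 1)).choose (s + 1) = (p + 1 + s).choose s + (p + (s + 1)).choose (s + 1) := by
        rw [show p + 1 + (s + 1) = (p + 1 + s) + 1 by ring, Nat.choose_succ_succ,
          show p + 1 + s = p + (s + 1) by ring]
      rw [h]
      push_cast
      ring

end Inner

end Wiener


theorem HasJet.congr_coeff {E : Type*} [NormedAddCommGroup E] [NormedSpace ℝ E] {f : ℝ → E}
    {p₀ p₁ p₂ p₃ q₀ q₁ q₂ q₃ : E} (h : HasJet f p₀ p₁ p₂ p₃) (h0 : p₀ = q₀) (h1 : p₁ = q₁)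
    (h2 : p₂ = q₂) (h3 : p₃ = q₃) : HasJet f q₀ q₁ q₂ q₃ := by
  subst h0 h1 h2 h3; exact h

/-! ### Expansions of the Cauchy kernel between the two boundaries -/

namespace CrossJet

variable {E : Type*} [AddCommGroup E] [Module ℝ E] (μ : ℕ → ℕ → ℕ → ℕ → ℕ → ℕ → E)
  (bj bi aj ai kj ki P S : ℝ)

/-- The coefficient of `t^0`; `μ p q x y z r` stands for `U^p U'^q h^x Z^y Z'^z g^r`. -/
def c0 : E :=
  ((-(bi * bi))) • μ 0 0 0 0 0 1 + ((bi * bj)) • μ 0 0 1 0 0 1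

/-- The coefficient of `t^1`; `μ p q x y z r` stands for `U^p U'^q h^x Z^y Z'^z g^r`. -/
def c1 : E :=
  ((aj * bi * bi)) • μ 0 1 0 0 0 2 + ((P * ai * bi)) • μ 0 1 0 0 1 1 +
    ((-(aj * bi * bj))) • μ 0 1 1 0 0 2 + ((-(P * ai * bj))) • μ 0 1 1 0 1 1 +
    ((-(ai * bi * bi))) • μ 0 1 1 0 1 2 + ((ai * bi * bj)) • μ 0 1 2 0 1 2 +
    ((-(ai * bi))) • μ 1 0 0 1 0 1 + ((aj * bi)) • μ 1 0 1 0 0 1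

/-- The coefficient of `t^2`; `μ p q x y z r` stands for `U^p U'^q h^x Z^y Z'^z g^r`. -/
def c2 : E :=
  ((bi * bi * kj)) • μ 0 2 0 0 0 2 + ((-(aj * aj * bi * bi))) • μ 0 2 0 0 0 3 +
    ((-(P * ai * aj * bi))) • μ 0 2 0 0 1 2 + ((S * bi * ki)) • μ 0 2 0 0 2 1 +
    ((-(bi * bj * kj))) • μ 0 2 1 0 0 2 + ((aj * aj * bi * bj)) • μ 0 2 1 0 0 3 +
    ((P * ai * aj * bj)) • μ 0 2 1 0 1 2 + ((2 * ai * aj * bi * bi)) • μ 0 2 1 0 1 3 +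
    ((-(S * bj * ki))) • μ 0 2 1 0 2 1 +
    ((P * ai * ai * bi) + (-(bi * bi * ki))) • μ 0 2 1 0 2 2 +
    ((-(2 * ai * aj * bi * bj))) • μ 0 2 2 0 1 3 +
    ((-(P * ai * ai * bj)) + (bi * bj * ki)) • μ 0 2 2 0 2 2 +
    ((-(ai * ai * bi * bi))) • μ 0 2 2 0 2 3 + ((ai * ai * bi * bj)) • μ 0 2 3 0 2 3 +
    ((ai * aj * bi)) • μ 1 1 0 1 0 2 + ((P * ai * ai)) • μ 1 1 0 1 1 1 +
    ((-(aj * aj * bi))) • μ 1 1 1 0 0 2 + ((-(P * ai * aj))) • μ 1 1 1 0 1 1 +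
    ((-(ai * ai * bi))) • μ 1 1 1 1 1 2 + ((ai * aj * bi)) • μ 1 1 2 0 1 2 +
    ((-(bi * ki))) • μ 2 0 0 2 0 1 + ((bi * kj)) • μ 2 0 1 0 0 1

/-- The coefficient of `t^3`; `μ p q x y z r` stands for `U^p U'^q h^x Z^y Z'^z g^r`. -/
def c3 : E :=
  ((-(2 * aj * bi * bi * kj))) • μ 0 3 0 0 0 3 + ((aj * aj * aj * bi * bi)) • μ 0 3 0 0 0 4 +
    ((-(P * ai * bi * kj))) • μ 0 3 0 0 1 2 + ((P * ai * aj * aj * bi)) • μ 0 3 0 0 1 3 +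
    ((-(S * aj * bi * ki))) • μ 0 3 0 0 2 2 + ((2 * aj * bi * bj * kj)) • μ 0 3 1 0 0 3 +
    ((-(aj * aj * aj * bi * bj))) • μ 0 3 1 0 0 4 + ((P * ai * bj * kj)) • μ 0 3 1 0 1 2 +
    ((-(P * ai * aj * aj * bj)) + (2 * ai * bi * bi * kj)) • μ 0 3 1 0 1 3 +
    ((-(3 * ai * aj * aj * bi * bi))) • μ 0 3 1 0 1 4 + ((S * aj * bj * ki)) • μ 0 3 1 0 2 2 +
    ((-(2 * P * ai * ai * aj * bi)) + (2 * aj * bi * bi * ki)) • μ 0 3 1 0 2 3 +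
    ((S * ai * bi * ki) + (P * ai * bi * ki)) • μ 0 3 1 0 3 2 +
    ((-(2 * ai * bi * bj * kj))) • μ 0 3 2 0 1 3 +
    ((3 * ai * aj * aj * bi * bj)) • μ 0 3 2 0 1 4 +
    ((2 * P * ai * ai * aj * bj) + (-(2 * aj * bi * bj * ki))) • μ 0 3 2 0 2 3 +
    ((3 * ai * ai * aj * bi * bi)) • μ 0 3 2 0 2 4 +
    ((-(S * ai * bj * ki)) + (-(P * ai * bj * ki))) • μ 0 3 2 0 3 2 +
    ((P * ai * ai * ai * bi) + (-(2 * ai * bi * bi * ki))) • μ 0 3 2 0 3 3 +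
    ((-(3 * ai * ai * aj * bi * bj))) • μ 0 3 3 0 2 4 +
    ((-(P * ai * ai * ai * bj)) + (2 * ai * bi * bj * ki)) • μ 0 3 3 0 3 3 +
    ((-(ai * ai * ai * bi * bi))) • μ 0 3 3 0 3 4 + ((ai * ai * ai * bi * bj)) • μ 0 3 4 0 3 4 +
    ((ai * bi * kj)) • μ 1 2 0 1 0 2 + ((-(ai * aj * aj * bi))) • μ 1 2 0 1 0 3 +
    ((-(P * ai * ai * aj))) • μ 1 2 0 1 1 2 + ((S * ai * ki)) • μ 1 2 0 1 2 1 +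
    ((-(aj * bi * kj))) • μ 1 2 1 0 0 2 + ((aj * aj * aj * bi)) • μ 1 2 1 0 0 3 +
    ((P * ai * aj * aj)) • μ 1 2 1 0 1 2 + ((-(S * aj * ki))) • μ 1 2 1 0 2 1 +
    ((2 * ai * ai * aj * bi)) • μ 1 2 1 1 1 3 +
    ((P * ai * ai * ai) + (-(ai * bi * ki))) • μ 1 2 1 1 2 2 +
    ((-(2 * ai * aj * aj * bi))) • μ 1 2 2 0 1 3 +
    ((-(P * ai * ai * aj)) + (aj * bi * ki)) • μ 1 2 2 0 2 2 +
    ((-(ai * ai * ai * bi))) • μ 1 2 2 1 2 3 + ((ai * ai * aj * bi)) • μ 1 2 3 0 2 3 +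
    ((aj * bi * ki)) • μ 2 1 0 2 0 2 + ((P * ai * ki)) • μ 2 1 0 2 1 1 +
    ((-(aj * bi * kj))) • μ 2 1 1 0 0 2 + ((-(P * ai * kj))) • μ 2 1 1 0 1 1 +
    ((-(ai * bi * ki))) • μ 2 1 1 2 1 2 + ((ai * bi * kj)) • μ 2 1 2 0 1 2

/-- The coefficients are linear combinations of an abstract family μ so that the mean over η can be
applied monomial by monomial after a single expansion. -/
theorem map_c0 {F : Type*} [AddCommGroup F] [Module ℝ F] (L : E →ₗ[ℝ] F) :
    L (c0 μ bj bi) =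
      c0 (fun p q x y z r => L (μ p q x y z r)) bj bi := by
  simp only [c0, map_add, map_smul]

theorem map_c1 {F : Type*} [AddCommGroup F] [Module ℝ F] (L : E →ₗ[ℝ] F) :
    L (c1 μ bj bi aj ai P) =
      c1 (fun p q x y z r => L (μ p q x y z r)) bj bi aj ai P := by
  simp only [c1, map_add, map_smul]

theorem map_c2 {F : Type*} [AddCommGroup F] [Module ℝ F] (L : E →ₗ[ℝ] F) :
    L (c2 μ bj bi aj ai kj ki P S) =
      c2 (fun p q x y z r => L (μ p q x y z r)) bj bi aj ai kj ki P S := by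
  simp only [c2, map_add, map_smul]

theorem map_c3 {F : Type*} [AddCommGroup F] [Module ℝ F] (L : E →ₗ[ℝ] F) :
    L (c3 μ bj bi aj ai kj ki P S) =
      c3 (fun p q x y z r => L (μ p q x y z r)) bj bi aj ai kj ki P S := by
  simp only [c3, map_add, map_smul]

variable {A : Type*} [NormedCommRing A] [NormedAlgebra ℝ A] [CompleteSpace A]

/-- In the application U = u^k, U' = u^{-k}, h = η, Z = η^{km}, Z' = η^{-km} and g inverts the
denominator at t = 0. The reals bj, bi are the radii, aj, ai and kj, ki the amplitudes of the modes
k and 2k, and P = km - 1, S = 2km - 1 the degrees produced by differentiation. No relation between U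
and U' or between Z and Z' is imposed here. -/
theorem hasJet {U U' h Z Z' g d₀ : A} {n d D : ℝ → A}
    (hn : HasJet n (bj • h - bi • 1) (aj • (U * h) - ai • (U * Z))
      (kj • (U ^ 2 * h) - ki • (U ^ 2 * Z ^ 2)) 0)
    (hd : HasJet d d₀ (aj • U' - ai • (U' * h * Z')) (kj • U' ^ 2 - ki • (U' ^ 2 * h * Z' ^ 2)) 0)
    (hD : HasJet D (bi • 1) (-(P * ai) • (U' * Z')) (-(S * ki) • (U' ^ 2 * Z' ^ 2)) 0)
    {μ' : ℕ → ℕ → ℕ → ℕ → ℕ → ℕ → A}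
    (hg : g * d₀ = 1) (hμ : ∀ p q x y z r, μ' p q x y z r =
      U ^ p * U' ^ q * h ^ x * Z ^ y * Z' ^ z * g ^ r) :
    HasJet (fun t => n t * Ring.inverse (d t) * D t) (c0 μ' bj bi) (c1 μ' bj bi aj ai P) (c2 μ' bj bi aj ai kj ki P S)
      (c3 μ' bj bi aj ai kj ki P S) := by
  have h0 := (hn.mul (hd.inverse hg)).mul hD
  refine h0.congr_coeff ?_ ?_ ?_ ?_
  · simp only [c0, hμ, Algebra.smul_def, map_mul, map_neg, map_add]
    ring
  · simp only [c1, hμ, Algebra.smul_def, map_mul, map_neg, map_add]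
    ring
  · simp only [c2, hμ, Algebra.smul_def, map_mul, map_neg, map_add, map_ofNat]
    ring
  · simp only [c3, hμ, Algebra.smul_def, map_mul, map_neg, map_add, map_ofNat]
    ring

end CrossJet
/-! ### Expansions of the Cauchy kernel on one boundary -/

namespace SelfJet

variable {E : Type*} [AddCommGroup E] [Module ℝ E] (μ : ℕ → ℕ → ℕ → ℕ → ℕ → ℕ → ℕ → E)
  (be al ka P S g : ℝ)

/-- The coefficient of `t^0`; `μ p q x y x' y' z` stands for
`U^p U'^q K₁^x K₂^y K₁'^x' K₂'^y' Z'^z`. -/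
def c0 : E :=
  ((-(be * be * g))) • μ 0 0 0 0 0 0 0

/-- The coefficient of `t^1`; `μ p q x y x' y' z` stands for
`U^p U'^q K₁^x K₂^y K₁'^x' K₂'^y' Z'^z`. -/
def c1 : E :=
  ((P * al * be * g)) • μ 0 1 0 0 0 0 1 + ((-(al * be * be * g * g))) • μ 0 1 0 0 1 0 0 +
    ((al * be * g)) • μ 1 0 1 0 0 0 0

/-- The coefficient of `t^2`; `μ p q x y x' y' z` stands for
`U^p U'^q K₁^x K₂^y K₁'^x' K₂'^y' Z'^z`. -/
def c2 : E :=
  ((S * be * g * ka)) • μ 0 2 0 0 0 0 2 + ((-(be * be * g * g * ka))) • μ 0 2 0 0 0 1 0 +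
    ((P * al * al * be * g * g)) • μ 0 2 0 0 1 0 1 +
    ((-(al * al * be * be * g * g * g))) • μ 0 2 0 0 2 0 0 +
    ((-(P * al * al * g))) • μ 1 1 1 0 0 0 1 + ((al * al * be * g * g)) • μ 1 1 1 0 1 0 0 +
    ((be * g * ka)) • μ 2 0 0 1 0 0 0

/-- The coefficient of `t^3`; `μ p q x y x' y' z` stands for
`U^p U'^q K₁^x K₂^y K₁'^x' K₂'^y' Z'^z`. -/
def c3 : E :=
  ((P * al * be * g * g * ka)) • μ 0 3 0 0 0 1 1 +
    ((S * al * be * g * g * ka)) • μ 0 3 0 0 1 0 2 +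
    ((-(2 * al * be * be * g * g * g * ka))) • μ 0 3 0 0 1 1 0 +
    ((P * al * al * al * be * g * g * g)) • μ 0 3 0 0 2 0 1 +
    ((-(al * al * al * be * be * g * g * g * g))) • μ 0 3 0 0 3 0 0 +
    ((-(S * al * g * ka))) • μ 1 2 1 0 0 0 2 + ((al * be * g * g * ka)) • μ 1 2 1 0 0 1 0 +
    ((-(P * al * al * al * g * g))) • μ 1 2 1 0 1 0 1 +
    ((al * al * al * be * g * g * g)) • μ 1 2 1 0 2 0 0 +
    ((-(P * al * g * ka))) • μ 2 1 0 1 0 0 1 + ((al * be * g * g * ka)) • μ 2 1 0 1 1 0 0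

theorem map_c0 {F : Type*} [AddCommGroup F] [Module ℝ F] (L : E →ₗ[ℝ] F) :
    L (c0 μ be g) = c0 (fun p q x y x' y' z => L (μ p q x y x' y' z)) be g := by
  simp only [c0, map_add, map_smul]

theorem map_c1 {F : Type*} [AddCommGroup F] [Module ℝ F] (L : E →ₗ[ℝ] F) :
    L (c1 μ be al P g) = c1 (fun p q x y x' y' z => L (μ p q x y x' y' z)) be al P g := by
  simp only [c1, map_add, map_smul]

theorem map_c2 {F : Type*} [AddCommGroup F] [Module ℝ F] (L : E →ₗ[ℝ] F) :
    L (c2 μ be al ka P S g) = c2 (fun p q x y x' y' z => L (μ p q x y x' y' z)) be al ka P S g := by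
  simp only [c2, map_add, map_smul]

theorem map_c3 {F : Type*} [AddCommGroup F] [Module ℝ F] (L : E →ₗ[ℝ] F) :
    L (c3 μ be al ka P S g) = c3 (fun p q x y x' y' z => L (μ p q x y x' y' z)) be al ka P S g := by
  simp only [c3, map_add, map_smul]

variable {A : Type*} [NormedCommRing A] [NormedAlgebra ℝ A] [CompleteSpace A]

/-- Here K₁, K₂ stand for the geometric sums η + ⋯ + η^{km-1} and η + ⋯ + η^{2km-1}, the primed
letters for the same sums in η⁻¹. The denominator at t = 0 is the scalar be, so its inverse g is a
scalar and no series in η arises. -/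
theorem hasJet {U U' K₁ K₂ K₁' K₂' Z' : A} {n d D : ℝ → A}
    (hn : HasJet n (-be • 1) (al • (U * K₁)) (ka • (U ^ 2 * K₂)) 0)
    (hd : HasJet d (be • 1) (-al • (U' * K₁')) (-ka • (U' ^ 2 * K₂')) 0)
    (hD : HasJet D (be • 1) (-(P * al) • (U' * Z')) (-(S * ka) • (U' ^ 2 * Z' ^ 2)) 0)
    (hg : g * be = 1) {μ' : ℕ → ℕ → ℕ → ℕ → ℕ → ℕ → ℕ → A}
    (hμ : ∀ p q x y x' y' z, μ' p q x y x' y' z =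
      U ^ p * U' ^ q * K₁ ^ x * K₂ ^ y * K₁' ^ x' * K₂' ^ y' * Z' ^ z) :
    HasJet (fun t => n t * Ring.inverse (d t) * D t) (c0 μ' be g) (c1 μ' be al P g)
      (c2 μ' be al ka P S g) (c3 μ' be al ka P S g) := by
  have hg' : (g • 1 : A) * (be • 1) = 1 := by
    rw [smul_mul_smul_comm, hg, one_smul, mul_one]
  have h0 := (hn.mul (hd.inverse hg')).mul hD
  refine h0.congr_coeff ?_ ?_ ?_ ?_
  · simp only [c0, hμ, Algebra.smul_def, map_mul, map_neg]
    ring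
  · simp only [c1, hμ, Algebra.smul_def, map_mul, map_neg]
    ring
  · simp only [c2, hμ, Algebra.smul_def, map_mul, map_neg, map_add]
    ring
  · simp only [c3, hμ, Algebra.smul_def, map_mul, map_neg, map_add, map_ofNat]
    ring

end SelfJet

/-! ### Constant terms of η^j (1 - bη)^{-r} and η^j (b - η)^{-r} -/

namespace Wiener

theorem e_pow (n j : ℤ) (r : ℕ) : e n j ^ r = e (r * n) (r * j) := by
  induction r with
  | zero => rw [pow_zero, ← e_zero]; simp
  | succ r ih => rw [pow_succ, ih, e_mul]; congr 1 <;> push_cast <;> ring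

/-- The coefficient in the mean of `η^j (1 - b η)^{-r}`. -/
def outerC (b : ℝ) (j : ℤ) (r : ℕ) : ℝ :=
  if 0 < j then 0 else if r = 0 then (if j = 0 then 1 else 0)
    else ((-j).toNat + (r - 1)).choose (r - 1) * b ^ (-j).toNat

theorem avg_outer {b : ℝ} (hb : b ∈ Ioo (0 : ℝ) 1) {g : Wiener} (hg : g * (1 - b • e 0 1) = 1)
    (n j : ℤ) (r : ℕ) : avg (e n j * g ^ r) = outerC b j r • e n 0 := by
  unfold outerC
  split_ifs with h1 h2 h3
  · rw [outer_pos hb hg n r h1, zero_smul]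
  · rw [h2, pow_zero, mul_one, avg_e, if_pos h3, one_smul]
  · rw [h2, pow_zero, mul_one, avg_e, if_neg h3, zero_smul]
  · obtain ⟨p, rfl⟩ : ∃ p : ℕ, j = -(p : ℤ) := ⟨(-j).toNat, by omega⟩
    obtain ⟨s, rfl⟩ : ∃ s : ℕ, r = s + 1 := ⟨r - 1, by omega⟩
    rw [outer_neg hb hg n s p]
    simp

/-- The coefficient in the mean of `η^j (b - η)^{-r}`. -/
def innerC (b : ℝ) (j : ℤ) (r : ℕ) : ℝ :=
  if j < r then 0 else if r = 0 then (if j = 0 then 1 else 0)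
    else (-1) ^ r * ((j - r).toNat + (r - 1)).choose (r - 1) * b ^ (j - r).toNat

theorem avg_inner {b : ℝ} (hb : b ∈ Ioo (0 : ℝ) 1) {g : Wiener} (hg : g * (b • 1 - e 0 1) = 1)
    (n j : ℤ) (r : ℕ) : avg (e n j * g ^ r) = innerC b j r • e n 0 := by
  unfold innerC
  split_ifs with h1 h2 h3
  · rw [inner_neg hb hg n r h1, zero_smul]
  · rw [h2, pow_zero, mul_one, avg_e, if_pos h3, one_smul]
  · rw [h2, pow_zero, mul_one, avg_e, if_neg h3, zero_smul]
  · obtain ⟨s, rfl⟩ : ∃ s : ℕ, r = s + 1 := ⟨r - 1, by omega⟩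
    obtain ⟨p, rfl⟩ : ∃ p : ℕ, j = (p : ℤ) + s + 1 := ⟨(j - (s + 1)).toNat, by push_cast at h1; omega⟩
    rw [inner_pos hb hg n s p]
    have h : ((p : ℤ) + s + 1 - (s + 1 : ℕ)).toNat = p := by push_cast; omega
    rw [h]
    simp

theorem choose_two (p : ℕ) : (((p + 2).choose 2 : ℕ) : ℝ) = ((p : ℝ) + 1) * (p + 2) / 2 := by
  rw [Nat.cast_choose_two]
  push_cast
  ring

variable {b : ℝ} {j : ℤ}

theorem outerC_of_pos (h : 0 < j) {r : ℕ} : outerC b j r = 0 := if_pos h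

theorem outerC_one (p : ℕ) (h : j = -(p : ℤ)) : outerC b j 1 = 1 * b ^ p := by
  subst h; simp [outerC]

theorem outerC_two (p : ℕ) (h : j = -(p : ℤ)) : outerC b j 2 = ((p : ℝ) + 1) * b ^ p := by
  subst h; simp [outerC]

theorem outerC_three (p : ℕ) (h : j = -(p : ℤ)) :
    outerC b j 3 = (((p : ℝ) + 1) * (p + 2) / 2) * b ^ p := by
  subst h; simp [outerC, choose_two]

theorem innerC_of_lt {r : ℕ} (h : j < r) : innerC b j r = 0 := if_pos h

theorem innerC_one (p : ℕ) (h : j = (p : ℤ) + 1) : innerC b j 1 = -(1 * b ^ p) := by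
  have h1 : ¬ (p : ℤ) + 1 < 1 := by omega
  subst h; simp [innerC, h1]

theorem innerC_two (p : ℕ) (h : j = (p : ℤ) + 2) : innerC b j 2 = ((p : ℝ) + 1) * b ^ p := by
  have h1 : ¬ (p : ℤ) + 2 < 2 := by omega
  subst h; simp [innerC, h1]

theorem innerC_three (p : ℕ) (h : j = (p : ℤ) + 3) :
    innerC b j 3 = -((((p : ℝ) + 1) * (p + 2) / 2) * b ^ p) := by
  have h1 : ¬ (p : ℤ) + 3 < 3 := by omega
  have h2 : (-1 : ℝ) ^ 3 = -1 := by norm_num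
  subst h; simp [innerC, h1, choose_two, h2]

/-- `outerC` on products of powers. -/
def outerX (b : ℝ) (N x y z r : ℕ) : ℝ := outerC b (x + ((N + 3 : ℕ) : ℤ) * ((y : ℤ) - z)) r

/-- `innerC` on products of powers. -/
def innerX (b : ℝ) (N x y z r : ℕ) : ℝ := innerC b (x + ((N + 3 : ℕ) : ℤ) * ((y : ℤ) - z)) r

/-- With km = N + 3, these are the means that occur in `CrossJet.c0`, ..., `CrossJet.c3`, apart from
those multiplying u^{-3k}, which are not needed explicitly. -/
theorem outerX_table (b : ℝ) (N : ℕ) :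
    outerX b N 0 0 0 1 = (1 * b ^ (0)) ∧
    outerX b N 0 0 0 2 = (((0 : ℕ) + 1 : ℝ) * b ^ (0)) ∧
    outerX b N 0 0 0 3 = ((((0 : ℕ) + 1 : ℝ) * ((0 : ℕ) + 2) / 2) * b ^ (0)) ∧
    outerX b N 0 0 1 1 = (1 * b ^ (N + 3)) ∧
    outerX b N 0 0 1 2 = (((N + 3 : ℕ) + 1 : ℝ) * b ^ (N + 3)) ∧
    outerX b N 0 0 2 1 = (1 * b ^ (2 * N + 6)) ∧
    outerX b N 0 1 0 1 = 0 ∧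
    outerX b N 0 1 0 2 = 0 ∧
    outerX b N 0 1 0 3 = 0 ∧
    outerX b N 0 1 1 1 = (1 * b ^ (0)) ∧
    outerX b N 0 1 1 2 = (((0 : ℕ) + 1 : ℝ) * b ^ (0)) ∧
    outerX b N 0 1 2 1 = (1 * b ^ (N + 3)) ∧
    outerX b N 0 2 0 1 = 0 ∧
    outerX b N 0 2 0 2 = 0 ∧
    outerX b N 0 2 1 1 = 0 ∧
    outerX b N 1 0 0 1 = 0 ∧
    outerX b N 1 0 0 2 = 0 ∧
    outerX b N 1 0 0 3 = 0 ∧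
    outerX b N 1 0 1 1 = (1 * b ^ (N + 2)) ∧
    outerX b N 1 0 1 2 = (((N + 2 : ℕ) + 1 : ℝ) * b ^ (N + 2)) ∧
    outerX b N 1 0 1 3 = ((((N + 2 : ℕ) + 1 : ℝ) * ((N + 2 : ℕ) + 2) / 2) * b ^ (N + 2)) ∧
    outerX b N 1 0 2 1 = (1 * b ^ (2 * N + 5)) ∧
    outerX b N 1 0 2 2 = (((2 * N + 5 : ℕ) + 1 : ℝ) * b ^ (2 * N + 5)) ∧
    outerX b N 1 1 1 2 = 0 ∧
    outerX b N 1 1 1 3 = 0 ∧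
    outerX b N 1 1 2 2 = (((N + 2 : ℕ) + 1 : ℝ) * b ^ (N + 2)) ∧
    outerX b N 1 2 1 2 = 0 ∧
    outerX b N 2 0 1 2 = (((N + 1 : ℕ) + 1 : ℝ) * b ^ (N + 1)) ∧
    outerX b N 2 0 1 3 = ((((N + 1 : ℕ) + 1 : ℝ) * ((N + 1 : ℕ) + 2) / 2) * b ^ (N + 1)) ∧
    outerX b N 2 0 2 2 = (((2 * N + 4 : ℕ) + 1 : ℝ) * b ^ (2 * N + 4)) ∧
    outerX b N 2 0 2 3 = ((((2 * N + 4 : ℕ) + 1 : ℝ) * ((2 * N + 4 : ℕ) + 2) / 2) * b ^ (2 * N + 4)) ∧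
    outerX b N 2 1 2 3 = ((((N + 1 : ℕ) + 1 : ℝ) * ((N + 1 : ℕ) + 2) / 2) * b ^ (N + 1)) ∧
    outerX b N 3 0 2 3 = ((((2 * N + 3 : ℕ) + 1 : ℝ) * ((2 * N + 3 : ℕ) + 2) / 2) * b ^ (2 * N + 3)) := by
  refine ⟨outerC_one (0) (by push_cast; ring),
    outerC_two (0) (by push_cast; ring),
    outerC_three (0) (by push_cast; ring),
    outerC_one (N + 3) (by push_cast; ring),
    outerC_two (N + 3) (by push_cast; ring),
    outerC_one (2 * N + 6) (by push_cast; ring),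
    outerC_of_pos (by push_cast; omega),
    outerC_of_pos (by push_cast; omega),
    outerC_of_pos (by push_cast; omega),
    outerC_one (0) (by push_cast; ring),
    outerC_two (0) (by push_cast; ring),
    outerC_one (N + 3) (by push_cast; ring),
    outerC_of_pos (by push_cast; omega),
    outerC_of_pos (by push_cast; omega),
    outerC_of_pos (by push_cast; omega),
    outerC_of_pos (by push_cast; omega),
    outerC_of_pos (by push_cast; omega),
    outerC_of_pos (by push_cast; omega),
    outerC_one (N + 2) (by push_cast; ring),
    outerC_two (N + 2) (by push_cast; ring),
    outerC_three (N + 2) (by push_cast; ring),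
    outerC_one (2 * N + 5) (by push_cast; ring),
    outerC_two (2 * N + 5) (by push_cast; ring),
    outerC_of_pos (by push_cast; omega),
    outerC_of_pos (by push_cast; omega),
    outerC_two (N + 2) (by push_cast; ring),
    outerC_of_pos (by push_cast; omega),
    outerC_two (N + 1) (by push_cast; ring),
    outerC_three (N + 1) (by push_cast; ring),
    outerC_two (2 * N + 4) (by push_cast; ring),
    outerC_three (2 * N + 4) (by push_cast; ring),
    outerC_three (N + 1) (by push_cast; ring),
    outerC_three (2 * N + 3) (by push_cast; ring)⟩

theorem innerX_table (b : ℝ) (N : ℕ) :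
    innerX b N 0 0 0 1 = 0 ∧
    innerX b N 0 0 0 2 = 0 ∧
    innerX b N 0 0 0 3 = 0 ∧
    innerX b N 0 0 1 1 = 0 ∧
    innerX b N 0 0 1 2 = 0 ∧
    innerX b N 0 0 2 1 = 0 ∧
    innerX b N 0 1 0 1 = -(1 * b ^ (N + 2)) ∧
    innerX b N 0 1 0 2 = (((N + 1 : ℕ) + 1 : ℝ) * b ^ (N + 1)) ∧
    innerX b N 0 1 0 3 = -((((N : ℕ) + 1 : ℝ) * ((N : ℕ) + 2) / 2) * b ^ (N)) ∧
    innerX b N 0 1 1 1 = 0 ∧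
    innerX b N 0 1 1 2 = 0 ∧
    innerX b N 0 1 2 1 = 0 ∧
    innerX b N 0 2 0 1 = -(1 * b ^ (2 * N + 5)) ∧
    innerX b N 0 2 0 2 = (((2 * N + 4 : ℕ) + 1 : ℝ) * b ^ (2 * N + 4)) ∧
    innerX b N 0 2 1 1 = -(1 * b ^ (N + 2)) ∧
    innerX b N 1 0 0 1 = -(1 * b ^ (0)) ∧
    innerX b N 1 0 0 2 = 0 ∧
    innerX b N 1 0 0 3 = 0 ∧
    innerX b N 1 0 1 1 = 0 ∧
    innerX b N 1 0 1 2 = 0 ∧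
    innerX b N 1 0 1 3 = 0 ∧
    innerX b N 1 0 2 1 = 0 ∧
    innerX b N 1 0 2 2 = 0 ∧
    innerX b N 1 1 1 2 = 0 ∧
    innerX b N 1 1 1 3 = 0 ∧
    innerX b N 1 1 2 2 = 0 ∧
    innerX b N 1 2 1 2 = (((N + 2 : ℕ) + 1 : ℝ) * b ^ (N + 2)) ∧
    innerX b N 2 0 1 2 = 0 ∧
    innerX b N 2 0 1 3 = 0 ∧
    innerX b N 2 0 2 2 = 0 ∧
    innerX b N 2 0 2 3 = 0 ∧
    innerX b N 2 1 2 3 = 0 ∧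
    innerX b N 3 0 2 3 = 0 := by
  refine ⟨innerC_of_lt (by push_cast; omega),
    innerC_of_lt (by push_cast; omega),
    innerC_of_lt (by push_cast; omega),
    innerC_of_lt (by push_cast; omega),
    innerC_of_lt (by push_cast; omega),
    innerC_of_lt (by push_cast; omega),
    innerC_one (N + 2) (by push_cast; ring),
    innerC_two (N + 1) (by push_cast; ring),
    innerC_three (N) (by push_cast; ring),
    innerC_of_lt (by push_cast; omega),
    innerC_of_lt (by push_cast; omega),
    innerC_of_lt (by push_cast; omega),
    innerC_one (2 * N + 5) (by push_cast; ring),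
    innerC_two (2 * N + 4) (by push_cast; ring),
    innerC_one (N + 2) (by push_cast; ring),
    innerC_one (0) (by push_cast; ring),
    innerC_of_lt (by push_cast; omega),
    innerC_of_lt (by push_cast; omega),
    innerC_of_lt (by push_cast; omega),
    innerC_of_lt (by push_cast; omega),
    innerC_of_lt (by push_cast; omega),
    innerC_of_lt (by push_cast; omega),
    innerC_of_lt (by push_cast; omega),
    innerC_of_lt (by push_cast; omega),
    innerC_of_lt (by push_cast; omega),
    innerC_of_lt (by push_cast; omega),
    innerC_two (N + 2) (by push_cast; ring),
    innerC_of_lt (by push_cast; omega),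
    innerC_of_lt (by push_cast; omega),
    innerC_of_lt (by push_cast; omega),
    innerC_of_lt (by push_cast; omega),
    innerC_of_lt (by push_cast; omega),
    innerC_of_lt (by push_cast; omega)⟩

/-- Here the relations UU' = 1 and ZZ' = 1 enter: only differences of exponents remain. -/
theorem mon_eq (k M p q x y z r : ℕ) (g : Wiener) :
    e k 0 ^ p * e (-k) 0 ^ q * e 0 1 ^ x * e 0 (M : ℕ) ^ y * e 0 (-(M : ℕ)) ^ z * g ^ r =
      e (k * ((p : ℤ) - q)) (x + (M : ℤ) * ((y : ℤ) - z)) * g ^ r := by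
  simp only [e_pow, e_mul]
  congr 2 <;> ring

end Wiener

/-! ### Averaged expansions of the kernel between distinct boundaries -/

namespace Wiener

-- Point w on the outer and ξ on the inner boundary, so the inverse of 1 - bη is involved. In the
-- cubic coefficient the u^k terms cancel. The u^{-3k} coefficient K is left unspecified, because
-- only the mode k of the cubic term is projected later.
open CrossJet in
theorem hasJet_avg_cross01 {b : ℝ} (hb : b ∈ Ioo (0 : ℝ) 1) (k N : ℕ) (a c A C : ℝ) {n d D : ℝ → Wiener}
    (hn : HasJet n ((1 : ℝ) • e 0 1 - b • 1) (a • (e k 0 * e 0 1) - c • (e k 0 * e 0 (N + 3 : ℕ)))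
      (A • (e k 0 ^ 2 * e 0 1) - C • (e k 0 ^ 2 * e 0 (N + 3 : ℕ) ^ 2)) 0)
    (hd : HasJet d ((1 : ℝ) • 1 - b • e 0 1)
      (a • e (-k) 0 - c • (e (-k) 0 * e 0 1 * e 0 (-(N + 3 : ℕ))))
      (A • e (-k) 0 ^ 2 - C • (e (-k) 0 ^ 2 * e 0 1 * e 0 (-(N + 3 : ℕ)) ^ 2)) 0)
    (hD : HasJet D (b • 1) (-(((N : ℝ) + 2) * c) • (e (-k) 0 * e 0 (-(N + 3 : ℕ))))
      (-((2 * N + 5) * C) • (e (-k) 0 ^ 2 * e 0 (-(N + 3 : ℕ)) ^ 2)) 0) :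
    ∃ K : ℝ, HasJet (fun t => avg (n t * Ring.inverse (d t) * D t)) (-b ^ 2 • 1)
      ((b ^ 2 * a - b ^ (N + 4) * c) • e (-k) 0)
      ((b ^ 2 * A - b ^ 2 * a ^ 2 + (N + 4) * b ^ (N + 4) * a * c - b ^ (2 * N + 7) * C
        - (N + 3) * b ^ (2 * N + 6) * c ^ 2) • e (-(2 * k)) 0 + ((N + 2) * c ^ 2) • 1)
      ((-(N + 2) * a * c ^ 2 + (N + 2) * c * (b ^ (N + 3) * C + (N + 3) / 2 * b ^ (N + 2) * c ^ 2)) •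
        e (-k) 0 + K • e (-(3 * k)) 0) := by
  obtain ⟨g, hg⟩ := isUnit_iff_exists_inv'.1 (isUnit_one_sub hb 1)
  have hg' : g * ((1 : ℝ) • 1 - b • e 0 1) = 1 := by rw [one_smul, hg]
  have h := (CrossJet.hasJet _ _ _ _ _ _ _ _ hn hd hD hg' (μ' := fun p q x y z r =>
    e k 0 ^ p * e (-k) 0 ^ q * e 0 1 ^ x * e 0 (N + 3 : ℕ) ^ y * e 0 (-(N + 3 : ℕ)) ^ z * g ^ r)
    (fun _ _ _ _ _ _ => rfl)).map avg
  have hμ : (fun p q x y z r : ℕ => avg (e k 0 ^ p * e (-k) 0 ^ q * e 0 1 ^ x * e 0 (N + 3 : ℕ) ^ y *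
      e 0 (-(N + 3 : ℕ)) ^ z * g ^ r)) = fun p q x y z r : ℕ =>
        outerX b N x y z r • e (k * ((p : ℤ) - q)) 0 := by
    funext p q x y z r
    rw [mon_eq, avg_outer hb hg, outerX]
  have T := outerX_table b N
  -- K is the cubic expression restricted to the monomials with q = 3, which are exactly those
  -- carrying u^{-3k}.
  refine ⟨c3 (fun p q x y z r => if q = 3 then outerX b N x y z r else 0) 1 b a c A C (N + 2)
    (2 * N + 5), h.congr_coeff ?_ ?_ ?_ ?_⟩
  · refine (map_c0 _ _ _ (avg : Wiener →ₗ[ℝ] Wiener)).trans ?_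
    simp only [ContinuousLinearMap.coe_coe]
    rw [hμ]
    simp only [c0, T, Nat.cast_zero, sub_zero, mul_zero, e_zero]
    module
  · refine (map_c1 _ _ _ _ _ _ (avg : Wiener →ₗ[ℝ] Wiener)).trans ?_
    simp only [ContinuousLinearMap.coe_coe]
    rw [hμ]
    simp only [c1, T, Nat.cast_zero, sub_zero, Nat.cast_one, zero_sub, mul_one, mul_neg]
    push_cast
    module
  · refine (map_c2 _ _ _ _ _ _ _ _ _ (avg : Wiener →ₗ[ℝ] Wiener)).trans ?_
    simp only [ContinuousLinearMap.coe_coe]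
    rw [hμ]
    have e2 : (k : ℤ) * (((0 : ℕ) : ℤ) - (2 : ℕ)) = -(2 * k) := by push_cast; ring
    have e3 : (k : ℤ) * (((1 : ℕ) : ℤ) - (1 : ℕ)) = 0 := by push_cast; ring
    simp only [c2, T, e2, e3, e_zero]
    push_cast
    module
  · refine (map_c3 _ _ _ _ _ _ _ _ _ (avg : Wiener →ₗ[ℝ] Wiener)).trans ?_
    simp only [ContinuousLinearMap.coe_coe]
    rw [hμ]
    have e2 : (k : ℤ) * (((1 : ℕ) : ℤ) - (2 : ℕ)) = -k := by push_cast; ring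
    have e3 : (k : ℤ) * (((0 : ℕ) : ℤ) - (3 : ℕ)) = -(3 * k) := by push_cast; ring
    have e4 : (k : ℤ) * (((2 : ℕ) : ℤ) - (1 : ℕ)) = k := by push_cast; ring
    simp only [c3, if_true, reduceIte, Nat.reduceEqDiff, OfNat.one_ne_ofNat, e2, e3, e4, T]
    push_cast
    module
theorem isUnit_sub {b : ℝ} (hb : b ∈ Ioo (0 : ℝ) 1) : IsUnit (b • 1 - e 0 1 : Wiener) := by
  have h : (b • 1 - e 0 1 : Wiener) = -e 0 1 * (1 - b • e 0 (-1)) := by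
    rw [mul_sub, mul_one, neg_mul, mul_smul_comm, e_mul]
    simp only [add_zero, add_neg_cancel, e_zero]
    module
  rw [h]
  exact (isUnit_e 0 1).neg.mul (isUnit_one_sub hb (-1))

-- Point w on the inner and ξ on the outer boundary. The inverse of b - η now expands in η⁻¹, so
-- most of the means that survived in the other configuration vanish, and conversely.
open CrossJet in
theorem hasJet_avg_cross10 {b : ℝ} (hb : b ∈ Ioo (0 : ℝ) 1) (k N : ℕ) (a c A C : ℝ) {n d D : ℝ → Wiener}
    (hn : HasJet n (b • e 0 1 - (1 : ℝ) • 1)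
      (c • (e k 0 * e 0 1) - a • (e k 0 * e 0 (N + 3 : ℕ)))
      (C • (e k 0 ^ 2 * e 0 1) - A • (e k 0 ^ 2 * e 0 (N + 3 : ℕ) ^ 2)) 0)
    (hd : HasJet d (b • 1 - (1 : ℝ) • e 0 1)
      (c • e (-k) 0 - a • (e (-k) 0 * e 0 1 * e 0 (-(N + 3 : ℕ))))
      (C • e (-k) 0 ^ 2 - A • (e (-k) 0 ^ 2 * e 0 1 * e 0 (-(N + 3 : ℕ)) ^ 2)) 0)
    (hD : HasJet D ((1 : ℝ) • 1) (-(((N : ℝ) + 2) * a) • (e (-k) 0 * e 0 (-(N + 3 : ℕ))))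
      (-((2 * N + 5) * A) • (e (-k) 0 ^ 2 * e 0 (-(N + 3 : ℕ)) ^ 2)) 0) :
    ∃ K : ℝ, HasJet (fun t => avg (n t * Ring.inverse (d t) * D t)) (-b • 1)
      ((a * b ^ (N + 2) - c) • e k 0)
      ((A * b ^ (2 * N + 5) - C) • e (2 * k) 0 + (a * (N + 2) * b ^ (N + 1) * c) • 1)
      ((a * ((N + 2) * b ^ (N + 1) * C + (N + 2) * (N + 1) / 2 * b ^ N * c ^ 2)) • e (-k) 0 +
        (A * ((2 * N + 5) * (b ^ (2 * N + 4) * c - a * b ^ (N + 2)))) • e k 0 +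
        K • e (-(3 * k)) 0) := by
  obtain ⟨g, hg⟩ := isUnit_iff_exists_inv'.1 (isUnit_sub hb)
  have hg' : g * (b • 1 - (1 : ℝ) • e 0 1) = 1 := by rw [one_smul, hg]
  have h := (CrossJet.hasJet _ _ _ _ _ _ _ _ hn hd hD hg' (μ' := fun p q x y z r =>
    e k 0 ^ p * e (-k) 0 ^ q * e 0 1 ^ x * e 0 (N + 3 : ℕ) ^ y * e 0 (-(N + 3 : ℕ)) ^ z * g ^ r)
    (fun _ _ _ _ _ _ => rfl)).map avg
  have hμ : (fun p q x y z r : ℕ => avg (e k 0 ^ p * e (-k) 0 ^ q * e 0 1 ^ x * e 0 (N + 3 : ℕ) ^ y *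
      e 0 (-(N + 3 : ℕ)) ^ z * g ^ r)) = fun p q x y z r : ℕ =>
        innerX b N x y z r • e (k * ((p : ℤ) - q)) 0 := by
    funext p q x y z r
    rw [mon_eq, avg_inner hb hg, innerX]
  have T := innerX_table b N
  refine ⟨c3 (fun p q x y z r => if q = 3 then innerX b N x y z r else 0) b 1 c a C A (N + 2)
    (2 * N + 5), h.congr_coeff ?_ ?_ ?_ ?_⟩
  · refine (map_c0 _ _ _ (avg : Wiener →ₗ[ℝ] Wiener)).trans ?_
    simp only [ContinuousLinearMap.coe_coe]
    rw [hμ]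
    simp only [c0, T, Nat.cast_zero, sub_zero, mul_zero, e_zero]
    module
  · refine (map_c1 _ _ _ _ _ _ (avg : Wiener →ₗ[ℝ] Wiener)).trans ?_
    simp only [ContinuousLinearMap.coe_coe]
    rw [hμ]
    simp only [c1, T, Nat.cast_zero, sub_zero, Nat.cast_one, zero_sub, mul_one, mul_neg]
    push_cast
    module
  · refine (map_c2 _ _ _ _ _ _ _ _ _ (avg : Wiener →ₗ[ℝ] Wiener)).trans ?_
    simp only [ContinuousLinearMap.coe_coe]
    rw [hμ]
    have e2 : (k : ℤ) * (((0 : ℕ) : ℤ) - (2 : ℕ)) = -(2 * k) := by push_cast; ring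
    have e3 : (k : ℤ) * (((1 : ℕ) : ℤ) - (1 : ℕ)) = 0 := by push_cast; ring
    simp only [c2, T, e2, e3, e_zero]
    have e5 : (k : ℤ) * (((2 : ℕ) : ℤ) - (0 : ℕ)) = 2 * k := by push_cast; ring
    simp only [e5]
    push_cast
    module
  · refine (map_c3 _ _ _ _ _ _ _ _ _ (avg : Wiener →ₗ[ℝ] Wiener)).trans ?_
    simp only [ContinuousLinearMap.coe_coe]
    rw [hμ]
    have e2 : (k : ℤ) * (((1 : ℕ) : ℤ) - (2 : ℕ)) = -k := by push_cast; ring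
    have e3 : (k : ℤ) * (((0 : ℕ) : ℤ) - (3 : ℕ)) = -(3 * k) := by push_cast; ring
    have e4 : (k : ℤ) * (((2 : ℕ) : ℤ) - (1 : ℕ)) = k := by push_cast; ring
    simp only [c3, if_true, reduceIte, Nat.reduceEqDiff, OfNat.one_ne_ofNat, e2, e3, e4, T]
    push_cast
    module
end Wiener

namespace Wiener

/-! ### Means on one boundary -/

/-- The sum `η + ⋯ + η^a`. -/
def geo (a : ℕ) : Wiener := ∑ l ∈ Finset.Icc 1 a, e 0 (l : ℤ)

/-- The sum `η⁻¹ + ⋯ + η^{-a}`. -/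
def geoInv (a : ℕ) : Wiener := ∑ l ∈ Finset.Icc 1 a, e 0 (-(l : ℤ))

/-- The span of the negative powers of `η`. -/
def negSpan : Submodule ℝ Wiener := Submodule.span ℝ ((fun j : ℤ => e 0 j) '' Iio 0)

theorem e_mem_negSpan {j : ℤ} (hj : j < 0) : e 0 j ∈ negSpan := Submodule.subset_span ⟨j, hj, rfl⟩

theorem avg_eq_zero {x : Wiener} (hx : x ∈ negSpan) : avg x = 0 := by
  have h : negSpan ≤ LinearMap.ker (avg : Wiener →ₗ[ℝ] Wiener) := by
    refine Submodule.span_le.2 ?_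
    rintro _ ⟨j, hj, rfl⟩
    have : avg (e 0 j) = 0 := by rw [avg_e, if_neg (ne_of_lt hj)]
    exact this
  exact h hx

theorem mul_mem_negSpan {x y : Wiener} (hx : x ∈ negSpan) (hy : y ∈ negSpan) :
    x * y ∈ negSpan := by
  have h : negSpan * negSpan ≤ negSpan := by
    rw [negSpan, Submodule.span_mul_span]
    refine Submodule.span_mono ?_
    rintro _ ⟨_, ⟨i, hi, rfl⟩, _, ⟨j, hj, rfl⟩, rfl⟩
    refine ⟨i + j, ?_, ?_⟩
    · simp only [mem_Iio] at *; omega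
    · simp only [e_mul, add_zero]
  exact h (Submodule.mul_mem_mul hx hy)

theorem geoInv_mem (a : ℕ) : geoInv a ∈ negSpan :=
  Submodule.sum_mem _ fun l hl => e_mem_negSpan (by rw [Finset.mem_Icc] at hl; omega)

theorem geo_mul_e_mem {a : ℕ} {j : ℤ} (hj : a + j < 0) : geo a * e 0 j ∈ negSpan := by
  rw [geo, Finset.sum_mul]
  refine Submodule.sum_mem _ fun l hl => ?_
  rw [Finset.mem_Icc] at hl
  rw [e_mul, add_zero]
  exact e_mem_negSpan (by omega)

theorem avg_geo (a : ℕ) : avg (geo a) = 0 := by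
  rw [geo, map_sum]
  refine Finset.sum_eq_zero fun l hl => ?_
  rw [Finset.mem_Icc] at hl
  rw [avg_e, if_neg (by omega)]

theorem avg_geo_mul_e (a l : ℕ) : avg (geo a * e 0 (-(l : ℤ))) =
    (if l ∈ Finset.Icc 1 a then (1 : ℝ) else 0) • 1 := by
  rw [geo, Finset.sum_mul, map_sum]
  have h : ∀ i ∈ Finset.Icc 1 a, avg (e 0 (i : ℤ) * e 0 (-(l : ℤ))) =
      if l = i then (1 : Wiener) else 0 := fun i _ => by
    rw [e_mul, avg_e, add_zero, e_zero]
    refine if_congr ?_ rfl rfl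
    omega
  rw [Finset.sum_congr rfl h, Finset.sum_ite_eq]
  split_ifs <;> simp

theorem avg_geo_mul_geoInv (a c : ℕ) : avg (geo a * geoInv c) = ((min a c : ℕ) : ℝ) • 1 := by
  rw [geoInv, Finset.mul_sum, map_sum, Finset.sum_congr rfl fun l _ => avg_geo_mul_e a l,
    ← Finset.sum_smul, Finset.sum_ite_mem, Finset.sum_const, nsmul_eq_mul, mul_one]
  congr 2
  rw [show Finset.Icc 1 c ∩ Finset.Icc 1 a = Finset.Icc 1 (min a c) by
    ext l; simp only [Finset.mem_inter, Finset.mem_Icc]; omega, Nat.card_Icc]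
  omega

theorem sum_Icc_sub (a : ℕ) : ∑ l ∈ Finset.Icc 1 a, ((a : ℝ) - l) = a * (a - 1) / 2 := by
  rw [Finset.sum_sub_distrib, Finset.sum_const, Nat.card_Icc, nsmul_eq_mul, Nat.add_sub_cancel]
  have h : ∑ l ∈ Finset.Icc 1 a, (l : ℝ) = a * (a + 1) / 2 := by
    induction a with
    | zero => simp
    | succ a ih => rw [Finset.sum_Icc_succ_top (by omega), ih]; push_cast; ring
  rw [h]
  ring

/-- The constant term counts the pairs of integers in [1, a] with sum at most a. -/
theorem avg_geo_mul_geoInv_sq (a : ℕ) :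
    avg (geo a * geoInv a ^ 2) = ((a : ℝ) * (a - 1) / 2) • 1 := by
  have h1 : ∀ l ∈ Finset.Icc 1 a,
      avg (geo a * geoInv a * e 0 (-(l : ℤ))) = ((a : ℝ) - l) • 1 := by
    intro l hl
    rw [Finset.mem_Icc] at hl
    have h2 : ∀ i ∈ Finset.Icc 1 a, avg (geo a * (e 0 (-(i : ℤ)) * e 0 (-(l : ℤ)))) =
        (if i ∈ Finset.Icc 1 (a - l) then (1 : ℝ) else 0) • 1 := by
      intro i hi
      rw [Finset.mem_Icc] at hi
      rw [e_mul, add_zero, show -(i : ℤ) + -(l : ℤ) = -((i + l : ℕ) : ℤ) by push_cast; ring,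
        avg_geo_mul_e]
      congr 1
      refine if_congr ?_ rfl rfl
      simp only [Finset.mem_Icc]
      omega
    rw [mul_assoc, geoInv, Finset.sum_mul, Finset.mul_sum, map_sum, Finset.sum_congr rfl h2,
      ← Finset.sum_smul, Finset.sum_ite_mem, Finset.sum_const, nsmul_eq_mul, mul_one]
    congr 1
    rw [show Finset.Icc 1 a ∩ Finset.Icc 1 (a - l) = Finset.Icc 1 (a - l) by
      ext i; simp only [Finset.mem_inter, Finset.mem_Icc]; omega, Nat.card_Icc,
      Nat.add_sub_cancel, Nat.cast_sub hl.2]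
  rw [pow_two, ← mul_assoc]
  nth_rewrite 2 [geoInv]
  rw [Finset.mul_sum, map_sum, Finset.sum_congr rfl h1, ← Finset.sum_smul, sum_Icc_sub]

-- Most products lie in the span of negative powers of η and have mean zero. This includes the
-- product of η + ⋯ + η^{km-1} with η^{-km}. The remaining means pair a geometric sum in η with one
-- in η⁻¹ or with η^{-km}, and are counts of lattice points.
open SelfJet in
theorem hasJet_avg_self (k N : ℕ) {be al ka : ℝ} (hbe : be ≠ 0) {n d D : ℝ → Wiener}
    (hn : HasJet n (-be • 1) (al • (e k 0 * geo (N + 2))) (ka • (e k 0 ^ 2 * geo (2 * N + 5))) 0)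
    (hd : HasJet d (be • 1) (-al • (e (-k) 0 * geoInv (N + 2)))
      (-ka • (e (-k) 0 ^ 2 * geoInv (2 * N + 5))) 0)
    (hD : HasJet D (be • 1) (-(((N : ℝ) + 2) * al) • (e (-k) 0 * e 0 (-(N + 3 : ℕ))))
      (-((2 * N + 5) * ka) • (e (-k) 0 ^ 2 * e 0 (-(N + 3 : ℕ)) ^ 2)) 0) :
    HasJet (fun t => avg (n t * Ring.inverse (d t) * D t)) (-be • 1) 0
      (((N + 2) * al ^ 2 / be) • 1)
      (((N + 2) * al * ka / be + (N + 2) * (N + 1) / 2 * al ^ 3 / be ^ 2) • e (-k) 0) := by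
  have h := (SelfJet.hasJet _ _ _ _ _ be⁻¹ hn hd hD (inv_mul_cancel₀ hbe)
    (fun _ _ _ _ _ _ _ => rfl)).map avg
  have hZ : e 0 (-(N + 3 : ℕ)) ∈ negSpan := e_mem_negSpan (by push_cast; omega)
  have hK1 := geoInv_mem (N + 2)
  have hK2 := geoInv_mem (2 * N + 5)
  have hKZ : geo (N + 2) * e 0 (-(N + 3 : ℕ)) ∈ negSpan := geo_mul_e_mem (by push_cast; omega)
  have hz1 := avg_eq_zero hZ
  have hz2 := avg_eq_zero hK1
  have hz3 := avg_geo (N + 2)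
  have hz4 := avg_eq_zero (mul_mem_negSpan hZ hZ)
  have hz5 := avg_eq_zero hK2
  have hz6 := avg_eq_zero (mul_mem_negSpan hK1 hZ)
  have hz7 := avg_eq_zero (mul_mem_negSpan hK1 hK1)
  have hz8 := avg_geo (2 * N + 5)
  have hz9 := avg_eq_zero hKZ
  have hz10 := avg_eq_zero (mul_mem_negSpan hK2 hZ)
  have hz11 := avg_eq_zero (mul_mem_negSpan (mul_mem_negSpan hK1 hZ) hZ)
  have hz12 := avg_eq_zero (mul_mem_negSpan hK1 hK2)
  have hz13 := avg_eq_zero (mul_mem_negSpan (mul_mem_negSpan hK1 hK1) hZ)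
  have hz14 := avg_eq_zero (mul_mem_negSpan (mul_mem_negSpan hK1 hK1) hK1)
  have hz15 := avg_eq_zero (mul_mem_negSpan hKZ hZ)
  have hz16 := avg_eq_zero (mul_mem_negSpan hKZ hK1)
  have hv1 := avg_geo_mul_geoInv (N + 2) (N + 2)
  have hv2 := avg_geo_mul_geoInv (N + 2) (2 * N + 5)
  have hv3 := avg_geo_mul_geoInv (2 * N + 5) (N + 2)
  have hv4 := avg_geo_mul_geoInv_sq (N + 2)
  have hv5 := avg_geo_mul_e (2 * N + 5) (N + 3)
  rw [if_pos (by rw [Finset.mem_Icc]; omega)] at hv5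
  rw [min_self] at hv1
  rw [min_eq_left (by omega)] at hv2
  rw [min_eq_right (by omega)] at hv3
  rw [mul_right_comm] at hz16
  have hμ : (fun p q x y x' y' z : ℕ => avg (e k 0 ^ p * e (-k) 0 ^ q * geo (N + 2) ^ x *
      geo (2 * N + 5) ^ y * geoInv (N + 2) ^ x' * geoInv (2 * N + 5) ^ y' *
      e 0 (-(N + 3 : ℕ)) ^ z)) = fun p q x y x' y' z : ℕ => e (k * ((p : ℤ) - q)) 0 *
        avg (geo (N + 2) ^ x * geo (2 * N + 5) ^ y * geoInv (N + 2) ^ x' *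
          geoInv (2 * N + 5) ^ y' * e 0 (-(N + 3 : ℕ)) ^ z) := by
    funext p q x y x' y' z
    rw [← avg_e_mul]
    congr 1
    have : e k 0 ^ p * e (-k) 0 ^ q = e (k * ((p : ℤ) - q)) 0 := by
      simp only [e_pow, e_mul]
      congr 1 <;> ring
    rw [← this]
    ring
  refine h.congr_coeff ?_ ?_ ?_ ?_
  · refine (map_c0 _ _ _ (avg : Wiener →ₗ[ℝ] Wiener)).trans ?_
    simp only [ContinuousLinearMap.coe_coe]
    rw [hμ]
    simp only [c0, pow_zero, mul_one, Nat.cast_zero, sub_zero, mul_zero, e_zero, one_mul]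
    have : avg 1 = 1 := by rw [← e_zero, avg_e, if_pos rfl]
    rw [this]
    congr 1
    field_simp
  · refine (map_c1 _ _ _ _ _ (avg : Wiener →ₗ[ℝ] Wiener)).trans ?_
    simp only [ContinuousLinearMap.coe_coe]
    rw [hμ]
    simp only [c1, pow_zero, pow_one, mul_one, one_mul, hz1, hz2, hz3, mul_zero, smul_zero, add_zero]
  · refine (map_c2 _ _ _ _ _ _ _ (avg : Wiener →ₗ[ℝ] Wiener)).trans ?_
    simp only [ContinuousLinearMap.coe_coe]
    rw [hμ]
    simp only [c2, pow_zero, pow_one, mul_one, one_mul, pow_two, hz4, hz5, hz6, hz7, hz8, hz9, hv1,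
      mul_zero, smul_zero, add_zero, zero_add, sub_self, e_zero]
    push_cast
    match_scalars
    field_simp
  · refine (map_c3 _ _ _ _ _ _ _ (avg : Wiener →ₗ[ℝ] Wiener)).trans ?_
    simp only [ContinuousLinearMap.coe_coe]
    rw [hμ]
    have e2 : (k : ℤ) * (((1 : ℕ) : ℤ) - (2 : ℕ)) = -k := by push_cast; ring
    have e4 : (k : ℤ) * (((2 : ℕ) : ℤ) - (1 : ℕ)) = k := by push_cast; ring
    rw [pow_two, ← mul_assoc] at hv4
    simp only [c3, pow_zero, pow_one, mul_one, one_mul, pow_three', pow_two, hz10, hz11, hz12, hz13, hz14, hz15, hz16, hv2, hv3, hv4, hv5, ← mul_assoc,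
      mul_zero, smul_zero, add_zero, zero_add, e2, e4,
      mul_smul_comm]
    push_cast
    match_scalars
    · field_simp
      ring
    · field_simp
      ring

end Wiener

/-! ### Coordinates on ℓ¹ -/

namespace Ell1

/-- The coordinate functionals. -/
def coord (n : ℕ) : Ell1 →L[ℝ] ℝ := sum fun k => if k = n then 1 else 0

theorem coord_bound (n k : ℕ) : ‖if k = n then (1 : ℝ) else 0‖ ≤ 1 := by split_ifs <;> simp

theorem coord_δ (n k : ℕ) : coord n (δ k) = if k = n then 1 else 0 := sum_δ (coord_bound n) k

theorem coord_apply (n : ℕ) (x : Ell1) : coord n x = (x : ℕ → ℝ) n := by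
  have h := hasSum_sum (coord_bound n) x
  have h2 : HasSum (fun k => (x : ℕ → ℝ) k • if k = n then (1 : ℝ) else 0) ((x : ℕ → ℝ) n) := by
    have := hasSum_ite_eq n ((x : ℕ → ℝ) n)
    convert this using 2 with k
    split_ifs with hk <;> simp [hk]
  exact h.unique h2

end Ell1

/-! ### Expansion of the functional along curves with two modes -/

namespace Wiener

open Ell1

/-- Curves in the span of the modes `k = n + 1` and `2 k`. -/
def path (α κ : Fin 2 → ℝ) (n : ℕ) (t : ℝ) (j : Fin 2) : Ell1 :=
  -- The factors k² and (2k)², with k = n + 1, undo the scaling of the coordinates, so that α and κ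
  -- are the true Fourier amplitudes.
  (t * α j * ((n : ℝ) + 1) ^ 2) • δ n + (t ^ 2 * κ j * (2 * ((n : ℝ) + 1)) ^ 2) • δ (2 * n + 1)

variable {m : ℕ} {b : ℝ}

theorem hasJet_ser {y : ℕ → Wiener} {C : ℝ} (h : ∀ n : ℕ, ‖y (n + 1)‖ ≤ C * ((n : ℝ) + 1) ^ 2)
    (c : ℝ) (α κ : Fin 2 → ℝ) (n : ℕ) (j : Fin 2) :
    HasJet (fun t => c • 1 + ser y (path α κ n t j)) (c • 1) (α j • y (n + 1))
      (κ j • y (2 * (n + 1))) 0 := by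
  refine HasJet.of_eq fun t => ?_
  have h2 : 2 * n + 1 + 1 = 2 * (n + 1) := by ring
  have h3 : ((2 * n + 1 : ℕ) : ℝ) + 1 = 2 * ((n : ℝ) + 1) := by push_cast; ring
  have h4 : (n : ℝ) + 1 ≠ 0 := by positivity
  rw [path, map_add, map_smul, map_smul, ser_δ h, ser_δ h, h2, h3, smul_smul, smul_smul, smul_smul,
    smul_smul, smul_zero, add_zero, add_assoc]
  congr 3 <;> field_simp

section Monomials

variable {n N : ℕ} (hN : (n + 1) * m = N + 3)

theorem yS_two : yS (2 * (n + 1)) = e (n + 1 : ℕ) 0 ^ 2 := by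
  rw [yS, e_pow]; congr 1

theorem ySb_two : ySb (2 * (n + 1)) = e (-(n + 1 : ℕ)) 0 ^ 2 := by
  rw [ySb, e_pow]; congr 1

include hN in
theorem two_mul_deg : 2 * (n + 1) * m = 2 * N + 6 := by rw [mul_assoc, hN]; ring

include hN in
theorem deg_cast : ((n + 1 : ℕ) : ℝ) * m = N + 3 := by exact_mod_cast hN

include hN in
theorem two_deg_cast : ((2 * (n + 1) : ℕ) : ℝ) * m = 2 * N + 6 := by
  exact_mod_cast two_mul_deg hN

include hN in
theorem yD_one : yD m (n + 1) = (-((N : ℝ) + 2)) • e (-(n + 1 : ℕ)) 0 := by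
  rw [yD, deg_cast hN]; congr 2; ring

include hN in
theorem yD_two : yD m (2 * (n + 1)) = (-(2 * (N : ℝ) + 5)) • e (-(n + 1 : ℕ)) 0 ^ 2 := by
  rw [yD, two_deg_cast hN, e_pow]
  congr 1
  · ring

include hN in
theorem ySZ_one : ySZ m (n + 1) = e (n + 1 : ℕ) 0 * e 0 (N + 3 : ℕ) := by
  rw [ySZ, hN, e_mul, add_zero, zero_add]

include hN in
theorem ySZ_two : ySZ m (2 * (n + 1)) = e (n + 1 : ℕ) 0 ^ 2 * e 0 (N + 3 : ℕ) ^ 2 := by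
  rw [ySZ, two_mul_deg hN, e_pow, e_pow, e_mul]; congr 1 <;> push_cast <;> ring

include hN in
theorem ySbZ_one : ySbZ m (n + 1) = e (-(n + 1 : ℕ)) 0 * e 0 (-(N + 3 : ℕ)) := by
  rw [ySbZ, hN, e_mul, add_zero, zero_add]

include hN in
theorem ySbZ_two : ySbZ m (2 * (n + 1)) = e (-(n + 1 : ℕ)) 0 ^ 2 * e 0 (-(N + 3 : ℕ)) ^ 2 := by
  rw [ySbZ, two_mul_deg hN, e_pow, e_pow, e_mul]; congr 1 <;> push_cast <;> ring

include hN in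
theorem yDZ_one : yDZ m (n + 1) =
    (-((N : ℝ) + 2)) • (e (-(n + 1 : ℕ)) 0 * e 0 (-(N + 3 : ℕ))) := by
  rw [yDZ, deg_cast hN, hN, e_mul, add_zero, zero_add]; congr 2; ring

include hN in
theorem yDZ_two : yDZ m (2 * (n + 1)) =
    (-(2 * (N : ℝ) + 5)) • (e (-(n + 1 : ℕ)) 0 ^ 2 * e 0 (-(N + 3 : ℕ)) ^ 2) := by
  rw [yDZ, two_deg_cast hN, two_mul_deg hN, e_pow, e_pow, e_mul]
  congr 1
  · ring

include hN in
theorem yq_one : yq m (n + 1) = -(e (-(n + 1 : ℕ)) 0 * geoInv (N + 2)) := by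
  rw [yq, hN, geoInv, Finset.mul_sum]
  simp only [e_mul, add_zero, zero_add]
  rfl

include hN in
theorem yq_two : yq m (2 * (n + 1)) = -(e (-(n + 1 : ℕ)) 0 ^ 2 * geoInv (2 * N + 5)) := by
  rw [yq, two_mul_deg hN, geoInv, Finset.mul_sum, e_pow]
  simp only [e_mul, mul_zero, add_zero, zero_add]
  congr 1

include hN in
theorem yqs_one : yqs m (n + 1) = -(e (n + 1 : ℕ) 0 * geo (N + 2)) := by
  rw [yqs, hN, geo, Finset.mul_sum]
  simp only [e_mul, add_zero, zero_add]
  rfl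

include hN in
theorem yqs_two : yqs m (2 * (n + 1)) = -(e (n + 1 : ℕ) 0 ^ 2 * geo (2 * N + 5)) := by
  rw [yqs, two_mul_deg hN, geo, Finset.mul_sum, e_pow]
  simp only [e_mul, mul_zero, add_zero, zero_add]
  congr 1

end Monomials

section Jets

variable {n N : ℕ} (hN : (n + 1) * m = N + 3) (α κ : Fin 2 → ℝ)

include hN in
theorem hasJet_wDZ (j : Fin 2) : HasJet (fun t => wDZ m b j (path α κ n t)) (radius b j • 1)
    (-(((N : ℝ) + 2) * α j) • (e (-(n + 1 : ℕ)) 0 * e 0 (-(N + 3 : ℕ))))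
    (-((2 * N + 5) * κ j) • (e (-(n + 1 : ℕ)) 0 ^ 2 * e 0 (-(N + 3 : ℕ)) ^ 2)) 0 := by
  refine (hasJet_ser (yDZ_bound m) _ α κ n j).congr_coeff rfl ?_ ?_ rfl
  · rw [yDZ_one hN]; module
  · rw [yDZ_two hN]; module

include hN in
theorem hasJet_wD (j : Fin 2) : HasJet (fun t => wD m b j (path α κ n t)) (radius b j • 1)
    (-(((N : ℝ) + 2) * α j) • e (-(n + 1 : ℕ)) 0)
    (-((2 * N + 5) * κ j) • e (-(n + 1 : ℕ)) 0 ^ 2) 0 := by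
  refine (hasJet_ser (yD_bound m) _ α κ n j).congr_coeff rfl ?_ ?_ rfl
  · rw [yD_one hN]; module
  · rw [yD_two hN]; module

theorem hasJet_wS (j : Fin 2) : HasJet (fun t => wS b j (path α κ n t)) (radius b j • 1)
    (α j • e (n + 1 : ℕ) 0) (κ j • e (n + 1 : ℕ) 0 ^ 2) 0 := by
  refine (hasJet_ser yS_bound _ α κ n j).congr_coeff rfl rfl ?_ rfl
  rw [yS_two]

include hN in
theorem hasJet_wNum {i j : Fin 2} (hij : j ≠ i) : HasJet (fun t => wNum m b j i (path α κ n t))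
    (radius b j • e 0 1 - radius b i • 1)
    (α j • (e (n + 1 : ℕ) 0 * e 0 1) - α i • (e (n + 1 : ℕ) 0 * e 0 (N + 3 : ℕ)))
    (κ j • (e (n + 1 : ℕ) 0 ^ 2 * e 0 1) - κ i • (e (n + 1 : ℕ) 0 ^ 2 * e 0 (N + 3 : ℕ) ^ 2)) 0 := by
  have h1 := (hasJet_wS (b := b) (n := n) α κ j).map (ContinuousLinearMap.mul ℝ Wiener (e 0 1))
  have h2 := hasJet_ser (ySZ_bound m) (radius b i) α κ n i
  have h3 := h1.sub h2
  simp only [wNum, if_neg hij]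
  refine HasJet.congr_coeff h3 ?_ ?_ ?_ ?_
  · simp
  · rw [ySZ_one hN, map_smul, ContinuousLinearMap.mul_apply', mul_comm (e 0 1)]
  · rw [ySZ_two hN, map_smul, ContinuousLinearMap.mul_apply', mul_comm (e 0 1)]
  · simp

include hN in
theorem hasJet_wDen {i j : Fin 2} (hij : j ≠ i) : HasJet (fun t => wDen m b j i (path α κ n t))
    (radius b j • 1 - radius b i • e 0 1)
    (α j • e (-(n + 1 : ℕ)) 0 - α i • (e (-(n + 1 : ℕ)) 0 * e 0 1 * e 0 (-(N + 3 : ℕ))))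
    (κ j • e (-(n + 1 : ℕ)) 0 ^ 2 -
      κ i • (e (-(n + 1 : ℕ)) 0 ^ 2 * e 0 1 * e 0 (-(N + 3 : ℕ)) ^ 2)) 0 := by
  have h1 := (hasJet_ser (ySbZ_bound m) (radius b i) α κ n i).map
    (ContinuousLinearMap.mul ℝ Wiener (e 0 1))
  have h2 := hasJet_ser ySb_bound (radius b j) α κ n j
  have h3 := h2.sub h1
  simp only [wDen, if_neg hij]
  refine HasJet.congr_coeff h3 ?_ ?_ ?_ ?_
  · simp
  · rw [ySbZ_one hN, map_smul, ContinuousLinearMap.mul_apply']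
    congr 2
    ring
  · rw [ySbZ_two hN, map_smul, ContinuousLinearMap.mul_apply', ySb_two]
    congr 2
    ring
  · simp

include hN in
theorem hasJet_wNum_self (j : Fin 2) : HasJet (fun t => wNum m b j j (path α κ n t))
    (-radius b j • 1) (α j • (e (n + 1 : ℕ) 0 * geo (N + 2)))
    (κ j • (e (n + 1 : ℕ) 0 ^ 2 * geo (2 * N + 5))) 0 := by
  have h := (hasJet_ser (yqs_bound m) (radius b j) α κ n j).neg
  simp only [wNum, if_true]
  refine HasJet.congr_coeff h ?_ ?_ ?_ ?_
  · module
  · rw [yqs_one hN]; module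
  · rw [yqs_two hN]; module
  · simp

include hN in
theorem hasJet_wDen_self (j : Fin 2) : HasJet (fun t => wDen m b j j (path α κ n t))
    (radius b j • 1) (-α j • (e (-(n + 1 : ℕ)) 0 * geoInv (N + 2)))
    (-κ j • (e (-(n + 1 : ℕ)) 0 ^ 2 * geoInv (2 * N + 5))) 0 := by
  have h := hasJet_ser (yq_bound m) (radius b j) α κ n j
  simp only [wDen, if_true]
  refine HasJet.congr_coeff h rfl ?_ ?_ rfl
  · rw [yq_one hN]; module
  · rw [yq_two hN]; module

/-- The factor Φ_j'(w) depends on u alone, hence is a constant for the mean over η. -/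
theorem avg_mul_wD (x : Wiener) (j : Fin 2) (z : Fin 2 → Ell1) :
    avg (x * wD m b j z) = avg x * wD m b j z := by
  have h : (avg.comp (ContinuousLinearMap.mul ℝ Wiener x)).comp (ser (yD m)) =
      (ContinuousLinearMap.mul ℝ Wiener (avg x)).comp (ser (yD m)) := by
    refine ext_δ fun k => ?_
    simp only [ContinuousLinearMap.comp_apply, ser_δ (yD_bound m), yD, map_smul,
      ContinuousLinearMap.mul_apply']
    congr 2
    rw [mul_comm, avg_e_mul, mul_comm]
  rw [wD, mul_add, mul_add, map_add, mul_smul_comm, mul_one, map_smul, mul_smul_comm, mul_one]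
  congr 1
  exact congrArg (fun L => L (z j)) h

theorem avg_wS (j : Fin 2) (z : Fin 2 → Ell1) : avg (wS b j z) = wS b j z := by
  have h : avg.comp (ser yS) = ser yS := by
    refine ext_δ fun k => ?_
    simp only [ContinuousLinearMap.comp_apply, ser_δ yS_bound, yS, map_smul]
    rw [avg_e, if_pos rfl]
  have h1 : avg (1 : Wiener) = 1 := by rw [← e_zero, avg_e, if_pos rfl]
  rw [wS, map_add, map_smul, h1]
  congr 1
  exact congrArg (fun L => L (z j)) h

theorem GW_eq (p : ℝ × (Fin 2 → Ell1)) (j : Fin 2) : GW m b p j =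
    R (((1 - p.1) • wS b j p.2 + (avg (wT m b j 0 p.2) - avg (wT m b j 1 p.2))) *
      wD m b j p.2) := by
  rw [GW, wP, ← R_avg, avg_mul_wD, map_add, map_sub, map_smul, avg_wS]

theorem R_e_pos (n : ℕ) : R (e (n + 1 : ℕ) 0) = -((n : ℝ) + 1) • δ n := by
  rw [R_e, if_pos rfl]
  have : (((n + 1 : ℕ) : ℤ)).natAbs - 1 = n := by omega
  rw [this]
  push_cast
  rfl

theorem R_e_neg (n : ℕ) : R (e (-(n + 1 : ℕ)) 0) = ((n : ℝ) + 1) • δ n := by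
  rw [R_e, if_pos rfl]
  have : (-((n + 1 : ℕ) : ℤ)).natAbs - 1 = n := by omega
  rw [this]
  push_cast
  rw [neg_neg]

theorem R_e_two_pos (n : ℕ) : R (e (2 * (n + 1 : ℕ)) 0) = -(2 * ((n : ℝ) + 1)) • δ (2 * n + 1) := by
  have h := R_e_pos (2 * n + 1)
  rw [show ((2 * n + 1 + 1 : ℕ) : ℤ) = 2 * (n + 1 : ℕ) by push_cast; ring] at h
  rw [h]; congr 2; push_cast; ring

theorem R_e_two_neg (n : ℕ) : R (e (-(2 * (n + 1 : ℕ))) 0) = (2 * ((n : ℝ) + 1)) • δ (2 * n + 1) := by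
  have h := R_e_neg (2 * n + 1)
  rw [show ((2 * n + 1 + 1 : ℕ) : ℤ) = 2 * (n + 1 : ℕ) by push_cast; ring] at h
  rw [h]; congr 1; push_cast; ring

theorem R_one : R 1 = 0 := by rw [← e_zero, R_e, if_pos rfl]; simp

theorem coord_R_e_three (n : ℕ) : coord n (R (e (-(3 * (n + 1 : ℕ))) 0)) = 0 := by
  rw [R_e, if_pos rfl, map_smul, coord_δ, if_neg (by omega), smul_zero]

-- With km = N + 3 the linear coefficient is k times the first row of M_{km}(λ) applied to (a, c).
-- The mode 2k receives the corresponding row of M_{2km}(λ) applied to (A, C) together with the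
-- quadratic self-interaction km(ba - b^{km}c)². The leading factors k and 2k come from `R`. Of the
-- cubic coefficient only the mode k is recorded.
include hN in
theorem hasJet_GW_zero (hb : b ∈ Ioo (0 : ℝ) 1) (lam a c A C : ℝ) :
    ∃ p₃, HasJet (fun t => GW m b (lam, path ![a, c] ![A, C] n t) 0) 0
      ((((n : ℝ) + 1) * (a * ((N + 3) * lam - (N + 3) * b ^ 2 - 1) + b ^ (N + 4) * c)) • δ n)
      ((2 * ((n : ℝ) + 1) * (A * ((2 * N + 6) * lam - (2 * N + 6) * b ^ 2 - 1) + b ^ (2 * N + 7) * C +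
        (N + 3) * (b * a - b ^ (N + 3) * c) ^ 2)) • δ (2 * n + 1)) p₃ ∧
      coord n p₃ = ((n : ℝ) + 1) * ((N + 2) * a * A + (N + 2) * (N + 1) / 2 * a ^ 3 +
        (N + 2) * a * c ^ 2 - (N + 2) * c * b ^ (N + 3) * C -
        (N + 3) * (N + 2) / 2 * b ^ (N + 2) * c ^ 3 - (N + 2) ^ 2 * a * (a ^ 2 - c ^ 2) -
        (2 * N + 5) * (1 - lam) * a * A + (N + 2) * (1 - lam) * a * A) := by
  have hr0 : radius b 0 = 1 := rfl
  have hr1 : radius b 1 = b := rfl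
  have h00 := hasJet_avg_self (n + 1) N (be := radius b 0) (by rw [hr0]; exact one_ne_zero)
    (hasJet_wNum_self hN ![a, c] ![A, C] 0) (hasJet_wDen_self hN ![a, c] ![A, C] 0)
    (hasJet_wDZ hN ![a, c] ![A, C] 0)
  obtain ⟨K, h01⟩ := hasJet_avg_cross01 hb (n + 1) N a c A C
    (hasJet_wNum hN ![a, c] ![A, C] (i := 1) (j := 0) (by decide))
    (hasJet_wDen hN ![a, c] ![A, C] (i := 1) (j := 0) (by decide))
    (hasJet_wDZ hN ![a, c] ![A, C] 1)
  have hS := (hasJet_wS (b := b) (n := n) ![a, c] ![A, C] 0).const_smul (1 - lam)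
  have hD := hasJet_wD (b := b) hN ![a, c] ![A, C] 0
  have h := ((hS.add (h00.sub h01)).mul hD).map R
  have e1 : e (n + 1 : ℕ) 0 ^ 2 = e (2 * (n + 1 : ℕ)) 0 := by
    rw [e_pow]; congr 1
  have e2 : e (-(n + 1 : ℕ)) 0 ^ 2 = e (-(2 * (n + 1 : ℕ))) 0 := by
    rw [e_pow]; congr 1
  have e3 : e (n + 1 : ℕ) 0 * e (-(n + 1 : ℕ)) 0 = 1 := by
    rw [e_mul, add_neg_cancel, add_zero, e_zero]
  have e4 : e (n + 1 : ℕ) 0 * e (-(2 * (n + 1 : ℕ))) 0 = e (-(n + 1 : ℕ)) 0 := by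
    rw [e_mul]; congr 1; ring
  have e5 : e (-(n + 1 : ℕ)) 0 * e (-(n + 1 : ℕ)) 0 = e (-(2 * (n + 1 : ℕ))) 0 := by
    rw [e_mul]; congr 1; ring
  have e6 : e (-(n + 1 : ℕ)) 0 * e (-(2 * (n + 1 : ℕ))) 0 = e (-(3 * (n + 1 : ℕ))) 0 := by
    rw [e_mul]; congr 1; ring
  have e7 : e (2 * (n + 1 : ℕ)) 0 * e (-(n + 1 : ℕ)) 0 = e (n + 1 : ℕ) 0 := by
    rw [e_mul]; congr 1; ring
  have e8 : e (-(2 * (n + 1 : ℕ))) 0 * e (-(n + 1 : ℕ)) 0 = e (-(3 * (n + 1 : ℕ))) 0 := by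
    rw [e_mul]; congr 1; ring
  simp only [e1, e2, hr0, Matrix.cons_val_zero] at h
  refine ⟨_, (h.congr (Eventually.of_forall fun t => ?_)).congr_coeff ?_ ?_ ?_ rfl, ?_⟩
  · rw [GW_eq]; rfl
  · simp only [add_mul, sub_mul, mul_add, smul_mul_assoc, mul_smul_comm, one_mul, mul_one, map_add, map_sub, map_smul, R_one,
      smul_zero, add_zero, sub_zero]
  · simp only [add_mul, sub_mul, mul_add, smul_mul_assoc, mul_smul_comm, one_mul, mul_one, map_add, map_sub, map_smul, R_e_pos, R_e_neg, zero_mul, map_zero]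
    module
  · simp only [add_mul, sub_mul, mul_add, smul_mul_assoc, mul_smul_comm, one_mul, mul_one, map_add, map_sub, map_smul, e3, e5, R_one, R_e_two_pos, R_e_two_neg, zero_mul, map_zero]
    module
  · simp only [add_mul, sub_mul, mul_add, smul_mul_assoc, mul_smul_comm, one_mul, mul_one, mul_zero, smul_zero, map_add, map_sub, map_smul, e3, e4, e5, e6, e7, e8, R_one, R_e_pos, R_e_neg, zero_mul, map_zero, coord_R_e_three, coord_δ, if_true, smul_eq_mul]
    ring

-- On the inner boundary the quadratic self-interaction of the mode k cancels, and the second order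
-- coefficient is just the second row of M_{2km}(λ) applied to (A, C). Consequently the source
-- driving the mode 2k has a zero second component.
include hN in
theorem hasJet_GW_one (hb : b ∈ Ioo (0 : ℝ) 1) (lam a c A C : ℝ) :
    ∃ p₃, HasJet (fun t => GW m b (lam, path ![a, c] ![A, C] n t) 1) 0
      ((((n : ℝ) + 1) * (-b ^ (N + 3) * a + b * ((N + 3) * lam - (N + 2)) * c)) • δ n)
      ((2 * ((n : ℝ) + 1) * (-b ^ (2 * N + 6) * A + b * ((2 * N + 6) * lam - (2 * N + 5)) * C)) •
        δ (2 * n + 1)) p₃ ∧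
      coord n p₃ = ((n : ℝ) + 1) * (b * (a * ((N + 2) * b ^ (N + 1) * C +
        (N + 2) * (N + 1) / 2 * b ^ N * c ^ 2) -
        ((N + 2) * c * C / b + (N + 2) * (N + 1) / 2 * c ^ 3 / b ^ 2)) -
        (N + 2) ^ 2 * c * (b ^ (N + 1) * a * c - c ^ 2 / b) -
        (2 * N + 5) * C * (a * b ^ (N + 2) - lam * c) -
        (b * (2 * N + 5) * (b ^ (2 * N + 4) * A * c - b ^ (N + 2) * a * A) -
          (N + 2) * c * (A * b ^ (2 * N + 5) - lam * C))) := by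
  have hr0 : radius b 0 = 1 := rfl
  have hr1 : radius b 1 = b := rfl
  have hb0 : b ≠ 0 := hb.1.ne'
  have h11 := hasJet_avg_self (n + 1) N (be := radius b 1) (by rw [hr1]; exact hb0)
    (hasJet_wNum_self hN ![a, c] ![A, C] 1) (hasJet_wDen_self hN ![a, c] ![A, C] 1)
    (hasJet_wDZ hN ![a, c] ![A, C] 1)
  obtain ⟨K, h10⟩ := hasJet_avg_cross10 hb (n + 1) N a c A C
    (hasJet_wNum hN ![a, c] ![A, C] (i := 0) (j := 1) (by decide))
    (hasJet_wDen hN ![a, c] ![A, C] (i := 0) (j := 1) (by decide))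
    (hasJet_wDZ hN ![a, c] ![A, C] 0)
  have hS := (hasJet_wS (b := b) (n := n) ![a, c] ![A, C] 1).const_smul (1 - lam)
  have hD := hasJet_wD (b := b) hN ![a, c] ![A, C] 1
  have h := ((hS.add (h10.sub h11)).mul hD).map R
  have e1 : e (n + 1 : ℕ) 0 ^ 2 = e (2 * (n + 1 : ℕ)) 0 := by
    rw [e_pow]; congr 1
  have e2 : e (-(n + 1 : ℕ)) 0 ^ 2 = e (-(2 * (n + 1 : ℕ))) 0 := by
    rw [e_pow]; congr 1
  have e3 : e (n + 1 : ℕ) 0 * e (-(n + 1 : ℕ)) 0 = 1 := by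
    rw [e_mul, add_neg_cancel, add_zero, e_zero]
  have e4 : e (n + 1 : ℕ) 0 * e (-(2 * (n + 1 : ℕ))) 0 = e (-(n + 1 : ℕ)) 0 := by
    rw [e_mul]; congr 1; ring
  have e5 : e (-(n + 1 : ℕ)) 0 * e (-(n + 1 : ℕ)) 0 = e (-(2 * (n + 1 : ℕ))) 0 := by
    rw [e_mul]; congr 1; ring
  have e6 : e (-(n + 1 : ℕ)) 0 * e (-(2 * (n + 1 : ℕ))) 0 = e (-(3 * (n + 1 : ℕ))) 0 := by
    rw [e_mul]; congr 1; ring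
  have e7 : e (2 * (n + 1 : ℕ)) 0 * e (-(n + 1 : ℕ)) 0 = e (n + 1 : ℕ) 0 := by
    rw [e_mul]; congr 1; ring
  have e8 : e (-(2 * (n + 1 : ℕ))) 0 * e (-(n + 1 : ℕ)) 0 = e (-(3 * (n + 1 : ℕ))) 0 := by
    rw [e_mul]; congr 1; ring
  simp only [e1, e2, hr1, Matrix.cons_val_one, Matrix.cons_val_zero] at h
  refine ⟨_, (h.congr (Eventually.of_forall fun t => ?_)).congr_coeff ?_ ?_ ?_ rfl, ?_⟩
  · rw [GW_eq]; rfl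
  · simp only [add_mul, sub_mul, mul_add, smul_mul_assoc, mul_smul_comm, one_mul, mul_one, map_add, map_sub, map_smul, R_one,
      smul_zero, add_zero, sub_zero]
  · simp only [add_mul, sub_mul, mul_add, smul_mul_assoc, mul_smul_comm, one_mul, mul_one, map_add, map_sub, map_smul, R_e_pos, R_e_neg, zero_mul, map_zero]
    match_scalars
    field_simp
    ring
  · simp only [add_mul, sub_mul, mul_add, smul_mul_assoc, mul_smul_comm, one_mul, mul_one, map_add, map_sub, map_smul, e3, e5, R_one, R_e_two_pos, R_e_two_neg, zero_mul, map_zero]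
    match_scalars
    field_simp
    ring
  · simp only [add_mul, sub_mul, mul_add, smul_mul_assoc, mul_smul_comm, one_mul, mul_one, mul_zero, smul_zero, map_add, map_sub, map_smul, e3, e4, e5, e6, e7, e8, R_one, R_e_pos, R_e_neg, zero_mul, map_zero, coord_R_e_three, coord_δ, if_true, smul_eq_mul]
    field_simp
    ring

end Jets

end Wiener

/-! ### Bifurcation parameters -/

/-- The eigenvalue condition at `λ₀`, with the signs of the two factors. -/
structure IsBif (m : ℕ) (b lam0 : ℝ) : Prop where
  three_le : 3 ≤ m
  mem : b ∈ Ioo (0 : ℝ) 1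
  pos : 0 < m * lam0 - 1 - m * b ^ 2
  neg : m * lam0 - m + 1 < 0
  mul_eq : (m * lam0 - 1 - m * b ^ 2) * (m * lam0 - m + 1) + b ^ (2 * m) = 0

/-- Put s(b) = (1 - b²)m/2 - 1. The equation for b* says s(b*) = (b*)^m; since s decreases and b^m
increases, b^m < s for b < b*, so 0 ≤ Δ_m < s². With r = ±√Δ_m the two factors are r + s and r - s,
whose signs are clear from |r| < s and whose product is Δ_m - s² = -b^{2m}. -/
theorem isBif_of_lt {m : ℕ} (hm : 3 ≤ m) {bstar : ℝ} (hbstar : bstar ∈ Ioo (0 : ℝ) 1)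
    (h : 1 + bstar ^ m - (1 - bstar ^ 2) / 2 * m = 0) {b : ℝ} (hb : b ∈ Ioo 0 bstar) {lam0 : ℝ}
    (hlam : lam0 = lamPlus m b ∨ lam0 = lamMinus m b) : IsBif m b lam0 := by
  have hm0 : (0 : ℝ) < m := by exact_mod_cast (by omega : 0 < m)
  have h1 : b ^ m < bstar ^ m := pow_lt_pow_left₀ hb.2 hb.1.le (by omega)
  have h2 : b ^ 2 < bstar ^ 2 := pow_lt_pow_left₀ hb.2 hb.1.le (by omega)
  have hbm : 0 < b ^ m := pow_pos hb.1 m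
  set s := (1 - b ^ 2) / 2 * m - 1 with hs
  have h3 : b ^ m < s := by
    have : b ^ 2 * m < bstar ^ 2 * m := mul_lt_mul_of_pos_right h2 hm0
    rw [hs]; nlinarith
  have hD : Delta m b = s ^ 2 - b ^ (2 * m) := rfl
  have hpow : b ^ (2 * m) = (b ^ m) ^ 2 := by rw [← pow_mul, mul_comm]
  have hD0 : 0 ≤ Delta m b := by
    rw [hD, hpow]; nlinarith
  have hsq := Real.sq_sqrt hD0
  have hsn := Real.sqrt_nonneg (Delta m b)
  have hlt : √(Delta m b) < s := by
    rw [Real.sqrt_lt' (hbm.trans h3), hD]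
    have : 0 < b ^ (2 * m) := pow_pos hb.1 _
    linarith
  have key : ∀ r : ℝ, r ^ 2 = Delta m b → |r| < s → IsBif m b ((1 + b ^ 2) / 2 + 1 / m * r) := by
    intro r hr hrs
    have hml : (m : ℝ) * ((1 + b ^ 2) / 2 + 1 / m * r) = m * (1 + b ^ 2) / 2 + r := by
      field_simp
    have hr' := abs_lt.1 hrs
    refine ⟨hm, ⟨hb.1, hb.2.trans hbstar.2⟩, ?_, ?_, ?_⟩
    · rw [hml]; rw [hs] at hr'; linarith [hr'.1]
    · rw [hml]; rw [hs] at hr'; linarith [hr'.2]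
    · rw [hml]
      rw [hD, hs] at hr
      linear_combination hr
  rcases hlam with h | h
  · rw [h, lamPlus]
    exact key _ hsq (by rwa [abs_of_nonneg hsn])
  · rw [h, lamMinus]
    have := key (-√(Delta m b)) (by rw [neg_sq, hsq]) (by rwa [abs_neg, abs_of_nonneg hsn])
    rwa [mul_neg, ← sub_eq_add_neg] at this

namespace IsBif

variable {m : ℕ} {b lam0 : ℝ} (h : IsBif m b lam0)

include h

theorem one_le : 1 ≤ m := by have := h.three_le; omega

theorem pow_pos (n : ℕ) : 0 < b ^ n := _root_.pow_pos h.mem.1 n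

theorem det_eq (n : ℕ) : (M b n lam0).det =
    -b * ((n * lam0 - 1 - n * b ^ 2) * (-(n * lam0 - n + 1)) - b ^ (2 * n)) := by
  rw [M, Matrix.det_fin_two_of]
  ring

/-- Let A > 0 > p be the two factors at k = 1. For k = n + 2 the factors are kA + (k - 1) and kp -
(k - 1), so minus the determinant divided by b is (kA + k - 1)(-kp + k - 1) - b^{2km}. The term (k -
1)² outweighs b^{2km} ≤ 1, and the cross term k(k - 1)(A - p) supplies the quadratic growth. -/
theorem exists_det_bound : ∃ c > 0, ∀ n : ℕ, c * ((n : ℝ) + 2) ^ 2 ≤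
    -(M b ((n + 2) * m) lam0).det := by
  have hb := h.mem
  have hA := h.pos
  have hp := h.neg
  -- The half comes from k(k - 1) ≥ k²/2 for k ≥ 2.
  refine ⟨b * ((m * lam0 - 1 - m * b ^ 2) - (m * lam0 - m + 1)) / 2, by nlinarith [hb.1], fun n => ?_⟩
  rw [h.det_eq]
  have h1 : b ^ (2 * ((n + 2) * m)) ≤ 1 := pow_le_one₀ hb.1.le hb.2.le
  set A := m * lam0 - 1 - m * b ^ 2 with hA'
  set p := m * lam0 - m + 1 with hp'
  have e1 : (((n + 2) * m : ℕ) : ℝ) * lam0 - 1 - ((n + 2) * m : ℕ) * b ^ 2 =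
      (n + 2) * A + (n + 1) := by push_cast; rw [hA']; ring
  have e2 : -((((n + 2) * m : ℕ) : ℝ) * lam0 - ((n + 2) * m : ℕ) + 1) =
      (n + 2) * (-p) + (n + 1) := by push_cast; rw [hp']; ring
  rw [e1, e2]
  have h0 : (0 : ℝ) ≤ n := Nat.cast_nonneg n
  have h2 : ((n : ℝ) + 2) ^ 2 * (A - p) / 2 ≤
      ((n + 2) * A + (n + 1)) * ((n + 2) * (-p) + (n + 1)) - b ^ (2 * ((n + 2) * m)) := by
    have h3 : 0 ≤ A * (-p) := mul_nonneg hA.le (by linarith)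
    have h4 : 0 ≤ (A - p) := by linarith
    nlinarith [mul_nonneg h0 h4, mul_nonneg (mul_nonneg h0 h0) h4, mul_nonneg h0 h3,
      mul_nonneg (mul_nonneg h0 h0) h3]
  nlinarith [hb.1, h2]

theorem det_ne_zero {n : ℕ} (hn : 2 ≤ n) : (M b (n * m) lam0).det ≠ 0 := by
  obtain ⟨c, hc, hd⟩ := h.exists_det_bound
  obtain ⟨k, rfl⟩ : ∃ k, n = k + 2 := ⟨n - 2, by omega⟩
  have h1 := hd k
  have h2 : 0 < c * ((k : ℝ) + 2) ^ 2 := by positivity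
  linarith

end IsBif

namespace Wiener

open Ell1

/-! ### Block diagonal operators -/

/-- Diagonal operators. -/
def diag (a : ℕ → ℝ) : Ell1 →L[ℝ] Ell1 := Ell1.sum fun n => a n • δ n

theorem _root_.VStates.Ell1.ext_coord {x y : Ell1} (h : ∀ n, coord n x = coord n y) : x = y := by
  refine lp.ext (funext fun n => ?_)
  have := h n
  rwa [coord_apply, coord_apply] at this

theorem coord_diag {a : ℕ → ℝ} {C : ℝ} (ha : ∀ n, |a n| ≤ C) (n : ℕ) (x : Ell1) :
    coord n (diag a x) = a n * coord n x := by
  have hb : ∀ n, ‖a n • δ n‖ ≤ C := fun n => by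
    rw [norm_smul, norm_δ, mul_one]; exact ha n
  have h : (coord n).comp (diag a) = a n • coord n := by
    refine ext_δ fun k => ?_
    rw [ContinuousLinearMap.comp_apply, diag, sum_δ hb, map_smul, coord_δ,
      ContinuousLinearMap.smul_apply, coord_δ]
    split_ifs with hk
    · rw [hk]
    · simp
  exact congrArg (fun L => L x) h

/-- Block diagonal operators on `ℓ¹ × ℓ¹`. -/
def blockOp (d : ℕ → Matrix (Fin 2) (Fin 2) ℝ) : (Fin 2 → Ell1) →L[ℝ] (Fin 2 → Ell1) :=
  ContinuousLinearMap.pi fun i => ∑ j, (diag fun n => d n i j).comp (ContinuousLinearMap.proj j)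

theorem coord_blockOp {d : ℕ → Matrix (Fin 2) (Fin 2) ℝ} {C : ℝ} (hd : ∀ n i j, |d n i j| ≤ C)
    (x : Fin 2 → Ell1) (n : ℕ) (i : Fin 2) :
    coord n (blockOp d x i) = (d n).mulVec (fun j => coord n (x j)) i := by
  rw [blockOp, ContinuousLinearMap.pi_apply, ContinuousLinearMap.sum_apply, map_sum]
  simp only [Matrix.mulVec, dotProduct]
  refine Finset.sum_congr rfl fun j _ => ?_
  exact coord_diag (fun n => hd n i j) n (x j)

theorem ext_mode {F : Type*} [NormedAddCommGroup F] [NormedSpace ℝ F]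
    {f g : (Fin 2 → Ell1) →L[ℝ] F}
    (h : ∀ (a c : ℝ) (n : ℕ), f (fun j => ![a, c] j • δ n) = g (fun j => ![a, c] j • δ n)) :
    f = g := by
  have h1 : ∀ j, f.comp (ContinuousLinearMap.single ℝ (fun _ : Fin 2 => Ell1) j) =
      g.comp (ContinuousLinearMap.single ℝ (fun _ : Fin 2 => Ell1) j) := by
    intro j
    refine ext_δ fun n => ?_
    rw [ContinuousLinearMap.comp_apply, ContinuousLinearMap.comp_apply]
    have e : ContinuousLinearMap.single ℝ (fun _ : Fin 2 => Ell1) j (δ n) =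
        fun i => ![if j = 0 then (1 : ℝ) else 0, if j = 0 then 0 else 1] i • δ n := by
      funext i
      rw [ContinuousLinearMap.single_apply]
      fin_cases i <;> fin_cases j <;> simp
    rw [e]
    exact h _ _ n
  refine ContinuousLinearMap.ext fun x => ?_
  have hx : x = ∑ j, ContinuousLinearMap.single ℝ (fun _ : Fin 2 => Ell1) j (x j) := by
    funext i
    fin_cases i <;> simp
  rw [hx, map_sum, map_sum]
  exact Finset.sum_congr rfl fun j _ => congrArg (fun L => L (x j)) (h1 j)

/-- By the adjugate formula the inverse blocks have entries at most C/c, so inverting block by block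
gives a bounded operator on ℓ¹ × ℓ¹. -/
theorem isInvertible_blockOp {d : ℕ → Matrix (Fin 2) (Fin 2) ℝ} {C c : ℝ}
    (hd : ∀ n i j, |d n i j| ≤ C) (hc : 0 < c) (hdet : ∀ n, c ≤ |(d n).det|) :
    (blockOp d).IsInvertible := by
  have hne : ∀ n, (d n).det ≠ 0 := fun n => abs_pos.1 (hc.trans_le (hdet n))
  have hinv : ∀ n i j, |(d n)⁻¹ i j| ≤ C / c := by
    intro n i j
    have h1 : |(d n).adjugate i j| ≤ C := by
      rw [Matrix.adjugate_fin_two]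
      fin_cases i <;> fin_cases j <;> simp <;> exact hd _ _ _
    rw [Matrix.inv_def, Matrix.smul_apply, smul_eq_mul, abs_mul, Ring.inverse_eq_inv', abs_inv]
    have hC : 0 ≤ C := (abs_nonneg _).trans (hd 0 0 0)
    rw [inv_mul_eq_div]
    exact div_le_div₀ hC h1 hc (hdet n)
  refine ContinuousLinearMap.IsInvertible.of_inverse (g := blockOp fun n => (d n)⁻¹) ?_ ?_
  · refine ContinuousLinearMap.ext fun x => funext fun i => ext_coord fun n => ?_
    rw [ContinuousLinearMap.comp_apply, coord_blockOp hd]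
    have : (fun j => coord n (blockOp (fun n => (d n)⁻¹) x j)) =
        ((d n)⁻¹).mulVec fun j => coord n (x j) := funext fun j => coord_blockOp hinv x n j
    rw [this, Matrix.mulVec_mulVec, Matrix.mul_nonsing_inv _ (hne n).isUnit, Matrix.one_mulVec]
    rfl
  · refine ContinuousLinearMap.ext fun x => funext fun i => ext_coord fun n => ?_
    rw [ContinuousLinearMap.comp_apply, coord_blockOp hinv]
    have : (fun j => coord n (blockOp d x j)) =
        (d n).mulVec fun j => coord n (x j) := funext fun j => coord_blockOp hd x n j
    rw [this, Matrix.mulVec_mulVec, Matrix.nonsing_inv_mul _ (hne n).isUnit, Matrix.one_mulVec]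
    rfl

/-! ### The linearization at `0` -/

/-- The blocks of the linearization. -/
def dmat (m : ℕ) (b lam : ℝ) (n : ℕ) : Matrix (Fin 2) (Fin 2) ℝ :=
  ((n : ℝ) + 1)⁻¹ • M b ((n + 1) * m) lam

theorem dmat_eq (m : ℕ) (b lam : ℝ) (n : ℕ) : dmat m b lam n =
    !![m * lam - m * b ^ 2 - ((n : ℝ) + 1)⁻¹, ((n : ℝ) + 1)⁻¹ * b ^ ((n + 1) * m + 1);
      -(((n : ℝ) + 1)⁻¹ * b ^ ((n + 1) * m)), b * (m * lam - m + ((n : ℝ) + 1)⁻¹)] := by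
  have h : (n : ℝ) + 1 ≠ 0 := by positivity
  rw [dmat, M]
  ext i j
  fin_cases i <;> fin_cases j <;> simp <;> field_simp <;> ring

theorem dmat_bound {b : ℝ} (hb : b ∈ Ioo (0 : ℝ) 1) (m : ℕ) (lam : ℝ) (n : ℕ) (i j : Fin 2) :
    |dmat m b lam n i j| ≤ m * (|lam| + 1) + 1 := by
  have h0 : (0 : ℝ) < (n : ℝ) + 1 := by positivity
  have h1 : ((n : ℝ) + 1)⁻¹ ≤ 1 := inv_le_one_of_one_le₀ (by linarith [(Nat.cast_nonneg n : (0:ℝ) ≤ n)])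
  have h2 : 0 < ((n : ℝ) + 1)⁻¹ := inv_pos.2 h0
  have hm : (0 : ℝ) ≤ m := Nat.cast_nonneg m
  have hl := abs_nonneg lam
  have hl1 := abs_le.1 (le_refl |lam|)
  have hp : ∀ k : ℕ, 0 ≤ ((n : ℝ) + 1)⁻¹ * b ^ k ∧ ((n : ℝ) + 1)⁻¹ * b ^ k ≤ 1 := fun k =>
    ⟨mul_nonneg h2.le (pow_nonneg hb.1.le k),
      mul_le_one₀ h1 (pow_nonneg hb.1.le k) (pow_le_one₀ hb.1.le hb.2.le)⟩
  have hml : 0 ≤ m * |lam| := mul_nonneg hm hl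
  have hml1 : m * lam ≤ m * |lam| := mul_le_mul_of_nonneg_left hl1.2 hm
  have hml2 : -(m * |lam|) ≤ m * lam := by nlinarith
  have hb2 : b ^ 2 ≤ 1 := pow_le_one₀ hb.1.le hb.2.le
  have hb3 : 0 ≤ b ^ 2 := sq_nonneg b
  rw [dmat_eq]
  fin_cases i <;> fin_cases j <;> simp
  · rw [abs_le]; constructor <;> nlinarith
  · have := hp ((n + 1) * m + 1)
    rw [abs_of_pos h0, abs_of_pos hb.1]
    nlinarith [this.2]
  · have := hp ((n + 1) * m)
    rw [abs_of_pos h0, abs_of_pos hb.1]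
    nlinarith [this.2]
  · have h5 : |m * lam - m + ((n : ℝ) + 1)⁻¹| ≤ m * (|lam| + 1) + 1 := by
      rw [abs_le]; constructor <;> nlinarith
    calc |b| * |m * lam - m + ((n : ℝ) + 1)⁻¹| ≤ 1 * (m * (|lam| + 1) + 1) := by
          refine mul_le_mul ?_ h5 (abs_nonneg _) zero_le_one
          rw [abs_of_pos hb.1]; exact hb.2.le
      _ = _ := one_mul _

theorem path_eq (a c : ℝ) (n : ℕ) (t : ℝ) :
    path ![a / ((n : ℝ) + 1) ^ 2, c / ((n : ℝ) + 1) ^ 2] ![0, 0] n t =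
      t • fun j => ![a, c] j • δ n := by
  have h : (n : ℝ) + 1 ≠ 0 := by positivity
  funext j
  rw [path, Pi.smul_apply, smul_smul]
  fin_cases j
  · simp; field_simp
  · simp; field_simp

theorem exists_degree {m : ℕ} (hm : 3 ≤ m) (n : ℕ) : ∃ N, (n + 1) * m = N + 3 :=
  ⟨(n + 1) * m - 3, by have : m ≤ (n + 1) * m := Nat.le_mul_of_pos_left m (by omega); omega⟩

theorem _root_.VStates.HasJet.eq_zero {E : Type*} [NormedAddCommGroup E] [NormedSpace ℝ E]
    {f : ℝ → E} {p₀ p₁ p₂ p₃ : E} (h : HasJet f p₀ p₁ p₂ p₃) : f 0 = p₀ := by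
  have h1 := Asymptotics.IsBigO.eq_zero_of_norm_pow (n := 4) (x₀ := (0 : ℝ))
    (f := fun t => f t - (p₀ + t • p₁ + t ^ 2 • p₂ + t ^ 3 • p₃))
  have h2 := Asymptotics.IsBigO.eq_zero_imp h
  have h3 := h2.self_of_nhds (by simp)
  simpa [sub_eq_zero] using h3

theorem _root_.VStates.HasJet.hasDerivAt {E : Type*} [NormedAddCommGroup E] [NormedSpace ℝ E]
    {f : ℝ → E} {p₀ p₁ p₂ p₃ : E} (h : HasJet f p₀ p₁ p₂ p₃) : HasDerivAt f p₁ 0 := by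
  have h1 : HasDerivAt (fun t : ℝ => p₀ + t • p₁ + t ^ 2 • p₂ + t ^ 3 • p₃) p₁ 0 := by
    have := ((((hasDerivAt_id (0 : ℝ)).smul_const p₁).const_add p₀).fun_add
      (((hasDerivAt_pow 2 (0 : ℝ)).smul_const p₂))).fun_add
        ((hasDerivAt_pow 3 (0 : ℝ)).smul_const p₃)
    simpa using this
  have h2 : HasDerivAt (fun t : ℝ => f t - (p₀ + t • p₁ + t ^ 2 • p₂ + t ^ 3 • p₃)) 0 0 := by
    rw [hasDerivAt_iff_isLittleO]
    have h3 : (fun t : ℝ => t ^ 4) =o[𝓝 0] fun t : ℝ => t := by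
      simpa using Asymptotics.isLittleO_pow_pow (𝕜 := ℝ) (m := 1) (n := 4) (by norm_num)
    have h4 := Asymptotics.IsBigO.trans_isLittleO h h3
    have h5 := h.eq_zero
    simpa [h5] using h4
  simpa using h2.fun_add h1

theorem GW_zero {m : ℕ} (hm : 3 ≤ m) {b : ℝ} (hb : b ∈ Ioo (0 : ℝ) 1) (lam : ℝ) :
    GW m b (lam, 0) = 0 := by
  obtain ⟨N, hN⟩ := exists_degree hm 0
  obtain ⟨p, hp, -⟩ := hasJet_GW_zero hN hb lam 0 0 0 0
  obtain ⟨q, hq, -⟩ := hasJet_GW_one hN hb lam 0 0 0 0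
  have e : path ![0, 0] ![0, 0] 0 0 = 0 := by funext j; simp [path]
  have h1 := hp.eq_zero
  have h2 := hq.eq_zero
  rw [e] at h1 h2
  funext j
  fin_cases j
  · exact h1
  · exact h2

/-- The trivial branch `GW (λ, 0) = 0` kills the λ-direction. In the other directions single modes
suffice, and there the derivative is the linear coefficient of the expansion with no second mode.
Since inputs are scaled by k² and outputs by k, the block is M_{km}/k, which stays bounded with
determinant of order one. -/
theorem fderiv_GW {m : ℕ} (hm : 3 ≤ m) {b : ℝ} (hb : b ∈ Ioo (0 : ℝ) 1) (lam : ℝ) :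
    fderiv ℝ (GW m b) (lam, 0) =
      (blockOp (dmat m b lam)).comp (ContinuousLinearMap.snd ℝ ℝ (Fin 2 → Ell1)) := by
  have hd : HasFDerivAt (GW m b) (fderiv ℝ (GW m b) (lam, 0)) (lam, 0) :=
    ((contDiffAt_GW (n := 1) (isUnit_wDen_zero hb)).differentiableAt one_ne_zero).hasFDerivAt
  set D := fderiv ℝ (GW m b) (lam, 0) with hD
  have h1 : D.comp (ContinuousLinearMap.inl ℝ ℝ (Fin 2 → Ell1)) = 0 := by
    have h2 : HasFDerivAt (fun μ : ℝ => GW m b (μ, 0))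
        (D.comp (ContinuousLinearMap.inl ℝ ℝ (Fin 2 → Ell1))) lam :=
      HasFDerivAt.comp (g := GW m b) (f := fun μ : ℝ => (μ, (0 : Fin 2 → Ell1))) lam hd
        (hasFDerivAt_prodMk_left lam (0 : Fin 2 → Ell1))
    have h3 : HasFDerivAt (fun μ : ℝ => GW m b (μ, 0)) (0 : ℝ →L[ℝ] (Fin 2 → Ell1)) lam := by
      simp only [GW_zero hm hb]
      exact hasFDerivAt_const _ _
    exact h2.unique h3
  have h2 : D.comp (ContinuousLinearMap.inr ℝ ℝ (Fin 2 → Ell1)) = blockOp (dmat m b lam) := by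
    refine ext_mode fun a c n => ?_
    obtain ⟨N, hN⟩ := exists_degree hm n
    have hl : HasDerivAt (fun t : ℝ => (lam, t • fun j => ![a, c] j • δ n))
        ((0 : ℝ), fun j => ![a, c] j • δ n) 0 := by
      refine (hasDerivAt_const _ _).prodMk ?_
      simpa using (hasDerivAt_id (0 : ℝ)).smul_const (fun j => ![a, c] j • δ n)
    have h3 : HasDerivAt (fun t : ℝ => GW m b (lam, t • fun j => ![a, c] j • δ n))
        (D (0, fun j => ![a, c] j • δ n)) 0 := by
      have hd' : HasFDerivAt (GW m b) D (lam, (0 : ℝ) • fun j => ![a, c] j • δ n) := by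
        rw [zero_smul]; exact hd
      exact hd'.comp_hasDerivAt 0 hl
    obtain ⟨p, hp, -⟩ := hasJet_GW_zero hN hb lam (a / ((n : ℝ) + 1) ^ 2) (c / ((n : ℝ) + 1) ^ 2) 0 0
    obtain ⟨q, hq, -⟩ := hasJet_GW_one hN hb lam (a / ((n : ℝ) + 1) ^ 2) (c / ((n : ℝ) + 1) ^ 2) 0 0
    have h0 := hp.hasDerivAt
    have h1 := hq.hasDerivAt
    simp only [path_eq] at h0 h1
    rw [ContinuousLinearMap.comp_apply, ContinuousLinearMap.inr_apply]
    rw [hasDerivAt_pi] at h3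
    have hn : (n : ℝ) + 1 ≠ 0 := by positivity
    have hNr : ((n : ℝ) + 1) * m = N + 3 := by exact_mod_cast hN
    have hM : (N : ℝ) = ((n : ℝ) + 1) * m - 3 := by linarith
    have e := fun i => (h3 i)
    funext i
    refine ext_coord fun k => ?_
    rw [coord_blockOp (dmat_bound hb m lam)]
    have hv : (fun j => coord k (![a, c] j • δ n)) = if n = k then ![a, c] else 0 := by
      funext j
      rw [map_smul, coord_δ]
      split_ifs <;> simp
    rw [hv]
    fin_cases i
    · have := (e 0).unique h0
      refine (congrArg (coord k) this).trans ?_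
      rw [map_smul, coord_δ]
      split_ifs with hk
      · subst hk
        rw [dmat_eq]
        simp [Matrix.mulVec, dotProduct, Fin.sum_univ_two]
        rw [hN, hM]
        field_simp
        ring
      · simp
    · have := (e 1).unique h1
      refine (congrArg (coord k) this).trans ?_
      rw [map_smul, coord_δ]
      split_ifs with hk
      · subst hk
        rw [dmat_eq]
        simp [Matrix.mulVec, dotProduct, Fin.sum_univ_two]
        rw [hN, hM]
        field_simp
        ring
      · simp
  refine ContinuousLinearMap.ext fun x => ?_
  have hx : x = (x.1, 0) + (0, x.2) := by simp
  rw [hx, map_add]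
  have e1 := congrArg (fun L => L x.1) h1
  have e2 := congrArg (fun L => L x.2) h2
  simp only [ContinuousLinearMap.comp_apply, ContinuousLinearMap.inl_apply,
    ContinuousLinearMap.inr_apply, ContinuousLinearMap.zero_apply] at e1 e2
  rw [e1, e2]
  simp

end Wiener

/-! ### Lyapunov-Schmidt reduction in `ℓ¹` -/

/-- The normalization constant of `Ŵ_m`. -/
def nuW (m : ℕ) (b lam0 : ℝ) : ℝ := √((m * lam0 - m + 1) ^ 2 + b ^ (2 * m))

theorem WHat_zero (m : ℕ) (b lam0 : ℝ) :
    WHat m b lam0 0 = (nuW m b lam0)⁻¹ * (m * lam0 - m + 1) := rfl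

theorem WHat_one (m : ℕ) (b lam0 : ℝ) : WHat m b lam0 1 = (nuW m b lam0)⁻¹ * -b ^ m := rfl

namespace IsBif

variable {m : ℕ} {b lam0 : ℝ} (h : IsBif m b lam0)

include h

theorem nuW_sq : nuW m b lam0 ^ 2 = (m * lam0 - m + 1) ^ 2 + b ^ (2 * m) :=
  Real.sq_sqrt (add_nonneg (sq_nonneg _) (h.pow_pos _).le)

theorem nuW_pos : 0 < nuW m b lam0 :=
  Real.sqrt_pos.2 (add_pos_of_nonneg_of_pos (sq_nonneg _) (h.pow_pos _))

theorem WHat_norm : WHat m b lam0 0 * WHat m b lam0 0 + WHat m b lam0 1 * WHat m b lam0 1 = 1 := by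
  rw [WHat_zero, WHat_one]
  have h1 := h.nuW_sq
  have h2 := h.nuW_pos.ne'
  rw [pow_mul'] at h1
  field_simp
  linear_combination -h1

/-- `Ŵ_m` spans the cokernel of `M_m`. -/
theorem WHat_M (c : Fin 2) : WHat m b lam0 0 * M b m lam0 0 c + WHat m b lam0 1 * M b m lam0 1 c = 0 := by
  rw [WHat_zero, WHat_one, M]
  have h1 := h.mul_eq
  rw [pow_mul'] at h1
  fin_cases c
  · simp
    linear_combination (nuW m b lam0)⁻¹ * h1
  · simp
    ring

end IsBif

namespace Wiener

open Ell1

variable (m : ℕ) (b lam0 : ℝ)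

/-- The element `𝕎_m` in coordinates. -/
def wvec : Fin 2 → Ell1 := fun j => WHat m b lam0 j • δ 0

/-- The component along `𝕎_m`. -/
def ell : (Fin 2 → Ell1) →L[ℝ] ℝ :=
  ∑ j, WHat m b lam0 j • (coord 0).comp (ContinuousLinearMap.proj j)

theorem ell_apply (z : Fin 2 → Ell1) :
    ell m b lam0 z = WHat m b lam0 0 * coord 0 (z 0) + WHat m b lam0 1 * coord 0 (z 1) := by
  rw [ell, Fin.sum_univ_two]
  simp

/-- The augmented equation. -/
def Psi (v : (ℝ × ℝ) × (Fin 2 → Ell1)) : Fin 2 → Ell1 :=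
  (GW m b (v.1.1, v.2) - ell m b lam0 (GW m b (v.1.1, v.2)) • wvec m b lam0) +
    (coord 0 (v.2 1) - v.1.2) • wvec m b lam0

variable {m b lam0} (h : IsBif m b lam0)

include h

theorem ell_wvec : ell m b lam0 (wvec m b lam0) = 1 := by
  have hw : ∀ j, wvec m b lam0 j = WHat m b lam0 j • δ 0 := fun _ => rfl
  rw [ell_apply, hw, hw, map_smul, map_smul, coord_δ, if_pos rfl]
  simpa using h.WHat_norm

/-- Applying `ell` separates the two conditions: it annihilates the projected part and takes the
value 1 on `wvec`. -/
theorem Psi_eq_zero_iff (v : (ℝ × ℝ) × (Fin 2 → Ell1)) : Psi m b lam0 v = 0 ↔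
    coord 0 (v.2 1) = v.1.2 ∧
      GW m b (v.1.1, v.2) = ell m b lam0 (GW m b (v.1.1, v.2)) • wvec m b lam0 := by
  constructor
  · intro h0
    have h1 := congrArg (ell m b lam0) h0
    rw [Psi, map_add, map_sub, map_smul, map_smul, ell_wvec h, map_zero] at h1
    have h2 : coord 0 (v.2 1) - v.1.2 = 0 := by simpa using h1
    refine ⟨sub_eq_zero.1 h2, ?_⟩
    rw [Psi, h2, zero_smul, add_zero, sub_eq_zero] at h0
    exact h0
  · rintro ⟨h1, h2⟩
    rw [Psi, h1, sub_self, zero_smul, add_zero, sub_eq_zero]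
    exact h2

/-- The component along `𝕎_m` annihilates the range of the linearization. -/
theorem ell_blockOp (x : Fin 2 → Ell1) : ell m b lam0 (blockOp (dmat m b lam0) x) = 0 := by
  have hd := dmat_bound h.mem m lam0
  rw [ell_apply, coord_blockOp hd, coord_blockOp hd]
  have h1 : ∀ i j, dmat m b lam0 0 i j = M b m lam0 i j := fun i j => by
    rw [dmat]; simp
  simp only [Matrix.mulVec, dotProduct, Fin.sum_univ_two, h1]
  linear_combination coord 0 (x 0) * h.WHat_M 0 + coord 0 (x 1) * h.WHat_M 1

omit h in
/-- The blocks of the augmented linearization. -/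
def augMat (m : ℕ) (b lam0 : ℝ) (n : ℕ) : Matrix (Fin 2) (Fin 2) ℝ :=
  if n = 0 then M b m lam0 + !![0, WHat m b lam0 0; 0, WHat m b lam0 1] else dmat m b lam0 n

theorem abs_WHat_le (j : Fin 2) : |WHat m b lam0 j| ≤ 1 := by
  have := h.WHat_norm
  rw [abs_le]
  fin_cases j
  · constructor <;> simp <;>
      nlinarith [mul_self_nonneg (WHat m b lam0 0), mul_self_nonneg (WHat m b lam0 1)]
  · constructor <;> simp <;>
      nlinarith [mul_self_nonneg (WHat m b lam0 0), mul_self_nonneg (WHat m b lam0 1)]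

theorem augMat_bound (n : ℕ) (i j : Fin 2) :
    |augMat m b lam0 n i j| ≤ m * (|lam0| + 1) + 1 + 1 := by
  have hd := dmat_bound h.mem m lam0
  unfold augMat
  split_ifs with hn
  · have h1 : M b m lam0 i j = dmat m b lam0 0 i j := by rw [dmat]; simp
    rw [Matrix.add_apply, h1]
    refine (abs_add_le _ _).trans (add_le_add (hd 0 i j) ?_)
    fin_cases i <;> fin_cases j <;> simp <;> exact abs_WHat_le h _
  · exact (hd n i j).trans (by linarith)

/-- Adding Ŵ to the second column of the singular matrix M_m leaves the determinant of the first
column of M_m against Ŵ, which is ν⁻¹ b^m (p - A), where A and p are the two factors of the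
eigenvalue equation and ν normalizes Ŵ. It is nonzero because A > 0 > p. -/
theorem det_augMat_zero : (augMat m b lam0 0).det ≠ 0 := by
  have e : (augMat m b lam0 0).det = (nuW m b lam0)⁻¹ * b ^ m *
      ((m * lam0 - m + 1) - (m * lam0 - 1 - m * b ^ 2)) := by
    rw [augMat, if_pos rfl, Matrix.det_fin_two]
    simp only [M, WHat_zero, WHat_one, Matrix.add_apply, Matrix.of_apply, Matrix.cons_val',
      Matrix.cons_val_zero, Matrix.cons_val_one, Matrix.cons_val_fin_one]
    have h1 := h.mul_eq
    rw [pow_mul'] at h1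
    linear_combination b * h1
  rw [e]
  have h1 := h.pos
  have h2 := h.neg
  have h3 := inv_pos.2 h.nuW_pos
  have h4 := h.pow_pos m
  have h5 : (m * lam0 - m + 1) - (m * lam0 - 1 - m * b ^ 2) < 0 := by linarith
  exact mul_ne_zero (mul_ne_zero h3.ne' h4.ne') h5.ne

theorem exists_det_augMat : ∃ c > 0, ∀ n, c ≤ |(augMat m b lam0 n).det| := by
  obtain ⟨c, hc, hd⟩ := h.exists_det_bound
  refine ⟨min c |(augMat m b lam0 0).det|, lt_min hc (abs_pos.2 (det_augMat_zero h)), fun n => ?_⟩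
  rcases Nat.eq_zero_or_pos n with rfl | hn
  · exact min_le_right _ _
  · refine (min_le_left _ _).trans ?_
    obtain ⟨k, rfl⟩ : ∃ k, n = k + 1 := ⟨n - 1, by omega⟩
    have h0 : ((k : ℝ) + 2) ≠ 0 := by positivity
    have h1 : (augMat m b lam0 (k + 1)).det = ((((k : ℝ) + 2)) ^ 2)⁻¹ * (M b ((k + 2) * m) lam0).det := by
      rw [augMat, if_neg (by omega), dmat, Matrix.det_smul, Fintype.card_fin, inv_pow]
      push_cast
      congr 3
      ring
    have h2 := hd k
    rw [h1, abs_mul, abs_inv, abs_of_pos (by positivity : (0 : ℝ) < ((k : ℝ) + 2) ^ 2)]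
    rw [le_inv_mul_iff₀ (by positivity), mul_comm]
    exact h2.trans (neg_le_abs _)

theorem isInvertible_aug : (blockOp (augMat m b lam0)).IsInvertible := by
  obtain ⟨c, hc, hd⟩ := exists_det_augMat h
  exact isInvertible_blockOp (augMat_bound h) hc hd

theorem blockOp_aug (x : Fin 2 → Ell1) : blockOp (augMat m b lam0) x =
    blockOp (dmat m b lam0) x + coord 0 (x 1) • wvec m b lam0 := by
  funext i
  refine ext_coord fun n => ?_
  rw [coord_blockOp (augMat_bound h), Pi.add_apply, map_add,
    coord_blockOp (dmat_bound h.mem m lam0), Pi.smul_apply, wvec, map_smul, map_smul, coord_δ]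
  unfold augMat
  by_cases hn : n = 0
  · subst hn
    have h1 : dmat m b lam0 0 = M b m lam0 := by rw [dmat]; simp
    rw [if_pos rfl, if_pos rfl, h1]
    simp only [Matrix.mulVec, dotProduct, Fin.sum_univ_two, Matrix.add_apply]
    fin_cases i <;> simp <;> ring
  · rw [if_neg hn, if_neg (Ne.symm hn)]
    simp

theorem contDiffAt_Psi {n : WithTop ℕ∞} : ContDiffAt ℝ n (Psi m b lam0) ((lam0, 0), 0) := by
  have h1 : ContDiffAt ℝ n (GW m b) (lam0, 0) := contDiffAt_GW (isUnit_wDen_zero h.mem)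
  have h2 : ContDiffAt ℝ n (fun v : (ℝ × ℝ) × (Fin 2 → Ell1) => GW m b (v.1.1, v.2))
      ((lam0, 0), 0) :=
    ContDiffAt.comp (g := GW m b) ((lam0, 0), 0) h1 (by fun_prop)
  unfold Psi
  refine (h2.sub (ContDiffAt.fun_smul ((ell m b lam0).contDiff.contDiffAt.comp _ h2)
    contDiffAt_const)).add (ContDiffAt.fun_smul ?_ contDiffAt_const)
  refine ContDiffAt.sub ?_ (by fun_prop)
  exact (((coord 0).comp ((ContinuousLinearMap.proj (R := ℝ) (φ := fun _ : Fin 2 => Ell1) 1).comp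
    (ContinuousLinearMap.snd ℝ (ℝ × ℝ) (Fin 2 → Ell1))))).contDiff.contDiffAt

/-- The projection term contributes nothing, since `ell` vanishes on the range of the linearization.
What remains is the block operator plus the rank one operator coming from the amplitude condition.
-/
theorem fderiv_Psi : (fderiv ℝ (Psi m b lam0) ((lam0, 0), 0)).comp
    (ContinuousLinearMap.inr ℝ (ℝ × ℝ) (Fin 2 → Ell1)) = blockOp (augMat m b lam0) := by
  have hd : HasFDerivAt (Psi m b lam0) (fderiv ℝ (Psi m b lam0) ((lam0, 0), 0)) ((lam0, 0), 0) :=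
    ((contDiffAt_Psi h (n := 1)).differentiableAt one_ne_zero).hasFDerivAt
  have h1 : HasFDerivAt (fun x => Psi m b lam0 ((lam0, 0), x))
      ((fderiv ℝ (Psi m b lam0) ((lam0, 0), 0)).comp
        (ContinuousLinearMap.inr ℝ (ℝ × ℝ) (Fin 2 → Ell1))) 0 :=
    HasFDerivAt.comp (g := Psi m b lam0) (f := fun x => ((lam0, 0), x)) 0 hd
      (hasFDerivAt_prodMk_right (lam0, (0 : ℝ)) (0 : Fin 2 → Ell1))
  have hG : HasFDerivAt (fun x => GW m b (lam0, x)) (blockOp (dmat m b lam0)) 0 := by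
    have h2 : HasFDerivAt (GW m b) (fderiv ℝ (GW m b) (lam0, 0)) (lam0, 0) :=
      ((contDiffAt_GW (n := 1) (isUnit_wDen_zero h.mem)).differentiableAt one_ne_zero).hasFDerivAt
    have h3 := HasFDerivAt.comp (g := GW m b) (f := fun x => (lam0, x)) 0 h2
      (hasFDerivAt_prodMk_right lam0 (0 : Fin 2 → Ell1))
    rw [fderiv_GW h.three_le h.mem] at h3
    exact h3
  have hc : HasFDerivAt (fun x : Fin 2 → Ell1 => coord 0 (x 1) - (0 : ℝ))
      ((coord 0).comp (ContinuousLinearMap.proj (R := ℝ) (φ := fun _ : Fin 2 => Ell1) 1)) 0 := by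
    simp only [sub_zero]
    exact ((coord 0).comp (ContinuousLinearMap.proj (R := ℝ) (φ := fun _ : Fin 2 => Ell1) 1)).hasFDerivAt
  have h2 := (hG.sub (((ell m b lam0).hasFDerivAt.comp 0 hG).smul_const (wvec m b lam0))).add
    (hc.smul_const (wvec m b lam0))
  refine (h1.unique h2).trans ?_
  refine ContinuousLinearMap.ext fun x => ?_
  rw [blockOp_aug h]
  simp [ell_blockOp h]

/-- Implicit function theorem for the augmented equation, with (λ, t) as parameters and the whole
sequence as unknown. -/
theorem exists_chi : ∃ χ : ℝ × ℝ → (Fin 2 → Ell1), ContDiffAt ℝ ω χ (lam0, 0) ∧ χ (lam0, 0) = 0 ∧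
    ∀ᶠ v in 𝓝 (((lam0, 0), 0) : (ℝ × ℝ) × (Fin 2 → Ell1)), Psi m b lam0 v = 0 ↔ χ v.1 = v.2 := by
  have cdf := contDiffAt_Psi h (n := ω)
  have hi : (fderiv ℝ (Psi m b lam0) ((lam0, 0), 0) ∘L
      ContinuousLinearMap.inr ℝ (ℝ × ℝ) (Fin 2 → Ell1)).IsInvertible := by
    rw [fderiv_Psi h]; exact isInvertible_aug h
  have h0 : Psi m b lam0 ((lam0, 0), 0) = 0 := by
    rw [Psi_eq_zero_iff h, GW_zero h.three_le h.mem]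
    simp
  refine ⟨cdf.implicitFunction (by simp) hi, cdf.contDiffAt_implicitFunction _ hi,
    cdf.implicitFunction_apply_self _ hi, ?_⟩
  have := cdf.eventually_apply_eq_iff_implicitFunction (by simp) hi
  rw [h0] at this
  exact this

end Wiener

/-! ### Mean squares and Fourier coefficients on the circle -/

open Wiener

/-- The integral of `‖h‖²` over the circle. -/
def ms (h : Circle → ℂ) : ℝ := ∫ θ in (-Real.pi)..Real.pi, ‖h (Circle.exp θ)‖ ^ 2

theorem periodic_circle {F : Type*} (g : Circle → F) :
    Function.Periodic (fun θ : ℝ => g (Circle.exp θ)) (2 * Real.pi) := fun θ => by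
  simp only [Circle.exp_add_two_pi]

theorem integral_circle_rotate {F : Type*} [NormedAddCommGroup F] [NormedSpace ℝ F] (g : Circle → F)
    (ζ : Circle) : ∫ θ in (-Real.pi)..Real.pi, g (Circle.exp θ * ζ) =
      ∫ θ in (-Real.pi)..Real.pi, g (Circle.exp θ) := by
  obtain ⟨t, rfl⟩ : ∃ t, Circle.exp t = ζ := ⟨_, Circle.exp_arg ζ⟩
  simp only [← Circle.exp_add]
  rw [intervalIntegral.integral_comp_add_right (fun θ => g (Circle.exp θ))]
  have h := (periodic_circle g).intervalIntegral_add_eq (-Real.pi + t) (-Real.pi)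
  have e1 : -Real.pi + t + 2 * Real.pi = Real.pi + t := by ring
  have e2 : -Real.pi + 2 * Real.pi = Real.pi := by ring
  rwa [e1, e2] at h

theorem integral_circle_zero_two_pi {F : Type*} [NormedAddCommGroup F] [NormedSpace ℝ F]
    (g : Circle → F) : ∫ θ in (0 : ℝ)..2 * Real.pi, g (Circle.exp θ) =
      ∫ θ in (-Real.pi)..Real.pi, g (Circle.exp θ) := by
  have h := (periodic_circle g).intervalIntegral_add_eq 0 (-Real.pi)
  have e2 : -Real.pi + 2 * Real.pi = Real.pi := by ring
  rwa [zero_add, e2] at h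

theorem ms_rotate (h : Circle → ℂ) (ζ : Circle) : ms (fun w => h (w * ζ)) = ms h :=
  integral_circle_rotate (fun w => ‖h w‖ ^ 2) ζ

theorem ms_nonneg (h : Circle → ℂ) : 0 ≤ ms h :=
  intervalIntegral.integral_nonneg (by linarith [Real.pi_pos]) fun _ _ => by positivity

theorem neg_pi_lt_pi : -Real.pi < Real.pi := by linarith [Real.pi_pos]

theorem integral_swap_of_continuous {F : ℝ → ℝ → ℝ} (hF : Continuous (Function.uncurry F)) {a b c d : ℝ} :
    ∫ x in a..b, ∫ y in c..d, F x y = ∫ y in c..d, ∫ x in a..b, F x y := by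
  refine intervalIntegral_intervalIntegral_swap ?_
  exact (hF.continuousOn.integrableOn_compact
    (isCompact_uIcc.prod isCompact_uIcc)).mono_set (prod_mono uIoc_subset_uIcc uIoc_subset_uIcc)

/-- The Fourier coefficients. -/
def fc (g : Circle → ℂ) (k : ℤ) : ℂ :=
  (2 * Real.pi : ℂ)⁻¹ * ∫ θ in (-Real.pi)..Real.pi, g (Circle.exp θ) * (Circle.exp θ : ℂ) ^ (-k)

theorem hasSum_sq_fc {g : Circle → ℂ} (hg : Continuous g) :
    HasSum (fun k => ‖fc g k‖ ^ 2) ((2 * Real.pi)⁻¹ * ms g) := by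
  have hc : Continuous fun θ : ℝ => g (Circle.exp θ) := hg.comp Circle.exp.continuous
  obtain ⟨C, hC⟩ := isCompact_univ.exists_bound_of_continuousOn hg.continuousOn
  have h := hasSum_sq_fourierCoeffOn (f := fun θ : ℝ => g (Circle.exp θ)) neg_pi_lt_pi
    (MemLp.of_bound hc.aestronglyMeasurable C (Eventually.of_forall fun θ => hC _ (mem_univ _)))
  have e : Real.pi - -Real.pi = 2 * Real.pi := by ring
  have key : ∀ k, fourierCoeffOn neg_pi_lt_pi (fun θ : ℝ => g (Circle.exp θ)) k = fc g k := fun k => by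
    rw [fourierCoeffOn_eq_integral, fc, Complex.real_smul]
    congr 1
    · rw [e]; simp
    · refine intervalIntegral.integral_congr fun θ _ => ?_
      simp only [smul_eq_mul]
      rw [mul_comm, fourier_coe_apply, Circle.coe_exp, ← Complex.exp_int_mul, e]
      congr 2
      have := Complex.ofReal_ne_zero.2 Real.pi_ne_zero
      push_cast
      field_simp
  simp only [key] at h
  rw [e, smul_eq_mul] at h
  exact h

theorem continuous_coe_zpow (k : ℤ) : Continuous fun θ : ℝ => (Circle.exp θ : ℂ) ^ k := by
  simp only [← Circle.coe_zpow]
  exact (show Continuous fun z : Circle => (z : ℂ) by fun_prop).comp (Circle.exp.continuous.zpow k)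

theorem eCoeff_eq_fc {R : Circle → ℝ} (hR : Continuous R) (n : ℕ) :
    eCoeff n R = 2 * (fc (fun w => (R w : ℂ)) n).im := by
  have hi : IntervalIntegrable (fun θ : ℝ => (R (Circle.exp θ) : ℂ) * (Circle.exp θ : ℂ) ^ (-(n : ℤ)))
      volume (-Real.pi) Real.pi := by
    refine Continuous.intervalIntegrable ?_ _ _
    refine (Complex.continuous_ofReal.comp (hR.comp Circle.exp.continuous)).mul ?_
    exact continuous_coe_zpow _
  have h1 := Complex.imCLM.intervalIntegral_comp_comm hi
  rw [eCoeff, integral_circle_zero_two_pi (fun w => R w * eFun n w), fc]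
  have e : (2 * Real.pi : ℂ)⁻¹ = ((2 * Real.pi)⁻¹ : ℝ) := by push_cast; rfl
  rw [e, Complex.im_ofReal_mul]
  rw [← Complex.imCLM_apply]
  rw [← h1]
  have h2 : ∀ θ : ℝ, Complex.imCLM ((R (Circle.exp θ) : ℂ) * (Circle.exp θ : ℂ) ^ (-(n : ℤ))) =
      R (Circle.exp θ) * eFun n (Circle.exp θ) := fun θ => by
    rw [Complex.imCLM_apply, Complex.im_ofReal_mul, eFun, coe_zpow_neg']
  simp only [h2]
  have := Real.pi_ne_zero
  field_simp

/-- Bessel's inequality. -/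
theorem sum_sq_eCoeff_le {R : Circle → ℝ} (hR : Continuous R) (s : Finset ℕ) :
    ∑ n ∈ s, eCoeff n R ^ 2 ≤ ms fun w => (R w : ℂ) := by
  have h := hasSum_sq_fc (Complex.continuous_ofReal.comp hR)
  have h1 : ∑ n ∈ s, ‖fc (fun w => (R w : ℂ)) n‖ ^ 2 ≤
      (2 * Real.pi)⁻¹ * ms (fun w => (R w : ℂ)) := by
    have := sum_le_hasSum (s.map Nat.castEmbedding) (fun _ _ => by positivity) h
    rwa [Finset.sum_map] at this
  have h2 : ∀ n ∈ s, eCoeff n R ^ 2 ≤ 4 * ‖fc (fun w => (R w : ℂ)) n‖ ^ 2 := fun n _ => by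
    rw [eCoeff_eq_fc hR]
    have h3 := Complex.abs_im_le_norm (fc (fun w => (R w : ℂ)) n)
    have h4 := sq_le_sq' (by linarith [abs_nonneg (fc (fun w => (R w : ℂ)) n).im, neg_abs_le (fc (fun w => (R w : ℂ)) n).im]) ((le_abs_self _).trans h3)
    linarith
  refine (Finset.sum_le_sum h2).trans ?_
  rw [← Finset.mul_sum]
  have h5 : (2 * Real.pi)⁻¹ * ms (fun w => (R w : ℂ)) ≤ 4⁻¹ * ms (fun w => (R w : ℂ)) := by
    refine mul_le_mul_of_nonneg_right ?_ (ms_nonneg _)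
    exact inv_anti₀ (by norm_num) (by linarith [Real.pi_gt_three])
  linarith

/-- Integration by parts over a period. The index shifts by one because the derivative is taken in w
and not in the angle. -/
theorem fc_circleDeriv {h : Circle → ℂ} (hd : CircleDifferentiable h) (hc : Continuous h)
    (hc' : Continuous (circleDeriv h)) (k : ℤ) : fc (circleDeriv h) (k - 1) = k * fc h k := by
  have h1 : ∀ θ ∈ uIcc (-Real.pi) Real.pi, HasDerivAt
      (fun θ : ℝ => h (Circle.exp θ) * (Circle.exp θ : ℂ) ^ (-k))
      (Complex.I * (circleDeriv h (Circle.exp θ) * (Circle.exp θ : ℂ) ^ (-(k - 1)) -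
        k * (h (Circle.exp θ) * (Circle.exp θ : ℂ) ^ (-k)))) θ := fun θ _ => by
    have h2 := hasDerivAt_circle hd 1 θ
    simp only [one_mul, Circle.coe_one] at h2
    have h3 : HasDerivAt (fun θ : ℝ => (Circle.exp θ : ℂ) ^ (-k))
        ((Circle.exp θ : ℂ) ^ (-k) * (-k * Complex.I)) θ := by
      have e : (fun θ : ℝ => (Circle.exp θ : ℂ) ^ (-k)) =
          fun θ : ℝ => Complex.exp ((θ : ℂ) * (-k * Complex.I)) := by
        funext θ
        rw [Circle.coe_exp, ← Complex.exp_int_mul]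
        congr 1
        push_cast
        ring
      rw [e, congrFun e θ]
      simpa using ((Complex.ofRealCLM.hasDerivAt (x := θ)).mul_const (-k * Complex.I)).cexp
    refine (h2.mul h3).congr_deriv ?_
    rw [show -(k - 1) = -k + 1 by ring, zpow_add₀ (Circle.coe_ne_zero _), zpow_one]
    ring
  have i1 : IntervalIntegrable (fun θ : ℝ => circleDeriv h (Circle.exp θ) *
      (Circle.exp θ : ℂ) ^ (-(k - 1))) volume (-Real.pi) Real.pi :=
    ((hc'.comp Circle.exp.continuous).mul (continuous_coe_zpow _)).intervalIntegrable _ _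
  have i2 : IntervalIntegrable (fun θ : ℝ => h (Circle.exp θ) *
      (Circle.exp θ : ℂ) ^ (-k)) volume (-Real.pi) Real.pi :=
    ((hc.comp Circle.exp.continuous).mul (continuous_coe_zpow _)).intervalIntegrable _ _
  have h2 := intervalIntegral.integral_eq_sub_of_hasDerivAt h1
    ((i1.sub (i2.const_mul _)).const_mul _)
  have e : Circle.exp (-Real.pi) = Circle.exp Real.pi := by
    rw [show Real.pi = -Real.pi + 2 * Real.pi by ring, Circle.exp_add_two_pi]
    congr 1
    ring
  rw [e, sub_self, intervalIntegral.integral_const_mul, intervalIntegral.integral_sub i1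
    (i2.const_mul _), intervalIntegral.integral_const_mul] at h2
  have h3 := (mul_eq_zero.1 h2).resolve_left Complex.I_ne_zero
  rw [fc, fc, sub_eq_zero.1 h3]
  ring

section Series

variable {m : ℕ} {a : ℕ → ℝ} {f : Circle → ℂ}

/-- At w = 1 all powers of w̄ equal 1, and unconditional convergence of the numerical series is
absolute convergence. -/
theorem IsSeries.summable_abs (h : IsSeries m a f) : Summable fun n => |a n| := by
  have h1 := (h 1).summable.norm
  simpa using h1

theorem IsSeries.fc_eq (h : IsSeries m a f) (k : ℤ) :
    HasSum (fun n => if k = -(((n + 1) * m - 1 : ℕ) : ℤ) then (a n : ℂ) else 0) (fc f k) := by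
  let F : ℕ → C(ℝ, ℂ) := fun n =>
    ⟨fun θ => (a n : ℂ) * conj (Circle.exp θ : ℂ) ^ ((n + 1) * m - 1) * (Circle.exp θ : ℂ) ^ (-k), by
      have := continuous_coe_zpow (-k)
      fun_prop⟩
  have hs : Summable fun n => ‖(F n).restrict
      (⟨uIcc (-Real.pi) Real.pi, isCompact_uIcc⟩ : TopologicalSpace.Compacts ℝ)‖ := by
    refine Summable.of_nonneg_of_le (fun _ => norm_nonneg _) (fun n => ?_) h.summable_abs
    refine (ContinuousMap.norm_le _ (abs_nonneg _)).2 fun θ => le_of_eq ?_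
    simp [F]
  have h1 := (intervalIntegral.hasSum_intervalIntegral_of_summable_norm hs).mul_left (2 * Real.pi : ℂ)⁻¹
  have e : ∀ θ : ℝ, ∑' n, F n θ = f (Circle.exp θ) * (Circle.exp θ : ℂ) ^ (-k) := fun θ =>
    ((h (Circle.exp θ)).mul_right _).tsum_eq
  simp only [e] at h1
  refine hasSum_of_eq h1 fun n => ?_
  have e2 : ∀ θ : ℝ, F n θ = (a n : ℂ) * (Circle.exp θ : ℂ) ^ (-(((n + 1) * m - 1 : ℕ) : ℤ) - k) :=
    fun θ => by
      rw [zpow_sub₀ (Circle.coe_ne_zero _), coe_zpow_neg', div_eq_mul_inv, ← zpow_neg]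
      simp only [F, ContinuousMap.coe_mk]
      ring
  simp only [e2]
  rw [intervalIntegral.integral_const_mul, integral_exp_zpow]
  have hp := Complex.ofReal_ne_zero.2 Real.pi_ne_zero
  by_cases hk : k = -(((n + 1) * m - 1 : ℕ) : ℤ)
  · rw [if_pos hk, if_pos (by omega)]
    field_simp
  · rw [if_neg hk, if_neg (by omega), mul_zero, mul_zero]

theorem exponent_injective (hm : 1 ≤ m) :
    Function.Injective fun n : ℕ => -(((n + 1) * m - 1 : ℕ) : ℤ) := fun n n' h => by
  have h1 := exponent_succ hm n
  have h2 := exponent_succ hm n'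
  have h3 : (n + 1) * m = (n' + 1) * m := by
    simp only [neg_inj, Nat.cast_inj] at h
    omega
  exact Nat.succ_injective (Nat.eq_of_mul_eq_mul_right hm h3)

theorem IsSeries.fc_exponent (hm : 1 ≤ m) (h : IsSeries m a f) (n : ℕ) :
    fc f (-(((n + 1) * m - 1 : ℕ) : ℤ)) = a n := by
  refine (h.fc_eq _).unique ?_
  have h1 : ∀ n', (-(((n + 1) * m - 1 : ℕ) : ℤ) = -(((n' + 1) * m - 1 : ℕ) : ℤ)) ↔ n' = n :=
    fun n' => ⟨fun e => (exponent_injective hm e).symm, fun e => by rw [e]⟩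
  simp only [h1]
  have := hasSum_ite_eq n (a n : ℂ)
  refine hasSum_of_eq this fun n' => ?_
  split_ifs with e
  · rw [e]
  · rfl

theorem IsSeries.fc_of_notMem (h : IsSeries m a f) {k : ℤ}
    (hk : k ∉ range fun n : ℕ => -(((n + 1) * m - 1 : ℕ) : ℤ)) : fc f k = 0 := by
  refine (h.fc_eq k).unique ?_
  have h1 : ∀ n : ℕ, k ≠ -(((n + 1) * m - 1 : ℕ) : ℤ) := fun n e => hk ⟨n, e.symm⟩
  simp only [h1, if_false]
  exact hasSum_zero

theorem IsSeries.hasSum_ms (hm : 1 ≤ m) (h : IsSeries m a f) (hf : Continuous f) :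
    HasSum (fun n => a n ^ 2) ((2 * Real.pi)⁻¹ * ms f) := by
  have h1 := (exponent_injective hm).hasSum_iff (f := fun k => ‖fc f k‖ ^ 2)
    (a := (2 * Real.pi)⁻¹ * ms f) fun k hk => by
      rw [h.fc_of_notMem hk]; simp
  have h2 := h1.2 (hasSum_sq_fc hf)
  convert h2 using 2 with n
  simp only [Function.comp_apply]
  rw [h.fc_exponent hm]
  simp

theorem IsSeries.hasSum_ms_deriv (hm : 1 ≤ m) (h : IsSeries m a f) (hf : Continuous f)
    (hd : CircleDifferentiable f) (hc' : Continuous (circleDeriv f)) :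
    HasSum (fun n => ((((n + 1) * m - 1 : ℕ) : ℝ) * a n) ^ 2) ((2 * Real.pi)⁻¹ * ms (circleDeriv f)) := by
  have hi : Function.Injective fun n : ℕ => -(((n + 1) * m - 1 : ℕ) : ℤ) - 1 := fun n n' e =>
    exponent_injective hm (sub_left_injective e)
  have h1 := hi.hasSum_iff (f := fun k => ‖fc (circleDeriv f) k‖ ^ 2)
    (a := (2 * Real.pi)⁻¹ * ms (circleDeriv f)) fun k hk => by
      have : fc (circleDeriv f) (k + 1 - 1) = 0 := by
        rw [fc_circleDeriv hd hf hc', h.fc_of_notMem, mul_zero]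
        rintro ⟨n, hn⟩
        exact hk ⟨n, by simp only at hn ⊢; omega⟩
      rw [add_sub_cancel_right] at this
      rw [this]; simp
  have h2 := h1.2 (hasSum_sq_fc hc')
  convert h2 using 2 with n
  simp only [Function.comp_apply]
  rw [fc_circleDeriv hd hf hc', h.fc_exponent hm, norm_mul, mul_pow, mul_pow]
  simp

end Series

/-! ### Uniform strict differentiability of the integrand -/

/-- At each point of K, strict differentiability and continuity of the derivative give the estimate
on a neighbourhood, parameter included. Compactness of K makes the neighbourhood of (l₀, y₀, y₀)
uniform. -/
theorem uniform_strict_deriv {P L Y Z : Type*} [NormedAddCommGroup P] [NormedSpace ℝ P]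
    [NormedAddCommGroup L] [NormedSpace ℝ L] [NormedAddCommGroup Y] [NormedSpace ℝ Y]
    [NormedAddCommGroup Z] [NormedSpace ℝ Z] {F : P × L × Y → Z} {K : Set P} (hK : IsCompact K)
    {l₀ : L} {y₀ : Y} (hF : ∀ p ∈ K, ContDiffAt ℝ 1 F (p, l₀, y₀)) {ε : ℝ} (hε : 0 < ε) :
    ∀ᶠ x : L × Y × Y in 𝓝 (l₀, y₀, y₀), ∀ p ∈ K,
      ‖F (p, x.1, x.2.1) - F (p, x.1, x.2.2) -
        fderiv ℝ F (p, l₀, y₀) (0, 0, x.2.1 - x.2.2)‖ ≤ ε * ‖x.2.1 - x.2.2‖ := by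
  refine hK.eventually_forall_of_forall_eventually fun p₀ hp₀ => ?_
  have h1 := ((hF p₀ hp₀).hasStrictFDerivAt one_ne_zero).isLittleO.def (half_pos hε)
  have c1 : Tendsto (fun z : (L × Y × Y) × P => (((z.2, z.1.1, z.1.2.1) : P × L × Y),
      ((z.2, z.1.1, z.1.2.2) : P × L × Y))) (𝓝 ((l₀, y₀, y₀), p₀))
      (𝓝 ((p₀, l₀, y₀), (p₀, l₀, y₀))) :=
    Continuous.tendsto' (by fun_prop) _ _ rfl
  have h2 : ∀ᶠ z : (L × Y × Y) × P in 𝓝 ((l₀, y₀, y₀), p₀),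
      ‖fderiv ℝ F (z.2, l₀, y₀) - fderiv ℝ F (p₀, l₀, y₀)‖ ≤ ε / 2 := by
    have h3 : ContinuousAt (fderiv ℝ F) (p₀, l₀, y₀) :=
      ((hF p₀ hp₀).fderiv_right (m := 0) (by simp)).continuousAt
    have c2 : Tendsto (fun z : (L × Y × Y) × P => ((z.2, l₀, y₀) : P × L × Y))
        (𝓝 ((l₀, y₀, y₀), p₀)) (𝓝 (p₀, l₀, y₀)) := Continuous.tendsto' (by fun_prop) _ _ rfl
    have h4 := (h3.tendsto.comp c2).eventually (Metric.ball_mem_nhds _ (half_pos hε))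
    filter_upwards [h4] with z hz
    rw [← dist_eq_norm]
    exact (show dist _ _ < _ from hz).le
  filter_upwards [c1.eventually h1, h2] with z hz1 hz2
  have e : ((z.2, z.1.1, z.1.2.1) : P × L × Y) - (z.2, z.1.1, z.1.2.2) =
      (0, 0, z.1.2.1 - z.1.2.2) := by simp
  have n1 : ‖((0, 0, z.1.2.1 - z.1.2.2) : P × L × Y)‖ = ‖z.1.2.1 - z.1.2.2‖ := by
    simp [Prod.norm_def]
  simp only [e, n1] at hz1
  have h5 := (fderiv ℝ F (z.2, l₀, y₀) - fderiv ℝ F (p₀, l₀, y₀)).le_of_opNorm_le hz2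
    (0, 0, z.1.2.1 - z.1.2.2)
  rw [n1, ContinuousLinearMap.sub_apply] at h5
  have h6 := norm_sub_le (F (z.2, z.1.1, z.1.2.1) - F (z.2, z.1.1, z.1.2.2) -
    fderiv ℝ F (p₀, l₀, y₀) (0, 0, z.1.2.1 - z.1.2.2))
    (fderiv ℝ F (z.2, l₀, y₀) (0, 0, z.1.2.1 - z.1.2.2) -
      fderiv ℝ F (p₀, l₀, y₀) (0, 0, z.1.2.1 - z.1.2.2))
  rw [sub_sub_sub_cancel_right] at h6
  linarith

theorem uniform_continuousAt {P L Z : Type*} [NormedAddCommGroup P] [NormedSpace ℝ P]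
    [NormedAddCommGroup L] [NormedSpace ℝ L] [NormedAddCommGroup Z] [NormedSpace ℝ Z] {F : P × L → Z}
    {K : Set P} (hK : IsCompact K) {l₀ : L} (hF : ∀ p ∈ K, ContDiffAt ℝ 1 F (p, l₀)) :
    ∀ᶠ x in 𝓝 l₀, ∀ p ∈ K, ContinuousAt F (p, x) := by
  refine hK.eventually_forall_of_forall_eventually fun p₀ hp₀ => ?_
  have h1 := (hF p₀ hp₀).eventually (by simp)
  have c1 : Tendsto (fun z : L × P => (z.2, z.1)) (𝓝 (l₀, p₀)) (𝓝 (p₀, l₀)) :=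
    Continuous.tendsto' (by fun_prop) _ _ rfl
  exact (c1.eventually h1).mono fun z hz => hz.continuousAt

/-- The values on which the integrand of `G` depends: for each boundary component, the values of
`f` at `w` and `ξ`, those of `f'`, and the divided difference. -/
abbrev Dat : Type := Fin 2 → Fin 5 → ℂ

/-- The kernel of the Cauchy term as a function of the points and values. -/
def kerD (b : ℝ) (j i : Fin 2) (z : (ℂ × ℂ) × ℝ × Dat) : ℂ :=
  if j = i then -conj z.1.1 * (conj (radius b j + z.2.2 j 4) * (radius b j + z.2.2 j 4)⁻¹) *
    (radius b j + z.2.2 j 3)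
  else conj (radius b j * z.1.1 + z.2.2 j 0 - (radius b i * z.1.2 + z.2.2 i 1)) *
    (radius b j * z.1.1 + z.2.2 j 0 - (radius b i * z.1.2 + z.2.2 i 1))⁻¹ *
    (radius b i + z.2.2 i 3) * z.1.2

/-- The integrand of `G` as a function of the points and values. -/
def gam (b : ℝ) (j : Fin 2) (z : (ℂ × ℂ) × ℝ × Dat) : ℂ :=
  ((1 - (z.2.1 : ℂ)) * conj (radius b j * z.1.1 + z.2.2 j 0) + (kerD b j 0 z - kerD b j 1 z)) *
    z.1.1 * (radius b j + z.2.2 j 2)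

/-- The torus. -/
def torus : Set (ℂ × ℂ) := Metric.sphere 0 1 ×ˢ Metric.sphere 0 1

theorem isCompact_torus : IsCompact torus := (isCompact_sphere _ _).prod (isCompact_sphere _ _)

theorem mem_torus (w ξ : Circle) : ((w : ℂ), (ξ : ℂ)) ∈ torus := by
  simp [torus, Circle.norm_coe]

theorem radius_ne_zero {b : ℝ} (hb : b ∈ Ioo (0 : ℝ) 1) (j : Fin 2) : (radius b j : ℂ) ≠ 0 := by
  have := hb.1.ne'
  fin_cases j <;> simp [radius, this]

/-- At zero data the denominators are the radius b_j on one boundary and b_j w - b_i ξ between two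
boundaries. The latter cannot vanish, because its two terms have different moduli. -/
theorem contDiffAt_kerD {b : ℝ} (hb : b ∈ Ioo (0 : ℝ) 1) (j i : Fin 2) {q : ℂ × ℂ} (hq : q ∈ torus)
    (lam : ℝ) : ContDiffAt ℝ 1 (kerD b j i) (q, lam, 0) := by
  have hc : ∀ {f : (ℂ × ℂ) × ℝ × Dat → ℂ} {z}, ContDiffAt ℝ 1 f z →
      ContDiffAt ℝ 1 (fun z => conj (f z)) z := fun h =>
    Complex.conjCLE.contDiff.contDiffAt.comp _ h
  unfold kerD
  split_ifs with hji
  · have h4 : ContDiffAt ℝ 1 (fun z : (ℂ × ℂ) × ℝ × Dat => (radius b j : ℂ) + z.2.2 j 4)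
      (q, lam, 0) := by fun_prop
    have h3 : ContDiffAt ℝ 1 (fun z : (ℂ × ℂ) × ℝ × Dat => (radius b j : ℂ) + z.2.2 j 3)
      (q, lam, 0) := by fun_prop
    refine ((hc (by fun_prop)).neg.mul ((hc h4).mul (h4.inv ?_))).mul h3
    simpa using radius_ne_zero hb j
  · have h4 : ContDiffAt ℝ 1 (fun z : (ℂ × ℂ) × ℝ × Dat =>
      (radius b j : ℂ) * z.1.1 + z.2.2 j 0 - ((radius b i : ℂ) * z.1.2 + z.2.2 i 1)) (q, lam, 0) := by
      fun_prop
    have h3 : ContDiffAt ℝ 1 (fun z : (ℂ × ℂ) × ℝ × Dat => (radius b i : ℂ) + z.2.2 i 3)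
      (q, lam, 0) := by fun_prop
    refine (((hc h4).mul (h4.inv ?_)).mul h3).mul (by fun_prop)
    simp only [Pi.zero_apply, add_zero]
    intro h0
    have h5 := congrArg norm (sub_eq_zero.1 h0)
    rw [norm_mul, norm_mul, mem_sphere_zero_iff_norm.1 hq.1, mem_sphere_zero_iff_norm.1 hq.2,
      mul_one, mul_one, Complex.norm_real, Complex.norm_real] at h5
    have := hb.1
    have := hb.2
    fin_cases j <;> fin_cases i <;> simp [radius, abs_of_pos hb.1] at h5 hji <;> linarith

theorem contDiffAt_gam {b : ℝ} (hb : b ∈ Ioo (0 : ℝ) 1) (j : Fin 2) {q : ℂ × ℂ} (hq : q ∈ torus)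
    (lam : ℝ) : ContDiffAt ℝ 1 (gam b j) (q, lam, 0) := by
  unfold gam
  have h0 := contDiffAt_kerD hb j 0 hq lam
  have h1 := contDiffAt_kerD hb j 1 hq lam
  have h2 : ContDiffAt ℝ 1 (fun z : (ℂ × ℂ) × ℝ × Dat => (z.2.1 : ℂ)) (q, lam, 0) :=
    Complex.ofRealCLM.contDiff.contDiffAt.comp _ (by fun_prop)
  have h3 : ContDiffAt ℝ 1 (fun z : (ℂ × ℂ) × ℝ × Dat =>
      conj ((radius b j : ℂ) * z.1.1 + z.2.2 j 0)) (q, lam, 0) :=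
    Complex.conjCLE.contDiff.contDiffAt.comp _ (by fun_prop)
  exact ((((contDiffAt_const.sub h2).mul h3).add (h0.sub h1)).mul (by fun_prop)).mul (by fun_prop)

/-! ### Divided differences along the circle -/

/-- The projection of the line to `[-π, π]`. -/
def clampPi (s : ℝ) : ℝ := max (-Real.pi) (min Real.pi s)

theorem clampPi_mem (s : ℝ) : clampPi s ∈ Icc (-Real.pi) Real.pi :=
  ⟨le_max_left _ _, max_le neg_pi_lt_pi.le (min_le_left _ _)⟩

theorem clampPi_eq {s : ℝ} (hs : s ∈ Icc (-Real.pi) Real.pi) : clampPi s = s := by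
  rw [clampPi, min_eq_right hs.2, max_eq_right hs.1]

theorem continuous_clampPi : Continuous clampPi := by unfold clampPi; fun_prop

/-- The mean of `g(w e^{ius}) e^{ius}` over `u ∈ [0, 1]`. -/
def segMean (g : C(Circle, ℂ)) (w : Circle) (s : ℝ) : ℂ :=
  ∫ u in (0 : ℝ)..1, g (w * Circle.exp (u * s)) * (Circle.exp (u * s) : ℂ)

theorem continuous_segMean (g : C(Circle, ℂ)) :
    Continuous fun p : Circle × ℝ => segMean g p.1 p.2 := by
  unfold segMean
  refine intervalIntegral.continuous_parametric_intervalIntegral_of_continuous' ?_ _ _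
  unfold Function.uncurry
  fun_prop

theorem segMean_sub (g g' : C(Circle, ℂ)) (w : Circle) (s : ℝ) :
    segMean (g - g') w s = segMean g w s - segMean g' w s := by
  unfold segMean
  rw [← intervalIntegral.integral_sub (Continuous.intervalIntegrable (by fun_prop) _ _)
    (Continuous.intervalIntegrable (by fun_prop) _ _)]
  simp only [ContinuousMap.sub_apply, sub_mul]

theorem segMean_smul (c : ℝ) (g : C(Circle, ℂ)) (w : Circle) (s : ℝ) :
    segMean (c • g) w s = c * segMean g w s := by
  unfold segMean
  rw [← intervalIntegral.integral_const_mul]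
  simp only [ContinuousMap.smul_apply, Complex.real_smul, mul_assoc]

theorem norm_segMean_le (g : C(Circle, ℂ)) (w : Circle) (s : ℝ) : ‖segMean g w s‖ ≤ ‖g‖ := by
  have h := intervalIntegral.norm_integral_le_of_norm_le_const (a := (0 : ℝ)) (b := 1) (C := ‖g‖)
    (f := fun u => g (w * Circle.exp (u * s)) * (Circle.exp (u * s) : ℂ)) fun u _ => by
      rw [norm_mul, Circle.norm_coe, mul_one]; exact g.norm_coe_le_norm _
  rwa [sub_zero, abs_one, mul_one] at h

/-- Fundamental theorem of calculus along the arc u ↦ w e^{ius}, with the factor s extracted, so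
that the right-hand mean stays continuous at s = 0. -/
theorem sub_eq_segMean {f : Circle → ℂ} (hf : CircleDifferentiable f) {g : C(Circle, ℂ)}
    (hg : circleDeriv f = g) (w : Circle) (s : ℝ) :
    f (w * Circle.exp s) - f w = Complex.I * s * w * segMean g w s := by
  have h1 : ∀ u ∈ uIcc (0 : ℝ) 1, HasDerivAt (fun u : ℝ => f (w * Circle.exp (u * s)))
      (Complex.I * s * w * (g (w * Circle.exp (u * s)) * (Circle.exp (u * s) : ℂ))) u := fun u _ => by
    have h2 := (hasDerivAt_circle hf w (u * s)).scomp u ((hasDerivAt_id u).mul_const s)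
    refine h2.congr_deriv ?_
    rw [hg, Complex.real_smul]
    push_cast
    ring
  have h2 := intervalIntegral.integral_eq_sub_of_hasDerivAt h1
    (Continuous.intervalIntegrable (by fun_prop) _ _)
  rw [intervalIntegral.integral_const_mul] at h2
  rw [segMean, h2]
  simp

/-- The mean of `e^{ius}` over `u ∈ [0, 1]`. -/
def segExp (s : ℝ) : ℂ := segMean 1 1 s

theorem continuous_segExp : Continuous segExp := by
  have h := (continuous_segMean 1).comp (Continuous.prodMk_right (1 : Circle) (Y := ℝ))
  have e : segExp = (fun p : Circle × ℝ => segMean 1 p.1 p.2) ∘ fun s => (1, s) := rfl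
  rw [e]
  exact h

theorem exp_sub_one_eq (s : ℝ) : (Circle.exp s : ℂ) - 1 = Complex.I * s * segExp s := by
  have hd : ∀ w : Circle, HasDerivAt (fun θ : ℝ => ((Circle.exp θ * w : Circle) : ℂ))
      (1 * (Complex.I * w)) 0 := fun w => by simpa using hasDerivAt_circle_id w 1
  have h := sub_eq_segMean (f := fun w : Circle => (w : ℂ)) (g := 1)
    (fun w => (hd w).differentiableAt) (funext fun w => circleDeriv_eq (hd w)) 1 s
  simpa [segExp] using h

theorem exp_ne_one {s : ℝ} (hs : s ∈ Icc (-Real.pi) Real.pi) (h0 : s ≠ 0) : Circle.exp s ≠ 1 := by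
  rw [Ne, Circle.exp_eq_one]
  rintro ⟨k, hk⟩
  have hp := Real.pi_pos
  have h1 : |(k : ℝ)| < 1 := by
    have : |s| ≤ Real.pi := abs_le.2 hs
    rw [hk, abs_mul, abs_of_pos (by positivity : 0 < 2 * Real.pi)] at this
    nlinarith [abs_nonneg (k : ℝ)]
  have h2 : k = 0 := by
    rw [← Int.cast_abs] at h1
    have : |k| < 1 := by exact_mod_cast h1
    exact Int.abs_lt_one_iff.1 this
  subst h2
  simp at hk
  exact h0 hk

/-- The product is·`segExp s` equals e^{is} - 1, which vanishes on [-π, π] only at s = 0, where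
`segExp` is 1. Outside this interval zeros occur, whence the clamping of the angle. -/
theorem segExp_ne_zero {s : ℝ} (hs : s ∈ Icc (-Real.pi) Real.pi) : segExp s ≠ 0 := by
  by_cases h0 : s = 0
  · subst h0; simp [segExp, segMean]
  · intro h
    have h1 := exp_sub_one_eq s
    rw [h, mul_zero, sub_eq_zero] at h1
    exact exp_ne_one hs h0 (Circle.ext (by simpa using h1))

theorem exists_segExp_bound : ∃ c > 0, ∀ s, c ≤ ‖segExp (clampPi s)‖ := by
  obtain ⟨s₀, hs₀, h⟩ := isCompact_Icc.exists_isMinOn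
    (s := Icc (-Real.pi) Real.pi) ⟨0, by simp [Real.pi_pos.le]⟩
    (f := fun s => ‖segExp s‖) continuous_segExp.norm.continuousOn
  exact ⟨‖segExp s₀‖, norm_pos_iff.2 (segExp_ne_zero hs₀), fun s => h (clampPi_mem s)⟩

/-! ### Square mean estimates for the data of a function -/

theorem continuous_segMean_comp (g : C(Circle, ℂ)) {T : Type*} [TopologicalSpace T] {a : T → Circle}
    {c : T → ℝ} (ha : Continuous a) (hc : Continuous c) : Continuous fun t => segMean g (a t) (c t) :=
  Continuous.comp (g := fun p : Circle × ℝ => segMean g p.1 p.2) (f := fun t => (a t, c t))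
    (continuous_segMean g) (ha.prodMk hc)

section Data

variable {m : ℕ} {α : HolderExp}

/-- The continuous functions underlying an element of `X_m`. -/
def fC (h : X m α) (j : Fin 2) : C(Circle, ℂ) := (h.1 j).toC

/-- Their derivatives. -/
def dC (h : X m α) (j : Fin 2) : C(Circle, ℂ) := (C1Holder.derivL (h.1 j)).toC

theorem coe_dC (h : X m α) (j : Fin 2) : circleDeriv (fC h j) = dC h j := rfl

theorem fC_sub (h h' : X m α) (j : Fin 2) : fC (h - h') j = fC h j - fC h' j :=
  map_sub C1Holder.toC _ _

theorem fC_smul (c : ℝ) (h : X m α) (j : Fin 2) : fC (c • h) j = c • fC h j :=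
  map_smul C1Holder.toC _ _

theorem dC_sub (h h' : X m α) (j : Fin 2) : dC (h - h') j = dC h j - dC h' j := by
  have e : (h - h').1 j = h.1 j - h'.1 j := rfl
  rw [dC, e, map_sub, map_sub]
  rfl

theorem dC_smul (c : ℝ) (h : X m α) (j : Fin 2) : dC (c • h) j = c • dC h j := by
  have e : (c • h).1 j = c • h.1 j := rfl
  rw [dC, e, map_smul, map_smul]
  rfl

theorem norm_fC_le (h : X m α) (j : Fin 2) : ‖fC h j‖ ≤ ‖h‖ := by
  refine le_trans ?_ (norm_le_pi_norm h.1 j)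
  rw [C1Holder.norm_def]
  exact le_add_of_nonneg_right (norm_nonneg _)

theorem norm_dC_le (h : X m α) (j : Fin 2) : ‖dC h j‖ ≤ ‖h‖ := by
  refine le_trans ?_ (norm_le_pi_norm h.1 j)
  rw [C1Holder.norm_def, CHolder.norm_def, add_comm, add_assoc]
  exact le_add_of_nonneg_right (by positivity)

/-- The data entering the integrand of `G` at `w` and `ξ = w e^{is}`. -/
def yDat (h : X m α) (w : Circle) (s : ℝ) : Dat := fun j =>
  ![fC h j w, fC h j (w * Circle.exp s), dC h j w, dC h j (w * Circle.exp s),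
    -- For |s| ≤ π and s ≠ 0 this is the divided difference (f(ξ) - f(w))/(ξ - w), the common factor
    -- isw being cancelled; it extends continuously to s = 0 and to the whole line.
    segMean (dC h j) w (clampPi s) * (segExp (clampPi s))⁻¹]

theorem yDat_sub (h h' : X m α) (w : Circle) (s : ℝ) :
    yDat (h - h') w s = yDat h w s - yDat h' w s := by
  funext j k
  simp only [yDat, fC_sub, dC_sub, segMean_sub, Pi.sub_apply]
  fin_cases k <;> simp [sub_mul]

theorem yDat_smul (c : ℝ) (h : X m α) (w : Circle) (s : ℝ) :
    yDat (c • h) w s = c • yDat h w s := by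
  funext j k
  simp only [yDat, fC_smul, dC_smul, segMean_smul, Pi.smul_apply]
  fin_cases k <;> simp [mul_assoc]

theorem continuous_yDat (h : X m α) : Continuous fun p : Circle × ℝ => yDat h p.1 p.2 := by
  refine continuous_pi fun j => continuous_pi fun k => ?_
  have h1 : Continuous fun p : Circle × ℝ => segMean (dC h j) p.1 (clampPi p.2) :=
    continuous_segMean_comp _ continuous_fst (continuous_clampPi.comp continuous_snd)
  have h2 : Continuous fun p : Circle × ℝ => (segExp (clampPi p.2))⁻¹ :=
    (continuous_segExp.comp (continuous_clampPi.comp continuous_snd)).inv₀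
      fun p => segExp_ne_zero (clampPi_mem _)
  fin_cases k
  · change Continuous fun p : Circle × ℝ => fC h j p.1
    fun_prop
  · change Continuous fun p : Circle × ℝ => fC h j (p.1 * Circle.exp p.2)
    fun_prop
  · change Continuous fun p : Circle × ℝ => dC h j p.1
    fun_prop
  · change Continuous fun p : Circle × ℝ => dC h j (p.1 * Circle.exp p.2)
    fun_prop
  · exact h1.mul h2

theorem continuous_yDat_comp (h : X m α) {T : Type*} [TopologicalSpace T] {a : T → Circle} {c : T → ℝ}
    (ha : Continuous a) (hc : Continuous c) : Continuous fun t => yDat h (a t) (c t) :=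
  Continuous.comp (g := fun p : Circle × ℝ => yDat h p.1 p.2) (f := fun t => (a t, c t))
    (continuous_yDat h) (ha.prodMk hc)

theorem exists_norm_yDat_le : ∃ C > 0, ∀ (h : X m α) (w : Circle) (s : ℝ),
    ‖yDat h w s‖ ≤ C * ‖h‖ := by
  obtain ⟨c, hc, hs⟩ := exists_segExp_bound
  refine ⟨1 + c⁻¹, by positivity, fun h w s => ?_⟩
  have hC : 0 ≤ (1 + c⁻¹) * ‖h‖ := by positivity
  have h1 : ‖h‖ ≤ (1 + c⁻¹) * ‖h‖ := by
    have : 0 ≤ c⁻¹ * ‖h‖ := by positivity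
    linarith
  refine (pi_norm_le_iff_of_nonneg hC).2 fun j => (pi_norm_le_iff_of_nonneg hC).2 fun k => ?_
  have hf : ∀ z, ‖fC h j z‖ ≤ (1 + c⁻¹) * ‖h‖ := fun z =>
    (((fC h j).norm_coe_le_norm z).trans (norm_fC_le h j)).trans h1
  have hd : ∀ z, ‖dC h j z‖ ≤ (1 + c⁻¹) * ‖h‖ := fun z =>
    (((dC h j).norm_coe_le_norm z).trans (norm_dC_le h j)).trans h1
  fin_cases k
  · exact hf _
  · exact hf _
  · exact hd _
  · exact hd _
  · change ‖segMean (dC h j) w (clampPi s) * (segExp (clampPi s))⁻¹‖ ≤ _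
    rw [norm_mul, norm_inv, mul_comm]
    have h2 := (norm_segMean_le (dC h j) w (clampPi s)).trans (norm_dC_le h j)
    calc _ ≤ c⁻¹ * ‖h‖ := mul_le_mul (inv_anti₀ hc (hs s)) h2 (norm_nonneg _) (by positivity)
      _ ≤ _ := by linarith [norm_nonneg h]

/-- The squared `H¹` norm on the circle. -/
def sobolev (h : X m α) : ℝ := ∑ j, (ms (fC h j) + ms (dC h j))

theorem sobolev_nonneg (h : X m α) : 0 ≤ sobolev h :=
  Finset.sum_nonneg fun _ _ => add_nonneg (ms_nonneg _) (ms_nonneg _)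

theorem sq_integral_le {g : ℝ → ℝ} (hg : Continuous g) {a b : ℝ} (hab : a < b) :
    (∫ x in a..b, g x) ^ 2 ≤ (b - a) * ∫ x in a..b, g x ^ 2 := by
  set A := ∫ x in a..b, g x with hA
  set c := A / (b - a)
  have hba : 0 < b - a := sub_pos.2 hab
  have h0 : 0 ≤ ∫ x in a..b, (g x - c) ^ 2 :=
    intervalIntegral.integral_nonneg hab.le fun _ _ => sq_nonneg _
  have e : ∀ x, (g x - c) ^ 2 = g x ^ 2 - 2 * c * g x + c ^ 2 := fun x => by ring
  simp only [e] at h0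
  rw [intervalIntegral.integral_add (Continuous.intervalIntegrable (by fun_prop) _ _)
    (Continuous.intervalIntegrable (by fun_prop) _ _),
    intervalIntegral.integral_sub (Continuous.intervalIntegrable (by fun_prop) _ _)
    (Continuous.intervalIntegrable (by fun_prop) _ _), intervalIntegral.integral_const_mul,
    intervalIntegral.integral_const, ← hA, smul_eq_mul] at h0
  have hcA : c * (b - a) = A := div_mul_cancel₀ _ hba.ne'
  have h1 : A * c ≤ ∫ x in a..b, g x ^ 2 := by
    have : (b - a) * c ^ 2 = A * c := by rw [← hcA]; ring
    linarith
  calc A ^ 2 = (b - a) * (A * c) := by rw [← hcA]; ring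
    _ ≤ _ := mul_le_mul_of_nonneg_left h1 hba.le

theorem sq_pi_norm_le {ι : Type*} [Fintype ι] {E : ι → Type*} [∀ i, SeminormedAddCommGroup (E i)]
    (y : ∀ i, E i) : ‖y‖ ^ 2 ≤ ∑ i, ‖y i‖ ^ 2 := by
  have h0 : 0 ≤ ∑ i, ‖y i‖ ^ 2 := Finset.sum_nonneg fun _ _ => by positivity
  rw [← Real.le_sqrt (norm_nonneg _) h0]
  refine (pi_norm_le_iff_of_nonneg (Real.sqrt_nonneg _)).2 fun i => ?_
  rw [Real.le_sqrt (norm_nonneg _) h0]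
  exact Finset.single_le_sum (f := fun i => ‖y i‖ ^ 2) (fun _ _ => by positivity) (Finset.mem_univ i)

/-- Cauchy-Schwarz in u, then Fubini and rotation invariance: each rotate of g has the same mean
square. -/
theorem ms_segMean_le (g : C(Circle, ℂ)) (s : ℝ) : ms (fun w => segMean g w s) ≤ ms g := by
  have hc : Continuous fun p : ℝ × ℝ => ‖g (Circle.exp p.1 * Circle.exp (p.2 * s))‖ ^ 2 := by fun_prop
  have h1 : ∀ w : Circle, ‖segMean g w s‖ ^ 2 ≤ ∫ u in (0 : ℝ)..1, ‖g (w * Circle.exp (u * s))‖ ^ 2 :=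
    fun w => by
      have h2 : ‖segMean g w s‖ ≤ ∫ u in (0 : ℝ)..1, ‖g (w * Circle.exp (u * s))‖ := by
        refine (intervalIntegral.norm_integral_le_integral_norm zero_le_one).trans (le_of_eq ?_)
        simp only [norm_mul, Circle.norm_coe, mul_one]
      have h3 := sq_integral_le (g := fun u => ‖g (w * Circle.exp (u * s))‖) (by fun_prop) zero_lt_one
      rw [sub_zero, one_mul] at h3
      exact (pow_le_pow_left₀ (norm_nonneg _) h2 2).trans h3
  have c1 : Continuous fun θ : ℝ => ‖segMean g (Circle.exp θ) s‖ ^ 2 := by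
    exact (continuous_segMean_comp g Circle.exp.continuous continuous_const).norm.pow 2
  have c2 : Continuous fun θ : ℝ => ∫ u in (0 : ℝ)..1, ‖g (Circle.exp θ * Circle.exp (u * s))‖ ^ 2 :=
    intervalIntegral.continuous_parametric_intervalIntegral_of_continuous' hc _ _
  refine (intervalIntegral.integral_mono_on neg_pi_lt_pi.le (c1.intervalIntegrable _ _)
    (c2.intervalIntegrable _ _) fun θ _ => h1 (Circle.exp θ)).trans ?_
  rw [integral_swap_of_continuous
    (F := fun θ u => ‖g (Circle.exp θ * Circle.exp (u * s))‖ ^ 2) hc]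
  have h5 : ∀ u : ℝ, ∫ θ in (-Real.pi)..Real.pi, ‖g (Circle.exp θ * Circle.exp (u * s))‖ ^ 2 = ms g :=
    fun u => ms_rotate g _
  simp only [h5]
  simp

theorem ms_smul_le {g : Circle → ℂ} (hg : Continuous g) {c : ℂ} {C : ℝ} (h : ‖c‖ ≤ C) :
    ms (fun w => g w * c) ≤ C ^ 2 * ms g := by
  unfold ms
  rw [← intervalIntegral.integral_const_mul]
  have hc : Continuous fun θ : ℝ => g (Circle.exp θ) := hg.comp Circle.exp.continuous
  refine intervalIntegral.integral_mono_on neg_pi_lt_pi.le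
    (Continuous.intervalIntegrable (by fun_prop) _ _)
    (Continuous.intervalIntegrable (by fun_prop) _ _) fun θ _ => ?_
  rw [norm_mul, mul_pow, mul_comm]
  gcongr

/-- For fixed s every entry is a rotate of f or f', or an arc average of f' times a bounded factor,
so its mean square is controlled by the H¹ norm uniformly in s. -/
theorem exists_integral_sq_yDat_le : ∃ C > 0, ∀ (h : X m α) (s : ℝ),
    ∫ θ in (-Real.pi)..Real.pi, ‖yDat h (Circle.exp θ) s‖ ^ 2 ≤ C * sobolev h := by
  obtain ⟨c, hc, hs⟩ := exists_segExp_bound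
  refine ⟨2 + (c⁻¹) ^ 2, by positivity, fun h s => ?_⟩
  have hy : Continuous fun θ : ℝ => yDat h (Circle.exp θ) s :=
    continuous_yDat_comp h Circle.exp.continuous continuous_const
  have hyj : ∀ j k, Continuous fun θ : ℝ => yDat h (Circle.exp θ) s j k := fun j k => by fun_prop
  have h1 : ∀ θ ∈ Icc (-Real.pi) Real.pi, ‖yDat h (Circle.exp θ) s‖ ^ 2 ≤
      ∑ j, ∑ k, ‖yDat h (Circle.exp θ) s j k‖ ^ 2 := fun θ _ =>
    (sq_pi_norm_le _).trans (Finset.sum_le_sum fun j _ => sq_pi_norm_le _)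
  refine (intervalIntegral.integral_mono_on neg_pi_lt_pi.le
    (Continuous.intervalIntegrable (by fun_prop) _ _)
    (Continuous.intervalIntegrable (by fun_prop) _ _) h1).trans ?_
  rw [intervalIntegral.integral_finsetSum fun j _ =>
    Continuous.intervalIntegrable (by fun_prop) _ _, sobolev, Finset.mul_sum]
  refine Finset.sum_le_sum fun j _ => ?_
  rw [intervalIntegral.integral_finsetSum fun k _ =>
    Continuous.intervalIntegrable (by fun_prop) _ _, Fin.sum_univ_five]
  have e0 : ∫ θ in (-Real.pi)..Real.pi, ‖yDat h (Circle.exp θ) s j 0‖ ^ 2 = ms (fC h j) := rfl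
  have e1 : ∫ θ in (-Real.pi)..Real.pi, ‖yDat h (Circle.exp θ) s j 1‖ ^ 2 = ms (fC h j) :=
    ms_rotate (fC h j) _
  have e2 : ∫ θ in (-Real.pi)..Real.pi, ‖yDat h (Circle.exp θ) s j 2‖ ^ 2 = ms (dC h j) := rfl
  have e3 : ∫ θ in (-Real.pi)..Real.pi, ‖yDat h (Circle.exp θ) s j 3‖ ^ 2 = ms (dC h j) :=
    ms_rotate (dC h j) _
  have e4 : ∫ θ in (-Real.pi)..Real.pi, ‖yDat h (Circle.exp θ) s j 4‖ ^ 2 ≤ (c⁻¹) ^ 2 * ms (dC h j) := by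
    have hcs : Continuous fun w : Circle => segMean (dC h j) w (clampPi s) :=
      continuous_segMean_comp _ continuous_id continuous_const
    have h2 : ‖(segExp (clampPi s))⁻¹‖ ≤ c⁻¹ := by
      rw [norm_inv]; exact inv_anti₀ hc (hs s)
    exact (ms_smul_le hcs h2).trans
      (mul_le_mul_of_nonneg_left (ms_segMean_le _ _) (by positivity))
  rw [e0, e1, e2, e3]
  have := ms_nonneg (fC h j)
  have := ms_nonneg (dC h j)
  have : 0 ≤ (c⁻¹) ^ 2 * ms (fC h j) := by positivity
  linarith

/-- The `L¹` norm of the data in the second variable. -/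
def datMean (h : X m α) (w : Circle) : ℝ := ∫ s in (-Real.pi)..Real.pi, ‖yDat h w s‖

theorem datMean_nonneg (h : X m α) (w : Circle) : 0 ≤ datMean h w :=
  intervalIntegral.integral_nonneg neg_pi_lt_pi.le fun _ _ => norm_nonneg _

theorem continuous_datMean (h : X m α) : Continuous (datMean h) :=
  intervalIntegral.continuous_parametric_intervalIntegral_of_continuous'
    (f := fun w s => ‖yDat h w s‖) (continuous_yDat h).norm _ _

theorem exists_ms_datMean_le : ∃ C > 0, ∀ h : X m α,
    ms (fun w => (datMean h w : ℂ)) ≤ C * sobolev h := by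
  obtain ⟨C, hC, hle⟩ := exists_integral_sq_yDat_le (m := m) (α := α)
  have hp := Real.pi_pos
  refine ⟨(2 * Real.pi) * (2 * Real.pi) * C, by positivity, fun h => ?_⟩
  have hc : Continuous fun p : ℝ × ℝ => ‖yDat h (Circle.exp p.1) p.2‖ ^ 2 := by
    exact (continuous_yDat_comp h (Circle.exp.continuous.comp continuous_fst)
      continuous_snd).norm.pow 2
  have e : Real.pi - -Real.pi = 2 * Real.pi := by ring
  have h1 : ∀ θ ∈ Icc (-Real.pi) Real.pi, ‖(datMean h (Circle.exp θ) : ℂ)‖ ^ 2 ≤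
      2 * Real.pi * ∫ s in (-Real.pi)..Real.pi, ‖yDat h (Circle.exp θ) s‖ ^ 2 := fun θ _ => by
    have h4 : Continuous fun s : ℝ => yDat h (Circle.exp θ) s :=
      continuous_yDat_comp h continuous_const continuous_id
    have := sq_integral_le h4.norm neg_pi_lt_pi
    rw [e] at this
    rw [Complex.norm_real, Real.norm_eq_abs, sq_abs]
    exact this
  have c1 : Continuous fun θ : ℝ => ‖(datMean h (Circle.exp θ) : ℂ)‖ ^ 2 := by
    have := continuous_datMean h
    fun_prop
  have c2 : Continuous fun θ : ℝ => 2 * Real.pi *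
      ∫ s in (-Real.pi)..Real.pi, ‖yDat h (Circle.exp θ) s‖ ^ 2 :=
    continuous_const.mul
      (intervalIntegral.continuous_parametric_intervalIntegral_of_continuous' hc _ _)
  refine (intervalIntegral.integral_mono_on neg_pi_lt_pi.le (c1.intervalIntegrable _ _)
    (c2.intervalIntegrable _ _) h1).trans ?_
  rw [intervalIntegral.integral_const_mul, integral_swap_of_continuous
    (F := fun θ s => ‖yDat h (Circle.exp θ) s‖ ^ 2) hc,
    show 2 * Real.pi * (2 * Real.pi) * C * sobolev h = 2 * Real.pi * (2 * Real.pi * (C * sobolev h)) by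
      ring]
  refine mul_le_mul_of_nonneg_left ?_ (by positivity)
  have c3 : Continuous fun s : ℝ => ∫ θ in (-Real.pi)..Real.pi, ‖yDat h (Circle.exp θ) s‖ ^ 2 := by
    refine intervalIntegral.continuous_parametric_intervalIntegral_of_continuous'
      (f := fun s θ => ‖yDat h (Circle.exp θ) s‖ ^ 2) ?_ _ _
    exact (continuous_yDat_comp h (Circle.exp.continuous.comp continuous_snd)
      continuous_fst).norm.pow 2
  refine (intervalIntegral.integral_mono_on neg_pi_lt_pi.le (c3.intervalIntegrable _ _)
    ((show Continuous fun _ : ℝ => C * sobolev h from continuous_const).intervalIntegrable _ _) fun s _ => hle h s).trans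
    (le_of_eq ?_)
  rw [intervalIntegral.integral_const, e, smul_eq_mul]

theorem hasSum_sobolev (hm : 1 ≤ m) {h : X m α} {a : Fin 2 → ℕ → ℝ}
    (ha : ∀ j, IsSeries m (a j) (fC h j)) :
    HasSum (fun n => ∑ j, (a j n ^ 2 + ((((n + 1) * m - 1 : ℕ) : ℝ) * a j n) ^ 2))
      ((2 * Real.pi)⁻¹ * sobolev h) := by
  rw [sobolev, Finset.mul_sum]
  refine hasSum_sum fun j _ => ?_
  rw [mul_add]
  exact ((ha j).hasSum_ms hm (fC h j).continuous).add
    ((ha j).hasSum_ms_deriv hm (fC h j).continuous (h.1 j).mem.1 (h.1 j).mem.2.1)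

end Data

/-! ### The linearization in `H¹` -/

section Linearization

variable {m : ℕ} {α : HolderExp} {b : ℝ} {lam0 : ℝ}

/-- On one boundary the difference of the Φ_j is (w - ξ) times the divided difference, and for
unimodular w, ξ the conjugate of w - ξ, divided by w - ξ and multiplied by ξ, is -w̄. -/
theorem kern_eq_kerD (f : X m α) (lam : ℝ) (j i : Fin 2) (w : Circle) {s : ℝ}
    (hs : s ∈ Icc (-Real.pi) Real.pi) (h0 : s ≠ 0) : kern b f j i w (w * Circle.exp s) =
      kerD b j i (((w : ℂ), ((w * Circle.exp s : Circle) : ℂ)), lam, yDat f w s) := by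
  have hf : ∀ z, (f.1 j).toC z = fC f j z := fun _ => rfl
  unfold kern kerD
  rw [circleDeriv_Phi, show circleDeriv (f.1 i).toC = dC f i from rfl]
  split_ifs with hji
  · subst hji
    have h1 := sub_eq_segMean (f.1 j).mem.1 (coe_dC f j) w s
    have h2 := exp_sub_one_eq s
    have hE := segExp_ne_zero hs
    set A : ℂ := segMean (dC f j) w (clampPi s) * (segExp (clampPi s))⁻¹ with hA
    have h3 : Phi b f j w - Phi b f j (w * Circle.exp s) =
        ((w : ℂ) - (w : ℂ) * Circle.exp s) * (radius b j + A) := by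
      rw [Phi, Phi, hA, clampPi_eq hs, Circle.coe_mul]
      have e : (w : ℂ) - (w : ℂ) * Circle.exp s = -(Complex.I * s * w * segExp s) := by
        linear_combination -(w : ℂ) * h2
      have e2 : (f.1 j) w - (f.1 j) (w * Circle.exp s) =
          -(Complex.I * s * w * segMean (dC f j) w s) := by rw [← h1]; simp
      have e3 : ((w : ℂ) - (w : ℂ) * Circle.exp s) * (segMean (dC f j) w s * (segExp s)⁻¹) =
          -(Complex.I * s * w * segMean (dC f j) w s) := by
        rw [e]; field_simp
      linear_combination e2 - e3
    change _ = -conj (w : ℂ) * (conj (radius b j + A) * (radius b j + A)⁻¹) *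
      (radius b j + dC f j (w * Circle.exp s))
    rw [← map_sub, h3, map_mul, div_eq_mul_inv, mul_inv]
    have h4 : (w : ℂ) - (w : ℂ) * Circle.exp s ≠ 0 := by
      intro h5
      have h6 : (w : ℂ) * (1 - Circle.exp s) = 0 := by linear_combination h5
      have h7 := (mul_eq_zero.1 h6).resolve_left (Circle.coe_ne_zero w)
      exact exp_ne_one hs h0 (Circle.ext (by simpa using (sub_eq_zero.1 h7).symm))
    have h8 : conj ((w : ℂ) - (w : ℂ) * Circle.exp s) * ((w : ℂ) - (w : ℂ) * Circle.exp s)⁻¹ *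
        ((w * Circle.exp s : Circle) : ℂ) = -conj (w : ℂ) := by
      rw [mul_right_comm, mul_inv_eq_iff_eq_mul₀ h4]
      have h9 := conj_mul_self w
      have h10 := conj_mul_self (w * Circle.exp s)
      rw [Circle.coe_mul] at h10 ⊢
      rw [map_sub]
      linear_combination h9 - h10
    linear_combination (conj (radius b j + A) * (radius b j + A)⁻¹ *
      (radius b j + dC f j (w * Circle.exp s))) * h8
  · rw [← map_sub, div_eq_mul_inv]
    rfl

/-- The data are bounded by a constant times the norm in X_m, uniformly in w and s. This is how the
Hölder topology enters the uniqueness argument. -/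
theorem eventually_yDat {P : ℝ → Dat → Prop} (hP : ∀ᶠ x : ℝ × Dat in 𝓝 (lam0, 0), P x.1 x.2) :
    ∀ᶠ x : ℝ × X m α in 𝓝 (lam0, 0), ∀ w s, P x.1 (yDat x.2 w s) := by
  obtain ⟨C, hC, hy⟩ := exists_norm_yDat_le (m := m) (α := α)
  obtain ⟨ε, hε, hB⟩ := Metric.eventually_nhds_iff_ball.1 hP
  have h1 : ∀ᶠ x : ℝ × X m α in 𝓝 (lam0, 0), dist x (lam0, 0) < min ε (ε / C) :=
    Metric.ball_mem_nhds _ (lt_min hε (div_pos hε hC))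
  filter_upwards [h1] with x hx w s
  rw [Prod.dist_eq, max_lt_iff, dist_zero_right] at hx
  refine hB (x.1, yDat x.2 w s) ?_
  rw [Metric.mem_ball, Prod.dist_eq, max_lt_iff, dist_zero_right]
  refine ⟨hx.1.trans_le (min_le_left _ _), (hy _ _ _).trans_lt ?_⟩
  have h2 := hx.2.trans_le (min_le_right _ _)
  rw [lt_div_iff₀ hC] at h2
  linarith

theorem eventually_continuous_of_contDiffAt {F : (ℂ × ℂ) × ℝ × Dat → ℂ}
    (hF : ∀ q ∈ torus, ContDiffAt ℝ 1 F (q, lam0, 0)) :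
    ∀ᶠ x : ℝ × X m α in 𝓝 (lam0, 0), Continuous fun p : Circle × ℝ =>
      F (((p.1 : ℂ), ((p.1 * Circle.exp p.2 : Circle) : ℂ)), x.1, yDat x.2 p.1 p.2) := by
  have h1 := uniform_continuousAt isCompact_torus hF
  have h2 := eventually_yDat (m := m) (α := α)
    (P := fun lam y => ∀ q ∈ torus, ContinuousAt F (q, lam, y)) h1
  filter_upwards [h2] with x hx
  refine continuous_iff_continuousAt.2 fun p => ?_
  have hc : Continuous fun p : Circle × ℝ =>
      ((((p.1 : ℂ), ((p.1 * Circle.exp p.2 : Circle) : ℂ)), x.1, yDat x.2 p.1 p.2) :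
        (ℂ × ℂ) × ℝ × Dat) := by
    have := continuous_yDat x.2
    fun_prop
  exact ContinuousAt.comp (g := F) (hx p.1 p.2 _ (mem_torus _ _)) hc.continuousAt

/-- `G` as a mean value of a function continuous on `𝕋 × ℝ`. -/
theorem eventually_G_eq (hb : b ∈ Ioo (0 : ℝ) 1) : ∀ᶠ x : ℝ × X m α in 𝓝 (lam0, 0), ∀ j,
    (Continuous fun p : Circle × ℝ =>
      gam b j (((p.1 : ℂ), ((p.1 * Circle.exp p.2 : Circle) : ℂ)), x.1, yDat x.2 p.1 p.2)) ∧
    ∀ w, G b x.1 x.2 j w = ((2 * Real.pi : ℂ)⁻¹ * ∫ s in (-Real.pi)..Real.pi,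
      gam b j (((w : ℂ), ((w * Circle.exp s : Circle) : ℂ)), x.1, yDat x.2 w s)).im := by
  have h1 : ∀ᶠ x : ℝ × X m α in 𝓝 (lam0, 0), ∀ j, Continuous fun p : Circle × ℝ =>
      gam b j (((p.1 : ℂ), ((p.1 * Circle.exp p.2 : Circle) : ℂ)), x.1, yDat x.2 p.1 p.2) :=
    eventually_all.2 fun j =>
      eventually_continuous_of_contDiffAt fun q hq => contDiffAt_gam hb j hq lam0
  have h2 : ∀ᶠ x : ℝ × X m α in 𝓝 (lam0, 0), ∀ j i, Continuous fun p : Circle × ℝ =>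
      kerD b j i (((p.1 : ℂ), ((p.1 * Circle.exp p.2 : Circle) : ℂ)), x.1, yDat x.2 p.1 p.2) :=
    eventually_all.2 fun j => eventually_all.2 fun i =>
      eventually_continuous_of_contDiffAt fun q hq => contDiffAt_kerD hb j i hq lam0
  filter_upwards [h1, h2] with x hx1 hx2 j
  refine ⟨hx1 j, fun w => ?_⟩
  have hae : ∀ᵐ s ∂(volume.restrict (uIoc (-Real.pi) Real.pi)),
      s ∈ Icc (-Real.pi) Real.pi ∧ s ≠ 0 := by
    refine ((ae_restrict_mem measurableSet_uIoc).and
      (ae_restrict_of_ae (Measure.ae_ne volume (0 : ℝ)))).mono fun s hs => ⟨?_, hs.2⟩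
    rw [uIoc_of_le neg_pi_lt_pi.le] at hs
    exact Ioc_subset_Icc_self hs.1
  have hk : ∀ i, (fun s => kern b x.2 j i w (w * Circle.exp s)) =ᵐ[volume.restrict
      (uIoc (-Real.pi) Real.pi)] fun s =>
      kerD b j i (((w : ℂ), ((w * Circle.exp s : Circle) : ℂ)), x.1, yDat x.2 w s) := fun i =>
    hae.mono fun s hs => kern_eq_kerD x.2 x.1 j i w hs.1 hs.2
  rw [G_eq]
  · congr 2
    refine intervalIntegral.integral_congr_ae ?_
    rw [← ae_restrict_iff' measurableSet_uIoc]
    filter_upwards [hk 0, hk 1] with s h0 h1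
    rw [integrandG, h0, h1, circleDeriv_Phi]
    rfl
  · intro i
    have hc : Continuous fun s : ℝ =>
        kerD b j i (((w : ℂ), ((w * Circle.exp s : Circle) : ℂ)), x.1, yDat x.2 w s) :=
      Continuous.comp (g := fun p : Circle × ℝ =>
        kerD b j i (((p.1 : ℂ), ((p.1 * Circle.exp p.2 : Circle) : ℂ)), x.1, yDat x.2 p.1 p.2))
        (f := fun s => (w, s)) (hx2 j i) (Continuous.prodMk_right w)
    exact (hc.intervalIntegrable _ _).congr_ae (hk i).symm

/-- The derivative of the integrand in the data at `0`. -/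
def gamD (b lam0 : ℝ) (j : Fin 2) (q : ℂ × ℂ) : Dat →L[ℝ] ℂ :=
  (fderiv ℝ (gam b j) (q, lam0, 0)).comp
    ((ContinuousLinearMap.inr ℝ (ℂ × ℂ) (ℝ × Dat)).comp (ContinuousLinearMap.inr ℝ ℝ Dat))

theorem continuousOn_gamD (hb : b ∈ Ioo (0 : ℝ) 1) (j : Fin 2) :
    ContinuousOn (gamD b lam0 j) torus := fun q hq => by
  have h1 : ContinuousAt (fderiv ℝ (gam b j)) (q, lam0, 0) :=
    ((contDiffAt_gam hb j hq lam0).fderiv_right (m := 0) (by simp)).continuousAt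
  have h2 : ContinuousAt (fun q : ℂ × ℂ => fderiv ℝ (gam b j) (q, lam0, (0 : Dat))) q :=
    ContinuousAt.comp (g := fderiv ℝ (gam b j)) (f := fun q : ℂ × ℂ => (q, lam0, (0 : Dat))) h1
      (by fun_prop)
  exact (h2.clm_comp continuousAt_const).continuousWithinAt

theorem continuous_gamD_yDat (hb : b ∈ Ioo (0 : ℝ) 1) (h : X m α) (j : Fin 2) :
    Continuous fun p : Circle × ℝ =>
      gamD b lam0 j ((p.1 : ℂ), ((p.1 * Circle.exp p.2 : Circle) : ℂ)) (yDat h p.1 p.2) := by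
  have h1 : Continuous fun p : Circle × ℝ => ((p.1 : ℂ), ((p.1 * Circle.exp p.2 : Circle) : ℂ)) := by
    fun_prop
  have h2 := (continuousOn_gamD (lam0 := lam0) hb j).comp_continuous h1 fun p => mem_torus _ _
  exact h2.clm_apply (continuous_yDat h)

/-- The linearization of `G` at the trivial solution. -/
def Lam (b lam0 : ℝ) (h : X m α) (j : Fin 2) (w : Circle) : ℝ :=
  ((2 * Real.pi : ℂ)⁻¹ * ∫ s in (-Real.pi)..Real.pi,
    gamD b lam0 j ((w : ℂ), ((w * Circle.exp s : Circle) : ℂ)) (yDat h w s)).im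

theorem continuous_Lam (hb : b ∈ Ioo (0 : ℝ) 1) (h : X m α) (j : Fin 2) :
    Continuous (Lam b lam0 h j) :=
  Complex.continuous_im.comp (continuous_const.mul
    (intervalIntegral.continuous_parametric_intervalIntegral_of_continuous' (f := fun (w : Circle) s =>
      gamD b lam0 j ((w : ℂ), ((w * Circle.exp s : Circle) : ℂ)) (yDat h w s))
      (continuous_gamD_yDat hb h j) _ _))

theorem continuous_gamD_yDat_right (hb : b ∈ Ioo (0 : ℝ) 1) (h : X m α) (j : Fin 2) (w : Circle) :
    Continuous fun s : ℝ =>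
      gamD b lam0 j ((w : ℂ), ((w * Circle.exp s : Circle) : ℂ)) (yDat h w s) :=
  (continuous_gamD_yDat hb h j).comp (Continuous.prodMk_right w)

theorem Lam_sub (hb : b ∈ Ioo (0 : ℝ) 1) (h h' : X m α) (j : Fin 2) (w : Circle) :
    Lam b lam0 (h - h') j w = Lam b lam0 h j w - Lam b lam0 h' j w := by
  unfold Lam
  rw [← Complex.sub_im, ← mul_sub, ← intervalIntegral.integral_sub
    ((continuous_gamD_yDat_right hb h j w).intervalIntegrable _ _)
    ((continuous_gamD_yDat_right hb h' j w).intervalIntegrable _ _)]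
  simp only [yDat_sub, map_sub]

theorem Lam_smul (c : ℝ) (h : X m α) (j : Fin 2) (w : Circle) :
    Lam b lam0 (c • h) j w = c * Lam b lam0 h j w := by
  unfold Lam
  simp only [yDat_smul, map_smul]
  rw [intervalIntegral.integral_smul, mul_smul_comm, Complex.smul_im, smul_eq_mul]

theorem norm_inv_two_pi_le : ‖(2 * Real.pi : ℂ)⁻¹‖ ≤ 1 := by
  have h : ‖(2 * Real.pi : ℂ)‖ = 2 * Real.pi := by
    rw [norm_mul, Complex.norm_real, Real.norm_of_nonneg Real.pi_pos.le]
    simp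
  rw [norm_inv, h]
  exact inv_le_one_of_one_le₀ (by linarith [Real.pi_gt_three])

theorem abs_im_mean_le {F : ℝ → ℂ} {h : X m α} {w : Circle} {C : ℝ}
    (hF : ∀ s, ‖F s‖ ≤ C * ‖yDat h w s‖) :
    |((2 * Real.pi : ℂ)⁻¹ * ∫ s in (-Real.pi)..Real.pi, F s).im| ≤ C * datMean h w := by
  have hy : Continuous fun s : ℝ => yDat h w s := continuous_yDat_comp h continuous_const continuous_id
  refine (Complex.abs_im_le_norm _).trans ?_
  rw [norm_mul]
  have h1 := intervalIntegral.norm_integral_le_of_norm_le (μ := volume) (g := fun s => C * ‖yDat h w s‖)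
    neg_pi_lt_pi.le (Eventually.of_forall fun s _ => hF s)
    (Continuous.intervalIntegrable (by fun_prop) _ _)
  rw [intervalIntegral.integral_const_mul] at h1
  exact (mul_le_of_le_one_left (norm_nonneg _) norm_inv_two_pi_le).trans h1

theorem exists_abs_Lam_le (hb : b ∈ Ioo (0 : ℝ) 1) : ∃ C > 0, ∀ (h : X m α) (j : Fin 2) (w : Circle),
    |Lam b lam0 h j w| ≤ C * datMean h w := by
  have h1 : ∀ j, ∃ C, ∀ q ∈ torus, ‖gamD b lam0 j q‖ ≤ C := fun j =>
    isCompact_torus.exists_bound_of_continuousOn (continuousOn_gamD hb j)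
  choose C hC using h1
  refine ⟨|C 0| + |C 1| + 1, by positivity, fun h j w => abs_im_mean_le fun s => ?_⟩
  refine (gamD b lam0 j _).le_of_opNorm_le ((hC j _ (mem_torus _ _)).trans ?_) _
  have h0 := abs_nonneg (C 0)
  have h1 := abs_nonneg (C 1)
  have h2 := le_abs_self (C 0)
  have h3 := le_abs_self (C 1)
  fin_cases j
  · change C 0 ≤ _; linarith
  · change C 1 ≤ _; linarith

/-- A pointwise substitute for strict differentiability: the integrand is a C¹ function of finitely
many values, uniformly over the torus, and the error is integrated in s. The majorant is an L¹ mean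
of the data of the difference, so no Hölder estimate for `G` is required. -/
theorem eventually_abs_G_sub_le (hb : b ∈ Ioo (0 : ℝ) 1) {ε : ℝ} (hε : 0 < ε) :
    ∀ᶠ x : ℝ × X m α × X m α in 𝓝 (lam0, 0, 0), ∀ j w,
      |G b x.1 x.2.1 j w - G b x.1 x.2.2 j w - Lam b lam0 (x.2.1 - x.2.2) j w| ≤
        ε * datMean (x.2.1 - x.2.2) w := by
  have h1 : ∀ᶠ y : ℝ × Dat × Dat in 𝓝 (lam0, 0, 0), ∀ j, ∀ q ∈ torus,
      ‖gam b j (q, y.1, y.2.1) - gam b j (q, y.1, y.2.2) - gamD b lam0 j q (y.2.1 - y.2.2)‖ ≤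
        ε * ‖y.2.1 - y.2.2‖ :=
    eventually_all.2 fun j =>
      uniform_strict_deriv isCompact_torus (fun q hq => contDiffAt_gam hb j hq lam0) hε
  obtain ⟨C, hC, hy⟩ := exists_norm_yDat_le (m := m) (α := α)
  obtain ⟨r, hr, hB⟩ := Metric.eventually_nhds_iff_ball.1 h1
  have h2 : ∀ᶠ x : ℝ × X m α × X m α in 𝓝 (lam0, 0, 0), dist x (lam0, 0, 0) < min r (r / C) :=
    Metric.ball_mem_nhds _ (lt_min hr (div_pos hr hC))
  have h3 : ∀ᶠ x : ℝ × X m α × X m α in 𝓝 (lam0, 0, 0), ∀ j, (Continuous fun p : Circle × ℝ =>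
      gam b j (((p.1 : ℂ), ((p.1 * Circle.exp p.2 : Circle) : ℂ)), x.1, yDat x.2.1 p.1 p.2)) ∧
      ∀ w, G b x.1 x.2.1 j w = ((2 * Real.pi : ℂ)⁻¹ * ∫ s in (-Real.pi)..Real.pi,
        gam b j (((w : ℂ), ((w * Circle.exp s : Circle) : ℂ)), x.1, yDat x.2.1 w s)).im :=
    (Continuous.tendsto' (by fun_prop : Continuous fun x : ℝ × X m α × X m α => (x.1, x.2.1))
      (lam0, 0, 0) (lam0, 0) rfl).eventually (eventually_G_eq hb)
  have h4 : ∀ᶠ x : ℝ × X m α × X m α in 𝓝 (lam0, 0, 0), ∀ j, (Continuous fun p : Circle × ℝ =>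
      gam b j (((p.1 : ℂ), ((p.1 * Circle.exp p.2 : Circle) : ℂ)), x.1, yDat x.2.2 p.1 p.2)) ∧
      ∀ w, G b x.1 x.2.2 j w = ((2 * Real.pi : ℂ)⁻¹ * ∫ s in (-Real.pi)..Real.pi,
        gam b j (((w : ℂ), ((w * Circle.exp s : Circle) : ℂ)), x.1, yDat x.2.2 w s)).im :=
    (Continuous.tendsto' (by fun_prop : Continuous fun x : ℝ × X m α × X m α => (x.1, x.2.2))
      (lam0, 0, 0) (lam0, 0) rfl).eventually (eventually_G_eq hb)
  filter_upwards [h2, h3, h4] with x hx h3 h4 j w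
  have c1 := ((h3 j).1.comp (Continuous.prodMk_right w)).intervalIntegrable (μ := volume)
    (-Real.pi) Real.pi
  have c2 := ((h4 j).1.comp (Continuous.prodMk_right w)).intervalIntegrable (μ := volume)
    (-Real.pi) Real.pi
  have c3 := (continuous_gamD_yDat_right (lam0 := lam0) hb (x.2.1 - x.2.2) j w).intervalIntegrable
    (μ := volume) (-Real.pi) Real.pi
  rw [(h3 j).2, (h4 j).2, Lam, ← Complex.sub_im, ← Complex.sub_im, ← mul_sub, ← mul_sub]
  have e := intervalIntegral.integral_sub (c1.sub c2) c3
  rw [intervalIntegral.integral_sub c1 c2] at e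
  have e' := congrArg (fun z => |((2 * Real.pi : ℂ)⁻¹ * z).im|) e
  refine (le_of_eq e'.symm).trans (abs_im_mean_le fun s => ?_)
  rw [Prod.dist_eq, Prod.dist_eq, max_lt_iff, max_lt_iff, dist_zero_right, dist_zero_right] at hx
  have hz : ∀ f : X m α, ‖f‖ < min r (r / C) → ‖yDat f w s‖ < r := fun f hf => by
    refine (hy f w s).trans_lt ?_
    have h5 := hf.trans_le (min_le_right _ _)
    rw [lt_div_iff₀ hC] at h5
    linarith
  have h6 := hB (x.1, yDat x.2.1 w s, yDat x.2.2 w s) (by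
    rw [Metric.mem_ball, Prod.dist_eq, Prod.dist_eq, max_lt_iff, max_lt_iff, dist_zero_right,
      dist_zero_right]
    exact ⟨hx.1.trans_le (min_le_left _ _), hz _ hx.2.1, hz _ hx.2.2⟩) j _
    (mem_torus w (w * Circle.exp s))
  rw [← yDat_sub] at h6
  exact h6

end Linearization

/-! ### The linearization on modes -/

open Ell1

theorem continuous_eFun (n : ℕ) : Continuous (eFun n) := (lipschitz_eFun n).continuous

theorem eCoeff_eFun {k l : ℕ} (hk : 0 < k) : eCoeff k (eFun l) = if k = l then 1 else 0 := by
  rw [eCoeff_eq_fc (continuous_eFun l), fc]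
  have e : ∀ θ : ℝ, ((eFun l (Circle.exp θ) : ℝ) : ℂ) * (Circle.exp θ : ℂ) ^ (-(k : ℤ)) =
      (2 * Complex.I)⁻¹ * (Circle.exp θ : ℂ) ^ (-(l : ℤ) - k) -
        (2 * Complex.I)⁻¹ * (Circle.exp θ : ℂ) ^ ((l : ℤ) - k) := fun θ => by
    have hi : ((Circle.exp θ : Circle) : ℂ)⁻¹ = conj (Circle.exp θ : ℂ) := by
      rw [← Circle.coe_inv, Circle.coe_inv_eq_conj]
    rw [eFun, Complex.im_eq_sub_conj, zpow_sub₀ (Circle.coe_ne_zero _),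
      zpow_sub₀ (Circle.coe_ne_zero _), coe_zpow_neg', map_pow, Complex.conj_conj, zpow_neg,
      zpow_natCast, zpow_natCast]
    simp only [div_eq_mul_inv, ← inv_pow, hi]
    ring
  simp only [e]
  rw [intervalIntegral.integral_sub
    (((continuous_coe_zpow _).const_mul _).intervalIntegrable _ _)
    (((continuous_coe_zpow _).const_mul _).intervalIntegrable _ _),
    intervalIntegral.integral_const_mul, intervalIntegral.integral_const_mul, integral_exp_zpow,
    integral_exp_zpow, if_neg (by omega)]
  have hp := Complex.ofReal_ne_zero.2 Real.pi_ne_zero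
  by_cases h : k = l
  · subst h
    rw [if_pos (sub_self _), if_pos rfl]
    have e2 : (2 * Real.pi : ℂ)⁻¹ * ((2 * Complex.I)⁻¹ * 0 - (2 * Complex.I)⁻¹ * (2 * Real.pi)) =
        ((1 / 2 : ℝ) : ℂ) * Complex.I := by
      push_cast
      field_simp
      rw [Complex.I_sq]
      ring
    rw [e2, Complex.im_ofReal_mul]
    simp
  · rw [if_neg (by omega), if_neg h]
    simp

theorem eCoeff_sub {R R' : Circle → ℝ} (hR : Continuous R) (hR' : Continuous R') (n : ℕ) :
    eCoeff n (fun w => R w - R' w) = eCoeff n R - eCoeff n R' := by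
  have h0 := (continuous_eFun n).comp Circle.exp.continuous
  unfold eCoeff
  have h := intervalIntegral.integral_sub (μ := volume) (a := 0) (b := 2 * Real.pi)
    (f := fun θ => R (Circle.exp θ) * eFun n (Circle.exp θ))
    (g := fun θ => R' (Circle.exp θ) * eFun n (Circle.exp θ))
    (((hR.comp Circle.exp.continuous).mul h0).intervalIntegrable _ _)
    (((hR'.comp Circle.exp.continuous).mul h0).intervalIntegrable _ _)
  rw [← mul_sub, ← h]
  simp only [sub_mul]

theorem eCoeff_const_mul (c : ℝ) (R : Circle → ℝ) (n : ℕ) :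
    eCoeff n (fun w => c * R w) = c * eCoeff n R := by
  unfold eCoeff
  simp only [mul_assoc]
  rw [intervalIntegral.integral_const_mul]
  ring

theorem eCoeff_outFun {m : ℕ} (hm : 1 ≤ m) (z : Ell1) (n : ℕ) :
    eCoeff ((n + 1) * m) (fun w => outFun m w z) = ((n : ℝ) + 1)⁻¹ * z n := by
  let F : ℕ → C(ℝ, ℝ) := fun k =>
    ⟨fun θ => z k * (((k : ℝ) + 1)⁻¹ * eFun ((k + 1) * m) (Circle.exp θ)) *
      eFun ((n + 1) * m) (Circle.exp θ), by
      have h1 := (continuous_eFun ((k + 1) * m)).comp Circle.exp.continuous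
      have h2 := (continuous_eFun ((n + 1) * m)).comp Circle.exp.continuous
      exact (continuous_const.mul (continuous_const.mul h1)).mul h2⟩
  have hs : Summable fun k => ‖(F k).restrict
      (⟨uIcc 0 (2 * Real.pi), isCompact_uIcc⟩ : TopologicalSpace.Compacts ℝ)‖ := by
    refine Summable.of_nonneg_of_le (fun _ => norm_nonneg _) (fun k => ?_) (Ell1.summable_abs z)
    refine (ContinuousMap.norm_le _ (abs_nonneg _)).2 fun θ => ?_
    change ‖z k * (((k : ℝ) + 1)⁻¹ * eFun ((k + 1) * m) (Circle.exp θ)) *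
      eFun ((n + 1) * m) (Circle.exp θ)‖ ≤ _
    rw [norm_mul, norm_mul, mul_assoc]
    have h1 := outFun_bound m (Circle.exp θ) k
    have h2 := abs_eFun_le ((n + 1) * m) (Circle.exp θ)
    exact mul_le_of_le_one_right (abs_nonneg _) (mul_le_one₀ h1 (norm_nonneg _) h2)
  have h1 := (intervalIntegral.hasSum_intervalIntegral_of_summable_norm hs).mul_left Real.pi⁻¹
  have e : ∀ θ : ℝ, ∑' k, F k θ = outFun m (Circle.exp θ) z * eFun ((n + 1) * m) (Circle.exp θ) :=
    fun θ => ((hasSum_outFun m (Circle.exp θ) z).mul_right _).tsum_eq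
  simp only [e] at h1
  change HasSum _ (eCoeff ((n + 1) * m) (fun w => outFun m w z)) at h1
  refine h1.unique ?_
  have h2 : ∀ k, Real.pi⁻¹ * ∫ θ in (0 : ℝ)..2 * Real.pi, F k θ =
      if k = n then ((n : ℝ) + 1)⁻¹ * z n else 0 := fun k => by
    have h3 : Real.pi⁻¹ * ∫ θ in (0 : ℝ)..2 * Real.pi, F k θ =
        eCoeff ((n + 1) * m) (fun w => (z k * ((k : ℝ) + 1)⁻¹) * eFun ((k + 1) * m) w) := by
      rw [eCoeff]
      simp only [F, ContinuousMap.coe_mk, mul_assoc]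
    rw [h3, eCoeff_const_mul, eCoeff_eFun (Nat.mul_pos (Nat.succ_pos n) hm)]
    by_cases hk : k = n
    · subst hk; simp [mul_comm]
    · rw [if_neg hk, if_neg, mul_zero]
      intro h4
      exact hk (Nat.succ_injective (Nat.eq_of_mul_eq_mul_right hm h4)).symm
  simp only [h2]
  exact hasSum_ite_eq n _

section Modes

variable {m : ℕ} {α : HolderExp} {b : ℝ} {lam0 : ℝ}

theorem ms_le_of_abs_le {R D : Circle → ℝ} (hR : Continuous R) (hD : Continuous D) {C : ℝ}
    (h : ∀ w, |R w| ≤ C * D w) : ms (fun w => (R w : ℂ)) ≤ C ^ 2 * ms (fun w => (D w : ℂ)) := by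
  unfold ms
  rw [← intervalIntegral.integral_const_mul]
  have c1 := hR.comp Circle.exp.continuous
  have c2 := hD.comp Circle.exp.continuous
  refine intervalIntegral.integral_mono_on neg_pi_lt_pi.le
    (Continuous.intervalIntegrable (by fun_prop) _ _)
    (Continuous.intervalIntegrable (by fun_prop) _ _) fun θ _ => ?_
  rw [Complex.norm_real, Complex.norm_real, Real.norm_eq_abs, Real.norm_eq_abs, sq_abs (D _),
    ← mul_pow]
  exact pow_le_pow_left₀ (abs_nonneg _) (h _) 2

theorem datMean_smul (c : ℝ) (h : X m α) (w : Circle) : datMean (c • h) w = |c| * datMean h w := by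
  unfold datMean
  simp only [yDat_smul, norm_smul, Real.norm_eq_abs]
  rw [intervalIntegral.integral_const_mul]

theorem hasDerivAt_G (hb : b ∈ Ioo (0 : ℝ) 1) (h : X m α) (j : Fin 2) (w : Circle) :
    HasDerivAt (fun τ : ℝ => G b lam0 (τ • h) j w) (Lam b lam0 h j w) 0 := by
  rw [hasDerivAt_iff_isLittleO, Asymptotics.isLittleO_iff]
  intro c hc
  have hd := datMean_nonneg h w
  have h1 := eventually_abs_G_sub_le (m := m) (α := α) (lam0 := lam0) hb
    (div_pos hc (by linarith : 0 < datMean h w + 1))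
  have c1 : Tendsto (fun τ : ℝ => (lam0, τ • h, (0 : X m α))) (𝓝 0) (𝓝 (lam0, 0, 0)) :=
    Continuous.tendsto' (by fun_prop) _ _ (by simp)
  filter_upwards [c1.eventually h1] with τ hτ
  have h2 := hτ j w
  simp only [sub_zero, Lam_smul, datMean_smul] at h2
  rw [zero_smul, sub_zero, smul_eq_mul, Real.norm_eq_abs, Real.norm_eq_abs]
  refine h2.trans ?_
  rw [div_mul_eq_mul_div, div_le_iff₀ (by linarith)]
  have : 0 ≤ c * |τ| := by positivity
  nlinarith

/-- Both sides are the derivative at τ = 0 of G along τ times the embedded sequence, computed once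
in the Hölder space and once in the Wiener algebra. -/
theorem Lam_iota (hm : 3 ≤ m) (hb : b ∈ Ioo (0 : ℝ) 1) (x : Fin 2 → Ell1) (j : Fin 2) (w : Circle) :
    Lam b lam0 (iota (by omega : 1 ≤ m) α x) j w = outFun m w (blockOp (dmat m b lam0) x j) := by
  refine (hasDerivAt_G hb _ j w).unique ?_
  have h2 : HasFDerivAt (GW m b) (fderiv ℝ (GW m b) (lam0, 0)) (lam0, 0) :=
    ((contDiffAt_GW (n := 1) (isUnit_wDen_zero hb)).differentiableAt one_ne_zero).hasFDerivAt
  rw [fderiv_GW hm hb] at h2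
  have hp : HasDerivAt (fun τ : ℝ => ((lam0, τ • x) : ℝ × (Fin 2 → Ell1))) (0, x) 0 :=
    (hasDerivAt_const (0 : ℝ) lam0).prodMk (by simpa using (hasDerivAt_id (0 : ℝ)).smul_const x)
  have e0 : ((lam0, (0 : ℝ) • x) : ℝ × (Fin 2 → Ell1)) = (lam0, 0) := by rw [zero_smul]
  rw [← e0] at h2
  have h3 := h2.comp_hasDerivAt (0 : ℝ) hp
  have h4 := (((outFun m w).comp (ContinuousLinearMap.proj (R := ℝ) (φ := fun _ : Fin 2 => Ell1)
    j)).hasFDerivAt).comp_hasDerivAt (0 : ℝ) h3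
  refine h4.congr_of_eventuallyEq ?_
  have c1 : Tendsto (fun τ : ℝ => τ • x) (𝓝 0) (𝓝 0) :=
    Continuous.tendsto' (by fun_prop) _ _ (by simp)
  filter_upwards [c1.eventually (eventually_isUnit hb)] with τ hτ
  rw [← map_smul, G_iota _ hτ]
  rfl

theorem exists_sq_eCoeff_Lam_le (hb : b ∈ Ioo (0 : ℝ) 1) : ∃ C > 0, ∀ (h : X m α) (j : Fin 2) (n : ℕ),
    eCoeff n (Lam b lam0 h j) ^ 2 ≤ C * sobolev h := by
  obtain ⟨C, hC, h1⟩ := exists_abs_Lam_le (m := m) (α := α) (lam0 := lam0) hb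
  obtain ⟨C', hC', h2⟩ := exists_ms_datMean_le (m := m) (α := α)
  refine ⟨C ^ 2 * C', by positivity, fun h j n => ?_⟩
  have h3 := sum_sq_eCoeff_le (continuous_Lam (lam0 := lam0) hb h j) {n}
  rw [Finset.sum_singleton] at h3
  refine h3.trans ((ms_le_of_abs_le (continuous_Lam hb h j) (continuous_datMean h) (h1 h j)).trans ?_)
  rw [mul_assoc]
  exact mul_le_mul_of_nonneg_left (h2 h) (by positivity)

/-- The truncation of a sequence of coefficients. -/
def truncVec (a : Fin 2 → ℕ → ℝ) (K : ℕ) : Fin 2 → Ell1 := fun j =>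
  ∑ k ∈ Finset.range K, (a j k * ((k : ℝ) + 1) ^ 2) • δ k

theorem coord_truncVec (a : Fin 2 → ℕ → ℝ) (K n : ℕ) (j : Fin 2) : coord n (truncVec a K j) =
    if n < K then a j n * ((n : ℝ) + 1) ^ 2 else 0 := by
  rw [truncVec, map_sum]
  simp only [map_smul, coord_δ, smul_eq_mul, mul_ite, mul_one, mul_zero]
  simp

/-- The formula is known for embedded sequences, in particular for truncations of h. The truncations
need not converge to h in C^{1+α}, but they do in H¹ by Parseval, and each Fourier coefficient of
the linearization is controlled by the H¹ norm. -/
theorem eCoeff_Lam (hm : 3 ≤ m) (hb : b ∈ Ioo (0 : ℝ) 1) {h : X m α} {a : Fin 2 → ℕ → ℝ}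
    (ha : ∀ j, IsSeries m (a j) (fC h j)) (j : Fin 2) (n : ℕ) :
    eCoeff ((n + 1) * m) (Lam b lam0 h j) = (M b ((n + 1) * m) lam0).mulVec (fun i => a i n) j := by
  have hm1 : 1 ≤ m := by omega
  obtain ⟨C, hC, hle⟩ := exists_sq_eCoeff_Lam_le (m := m) (α := α) (lam0 := lam0) hb
  set t : ℕ → ℝ := fun n => ∑ j, (a j n ^ 2 + ((((n + 1) * m - 1 : ℕ) : ℝ) * a j n) ^ 2)
  have ht : HasSum t ((2 * Real.pi)⁻¹ * sobolev h) := hasSum_sobolev hm1 ha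
  have hS : ∀ K, (2 * Real.pi)⁻¹ * sobolev (h - iota hm1 α (truncVec a K)) =
      (2 * Real.pi)⁻¹ * sobolev h - ∑ n ∈ Finset.range K, t n := fun K => by
    have ha' : ∀ j, IsSeries m (fun n => if n < K then 0 else a j n)
        (fC (h - iota hm1 α (truncVec a K)) j) := fun j => by
      have h1 := (ha j).add ((isSeries_iotaFun (truncVec a K j)).smul (-1))
      have e1 : (a j + (-1 : ℝ) • acoef (truncVec a K j)) = fun n => if n < K then 0 else a j n := by
        funext n
        have h2 : acoef (truncVec a K j) n = if n < K then a j n else 0 := by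
          have h3 := coord_truncVec a K n j
          rw [coord_apply] at h3
          rw [acoef, h3]
          split_ifs
          · field_simp
          · simp
        simp only [Pi.add_apply, Pi.smul_apply, h2, smul_eq_mul]
        split_ifs <;> ring
      have e2 : ((fC h j : Circle → ℂ) + (-1 : ℝ) • iotaFun m (truncVec a K j)) =
          fC (h - iota hm1 α (truncVec a K)) j := by
        funext w
        rw [fC_sub]
        change fC h j w + (-1 : ℝ) • iotaFun m (truncVec a K j) w =
          fC h j w - iotaFun m (truncVec a K j) w
        rw [neg_one_smul, sub_eq_add_neg]
      rw [e1, e2] at h1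
      exact h1
    refine (hasSum_sobolev hm1 ha').unique ?_
    have h4 := ht.sub (hasSum_sum_of_ne_finset_zero (s := Finset.range K)
      (f := fun n => if n < K then t n else 0) fun n hn => if_neg (by simpa using hn))
    rw [Finset.sum_congr rfl fun n hn => if_pos (Finset.mem_range.1 hn)] at h4
    have e : ∀ n, ∑ j, ((if n < K then 0 else a j n) ^ 2 +
        ((((n + 1) * m - 1 : ℕ) : ℝ) * if n < K then 0 else a j n) ^ 2) =
        t n - if n < K then t n else 0 := fun n => by
      split_ifs with hn
      · simp
      · rw [sub_zero]
    simp only [e]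
    exact h4
  set c := eCoeff ((n + 1) * m) (Lam b lam0 h j) -
    (M b ((n + 1) * m) lam0).mulVec (fun i => a i n) j with hc
  have h5 : ∀ K, n < K → c ^ 2 ≤ C * (2 * Real.pi) *
      ((2 * Real.pi)⁻¹ * sobolev h - ∑ n ∈ Finset.range K, t n) := fun K hK => by
    have h6 := hle (h - iota hm1 α (truncVec a K)) j ((n + 1) * m)
    have h7 : eCoeff ((n + 1) * m) (Lam b lam0 (h - iota hm1 α (truncVec a K)) j) = c := by
      rw [show Lam b lam0 (h - iota hm1 α (truncVec a K)) j = fun w => Lam b lam0 h j w -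
        Lam b lam0 (iota hm1 α (truncVec a K)) j w from funext fun w => Lam_sub hb _ _ j w,
        eCoeff_sub (continuous_Lam hb _ _) (continuous_Lam hb _ _), hc]
      congr 1
      rw [show Lam b lam0 (iota hm1 α (truncVec a K)) j = fun w =>
        outFun m w (blockOp (dmat m b lam0) (truncVec a K) j) from
        funext fun w => Lam_iota hm hb _ j w, eCoeff_outFun hm1, ← coord_apply,
        coord_blockOp (dmat_bound hb m lam0)]
      simp only [coord_truncVec, if_pos hK, dmat, Matrix.smul_apply, Pi.smul_apply, smul_eq_mul,
        Matrix.mulVec, dotProduct, Fin.sum_univ_two]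
      field_simp
    rw [h7] at h6
    refine h6.trans (le_of_eq ?_)
    rw [← hS K]
    have := Real.pi_ne_zero
    field_simp
  have h8 : Tendsto (fun K => C * (2 * Real.pi) *
      ((2 * Real.pi)⁻¹ * sobolev h - ∑ n ∈ Finset.range K, t n)) atTop (𝓝 0) := by
    have := ((tendsto_const_nhds (x := (2 * Real.pi)⁻¹ * sobolev h)).sub
      ht.tendsto_sum_nat).const_mul (C * (2 * Real.pi))
    simpa using this
  have h9 : c ^ 2 ≤ 0 := ge_of_tendsto h8 ((eventually_gt_atTop n).mono fun K hK => h5 K hK)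
  have h10 : c = 0 := by nlinarith
  exact sub_eq_zero.1 h10

end Modes

/-! ### Local uniqueness -/

section Uniqueness

variable {m : ℕ} {α : HolderExp} {b : ℝ} {lam0 : ℝ}

/-- Cramer's rule: det(A) v is the adjugate of A applied to Av, with entries at most B. -/
theorem sq_norm_le_of_det {A : Matrix (Fin 2) (Fin 2) ℝ} {B : ℝ} (hB : ∀ i j, |A i j| ≤ B)
    (v : Fin 2 → ℝ) : A.det ^ 2 * ∑ i, v i ^ 2 ≤ 4 * B ^ 2 * ∑ i, A.mulVec v i ^ 2 := by
  have hB' : ∀ i j, A i j ^ 2 ≤ B ^ 2 := fun i j => by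
    rw [← sq_abs]; exact pow_le_pow_left₀ (abs_nonneg _) (hB i j) 2
  have h0 : A.det * v 0 = A 1 1 * A.mulVec v 0 - A 0 1 * A.mulVec v 1 := by
    rw [Matrix.det_fin_two]
    simp only [Matrix.mulVec, dotProduct, Fin.sum_univ_two]
    ring
  have h1 : A.det * v 1 = A 0 0 * A.mulVec v 1 - A 1 0 * A.mulVec v 0 := by
    rw [Matrix.det_fin_two]
    simp only [Matrix.mulVec, dotProduct, Fin.sum_univ_two]
    ring
  have key : ∀ x y p q : ℝ, x ^ 2 ≤ B ^ 2 → y ^ 2 ≤ B ^ 2 →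
      (x * p - y * q) ^ 2 ≤ 2 * B ^ 2 * (p ^ 2 + q ^ 2) := fun x y p q hx hy => by
    have h2 : (x * p - y * q) ^ 2 ≤ 2 * (x ^ 2 * p ^ 2 + y ^ 2 * q ^ 2) := by
      nlinarith [sq_nonneg (x * p + y * q)]
    have h3 := mul_le_mul_of_nonneg_right hx (sq_nonneg p)
    have h4 := mul_le_mul_of_nonneg_right hy (sq_nonneg q)
    linarith
  have k0 := key _ _ (A.mulVec v 0) (A.mulVec v 1) (hB' 1 1) (hB' 0 1)
  have k1 := key _ _ (A.mulVec v 1) (A.mulVec v 0) (hB' 0 0) (hB' 1 0)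
  rw [← h0, mul_pow] at k0
  rw [← h1, mul_pow] at k1
  simp only [Fin.sum_univ_two]
  linarith

/-- For n ≥ 1 the determinant grows like k² while the entries grow like k, so M_{km} is bounded
below by a multiple of k, which is the strength of the H¹ norm. For n = 0 the matrix is singular,
but the condition v_1 = 0 defining 𝒳_m excludes its kernel, since the second row gives -b^m v_0. -/
theorem exists_mode_bound (h : IsBif m b lam0) : ∃ c > 0, ∀ (n : ℕ) (v : Fin 2 → ℝ),
    (n = 0 → v 1 = 0) → c * ∑ j, (v j ^ 2 + ((((n + 1) * m - 1 : ℕ) : ℝ) * v j) ^ 2) ≤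
      ∑ j, (M b ((n + 1) * m) lam0).mulVec v j ^ 2 := by
  obtain ⟨c, hc, hd⟩ := h.exists_det_bound
  set B := m * (|lam0| + 1) + 1 with hB
  have hB0 : 0 < B := by positivity
  have hm1 := h.one_le
  have hpow := h.pow_pos m
  have hE : ∀ (n : ℕ) (v : Fin 2 → ℝ), ∑ j, (v j ^ 2 + ((((n + 1) * m - 1 : ℕ) : ℝ) * v j) ^ 2) ≤
      ((1 + (m : ℝ) ^ 2) * ((n : ℝ) + 1) ^ 2) * ∑ j, v j ^ 2 := fun n v => by
    rw [Finset.mul_sum]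
    refine Finset.sum_le_sum fun j _ => ?_
    have h1 := exponent_le m n
    have h2 : (((n + 1) * m - 1 : ℕ) : ℝ) ^ 2 ≤ (m * ((n : ℝ) + 1)) ^ 2 :=
      pow_le_pow_left₀ (Nat.cast_nonneg _) h1 2
    have h3 : (1 : ℝ) ≤ ((n : ℝ) + 1) ^ 2 := one_le_pow₀ (by linarith [(Nat.cast_nonneg n : (0:ℝ) ≤ n)])
    have h4 := sq_nonneg (v j)
    have h5 : 1 + (((n + 1) * m - 1 : ℕ) : ℝ) ^ 2 ≤ (1 + (m : ℝ) ^ 2) * ((n : ℝ) + 1) ^ 2 := by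
      rw [mul_pow] at h2; linarith
    have := mul_le_mul_of_nonneg_right h5 h4
    linarith
  -- b^{2m} serves n = 0, c²/(4B²) serves n ≥ 1, and the division by 1 + m² converts powers of k
  -- into powers of the degree km - 1.
  refine ⟨min ((b ^ m) ^ 2) (c ^ 2 / (4 * B ^ 2)) / (1 + (m : ℝ) ^ 2), by positivity,
    fun n v hv => ?_⟩
  have hS : 0 ≤ ∑ j, v j ^ 2 := Finset.sum_nonneg fun _ _ => sq_nonneg _
  have key : min ((b ^ m) ^ 2) (c ^ 2 / (4 * B ^ 2)) * ((n : ℝ) + 1) ^ 2 * ∑ j, v j ^ 2 ≤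
      ∑ j, (M b ((n + 1) * m) lam0).mulVec v j ^ 2 := by
    rcases Nat.eq_zero_or_pos n with rfl | hn
    · have h1 := hv rfl
      have h2 : (M b ((0 + 1) * m) lam0).mulVec v 1 = -(b ^ m * v 0) := by
        simp [M, Matrix.mulVec, dotProduct, Fin.sum_univ_two, h1]
      rw [Fin.sum_univ_two, Fin.sum_univ_two, h1, h2]
      have h3 := mul_le_mul_of_nonneg_right
        (min_le_left ((b ^ m) ^ 2) (c ^ 2 / (4 * B ^ 2))) (sq_nonneg (v 0))
      have h4 := sq_nonneg ((M b ((0 + 1) * m) lam0).mulVec v 0)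
      norm_num
      nlinarith
    · obtain ⟨k, rfl⟩ : ∃ k, n = k + 1 := ⟨n - 1, by omega⟩
      have hk0 : (0 : ℝ) < (k : ℝ) + 2 := by positivity
      have h1 : ∀ i j, |M b ((k + 1 + 1) * m) lam0 i j| ≤ B * ((k : ℝ) + 2) := fun i j => by
        have h2 := dmat_bound h.mem m lam0 (k + 1) i j
        rw [dmat, Matrix.smul_apply, smul_eq_mul, abs_mul, abs_inv] at h2
        push_cast at h2
        rw [show (k : ℝ) + 1 + 1 = k + 2 by ring, abs_of_pos hk0, inv_mul_le_iff₀ hk0] at h2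
        linarith
      have h2 := sq_norm_le_of_det h1 v
      have h3 := hd k
      have h4 : (c * ((k : ℝ) + 2) ^ 2) ^ 2 ≤ (M b ((k + 1 + 1) * m) lam0).det ^ 2 := by
        rw [← neg_sq ((M b ((k + 1 + 1) * m) lam0).det)]
        exact pow_le_pow_left₀ (by positivity) h3 2
      have h5 := (mul_le_mul_of_nonneg_right h4 hS).trans h2
      have h6 := min_le_right ((b ^ m) ^ 2) (c ^ 2 / (4 * B ^ 2))
      have h7 : c ^ 2 / (4 * B ^ 2) * ((k : ℝ) + 2) ^ 2 * ∑ j, v j ^ 2 ≤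
          ∑ j, (M b ((k + 1 + 1) * m) lam0).mulVec v j ^ 2 := by
        rw [div_mul_eq_mul_div, div_mul_eq_mul_div, div_le_iff₀ (by positivity)]
        have h8 : 0 < ((k : ℝ) + 2) ^ 2 := by positivity
        refine le_of_mul_le_mul_right ?_ h8
        linarith
      push_cast
      rw [show (k : ℝ) + 1 + 1 = k + 2 by ring]
      exact (mul_le_mul_of_nonneg_right (mul_le_mul_of_nonneg_right h6 (by positivity)) hS).trans h7
  refine le_trans ?_ key
  have hmin : 0 ≤ min ((b ^ m) ^ 2) (c ^ 2 / (4 * B ^ 2)) := by positivity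
  have h9 := mul_le_mul_of_nonneg_left (hE n v) (div_nonneg hmin (by positivity : 0 ≤ 1 + (m : ℝ) ^ 2))
  refine h9.trans (le_of_eq ?_)
  have : (1 + (m : ℝ) ^ 2) ≠ 0 := by positivity
  field_simp

/-- Let f be the difference and R the residual (c₁ - c₂)𝕎_m minus the linearization at f. Smallness
of the solutions gives |R| ≤ ε `datMean f`, hence an L² bound of order ε by the H¹ norm of f.
Bessel's inequality and the lower bound on each mode give the reverse inequality with a fixed
constant, so the H¹ norm of f vanishes. -/
theorem eventually_unique (h : IsBif m b lam0) : ∀ᶠ x : ℝ × X m α × X m α in 𝓝 (lam0, 0, 0),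
    (∃ c : ℝ, ∀ j w, G b x.1 x.2.1 j w = c * (WHat m b lam0 j * eFun m w)) →
    (∃ c : ℝ, ∀ j w, G b x.1 x.2.2 j w = c * (WHat m b lam0 j * eFun m w)) →
    x.2.1 - x.2.2 ∈ XCompl m α → x.2.1 = x.2.2 := by
  have hb := h.mem
  have hm1 := h.one_le
  obtain ⟨c, hc, hmode⟩ := exists_mode_bound h
  obtain ⟨C, hC, hdat⟩ := exists_ms_datMean_le (m := m) (α := α)
  have hp := Real.pi_pos
  -- The factor 2 counts the two boundary components and 2π comes from the normalization of
  -- Parseval's identity.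
  obtain ⟨ε, hε, hε1⟩ : ∃ ε > 0, 2 * (ε ^ 2 * C) < c * (2 * Real.pi)⁻¹ := by
    have hq : 0 < c * (2 * Real.pi)⁻¹ / (4 * C) := by positivity
    refine ⟨√(c * (2 * Real.pi)⁻¹ / (4 * C)), Real.sqrt_pos.2 hq, ?_⟩
    rw [Real.sq_sqrt hq.le]
    have : 2 * (c * (2 * Real.pi)⁻¹ / (4 * C) * C) = c * (2 * Real.pi)⁻¹ / 2 := by
      field_simp; ring
    rw [this]
    have : 0 < c * (2 * Real.pi)⁻¹ := by positivity
    linarith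
  filter_upwards [eventually_abs_G_sub_le (m := m) (α := α) (lam0 := lam0) hb hε]
    with x hx ⟨c₁, h1⟩ ⟨c₂, h2⟩ ⟨a, ha0, ha⟩
  set f := x.2.1 - x.2.2 with hf
  set R : Fin 2 → Circle → ℝ := fun j w =>
    (c₁ - c₂) * WHat m b lam0 j * eFun m w - Lam b lam0 f j w with hR
  have hcW : ∀ j, Continuous fun w => (c₁ - c₂) * WHat m b lam0 j * eFun m w := fun j =>
    continuous_const.mul (continuous_eFun m)
  have hcR : ∀ j, Continuous (R j) := fun j => (hcW j).sub (continuous_Lam hb f j)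
  have hRle : ∀ j w, |R j w| ≤ ε * datMean f w := fun j w => by
    have := hx j w
    rw [h1, h2] at this
    refine le_of_eq_of_le ?_ this
    rw [hR]
    congr 1
    ring
  have hms : ∀ j, ms (fun w => (R j w : ℂ)) ≤ ε ^ 2 * C * sobolev f := fun j => by
    refine (ms_le_of_abs_le (hcR j) (continuous_datMean f) (hRle j)).trans ?_
    rw [mul_assoc]
    exact mul_le_mul_of_nonneg_left (hdat f) (by positivity)
  set t : ℕ → ℝ := fun n => ∑ j, (a j n ^ 2 + ((((n + 1) * m - 1 : ℕ) : ℝ) * a j n) ^ 2) with ht'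
  have ht : HasSum t ((2 * Real.pi)⁻¹ * sobolev f) := hasSum_sobolev hm1 ha
  have hcoef : ∀ n j, eCoeff ((n + 1) * m) (R j) =
      (if n = 0 then (c₁ - c₂) * WHat m b lam0 j else 0) -
        (M b ((n + 1) * m) lam0).mulVec (fun i => a i n) j := fun n j => by
    rw [hR, eCoeff_sub (hcW j) (continuous_Lam hb f j), eCoeff_Lam h.three_le hb ha,
      eCoeff_const_mul, eCoeff_eFun (Nat.mul_pos (Nat.succ_pos n) hm1)]
    have e : ((n + 1) * m = m) ↔ n = 0 := by
      constructor
      · intro e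
        have : (n + 1) * m = 1 * m := by rw [e, one_mul]
        have := Nat.eq_of_mul_eq_mul_right hm1 this
        omega
      · rintro rfl; simp
    simp only [e]
    split_ifs <;> simp
  have hmodes : ∀ n, c * t n ≤ ∑ j, eCoeff ((n + 1) * m) (R j) ^ 2 := fun n => by
    refine (hmode n (fun j => a j n) (fun hn => by rw [hn]; exact ha0)).trans ?_
    simp only [hcoef, Fin.sum_univ_two]
    split_ifs with hn
    -- On the mode m the residual is (c₁ - c₂)Ŵ - M_m a. As Ŵ is orthogonal to the range of M_m,
    -- Pythagoras shows that the first term can only increase its norm.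
    · subst hn
      have o0 := h.WHat_M 0
      have o1 := h.WHat_M 1
      have hN := h.WHat_norm
      rw [zero_add, one_mul]
      simp only [Matrix.mulVec, dotProduct, Fin.sum_univ_two]
      nlinarith [sq_nonneg ((c₁ - c₂)), congrArg (· * ((c₁ - c₂) * a 0 0)) o0,
        congrArg (· * ((c₁ - c₂) * a 1 0)) o1, congrArg (· * (c₁ - c₂) ^ 2) hN]
    · exact le_of_eq (by ring)
  have hle : c * ((2 * Real.pi)⁻¹ * sobolev f) ≤ 2 * (ε ^ 2 * C) * sobolev f := by
    refine le_of_tendsto (ht.tendsto_sum_nat.const_mul c) (Eventually.of_forall fun K => ?_)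
    rw [Finset.mul_sum]
    refine (Finset.sum_le_sum fun n _ => hmodes n).trans ?_
    rw [Finset.sum_comm]
    have hinj : Function.Injective fun n : ℕ => (n + 1) * m := fun n n' e =>
      Nat.succ_injective (Nat.eq_of_mul_eq_mul_right hm1 e)
    have h3 : ∀ j, ∑ n ∈ Finset.range K, eCoeff ((n + 1) * m) (R j) ^ 2 ≤
        ε ^ 2 * C * sobolev f := fun j => by
      have h4 := (sum_sq_eCoeff_le (hcR j) ((Finset.range K).map ⟨_, hinj⟩)).trans (hms j)
      rwa [Finset.sum_map] at h4
    rw [Fin.sum_univ_two]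
    have := h3 0
    have := h3 1
    linarith
  have hs0 : sobolev f = 0 := by
    have := sobolev_nonneg f
    nlinarith
  rw [hs0, mul_zero] at ht
  have htn : ∀ n j, 0 ≤ a j n ^ 2 + ((((n + 1) * m - 1 : ℕ) : ℝ) * a j n) ^ 2 := fun n j => by
    positivity
  have ht0 : ∀ n j, a j n = 0 := fun n j => by
    have h5 := (hasSum_zero_iff_of_nonneg fun n => Finset.sum_nonneg fun j _ => htn n j).1 ht
    have h6 := (Finset.sum_eq_zero_iff_of_nonneg fun j _ => htn n j).1 (congrFun h5 n) j
      (Finset.mem_univ j)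
    have := sq_nonneg (a j n)
    have := sq_nonneg ((((n + 1) * m - 1 : ℕ) : ℝ) * a j n)
    exact pow_eq_zero_iff two_ne_zero |>.1 (by linarith)
  have hf0 : f = 0 := by
    refine Subtype.ext (funext fun j => Subtype.ext (ContinuousMap.ext fun w => ?_))
    refine (ha j w).unique ?_
    simp only [ht0, Complex.ofReal_zero, zero_mul]
    exact hasSum_zero
  exact sub_eq_zero.1 hf0

end Uniqueness

/-! ### Smoothness of parametric integrals -/

section ParametricIntegral

variable {E : Type} [NormedAddCommGroup E] [NormedSpace ℝ E]

theorem continuousOn_of_contDiffAt_Icc {F : Type} [NormedAddCommGroup F] [NormedSpace ℝ F] {n : ℕ}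
    {f : ℝ × E → F} {p : E} (hf : ∀ s ∈ Icc (0 : ℝ) 1, ContDiffAt ℝ n f (s, p)) :
    ContinuousOn (fun s => f (s, p)) (Icc 0 1) := fun s hs =>
  (ContinuousAt.comp (g := f) (f := fun s => (s, p)) (hf s hs).continuousAt
    (by fun_prop)).continuousWithinAt

theorem intervalIntegrable_of_contDiffAt_Icc {F : Type} [NormedAddCommGroup F] [NormedSpace ℝ F]
    {n : ℕ} {f : ℝ × E → F} {p : E} (hf : ∀ s ∈ Icc (0 : ℝ) 1, ContDiffAt ℝ n f (s, p)) :
    IntervalIntegrable (fun s => f (s, p)) volume 0 1 := by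
  refine ContinuousOn.intervalIntegrable ?_
  rw [uIcc_of_le zero_le_one]
  exact continuousOn_of_contDiffAt_Icc hf

theorem eventually_contDiffAt_Icc {F : Type} [NormedAddCommGroup F] [NormedSpace ℝ F]
    {n : ℕ} {f : ℝ × E → F} {p : E} (hf : ∀ s ∈ Icc (0 : ℝ) 1, ContDiffAt ℝ n f (s, p)) :
    ∀ᶠ x in 𝓝 p, ∀ s ∈ Icc (0 : ℝ) 1, ContDiffAt ℝ n f (s, x) := by
  refine isCompact_Icc.eventually_forall_of_forall_eventually fun s hs => ?_
  have c1 : Tendsto (fun z : E × ℝ => (z.2, z.1)) (𝓝 (p, s)) (𝓝 (s, p)) :=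
    Continuous.tendsto' (by fun_prop) _ _ rfl
  exact c1.eventually ((hf s hs).eventually (by simp))

theorem continuousAt_integral_Icc {F : Type} [NormedAddCommGroup F] [NormedSpace ℝ F]
    {f : ℝ × E → F} {p : E} (hf : ∀ s ∈ Icc (0 : ℝ) 1, ContDiffAt ℝ (0 : ℕ) f (s, p)) :
    ContinuousAt (fun x => ∫ s in (0 : ℝ)..1, f (s, x)) p := by
  rw [Metric.continuousAt_iff']
  intro ε hε
  have h1 : ∀ᶠ x in 𝓝 p, ∀ s ∈ Icc (0 : ℝ) 1, ‖f (s, x) - f (s, p)‖ ≤ ε / 2 := by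
    refine isCompact_Icc.eventually_forall_of_forall_eventually fun s hs => ?_
    have c1 : Tendsto (fun z : E × ℝ => f (z.2, z.1) - f (z.2, p)) (𝓝 (p, s))
        (𝓝 (f (s, p) - f (s, p))) := by
      refine Tendsto.sub ?_ ?_
      · exact (hf s hs).continuousAt.tendsto.comp (Continuous.tendsto' (by fun_prop) _ _ rfl)
      · exact (hf s hs).continuousAt.tendsto.comp
          ((Continuous.tendsto' (by fun_prop) _ _ rfl : Tendsto (fun z : E × ℝ => (z.2, p))
            (𝓝 (p, s)) (𝓝 (s, p))))
    rw [sub_self] at c1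
    filter_upwards [c1.eventually (Metric.ball_mem_nhds _ (half_pos hε))] with z hz
    exact (mem_ball_zero_iff.1 hz).le
  filter_upwards [h1, eventually_contDiffAt_Icc hf] with x hx hc
  rw [dist_eq_norm, ← intervalIntegral.integral_sub (intervalIntegrable_of_contDiffAt_Icc hc)
    (intervalIntegrable_of_contDiffAt_Icc hf)]
  have h2 := intervalIntegral.norm_integral_le_of_norm_le_const (a := (0 : ℝ)) (b := 1) (C := ε / 2)
    (f := fun s => f (s, x) - f (s, p)) fun s hs => hx s (by
      rw [uIoc_of_le zero_le_one] at hs; exact Ioc_subset_Icc_self hs)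
  rw [sub_zero, abs_one, mul_one] at h2
  linarith

theorem hasFDerivAt_integral_Icc {F : Type} [NormedAddCommGroup F] [NormedSpace ℝ F]
    {f : ℝ × E → F} {p : E} (hf : ∀ s ∈ Icc (0 : ℝ) 1, ContDiffAt ℝ (1 : ℕ) f (s, p)) :
    HasFDerivAt (fun x => ∫ s in (0 : ℝ)..1, f (s, x))
      (∫ s in (0 : ℝ)..1, (fderiv ℝ f (s, p)).comp (ContinuousLinearMap.inr ℝ ℝ E)) p := by
  have hD : ∀ s ∈ Icc (0 : ℝ) 1, ContDiffAt ℝ (0 : ℕ)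
      (fun z : ℝ × E => (fderiv ℝ f z).comp (ContinuousLinearMap.inr ℝ ℝ E)) (s, p) := fun s hs =>
    ((hf s hs).fderiv_right (m := (0 : ℕ)) (by simp)).clm_comp contDiffAt_const
  have iD := intervalIntegrable_of_contDiffAt_Icc hD
  rw [hasFDerivAt_iff_isLittleO, Asymptotics.isLittleO_iff]
  intro ε hε
  -- The middle factor ℝ is a dummy filling the parameter slot of `uniform_strict_deriv`.
  have hF : ∀ s ∈ Icc (0 : ℝ) 1, ContDiffAt ℝ 1 (fun z : ℝ × ℝ × E => f (z.1, z.2.2)) (s, 0, p) :=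
    fun s hs => ContDiffAt.comp (g := f) (f := fun z : ℝ × ℝ × E => (z.1, z.2.2)) (s, 0, p) (hf s hs)
      (by fun_prop)
  have h1 := uniform_strict_deriv (F := fun z : ℝ × ℝ × E => f (z.1, z.2.2)) isCompact_Icc hF hε
  have c1 : Tendsto (fun x : E => ((0 : ℝ), x, p)) (𝓝 p) (𝓝 (0, p, p)) :=
    Continuous.tendsto' (by fun_prop) _ _ rfl
  filter_upwards [c1.eventually h1, eventually_contDiffAt_Icc hf] with x hx hc
  have e : (∫ s in (0 : ℝ)..1, (fderiv ℝ f (s, p)).comp (ContinuousLinearMap.inr ℝ ℝ E)) (x - p) =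
      ∫ s in (0 : ℝ)..1, fderiv ℝ f (s, p) (0, x - p) := by
    rw [ContinuousLinearMap.intervalIntegral_apply iD]
    rfl
  have i1 := intervalIntegrable_of_contDiffAt_Icc hc
  have i2 := intervalIntegrable_of_contDiffAt_Icc hf
  have i3 : IntervalIntegrable (fun s => fderiv ℝ f (s, p) (0, x - p)) volume 0 1 :=
    intervalIntegrable_of_contDiffAt_Icc (f := fun z => fderiv ℝ f z (0, x - p)) fun s hs =>
      ((hf s hs).fderiv_right (m := (0 : ℕ)) (by simp)).clm_apply contDiffAt_const
  rw [e, ← intervalIntegral.integral_sub i1 i2, ← intervalIntegral.integral_sub (i1.sub i2) i3]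
  have h2 := intervalIntegral.norm_integral_le_of_norm_le_const (a := (0 : ℝ)) (b := 1)
    (C := ε * ‖x - p‖) (f := fun s => f (s, x) - f (s, p) - fderiv ℝ f (s, p) (0, x - p))
    fun s hs => by
      rw [uIoc_of_le zero_le_one] at hs
      have hs' := Ioc_subset_Icc_self hs
      refine le_of_eq_of_le ?_ (hx s hs')
      congr 2
      have d1 : HasFDerivAt f (fderiv ℝ f (s, p)) (s, p) :=
        ((hf s hs').differentiableAt (by simp)).hasFDerivAt
      have d2 : HasFDerivAt (fun z : ℝ × ℝ × E => (z.1, z.2.2))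
          ((ContinuousLinearMap.fst ℝ ℝ (ℝ × E)).prod ((ContinuousLinearMap.snd ℝ ℝ E).comp
            (ContinuousLinearMap.snd ℝ ℝ (ℝ × E)))) (s, 0, p) :=
        ContinuousLinearMap.hasFDerivAt ((ContinuousLinearMap.fst ℝ ℝ (ℝ × E)).prod
          ((ContinuousLinearMap.snd ℝ ℝ E).comp (ContinuousLinearMap.snd ℝ ℝ (ℝ × E))))
      have d3 := HasFDerivAt.comp (g := f) (f := fun z : ℝ × ℝ × E => (z.1, z.2.2)) (s, 0, p) d1 d2
      have d4 := d3.fderiv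
      change fderiv ℝ f (s, p) (0, x - p) = fderiv ℝ (f ∘ fun z : ℝ × ℝ × E => (z.1, z.2.2)) (s, 0, p)
        (0, 0, x - p)
      rw [d4]
      rfl
  rw [sub_zero, abs_one, mul_one] at h2
  exact h2

/-- Induction on n: the derivative of the integral is the integral of the partial derivative, an
integral of the same kind with values in a space of operators, so the target space is kept general.
-/
theorem contDiffAt_integral_Icc (n : ℕ) {F : Type} [NormedAddCommGroup F] [NormedSpace ℝ F]
    {f : ℝ × E → F} {p : E} (hf : ∀ s ∈ Icc (0 : ℝ) 1, ContDiffAt ℝ n f (s, p)) :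
    ContDiffAt ℝ n (fun x => ∫ s in (0 : ℝ)..1, f (s, x)) p := by
  induction n generalizing F f p with
  | zero =>
    have h1 := (eventually_contDiffAt_Icc hf).mono fun x hx => continuousAt_integral_Icc hx
    exact contDiffAt_zero.2 ⟨_, h1, fun x hx => ContinuousAt.continuousWithinAt hx⟩
  | succ n ih =>
    push_cast
    refine contDiffAt_succ_iff_hasFDerivAt.2
      ⟨fun x => ∫ s in (0 : ℝ)..1, (fderiv ℝ f (s, x)).comp (ContinuousLinearMap.inr ℝ ℝ E),
        ⟨_, eventually_contDiffAt_Icc hf, fun x hx => hasFDerivAt_integral_Icc fun s hs =>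
          (hx s hs).of_le (by exact_mod_cast Nat.succ_le_succ (Nat.zero_le n))⟩, ?_⟩
    refine ih (f := fun z : ℝ × E => (fderiv ℝ f z).comp (ContinuousLinearMap.inr ℝ ℝ E)) fun s hs => ?_
    exact ((hf s hs).fderiv_right (m := (n : ℕ)) (by push_cast; exact le_rfl)).clm_comp
      contDiffAt_const

end ParametricIntegral

/-- The second derivative is determined by the expansion of second order. -/
theorem deriv_deriv_eq_of_isLittleO {K : ℝ → ℝ} (hK : ContDiffAt ℝ 2 K 0) {q : ℝ}
    (h : (fun t => K t - q * t ^ 2) =o[𝓝 0] fun t => t ^ 2) :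
    deriv K 0 = 0 ∧ deriv (deriv K) 0 = 2 * q := by
  have h0 : K 0 = 0 := by
    have h1 := (Asymptotics.isLittleO_iff.1 h one_pos).self_of_nhds
    simpa using h1
  have hd1 : ∀ᶠ t in 𝓝 (0 : ℝ), HasDerivAt K (deriv K t) t := by
    filter_upwards [hK.eventually (by simp)] with t ht
    exact (ht.differentiableAt (by simp)).hasDerivAt
  have hd2 : HasDerivAt (deriv K) (deriv (deriv K) 0) 0 := by
    have h2 : ContDiffAt ℝ 1 (fderiv ℝ K) 0 := hK.fderiv_right (by norm_num)
    have h3 : ContDiffAt ℝ 1 (deriv K) 0 := by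
      have : deriv K = fun t => fderiv ℝ K t 1 := funext fun t => rfl
      rw [this]
      exact h2.clm_apply contDiffAt_const
    exact (h3.differentiableAt (by simp)).hasDerivAt
  have e1 : deriv K 0 = 0 := by
    have h4 : HasDerivAt K 0 0 := by
      rw [hasDerivAt_iff_isLittleO]
      have h5 : (fun t : ℝ => t ^ 2) =o[𝓝 0] fun t => t := by
        simpa using Asymptotics.isLittleO_pow_id (𝕜 := ℝ) (n := 2) (by norm_num)
      have h6 := (h.trans h5).add (h5.const_mul_left q)
      simpa [h0] using h6
    exact h4.deriv
  refine ⟨e1, ?_⟩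
  obtain ⟨r, hr, hB⟩ := Metric.eventually_nhds_iff_ball.1 hd1
  set p := deriv (deriv K) 0
  have h7 : (fun t => deriv K t - p * t) =o[𝓝[Metric.ball 0 r] 0] fun t : ℝ => (t - 0) ^ 1 := by
    have := (hasDerivAt_iff_isLittleO.1 hd2).mono (nhdsWithin_le_nhds (s := Metric.ball 0 r))
    simpa [e1, mul_comm] using this
  -- Integrating K'(t) = pt + o(t) gives K(t) = pt²/2 + o(t²); comparison with the assumed expansion
  -- then forces p = 2q.
  have h8 := Convex.isLittleO_pow_succ_real (f := fun t => K t - p / 2 * t ^ 2)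
    (convex_ball (0 : ℝ) r) (Metric.mem_ball_self hr) (fun t ht => by
      have := ((hB t ht).sub (((hasDerivAt_id t).pow 2).const_mul (p / 2))).hasDerivWithinAt
        (s := Metric.ball 0 r)
      refine this.congr_deriv ?_
      simp
      ring) h7
  rw [nhdsWithin_eq_nhds.2 (Metric.ball_mem_nhds _ hr)] at h8
  have h9 : (fun t : ℝ => (q - p / 2) * t ^ 2) =o[𝓝 0] fun t => t ^ 2 := by
    have h10 : (fun t => K t - p / 2 * t ^ 2) =o[𝓝 0] fun t : ℝ => t ^ 2 := by
      simpa [h0] using h8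
    have h11 := h10.sub h
    refine h11.congr_left fun t => ?_
    ring
  by_contra hne
  have hq : q - p / 2 ≠ 0 := fun e => hne (by linarith)
  have h12 : (fun t : ℝ => t ^ 2) =o[𝓝 0] fun t => t ^ 2 :=
    (Asymptotics.isBigO_self_const_mul hq (fun t : ℝ => t ^ 2) _).trans_isLittleO h9
  have h13 : ∃ᶠ t in 𝓝 (0 : ℝ), t ^ 2 ≠ 0 := by
    have h14 : ∀ᶠ t in 𝓝[≠] (0 : ℝ), t ^ 2 ≠ 0 := by
      filter_upwards [self_mem_nhdsWithin] with t ht using pow_ne_zero 2 ht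
    exact h14.frequently.filter_mono nhdsWithin_le_nhds
  exact Asymptotics.isLittleO_irrefl h13 h12

/-! ### Expansion of the reduced equation -/

namespace Wiener

/-- `χ` parametrizes the zeros of `Psi`. -/
structure IsChi (m : ℕ) (b lam0 : ℝ) (χ : ℝ × ℝ → (Fin 2 → Ell1)) : Prop where
  contDiffAt : ContDiffAt ℝ ω χ (lam0, 0)
  apply_self : χ (lam0, 0) = 0
  eventually_iff : ∀ᶠ v in 𝓝 (((lam0, 0), 0) : (ℝ × ℝ) × (Fin 2 → Ell1)),
    Psi m b lam0 v = 0 ↔ χ v.1 = v.2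

/-- The reduced scalar equation. -/
def redH (m : ℕ) (b lam0 : ℝ) (χ : ℝ × ℝ → (Fin 2 → Ell1)) (p : ℝ × ℝ) : ℝ :=
  ell m b lam0 (GW m b (p.1, χ p))

namespace IsChi

variable {m : ℕ} {b lam0 : ℝ} {χ : ℝ × ℝ → (Fin 2 → Ell1)} (h : IsBif m b lam0)
  (hχ : IsChi m b lam0 χ)

include hχ in
theorem tendsto : Tendsto χ (𝓝 (lam0, 0)) (𝓝 0) := by
  have := hχ.contDiffAt.continuousAt.tendsto
  rwa [hχ.apply_self] at this

include hχ in
theorem tendsto_prod : Tendsto (fun p : ℝ × ℝ => (p, χ p)) (𝓝 (lam0, 0)) (𝓝 ((lam0, 0), 0)) :=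
  tendsto_id.prodMk_nhds hχ.tendsto

include h hχ

theorem eventually_eq : ∀ᶠ p in 𝓝 ((lam0, 0) : ℝ × ℝ), coord 0 (χ p 1) = p.2 ∧
    GW m b (p.1, χ p) = redH m b lam0 χ p • wvec m b lam0 := by
  filter_upwards [hχ.tendsto_prod.eventually hχ.eventually_iff] with p hp
  exact (Psi_eq_zero_iff h (p, χ p)).1 (hp.2 rfl)

theorem contDiffAt_redH : ContDiffAt ℝ ω (redH m b lam0 χ) (lam0, 0) := by
  have h1 : ContDiffAt ℝ ω (GW m b) (lam0, χ (lam0, 0)) := by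
    rw [hχ.apply_self]
    exact contDiffAt_GW (isUnit_wDen_zero h.mem)
  have h2 : ContDiffAt ℝ ω (fun p : ℝ × ℝ => GW m b (p.1, χ p)) (lam0, 0) :=
    ContDiffAt.comp (g := GW m b) (f := fun p : ℝ × ℝ => (p.1, χ p)) (lam0, 0) h1
      (contDiffAt_fst.prodMk hχ.contDiffAt)
  exact (ell m b lam0).contDiff.contDiffAt.comp _ h2

/-- Strict differentiability with an invertible partial derivative makes the residual control the
distance to the exact solution with the same parameters. -/
theorem exists_norm_sub_le : ∃ C > 0, ∀ᶠ v in 𝓝 (((lam0, 0), 0) : (ℝ × ℝ) × (Fin 2 → Ell1)),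
    ‖v.2 - χ v.1‖ ≤ C * ‖Psi m b lam0 v‖ := by
  obtain ⟨e, he⟩ := isInvertible_aug h
  set C := ‖(e.symm : (Fin 2 → Ell1) →L[ℝ] (Fin 2 → Ell1))‖ + 1 with hC
  have hC0 : 0 < C := by positivity
  have hs := (contDiffAt_Psi h (n := 1)).hasStrictFDerivAt one_ne_zero
  have h1 := Asymptotics.isLittleO_iff.1 hs.isLittleO (c := (2 * C)⁻¹) (by positivity)
  have c1 : Tendsto (fun v : (ℝ × ℝ) × (Fin 2 → Ell1) => (v, (v.1, χ v.1)))
      (𝓝 ((lam0, 0), 0)) (𝓝 (((lam0, 0), 0), ((lam0, 0), 0))) := by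
    refine tendsto_id.prodMk_nhds ?_
    exact hχ.tendsto_prod.comp (Continuous.tendsto' continuous_fst _ _ rfl)
  have c2 : Tendsto (fun v : (ℝ × ℝ) × (Fin 2 → Ell1) => (v.1, χ v.1))
      (𝓝 ((lam0, 0), 0)) (𝓝 ((lam0, 0), 0)) :=
    hχ.tendsto_prod.comp (Continuous.tendsto' continuous_fst _ _ rfl)
  refine ⟨2 * C, by positivity, ?_⟩
  filter_upwards [c1.eventually h1, c2.eventually hχ.eventually_iff] with v hv hz
  have hz' : Psi m b lam0 (v.1, χ v.1) = 0 := hz.2 rfl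
  have e1 : v - (v.1, χ v.1) = (0, v.2 - χ v.1) := by ext1 <;> simp
  have e2 : fderiv ℝ (Psi m b lam0) ((lam0, 0), 0) (0, v.2 - χ v.1) = e (v.2 - χ v.1) := by
    have := congrArg (fun L => L (v.2 - χ v.1)) (fderiv_Psi h)
    rw [← he] at this
    exact this
  rw [e1, e2, hz', sub_zero] at hv
  have e3 : ‖((0 : ℝ × ℝ), v.2 - χ v.1)‖ = ‖v.2 - χ v.1‖ := by simp [Prod.norm_def]
  rw [e3] at hv
  have h3 : ‖v.2 - χ v.1‖ ≤ C * ‖e (v.2 - χ v.1)‖ := by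
    have h4 := (e.symm : (Fin 2 → Ell1) →L[ℝ] (Fin 2 → Ell1)).le_opNorm (e (v.2 - χ v.1))
    rw [ContinuousLinearEquiv.coe_coe, e.symm_apply_apply] at h4
    refine h4.trans (mul_le_mul_of_nonneg_right ?_ (norm_nonneg _))
    rw [hC]; linarith
  have h5 : ‖e (v.2 - χ v.1)‖ ≤ ‖Psi m b lam0 v‖ + (2 * C)⁻¹ * ‖v.2 - χ v.1‖ := by
    have := norm_sub_norm_le (e (v.2 - χ v.1)) (Psi m b lam0 v)
    rw [norm_sub_rev] at this
    linarith
  have h6 := h3.trans (mul_le_mul_of_nonneg_left h5 hC0.le)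
  have h7 : C * (‖Psi m b lam0 v‖ + (2 * C)⁻¹ * ‖v.2 - χ v.1‖) =
      C * ‖Psi m b lam0 v‖ + ‖v.2 - χ v.1‖ / 2 := by
    field_simp
  linarith

/-- The reduced equation is insensitive to the approximation of the solution. -/
theorem abs_ell_sub_redH_le {ε : ℝ} (hε : 0 < ε) :
    ∀ᶠ v in 𝓝 (((lam0, 0), 0) : (ℝ × ℝ) × (Fin 2 → Ell1)),
      |ell m b lam0 (GW m b (v.1.1, v.2)) - redH m b lam0 χ v.1| ≤ ε * ‖Psi m b lam0 v‖ := by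
  obtain ⟨C, hC, hv⟩ := hχ.exists_norm_sub_le h
  have hs : HasStrictFDerivAt (fun z => ell m b lam0 (GW m b z))
      ((ell m b lam0).comp (fderiv ℝ (GW m b) (lam0, 0))) (lam0, 0) :=
    (ell m b lam0).hasStrictFDerivAt.comp (lam0, (0 : Fin 2 → Ell1))
      ((contDiffAt_GW (n := 1) (isUnit_wDen_zero h.mem)).hasStrictFDerivAt one_ne_zero)
  have h1 := Asymptotics.isLittleO_iff.1 hs.isLittleO (c := ε / C) (by positivity)
  have c1 : Tendsto (fun v : (ℝ × ℝ) × (Fin 2 → Ell1) => ((v.1.1, v.2), (v.1.1, χ v.1)))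
      (𝓝 ((lam0, 0), 0)) (𝓝 ((lam0, 0), (lam0, 0))) := by
    refine Tendsto.prodMk_nhds (Continuous.tendsto' (by fun_prop) _ _ rfl)
      (Tendsto.prodMk_nhds (Continuous.tendsto' (by fun_prop) _ _ rfl) ?_)
    exact hχ.tendsto.comp (Continuous.tendsto' continuous_fst _ _ rfl)
  filter_upwards [hv, c1.eventually h1] with v h2 h3
  have e1 : ((v.1.1, v.2) - (v.1.1, χ v.1) : ℝ × (Fin 2 → Ell1)) = (0, v.2 - χ v.1) := by
    ext1 <;> simp
  -- The first order term disappears because `ell` annihilates the range of the linearization. The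
  -- error is therefore an arbitrarily small multiple of the distance, not merely proportional to
  -- it.
  rw [e1, ContinuousLinearMap.comp_apply, fderiv_GW h.three_le h.mem,
    ContinuousLinearMap.comp_apply, ContinuousLinearMap.coe_snd', ell_blockOp h, sub_zero] at h3
  have e3 : ‖((0 : ℝ), v.2 - χ v.1)‖ = ‖v.2 - χ v.1‖ := by simp [Prod.norm_def]
  rw [e3] at h3
  refine h3.trans ?_
  calc ε / C * ‖v.2 - χ v.1‖ ≤ ε / C * (C * ‖Psi m b lam0 v‖) := by gcongr
    _ = ε * ‖Psi m b lam0 v‖ := by field_simp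

end IsChi

end Wiener

/-! ### The approximate solution and the expansion of the reduced equation -/

namespace Wiener

section Approx

variable (m : ℕ) (b lam0 : ℝ)

/-- The first order coefficient of the reduced equation. -/
def rho (lam : ℝ) : ℝ :=
  nuW m b lam0 * (b / b ^ m) * (m * (lam - lam0) *
    ((m * lam0 - 1 - m * b ^ 2) + (m * lam0 - m + 1) + m * (lam - lam0))) /
      ((m * lam0 - m + 1) - (m * lam0 - 1 - m * b ^ 2) - m * (lam - lam0))

/-- The first component of the approximate solution. -/
def apxA (lam : ℝ) : ℝ :=
  b / b ^ m * (m * lam - m + 1) + rho m b lam0 lam / nuW m b lam0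

/-- The size of the quadratic term. -/
def apxQ (lam : ℝ) : ℝ := m * (b * apxA m b lam0 lam - b ^ m) ^ 2

/-- The second order correction. -/
def apxK (lam : ℝ) : Fin 2 → ℝ :=
  ![-(apxQ m b lam0 lam * (b * (2 * m * lam - 2 * m + 1))) / (M b (2 * m) lam).det,
    -(apxQ m b lam0 lam * b ^ (2 * m)) / (M b (2 * m) lam).det]

/-- The approximate solution. -/
def apx (lam t : ℝ) : Fin 2 → Ell1 :=
  path ![apxA m b lam0 lam, 1] (apxK m b lam0 lam) 0 t

theorem continuous_apx (lam : ℝ) : Continuous (apx m b lam0 lam) := by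
  refine continuous_pi fun j => ?_
  unfold apx path
  fun_prop

theorem apx_zero (lam : ℝ) : apx m b lam0 lam 0 = 0 := by
  funext j; simp [apx, path]

theorem coord_apx (lam t : ℝ) : coord 0 (apx m b lam0 lam t 1) = t := by
  rw [apx, path, map_add, map_smul, map_smul, coord_δ, coord_δ]
  simp

/-- The third order coefficient at `λ₀` of the approximate solution. -/
def cub : ℝ :=
  let a := apxA m b lam0 lam0
  let A := apxK m b lam0 lam0 0
  let C := apxK m b lam0 lam0 1
  WHat m b lam0 0 * ((m - 1) * a * A + (m - 1) * (m - 2) / 2 * a ^ 3 +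
        (m - 1) * a - (m - 1) * b ^ m * C -
        m * (m - 1) / 2 * (b ^ m / b) - (m - 1) ^ 2 * a * (a ^ 2 - 1) -
        (2 * m - 1) * (1 - lam0) * a * A + (m - 1) * (1 - lam0) * a * A) +
    WHat m b lam0 1 * (b * (a * ((m - 1) * (b ^ m / b ^ 2) * C +
        (m - 1) * (m - 2) / 2 * (b ^ m / b ^ 3)) -
        ((m - 1) * C / b + (m - 1) * (m - 2) / 2 / b ^ 2)) -
        (m - 1) ^ 2 * ((b ^ m / b ^ 2) * a - 1 / b) -
        (2 * m - 1) * C * (a * (b ^ m / b) - lam0) -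
        (b * (2 * m - 1) * (b ^ (2 * m) / b ^ 2 * A - b ^ m / b * a * A) -
          (m - 1) * (A * (b ^ (2 * m) / b) - lam0 * C)))

end Approx

variable {m : ℕ} {b lam0 : ℝ} (h : IsBif m b lam0)

include h

/-- The numbers a(λ) and ρ(λ) solve M_m(λ)(a, 1) = b-independent normalization aside, ρŴ: the second
row expresses a through ρ, and substitution into the first row determines ρ. The denominator is
nonzero near λ₀ because the two factors of the eigenvalue equation have opposite signs. -/
theorem rho_row_zero {lam : ℝ}
    (hd : (m * lam0 - m + 1) - (m * lam0 - 1 - m * b ^ 2) - m * (lam - lam0) ≠ 0) :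
    apxA m b lam0 lam * (m * lam - m * b ^ 2 - 1) + b ^ (m + 1) =
      rho m b lam0 lam * WHat m b lam0 0 := by
  have h1 := h.mul_eq
  have hb := h.mem.1.ne'
  have hbm := (h.pow_pos m).ne'
  have hnu := h.nuW_pos.ne'
  rw [pow_mul'] at h1
  rw [apxA, rho, WHat_zero, pow_succ b m]
  generalize nuW m b lam0 = nu at *
  generalize b ^ m = B at *
  obtain ⟨D, hD⟩ : ∃ D, D = (m * lam0 - m + 1) - (m * lam0 - 1 - m * b ^ 2) - m * (lam - lam0) :=
    ⟨_, rfl⟩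
  rw [← hD] at hd ⊢
  field_simp
  -- The eigenvalue equation at λ₀ removes the constant term of the determinant, viewed as a
  -- polynomial in m(λ - λ₀).
  linear_combination D * h1 + (m * (lam - lam0)) *
    ((m * lam0 - 1 - m * b ^ 2) + (m * lam0 - m + 1) + m * (lam - lam0)) * hD

theorem rho_row_one {lam : ℝ} :
    -b ^ m * apxA m b lam0 lam + b * (m * lam - (m - 1)) = rho m b lam0 lam * WHat m b lam0 1 := by
  have hb := h.mem.1.ne'
  have hbm := (h.pow_pos m).ne'
  have hnu := h.nuW_pos.ne'
  rw [apxA, WHat_one]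
  field_simp
  ring

/-- The first mode is chosen so that the linear coefficient is ρ(λ) times the cokernel vector. The
second mode is obtained from Cramer's rule for M_{2m}(λ)(A, C) = -(m(ba - b^m)², 0), which cancels
the quadratic coefficient. The cubic coefficient is evaluated at λ₀ only. -/
theorem exists_hasJet_apx {lam : ℝ} (hdet : (M b (2 * m) lam).det ≠ 0)
    (hd : (m * lam0 - m + 1) - (m * lam0 - 1 - m * b ^ 2) - m * (lam - lam0) ≠ 0) :
    ∃ p₃ : Fin 2 → Ell1,
      (∀ j, HasJet (fun t => GW m b (lam, apx m b lam0 lam t) j) 0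
        (rho m b lam0 lam • wvec m b lam0 j) 0 (p₃ j)) ∧
      (lam = lam0 → ell m b lam0 p₃ = cub m b lam0) := by
  obtain ⟨N, hN⟩ := exists_degree h.three_le 0
  have hmN : m = N + 3 := by omega
  have hmr : (m : ℝ) = N + 3 := by exact_mod_cast hmN
  obtain ⟨p, hp, hp3⟩ := hasJet_GW_zero hN h.mem lam (apxA m b lam0 lam) 1
    (apxK m b lam0 lam 0) (apxK m b lam0 lam 1)
  obtain ⟨q, hq, hq3⟩ := hasJet_GW_one hN h.mem lam (apxA m b lam0 lam) 1
    (apxK m b lam0 lam 0) (apxK m b lam0 lam 1)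
  have ek : ![apxK m b lam0 lam 0, apxK m b lam0 lam 1] = apxK m b lam0 lam := by
    funext j; fin_cases j <;> rfl
  have edet : (M b (2 * m) lam).det = (2 * m * lam - 1 - 2 * m * b ^ 2) *
      (b * (2 * m * lam - 2 * m + 1)) + b ^ (2 * m + 1) * b ^ (2 * m) := by
    rw [M, Matrix.det_fin_two_of]; push_cast; ring
  have ew : ∀ j, wvec m b lam0 j = WHat m b lam0 j • δ 0 := fun _ => rfl
  have hb := h.mem.1.ne'
  rw [ek] at hp hq
  refine ⟨![p, q], fun j => ?_, fun hl => ?_⟩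
  · fin_cases j
    · refine hp.congr_coeff rfl ?_ ?_ rfl
      · change _ = rho m b lam0 lam • wvec m b lam0 0
        rw [ew, smul_smul, ← rho_row_zero h hd]
        congr 1
        rw [hmr, show N + 4 = m + 1 by omega]
        push_cast
        ring
      · convert zero_smul ℝ _ using 2
        have e1 : apxK m b lam0 lam 0 * (2 * m * lam - 2 * m * b ^ 2 - 1) +
            b ^ (2 * m + 1) * apxK m b lam0 lam 1 + apxQ m b lam0 lam = 0 := by
          simp only [apxK, Matrix.cons_val_zero, Matrix.cons_val_one]
          field_simp
          rw [edet]
          ring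
        rw [apxQ, hmr, show 2 * m + 1 = 2 * N + 7 by omega] at e1
        have e2 : b ^ (N + 3) = b ^ m := by rw [hmN]
        rw [e2]
        linear_combination (2 * (((0 : ℕ) : ℝ) + 1)) * e1
    · refine hq.congr_coeff rfl ?_ ?_ rfl
      · change _ = rho m b lam0 lam • wvec m b lam0 1
        rw [ew, smul_smul, ← rho_row_one h]
        congr 1
        rw [hmr, ← hmN]
        push_cast
        ring
      · convert zero_smul ℝ _ using 2
        have e1 : -b ^ (2 * m) * apxK m b lam0 lam 0 +
            b * (2 * m * lam - 2 * m + 1) * apxK m b lam0 lam 1 = 0 := by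
          simp only [apxK, Matrix.cons_val_zero, Matrix.cons_val_one]
          ring
        rw [hmr, show 2 * m = 2 * N + 6 by omega] at e1
        linear_combination (2 * (((0 : ℕ) : ℝ) + 1)) * e1
  · subst hl
    rw [ell_apply]
    simp only [Matrix.cons_val_zero, Matrix.cons_val_one]
    rw [hp3, hq3, cub]
    have e0 : (N : ℝ) = m - 3 := by linarith
    have e2 : b ^ (N + 2) = b ^ m / b := by rw [hmN, pow_succ b (N + 2)]; field_simp
    have e3 : b ^ (N + 1) = b ^ m / b ^ 2 := by rw [hmN]; field_simp; ring
    have e4 : b ^ N = b ^ m / b ^ 3 := by rw [hmN]; field_simp; ring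
    have e5 : b ^ (2 * N + 5) = b ^ (2 * m) / b := by
      rw [show 2 * m = 2 * N + 5 + 1 by omega, pow_succ b (2 * N + 5)]; field_simp
    have e6 : b ^ (2 * N + 4) = b ^ (2 * m) / b ^ 2 := by
      rw [show 2 * m = 2 * N + 4 + 2 by omega]; field_simp; ring
    have e7 : b ^ (N + 3) = b ^ m := by rw [hmN]
    rw [e2, e3, e4, e5, e6, e7, e0]
    push_cast
    ring

end Wiener

namespace Wiener

theorem rho_self (m : ℕ) (b lam0 : ℝ) : rho m b lam0 lam0 = 0 := by
  rw [rho]; simp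

variable {m : ℕ} {b lam0 : ℝ} {χ : ℝ × ℝ → (Fin 2 → Ell1)} (h : IsBif m b lam0)
  (hχ : IsChi m b lam0 χ)

include h

theorem eventually_nondegenerate : ∀ᶠ lam in 𝓝 lam0, (M b (2 * m) lam).det ≠ 0 ∧
    (m * lam0 - m + 1) - (m * lam0 - 1 - m * b ^ 2) - m * (lam - lam0) ≠ 0 := by
  have h1 : ContinuousAt (fun lam => (M b (2 * m) lam).det) lam0 := by
    simp only [M, Matrix.det_fin_two_of]
    fun_prop
  have h2 : ContinuousAt (fun lam : ℝ =>
      (m * lam0 - m + 1) - (m * lam0 - 1 - m * b ^ 2) - m * (lam - lam0)) lam0 := by fun_prop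
  refine (h1.eventually_ne (h.det_ne_zero le_rfl)).and (h2.eventually_ne ?_)
  have h3 := h.pos
  have h4 := h.neg
  rw [sub_self, mul_zero, sub_zero]
  exact ne_of_lt (by linarith)

theorem exists_hasJet_GW_apx {lam : ℝ} (hdet : (M b (2 * m) lam).det ≠ 0)
    (hd : (m * lam0 - m + 1) - (m * lam0 - 1 - m * b ^ 2) - m * (lam - lam0) ≠ 0) :
    ∃ p₃ : Fin 2 → Ell1, HasJet (fun t => GW m b (lam, apx m b lam0 lam t)) 0
        (rho m b lam0 lam • wvec m b lam0) 0 p₃ ∧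
      (lam = lam0 → ell m b lam0 p₃ = cub m b lam0) := by
  obtain ⟨p, hp, he⟩ := exists_hasJet_apx h hdet hd
  exact ⟨p, Asymptotics.isBigO_pi.2 hp, he⟩

/-- The projection removes the linear term, the quadratic one is zero, and the amplitude condition
holds exactly along the curve. -/
theorem isBigO_Psi_apx {lam : ℝ} (hdet : (M b (2 * m) lam).det ≠ 0)
    (hd : (m * lam0 - m + 1) - (m * lam0 - 1 - m * b ^ 2) - m * (lam - lam0) ≠ 0) :
    (fun t => Psi m b lam0 ((lam, t), apx m b lam0 lam t)) =O[𝓝 0] fun t : ℝ => t ^ 3 := by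
  obtain ⟨p, hp, -⟩ := exists_hasJet_GW_apx h hdet hd
  have h1 := hp.sub ((hp.map (ell m b lam0)).map ((1 : ℝ →L[ℝ] ℝ).smulRight (wvec m b lam0)))
  have h2 : (fun t : ℝ => t ^ 4) =O[𝓝 0] fun t : ℝ => t ^ 3 :=
    (Asymptotics.isLittleO_pow_pow (by norm_num)).isBigO
  have h3 : ∀ q : Fin 2 → Ell1, (fun t : ℝ => t ^ 3 • q) =O[𝓝 0] fun t : ℝ => t ^ 3 := fun q => by
    simpa using (Asymptotics.isBigO_refl (fun t : ℝ => t ^ 3) (𝓝 0)).smul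
      (Asymptotics.isBigO_const_const q (one_ne_zero (α := ℝ)) (𝓝 0))
  refine ((Asymptotics.IsBigO.trans h1 h2).add
    (h3 (p - ell m b lam0 p • wvec m b lam0))).congr_left fun t => ?_
  rw [Psi, coord_apx]
  simp [ell_wvec h]

include hχ

theorem eventually_apx {ε : ℝ} (hε : 0 < ε) : ∀ᶠ lam in 𝓝 lam0, ∀ᶠ t in 𝓝 (0 : ℝ),
    |ell m b lam0 (GW m b (lam, apx m b lam0 lam t)) - redH m b lam0 χ (lam, t)| ≤
      ε * ‖Psi m b lam0 ((lam, t), apx m b lam0 lam t)‖ := by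
  have h1 := eventually_eventually_nhds.2 (hχ.abs_ell_sub_redH_le h hε)
  have c1 : Tendsto (fun lam : ℝ => (((lam, (0 : ℝ)), (0 : Fin 2 → Ell1)))) (𝓝 lam0)
      (𝓝 ((lam0, 0), 0)) := Continuous.tendsto' (by fun_prop) _ _ rfl
  filter_upwards [c1.eventually h1] with lam hl
  have c2 : Tendsto (fun t : ℝ => (((lam, t), apx m b lam0 lam t))) (𝓝 0) (𝓝 ((lam, 0), 0)) := by
    refine Tendsto.prodMk_nhds (Continuous.tendsto' (by fun_prop) _ _ rfl) ?_
    exact (continuous_apx m b lam0 lam).tendsto' _ _ (apx_zero m b lam0 lam)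
  exact c2.eventually hl

/-- Along the approximate curve the component is ρ(λ)t + O(t³), and passing to the exact branch
costs at most the residual, again O(t³). There is no t² term, for every λ near λ₀. -/
theorem isBigO_redH : ∀ᶠ lam in 𝓝 lam0,
    (fun t => redH m b lam0 χ (lam, t) - rho m b lam0 lam * t) =O[𝓝 0] fun t : ℝ => t ^ 3 := by
  filter_upwards [eventually_apx h hχ one_pos, eventually_nondegenerate h] with lam h1 h2
  obtain ⟨p, hp, -⟩ := exists_hasJet_GW_apx h h2.1 h2.2
  have h3 : (fun t => ell m b lam0 (GW m b (lam, apx m b lam0 lam t)) - redH m b lam0 χ (lam, t))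
      =O[𝓝 0] fun t : ℝ => t ^ 3 := by
    refine (Asymptotics.IsBigO.of_bound 1 ?_).trans (isBigO_Psi_apx h h2.1 h2.2)
    simpa using h1
  have h4 := hp.map (ell m b lam0)
  have h5 : (fun t : ℝ => t ^ 4) =O[𝓝 0] fun t : ℝ => t ^ 3 :=
    (Asymptotics.isLittleO_pow_pow (by norm_num)).isBigO
  have h6 : (fun t : ℝ => t ^ 3 • ell m b lam0 p) =O[𝓝 0] fun t : ℝ => t ^ 3 := by
    simpa using (Asymptotics.isBigO_refl (fun t : ℝ => t ^ 3) (𝓝 0)).smul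
      (Asymptotics.isBigO_const_const (ell m b lam0 p) (one_ne_zero (α := ℝ)) (𝓝 0))
  refine (((Asymptotics.IsBigO.trans h4 h5).add h6).sub h3).congr_left fun t => ?_
  rw [map_smul, ell_wvec h]
  simp
  ring

/-- At λ₀ the linear coefficient vanishes. The passage to the exact branch now costs an arbitrarily
small multiple of t³, so the cubic coefficient of the approximate curve is the true one. -/
theorem isLittleO_redH :
    (fun t => redH m b lam0 χ (lam0, t) - cub m b lam0 * t ^ 3) =o[𝓝 0] fun t : ℝ => t ^ 3 := by
  have h2 := (eventually_nondegenerate h).self_of_nhds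
  obtain ⟨p, hp, hc⟩ := exists_hasJet_GW_apx h h2.1 h2.2
  obtain ⟨C, hC, hb⟩ := (isBigO_Psi_apx h h2.1 h2.2).exists_pos
  have h3 : (fun t => ell m b lam0 (GW m b (lam0, apx m b lam0 lam0 t)) - redH m b lam0 χ (lam0, t))
      =o[𝓝 0] fun t : ℝ => t ^ 3 := by
    refine Asymptotics.isLittleO_iff.2 fun ε hε => ?_
    filter_upwards [(eventually_apx h hχ (div_pos hε hC)).self_of_nhds, hb.bound] with t h4 h5
    refine h4.trans ?_
    calc ε / C * ‖Psi m b lam0 ((lam0, t), apx m b lam0 lam0 t)‖ ≤ ε / C * (C * ‖t ^ 3‖) := by gcongr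
      _ = ε * ‖t ^ 3‖ := by field_simp
  have h4 := hp.map (ell m b lam0)
  have h5 : (fun t : ℝ => t ^ 4) =o[𝓝 0] fun t : ℝ => t ^ 3 :=
    Asymptotics.isLittleO_pow_pow (by norm_num)
  refine ((Asymptotics.IsBigO.trans_isLittleO h4 h5).sub h3).congr_left fun t => ?_
  rw [map_smul, ell_wvec h, hc rfl, rho_self]
  simp
  ring

end Wiener

/-! ### The reduced equation divided by the amplitude -/

namespace Wiener

section Reduced

variable (m : ℕ) (b lam0 : ℝ) (χ : ℝ × ℝ → (Fin 2 → Ell1))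

/-- The `t`-derivative of the reduced equation. -/
def redHt (p : ℝ × ℝ) : ℝ := fderiv ℝ (redH m b lam0 χ) p (0, 1)

/-- The reduced equation divided by `t`. -/
def redK (p : ℝ × ℝ) : ℝ := ∫ s in (0 : ℝ)..1, redHt m b lam0 χ (p.1, s * p.2)

end Reduced

variable {m : ℕ} {b lam0 : ℝ} {χ : ℝ × ℝ → (Fin 2 → Ell1)} (h : IsBif m b lam0)
  (hχ : IsChi m b lam0 χ)

include h hχ

theorem contDiffAt_redHt : ContDiffAt ℝ ω (redHt m b lam0 χ) (lam0, 0) :=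
  ((hχ.contDiffAt_redH h).fderiv_right (m := ω) (by simp)).clm_apply contDiffAt_const

theorem contDiffAt_redK (n : ℕ) : ContDiffAt ℝ n (redK m b lam0 χ) (lam0, 0) := by
  refine contDiffAt_integral_Icc n (f := fun z : ℝ × ℝ × ℝ => redHt m b lam0 χ (z.2.1, z.1 * z.2.2))
    fun s hs => ?_
  refine ContDiffAt.comp (g := redHt m b lam0 χ) (f := fun z : ℝ × ℝ × ℝ => (z.2.1, z.1 * z.2.2))
    (s, lam0, 0) ?_ (by fun_prop)
  simp only [mul_zero]
  exact (contDiffAt_redHt h hχ).of_le le_top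

theorem redH_zero : ∀ᶠ lam in 𝓝 lam0, redH m b lam0 χ (lam, 0) = 0 := by
  filter_upwards [isBigO_redH h hχ] with lam hl
  have := (Asymptotics.IsBigO.eq_zero_imp hl).self_of_nhds (by simp)
  simpa using this

theorem hasDerivAt_redH : ∀ᶠ lam in 𝓝 lam0,
    HasDerivAt (fun t => redH m b lam0 χ (lam, t)) (rho m b lam0 lam) 0 := by
  filter_upwards [isBigO_redH h hχ, redH_zero h hχ] with lam hl h0
  have h1 : (fun t : ℝ => t ^ 3) =o[𝓝 0] fun t : ℝ => t := by
    simpa using Asymptotics.isLittleO_pow_pow (𝕜 := ℝ) (m := 1) (n := 3) (by norm_num)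
  rw [hasDerivAt_iff_isLittleO]
  have h2 := hl.trans_isLittleO h1
  simpa [h0, mul_comm] using h2

theorem eventually_differentiableAt_redH :
    ∀ᶠ p in 𝓝 ((lam0, 0) : ℝ × ℝ), DifferentiableAt ℝ (redH m b lam0 χ) p := by
  filter_upwards [((hχ.contDiffAt_redH h).of_le (m := 1) le_top).eventually (by simp)] with p hp
  exact hp.differentiableAt (by simp)

theorem eventually_continuousAt_redHt :
    ∀ᶠ p in 𝓝 ((lam0, 0) : ℝ × ℝ), ContinuousAt (redHt m b lam0 χ) p := by
  filter_upwards [((contDiffAt_redHt h hχ).of_le (m := 1) le_top).eventually (by simp)] with p hp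
  exact hp.continuousAt

omit h hχ in
theorem hasDerivAt_slice {p : ℝ × ℝ} (hp : DifferentiableAt ℝ (redH m b lam0 χ) p) :
    HasDerivAt (fun t => redH m b lam0 χ (p.1, t)) (redHt m b lam0 χ p) p.2 := by
  have h1 : HasDerivAt (fun t : ℝ => (p.1, t)) ((0 : ℝ), (1 : ℝ)) p.2 :=
    (hasDerivAt_const _ _).prodMk (hasDerivAt_id _)
  exact hp.hasFDerivAt.comp_hasDerivAt p.2 h1

theorem redK_zero : ∀ᶠ lam in 𝓝 lam0, redK m b lam0 χ (lam, 0) = rho m b lam0 lam := by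
  have c1 : Tendsto (fun lam : ℝ => (lam, (0 : ℝ))) (𝓝 lam0) (𝓝 (lam0, 0)) :=
    Continuous.tendsto' (by fun_prop) _ _ rfl
  filter_upwards [hasDerivAt_redH h hχ, c1.eventually (eventually_differentiableAt_redH h hχ)]
    with lam h1 h2
  rw [redK]
  simp only [mul_zero, intervalIntegral.integral_const, sub_zero, one_smul]
  exact (hasDerivAt_slice h2).unique h1

/-- Hadamard's lemma: H vanishes at t = 0, so it is t times the mean of ∂_t H along the segment from
0 to t. -/
theorem redH_eq_mul : ∀ᶠ p in 𝓝 ((lam0, 0) : ℝ × ℝ),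
    redH m b lam0 χ p = p.2 * redK m b lam0 χ p := by
  obtain ⟨r, hr, hB⟩ := Metric.eventually_nhds_iff_ball.1
    ((eventually_differentiableAt_redH h hχ).and (eventually_continuousAt_redHt h hχ))
  have c1 : Tendsto (fun p : ℝ × ℝ => p.1) (𝓝 (lam0, 0)) (𝓝 lam0) := continuous_fst.tendsto' _ _ rfl
  filter_upwards [Metric.ball_mem_nhds _ hr, c1.eventually (redH_zero h hχ)] with p hp h0
  have hseg : ∀ s ∈ Icc (0 : ℝ) 1, (p.1, s * p.2) ∈ Metric.ball ((lam0, 0) : ℝ × ℝ) r := by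
    intro s hs
    rw [Metric.mem_ball, Prod.dist_eq, max_lt_iff] at hp ⊢
    refine ⟨hp.1, ?_⟩
    have h2 := hp.2
    rw [dist_zero_right, Real.norm_eq_abs] at h2
    simp only [dist_zero_right, Real.norm_eq_abs, abs_mul, abs_of_nonneg hs.1]
    exact (mul_le_of_le_one_left (abs_nonneg _) hs.2).trans_lt h2
  have hder : ∀ s ∈ uIcc (0 : ℝ) 1, HasDerivAt (fun s => redH m b lam0 χ (p.1, s * p.2))
      (redHt m b lam0 χ (p.1, s * p.2) * p.2) s := by
    intro s hs
    rw [uIcc_of_le zero_le_one] at hs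
    have h3 := hasDerivAt_slice (hB _ (hseg s hs)).1
    exact HasDerivAt.comp (h₂ := fun t => redH m b lam0 χ (p.1, t)) (h := fun s => s * p.2) s h3
      (by simpa using (hasDerivAt_id s).mul_const p.2)
  have hcont : ContinuousOn (fun s => redHt m b lam0 χ (p.1, s * p.2)) (uIcc 0 1) := by
    intro s hs
    rw [uIcc_of_le zero_le_one] at hs
    exact (ContinuousAt.comp (g := redHt m b lam0 χ) (f := fun s => (p.1, s * p.2))
      (hB _ (hseg s hs)).2 (by fun_prop)).continuousWithinAt
  have h4 := intervalIntegral.integral_eq_sub_of_hasDerivAt hder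
    (hcont.mul continuousOn_const).intervalIntegrable
  rw [intervalIntegral.integral_mul_const, one_mul, zero_mul, h0, sub_zero] at h4
  rw [redK, mul_comm, h4]

omit h hχ in
theorem eventually_slice {P : ℝ × ℝ → Prop} {lam0 : ℝ} (hP : ∀ᶠ p in 𝓝 (lam0, 0), P p) :
    ∀ᶠ lam in 𝓝 lam0, ∀ᶠ t in 𝓝 (0 : ℝ), P (lam, t) := by
  have c1 : Tendsto (fun lam : ℝ => (lam, (0 : ℝ))) (𝓝 lam0) (𝓝 (lam0, 0)) :=
    Continuous.tendsto' (by fun_prop) _ _ rfl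
  filter_upwards [c1.eventually (eventually_eventually_nhds.2 hP)] with lam hl
  have c2 : Tendsto (fun t : ℝ => (lam, t)) (𝓝 0) (𝓝 (lam, 0)) :=
    Continuous.tendsto' (by fun_prop) _ _ rfl
  exact c2.eventually hl

/-- Dividing H = ρt + O(t³) by t leaves ρ + O(t²), whose t-derivative at 0 is zero. The statement
holds for all λ near λ₀, which later gives the mixed derivative. -/
theorem deriv_redK : ∀ᶠ lam in 𝓝 lam0, deriv (fun t => redK m b lam0 χ (lam, t)) 0 = 0 := by
  filter_upwards [isBigO_redH h hχ, redK_zero h hχ, eventually_slice (redH_eq_mul h hχ)]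
    with lam h1 h2 h3
  refine HasDerivAt.deriv ?_
  obtain ⟨C, hC⟩ := h1.bound
  have h4 : (fun t => redK m b lam0 χ (lam, t) - rho m b lam0 lam) =O[𝓝 0] fun t : ℝ => t ^ 2 := by
    refine Asymptotics.IsBigO.of_bound C ?_
    filter_upwards [h3, hC] with t ht hb
    rcases eq_or_ne t 0 with rfl | h0
    · simp [h2]
    · rw [ht, show t * redK m b lam0 χ (lam, t) - rho m b lam0 lam * t =
        t * (redK m b lam0 χ (lam, t) - rho m b lam0 lam) by ring, norm_mul,
        show ‖t ^ 3‖ = ‖t‖ * ‖t ^ 2‖ by rw [← norm_mul]; ring_nf, mul_left_comm] at hb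
      exact le_of_mul_le_mul_left hb (norm_pos_iff.2 h0)
  have h5 : (fun t : ℝ => t ^ 2) =o[𝓝 0] fun t : ℝ => t := by
    simpa using Asymptotics.isLittleO_pow_pow (𝕜 := ℝ) (m := 1) (n := 2) (by norm_num)
  rw [hasDerivAt_iff_isLittleO]
  have h6 := h4.trans_isLittleO h5
  simpa [h2] using h6

/-- Dividing the cubic expansion at λ₀ by t leaves κt² + o(t²), and for a C² function this fixes the
second derivative. -/
theorem deriv_deriv_redK : deriv (fun t => redK m b lam0 χ (lam0, t)) 0 = 0 ∧
    deriv (deriv fun t => redK m b lam0 χ (lam0, t)) 0 = 2 * cub m b lam0 := by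
  refine deriv_deriv_eq_of_isLittleO ?_ ?_
  · exact ContDiffAt.comp (g := redK m b lam0 χ) (f := fun t : ℝ => (lam0, t)) 0
      (by exact_mod_cast contDiffAt_redK h hχ 2) (by fun_prop)
  · refine Asymptotics.isLittleO_iff.2 fun ε hε => ?_
    have h2 : redK m b lam0 χ (lam0, 0) = 0 := by
      rw [(redK_zero h hχ).self_of_nhds, rho_self]
    filter_upwards [(eventually_slice (redH_eq_mul h hχ)).self_of_nhds,
      Asymptotics.isLittleO_iff.1 (isLittleO_redH h hχ) hε] with t ht hb
    rcases eq_or_ne t 0 with rfl | h0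
    · simp [h2]
    · rw [ht, show t * redK m b lam0 χ (lam0, t) - cub m b lam0 * t ^ 3 =
        t * (redK m b lam0 χ (lam0, t) - cub m b lam0 * t ^ 2) by ring, norm_mul,
        show ‖t ^ 3‖ = ‖t‖ * ‖t ^ 2‖ by rw [← norm_mul]; ring_nf, mul_left_comm] at hb
      exact le_of_mul_le_mul_left hb (norm_pos_iff.2 h0)

end Wiener

/-! ### Closed forms of the coefficients -/

namespace Wiener

variable {m : ℕ} {b lam0 : ℝ} (h : IsBif m b lam0)

include h

theorem sqrt_rpow_half : ((m * lam0 - m + 1) ^ 2 + b ^ (2 * m)) ^ (1 / 2 : ℝ) = nuW m b lam0 := by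
  rw [nuW, Real.sqrt_eq_rpow]

theorem rpow_three_half :
    ((m * lam0 - m + 1) ^ 2 + b ^ (2 * m)) ^ (3 / 2 : ℝ) = nuW m b lam0 ^ 3 := by
  rw [← h.nuW_sq, ← Real.rpow_natCast, ← Real.rpow_natCast, ← Real.rpow_mul h.nuW_pos.le]
  norm_num

theorem zpow_one_sub : b ^ (1 - (m : ℤ)) = b / b ^ m := by
  rw [zpow_sub₀ h.mem.1.ne', zpow_one, zpow_natCast]

theorem zpow_two_sub : b ^ (2 - (m : ℤ)) = b ^ 2 / b ^ m := by
  rw [zpow_sub₀ h.mem.1.ne', zpow_natCast]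
  norm_cast

theorem zpow_three_sub : b ^ (3 - 3 * (m : ℤ)) = b ^ 3 / (b ^ m) ^ 3 := by
  rw [zpow_sub₀ h.mem.1.ne', mul_comm, zpow_mul, zpow_natCast]
  norm_cast

theorem zpow_three_mul_sub : b ^ (3 * (m : ℤ) - 1) = (b ^ m) ^ 3 / b := by
  rw [zpow_sub₀ h.mem.1.ne', mul_comm, zpow_mul, zpow_natCast, zpow_one]
  norm_cast

theorem pow_two_mul_sub_two : b ^ (2 * m - 2) = (b ^ m) ^ 2 / b ^ 2 := by
  have h1 := h.three_le
  rw [eq_div_iff (pow_ne_zero 2 h.mem.1.ne'), ← pow_add, ← pow_mul]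
  congr 1
  omega

theorem pow_sub_one : b ^ (m - 1) = b ^ m / b := by
  have h1 := h.three_le
  rw [eq_div_iff h.mem.1.ne', ← pow_succ]
  congr 1
  omega

/-- The second order coefficient of the reduced function in the amplitude. -/
theorem two_mul_cub : 2 * cub m b lam0 =
    -(m * (m - 1) * b ^ (3 - 3 * (m : ℤ))) *
        ((b ^ (2 * m - 2) - (m * lam0 - m + 1) ^ 2) ^ 2 /
          ((m * lam0 - m + 1) ^ 2 + b ^ (2 * m)) ^ (1 / 2 : ℝ)) +
      betaTilde m b lam0 * calK m b lam0 := by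
  have hb := h.mem.1.ne'
  have hbm := (h.pow_pos m).ne'
  have hnu := h.nuW_pos.ne'
  have hd := h.det_ne_zero le_rfl
  have hm : (m : ℝ) ≠ 0 := by have := h.one_le; positivity
  rw [betaTilde, calK, sqrt_rpow_half h, zpow_one_sub h, zpow_two_sub h, zpow_three_sub h,
    zpow_three_mul_sub h, pow_two_mul_sub_two h, cub]
  simp only [apxK, apxQ, Matrix.cons_val_zero, Matrix.cons_val_one, WHat_zero, WHat_one, apxA,
    rho_self, zero_div, add_zero]
  rw [pow_succ b m, pow_mul' b 2 m]
  -- Once λ₀ is expressed through p = mλ₀ - m + 1, the claim is an identity of rational functions in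
  -- m, b, b^m, p, ν and the determinant of M_{2m}.
  obtain ⟨p, hp⟩ : ∃ p, p = m * lam0 - m + 1 := ⟨_, rfl⟩
  have hl : lam0 = (p + m - 1) / m := by rw [hp]; field_simp; ring
  generalize (M b (2 * m) lam0).det = d at *
  generalize nuW m b lam0 = nu at *
  generalize b ^ m = B at *
  rw [← hp]
  rw [hl]
  field_simp
  ring

theorem hasDerivAt_rho : ∀ᶠ lam in 𝓝 lam0, HasDerivAt (rho m b lam0)
    (nuW m b lam0 * (b / b ^ m) * (m *
      (((m * lam0 - 1 - m * b ^ 2) + (m * lam0 - m + 1) + 2 * (m * (lam - lam0))) *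
        ((m * lam0 - m + 1) - (m * lam0 - 1 - m * b ^ 2) - m * (lam - lam0)) +
      (m * (lam - lam0)) * ((m * lam0 - 1 - m * b ^ 2) + (m * lam0 - m + 1) + m * (lam - lam0))) /
      ((m * lam0 - m + 1) - (m * lam0 - 1 - m * b ^ 2) - m * (lam - lam0)) ^ 2)) lam := by
  filter_upwards [eventually_nondegenerate h] with lam hl
  have hx : HasDerivAt (fun lam : ℝ => m * (lam - lam0)) m lam := by
    simpa using ((hasDerivAt_id lam).sub_const lam0).const_mul (m : ℝ)
  have h1 := ((hx.fun_mul (hx.const_add ((m * lam0 - 1 - m * b ^ 2) + (m * lam0 - m + 1)))).const_mul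
    (nuW m b lam0 * (b / b ^ m))).fun_div
      (hx.const_sub ((m * lam0 - m + 1) - (m * lam0 - 1 - m * b ^ 2))) hl.2
  refine h1.congr_deriv ?_
  ring

/-- With A, p the two factors and B = b^m, the eigenvalue equation gives A = -B²/p. Hence p - A =
ν²/p and p + A = (p² - B²)/p, and these collapse the quotient ρ'(λ₀) = mν(b/B)(p + A)/(p - A). -/
theorem deriv_rho : deriv (rho m b lam0) lam0 =
    m * ((m * lam0 - m + 1) ^ 2 - b ^ (2 * m)) /
      (b ^ (m - 1) * ((m * lam0 - m + 1) ^ 2 + b ^ (2 * m)) ^ (1 / 2 : ℝ)) := by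
  rw [(hasDerivAt_rho h).self_of_nhds.deriv, sqrt_rpow_half h, pow_sub_one h]
  have hb := h.mem.1.ne'
  have hbm := (h.pow_pos m).ne'
  have hnu := h.nuW_pos.ne'
  have h1 := h.mul_eq
  have h2 := h.nuW_sq
  have h3 := h.pos
  have h4 := h.neg
  generalize nuW m b lam0 = nu at *
  rw [pow_mul' b 2 m] at h1 h2 ⊢
  generalize b ^ m = B at *
  generalize m * lam0 - m + 1 = p at *
  generalize m * lam0 - 1 - m * b ^ 2 = A0 at *
  have hp : p ≠ 0 := h4.ne
  have hA : A0 = -B ^ 2 / p := by field_simp; linear_combination h1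
  have hD : p - A0 ≠ 0 := ne_of_lt (by linarith)
  have hD' : (p - A0) = nu ^ 2 / p := by rw [hA, h2]; field_simp; ring
  simp only [sub_self, mul_zero, zero_mul, add_zero, sub_zero]
  rw [hD', hA]
  field_simp
  ring

theorem deriv_deriv_rho : deriv (deriv (rho m b lam0)) lam0 =
    4 * m ^ 2 * b ^ (1 - (m : ℤ)) * (m * lam0 - m + 1) ^ 3 /
      ((m * lam0 - m + 1) ^ 2 + b ^ (2 * m)) ^ (3 / 2 : ℝ) := by
  have e : deriv (rho m b lam0) =ᶠ[𝓝 lam0] _ := (hasDerivAt_rho h).mono fun lam hl => hl.deriv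
  rw [e.deriv_eq, rpow_three_half h, zpow_one_sub h]
  have hx : HasDerivAt (fun lam : ℝ => m * (lam - lam0)) m lam0 := by
    simpa using ((hasDerivAt_id lam0).sub_const lam0).const_mul (m : ℝ)
  have hl := (eventually_nondegenerate h).self_of_nhds.2
  have h5 := ((hx.const_sub ((m * lam0 - m + 1) - (m * lam0 - 1 - m * b ^ 2))))
  have h6 := (((((hx.const_mul 2).const_add ((m * lam0 - 1 - m * b ^ 2) + (m * lam0 - m + 1))).fun_mul
    h5).fun_add (hx.fun_mul (hx.const_add ((m * lam0 - 1 - m * b ^ 2) + (m * lam0 - m + 1))))).const_mul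
    (m : ℝ)).fun_div (h5.fun_pow 2) (pow_ne_zero 2 hl)
  rw [(h6.const_mul (nuW m b lam0 * (b / b ^ m))).deriv]
  have hb := h.mem.1.ne'
  have hbm := (h.pow_pos m).ne'
  have hnu := h.nuW_pos.ne'
  have h1 := h.mul_eq
  have h2 := h.nuW_sq
  have h3 := h.pos
  have h4 := h.neg
  generalize nuW m b lam0 = nu at *
  rw [pow_mul' b 2 m] at h1 h2
  generalize b ^ m = B at *
  generalize m * lam0 - m + 1 = p at *
  generalize m * lam0 - 1 - m * b ^ 2 = A0 at *
  have hp : p ≠ 0 := h4.ne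
  have hA : A0 = p - nu ^ 2 / p := by field_simp; linear_combination h1 + h2
  simp only [sub_self, mul_zero, zero_mul, add_zero, sub_zero, Nat.add_one_sub_one, pow_one,
    Nat.cast_ofNat]
  have hD' : (p - A0) = nu ^ 2 / p := by rw [hA]; ring
  have hS : A0 + p = 2 * p - nu ^ 2 / p := by rw [hA]; ring
  rw [hD', hS]
  field_simp
  ring

end Wiener

/-! ### The local parametrization -/

section LocalParam

variable {m : ℕ} {α : HolderExp} {b lam0 : ℝ}

theorem G_iota_of_eq_smul (hm : 1 ≤ m) {x : Fin 2 → Ell1} (hx : ∀ j i, IsUnit (wDen m b j i x))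
    {lam c : ℝ} (h : GW m b (lam, x) = c • wvec m b lam0) (j : Fin 2) (w : Circle) :
    G b lam (iota hm α x) j w = c * (WHat m b lam0 j * eFun m w) := by
  rw [G_iota hm hx, h, Pi.smul_apply, wvec, map_smul, map_smul, outFun_δ]
  simp

theorem smul_WGen_apply (c : ℝ) (j : Fin 2) (w : Circle) :
    (c • WGen m α b lam0).1 j w = c * (WHat m b lam0 j * eFun m w) := rfl

theorem Q_eq_smul (h : IsBif m b lam0) {R : Fin 2 → Circle → ℝ} {c : ℝ}
    (hR : ∀ j w, R j w = c * (WHat m b lam0 j * eFun m w)) :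
    Q m α b lam0 R = c • WGen m α b lam0 := by
  have e : ∀ j, eCoeff m (R j) = c * WHat m b lam0 j := fun j => by
    have : R j = fun w => (c * WHat m b lam0 j) * eFun m w := funext fun w => by
      rw [hR, mul_assoc]
    rw [this, eCoeff_const_mul, eCoeff_eFun (by have := h.one_le; omega), if_pos rfl, mul_one]
  rw [Q, Fin.sum_univ_two, e, e]
  congr 1
  linear_combination c * h.WHat_norm

/-- The coordinates of `v_m`. -/
def vvec (m : ℕ) (b lam0 : ℝ) : Fin 2 → Ell1 := fun j => vCoeff m b lam0 j • δ 0

theorem acoef_smul_δ (c : ℝ) (n : ℕ) : acoef (c • δ 0) n = if n = 0 then c else 0 := by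
  rw [acoef, ← coord_apply, map_smul, coord_δ]
  rcases eq_or_ne n 0 with rfl | hn
  · simp
  · simp [hn, Ne.symm hn]

theorem iota_vvec (hm : 1 ≤ m) : iota hm α (vvec m b lam0) = v m α b lam0 := by
  refine Subtype.ext (funext fun j => Subtype.ext (ContinuousMap.ext fun w => ?_))
  change iotaFun m (vCoeff m b lam0 j • δ 0) w = (vCoeff m b lam0 j • conjPow α (m - 1)).toC w
  rw [map_smul, ContinuousMap.smul_apply, Complex.real_smul]
  change _ = (vCoeff m b lam0 j : ℂ) * conj (w : ℂ) ^ (m - 1)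
  refine (isSeries_iotaFun (m := m) (vCoeff m b lam0 j • δ 0) w).unique ?_
  convert hasSum_ite_eq (0 : ℕ) ((vCoeff m b lam0 j : ℂ) * conj (w : ℂ) ^ (m - 1)) using 1
  funext n
  rw [acoef_smul_δ]
  rcases eq_or_ne n 0 with rfl | hn
  · simp
  · simp [hn]

theorem vCoeff_one : vCoeff m b lam0 1 = 1 := rfl

theorem v_ne_zero : v m α b lam0 ≠ 0 := by
  intro h0
  have h1 : (v m α b lam0).1 1 1 = (0 : X m α).1 1 1 := by rw [h0]
  have h2 : (v m α b lam0).1 1 1 = (1 : ℂ) := by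
    change (vCoeff m b lam0 1 • conjPow α (m - 1)).toC 1 = 1
    rw [vCoeff_one, one_smul]
    change conj ((1 : Circle) : ℂ) ^ (m - 1) = 1
    simp
  rw [h2] at h1
  exact one_ne_zero h1

/-- The projection to the complement along `v_m`, in coordinates. -/
def kap (hm : 1 ≤ m) (α : HolderExp) (b lam0 : ℝ) : (Fin 2 → Ell1) →L[ℝ] XCompl m α :=
  ((iota hm α).comp (ContinuousLinearMap.id ℝ _ -
    ((coord 0).comp (ContinuousLinearMap.proj 1)).smulRight (vvec m b lam0))).codRestrict
      (XCompl m α) fun x => by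
    refine ⟨fun j => acoef ((x - coord 0 (x 1) • vvec m b lam0) j), ?_, fun j => isSeries_iotaFun _⟩
    change acoef ((x - coord 0 (x 1) • vvec m b lam0) 1) 0 = 0
    rw [acoef, ← coord_apply, Pi.sub_apply, map_sub, Pi.smul_apply, vvec, map_smul, map_smul,
      coord_δ, vCoeff_one]
    simp

theorem coe_kap (hm : 1 ≤ m) (x : Fin 2 → Ell1) :
    (kap hm α b lam0 x : X m α) = iota hm α x - coord 0 (x 1) • v m α b lam0 := by
  change iota hm α (x - coord 0 (x 1) • vvec m b lam0) = _
  rw [map_sub, map_smul, iota_vvec]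

/-- The coordinate on the line `⟨v_m⟩`. -/
def kerCoord (m : ℕ) (α : HolderExp) (b lam0 : ℝ) : KerLine m α b lam0 →L[ℝ] ℝ :=
  ContinuousLinearEquiv.coord ℝ (v m α b lam0) v_ne_zero

theorem kerCoord_vLine : kerCoord m α b lam0 (vLine m α b lam0) = 1 :=
  ContinuousLinearEquiv.coord_self ℝ _ _

theorem kerCoord_smul (g : KerLine m α b lam0) :
    kerCoord m α b lam0 g • v m α b lam0 = (g : X m α) :=
  congrArg Subtype.val (ContinuousLinearEquiv.toSpanNonzeroSingleton_coord ℝ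
    (v_ne_zero (m := m) (α := α) (b := b) (lam0 := lam0)) g)

/-- The local parametrization of the solutions of the auxiliary equation. -/
def phiChi (hm : 1 ≤ m) (α : HolderExp) (b lam0 : ℝ) (χ : ℝ × ℝ → (Fin 2 → Ell1))
    (p : ℝ × KerLine m α b lam0) : XCompl m α :=
  kap hm α b lam0 (χ (p.1, kerCoord m α b lam0 p.2))

variable {χ : ℝ × ℝ → (Fin 2 → Ell1)} (h : IsBif m b lam0) (hχ : IsChi m b lam0 χ)

theorem tendsto_kerCoord : Tendsto (fun p : ℝ × KerLine m α b lam0 =>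
    (p.1, kerCoord m α b lam0 p.2)) (𝓝 (lam0, 0)) (𝓝 (lam0, 0)) :=
  Continuous.tendsto' (by fun_prop) _ _ (by simp)

include h hχ

theorem eventually_isUnit_chi :
    ∀ᶠ p in 𝓝 ((lam0, 0) : ℝ × ℝ), ∀ j i, IsUnit (wDen m b j i (χ p)) :=
  hχ.tendsto.eventually (eventually_isUnit h.mem)

/-- The second component of the first mode of χ is exactly t, so subtracting t v_m puts the embedded
branch into 𝒳_m and adding g = t v_m restores it. -/
theorem coe_add_phiChi : ∀ᶠ p in 𝓝 ((lam0, 0) : ℝ × KerLine m α b lam0),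
    (p.2 : X m α) + (phiChi h.one_le α b lam0 χ p : X m α) =
      iota h.one_le α (χ (p.1, kerCoord m α b lam0 p.2)) := by
  filter_upwards [tendsto_kerCoord.eventually (hχ.eventually_eq h)] with p hp
  rw [phiChi, coe_kap, hp.1, kerCoord_smul]
  abel

theorem G_phiChi : ∀ᶠ p in 𝓝 ((lam0, 0) : ℝ × KerLine m α b lam0), ∀ j w,
    G b p.1 ((p.2 : X m α) + (phiChi h.one_le α b lam0 χ p : X m α)) j w =
      redH m b lam0 χ (p.1, kerCoord m α b lam0 p.2) * (WHat m b lam0 j * eFun m w) := by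
  filter_upwards [coe_add_phiChi (α := α) h hχ, tendsto_kerCoord.eventually (hχ.eventually_eq h),
    tendsto_kerCoord.eventually (eventually_isUnit_chi h hχ)] with p h1 h2 h3 j w
  rw [h1]
  exact G_iota_of_eq_smul h.one_le h3 h2.2 j w

theorem contDiffAt_phiChi : ContDiffAt ℝ ω (phiChi h.one_le α b lam0 χ) (lam0, 0) := by
  have hk : ContDiff ℝ ω (kap h.one_le α b lam0) :=
    ContinuousLinearMap.contDiff (𝕜 := ℝ) (E := Fin 2 → Ell1) (F := XCompl m α)
      (kap h.one_le α b lam0)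
  refine hk.contDiffAt.comp _ ?_
  have hc : ContDiff ℝ ω (kerCoord m α b lam0) :=
    ContinuousLinearMap.contDiff (𝕜 := ℝ) (E := KerLine m α b lam0) (F := ℝ) (kerCoord m α b lam0)
  refine ContDiffAt.comp (g := χ) (f := fun p : ℝ × KerLine m α b lam0 =>
    (p.1, kerCoord m α b lam0 p.2)) (lam0, 0) ?_ ?_
  · simpa using hχ.contDiffAt
  · exact contDiffAt_fst.prodMk (hc.contDiffAt.comp _ contDiffAt_snd)

theorem phiChi_self : phiChi h.one_le α b lam0 χ (lam0, 0) = 0 := by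
  rw [phiChi]
  simp [hχ.apply_self]

/-- On the graph G is a multiple of 𝕎_m, hence the projected equation holds. Conversely a solution g
+ k and g + φ both make G a multiple of 𝕎_m and differ by an element of 𝒳_m, so `eventually_unique`
applies. -/
theorem isLocalParam_phiChi : IsLocalParam b lam0 (phiChi h.one_le α b lam0 χ) := by
  refine ⟨((contDiffAt_phiChi (α := α) h hχ).eventually (by simp)).mono fun p hp => hp.of_le le_top, ?_⟩
  have c0 := (contDiffAt_phiChi (α := α) h hχ).continuousAt.tendsto
  rw [phiChi_self h hχ] at c0
  have c1 : Tendsto (fun q : ℝ × KerLine m α b lam0 × XCompl m α => (q.1, q.2.1))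
      (𝓝 (lam0, 0, 0)) (𝓝 (lam0, 0)) := Continuous.tendsto' (by fun_prop) _ _ rfl
  have c3 : Tendsto (fun q : ℝ × KerLine m α b lam0 × XCompl m α =>
      ((q.2.1 : X m α) + (phiChi h.one_le α b lam0 χ (q.1, q.2.1) : X m α)))
      (𝓝 (lam0, 0, 0)) (𝓝 0) := by
    have e1 : Tendsto (fun q : ℝ × KerLine m α b lam0 × XCompl m α => (q.2.1 : X m α))
        (𝓝 (lam0, 0, 0)) (𝓝 0) := Continuous.tendsto' (by fun_prop) _ _ rfl
    have e2 : Tendsto (fun k : XCompl m α => (k : X m α)) (𝓝 0) (𝓝 0) :=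
      continuous_subtype_val.tendsto' _ _ rfl
    simpa using e1.add (e2.comp (c0.comp c1))
  have c2 : Tendsto (fun q : ℝ × KerLine m α b lam0 × XCompl m α =>
      (q.1, (q.2.1 : X m α) + (q.2.2 : X m α),
        (q.2.1 : X m α) + (phiChi h.one_le α b lam0 χ (q.1, q.2.1) : X m α)))
      (𝓝 (lam0, 0, 0)) (𝓝 (lam0, 0, 0)) := by
    refine Tendsto.prodMk_nhds (Continuous.tendsto' (by fun_prop) _ _ rfl)
      (Tendsto.prodMk_nhds (Continuous.tendsto' (by fun_prop) _ _ (by simp)) c3)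
  filter_upwards [c1.eventually (G_phiChi (α := α) h hχ), c2.eventually (eventually_unique h)]
    with q h1 h2
  constructor
  · intro hF
    have h3 := h2 ⟨∑ j, eCoeff m (G b q.1 ((q.2.1 : X m α) + (q.2.2 : X m α)) j) * WHat m b lam0 j,
        fun j w => ?_⟩ ⟨_, h1⟩ ?_
    · exact Subtype.ext (add_left_cancel h3)
    · have h4 : F1 b lam0 q.1 q.2.1 q.2.2 j w = 0 := by rw [hF]; rfl
      rw [F1, sub_eq_zero] at h4
      exact h4
    · simp only [add_sub_add_left_eq_sub]
      exact (XCompl m α).sub_mem q.2.2.2 (phiChi h.one_le α b lam0 χ (q.1, q.2.1)).2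
  · intro hk
    funext j w
    rw [F1, hk, Q_eq_smul h h1, smul_WGen_apply, h1, sub_self]
    rfl

/-- Both maps parametrize the same solution set near the bifurcation point, so it suffices to
compute with the one built from χ. -/
theorem eventuallyEq_phiChi {φ : ℝ × KerLine m α b lam0 → XCompl m α} (hφ : IsLocalParam b lam0 φ) :
    φ =ᶠ[𝓝 (lam0, 0)] phiChi h.one_le α b lam0 χ := by
  have c0 := (contDiffAt_phiChi (α := α) h hχ).continuousAt.tendsto
  rw [phiChi_self h hχ] at c0
  have c1 : Tendsto (fun p : ℝ × KerLine m α b lam0 =>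
      (p.1, p.2, phiChi h.one_le α b lam0 χ p)) (𝓝 (lam0, 0)) (𝓝 (lam0, 0, 0)) :=
    Tendsto.prodMk_nhds (continuous_fst.tendsto' _ _ rfl)
      (Tendsto.prodMk_nhds (continuous_snd.tendsto' _ _ rfl) c0)
  filter_upwards [c1.eventually hφ.2, c1.eventually (isLocalParam_phiChi (α := α) h hχ).2] with p h1 h2
  exact (h1.1 (h2.2 rfl)).symm

end LocalParam

/-! ### The reduced bifurcation function -/

theorem integral_eq_smul {E : Type*} [NormedAddCommGroup E] [NormedSpace ℝ E] [CompleteSpace E]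
    {f : ℝ → E} {g : ℝ → ℝ} {W : E} (h : ∀ s ∈ Icc (0 : ℝ) 1, f s = g s • W) :
    ∫ s in (0 : ℝ)..1, f s = (∫ s in (0 : ℝ)..1, g s) • W := by
  rw [← intervalIntegral.integral_smul_const]
  refine intervalIntegral.integral_congr fun s hs => ?_
  rw [uIcc_of_le zero_le_one] at hs
  exact h s hs

theorem fderiv_comp_comp {K E F : Type*} [NormedAddCommGroup K] [NormedSpace ℝ K]
    [NormedAddCommGroup E] [NormedSpace ℝ E] [NormedAddCommGroup F] [NormedSpace ℝ F]
    {T : K → ℝ} {T' : K →L[ℝ] ℝ} {L : E → F} {L' : E →L[ℝ] F} {f : ℝ → E} {c : E} {g : K}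
    (hT : HasFDerivAt T T' g) (hf : HasDerivAt f c (T g)) (hL : HasFDerivAt L L' (f (T g))) (v : K) :
    fderiv ℝ (fun g' => L (f (T g'))) g v = L' (T' v • c) := by
  have d2 : HasFDerivAt (fun g' => f (T g')) ((ContinuousLinearMap.toSpanSingleton ℝ c).comp T') g :=
    HasFDerivAt.comp (g := f) (f := T) _ hf.hasFDerivAt hT
  have d3 := HasFDerivAt.comp (g := L) (f := fun g' => f (T g')) g hL d2
  refine (congrArg (fun D => D v) d3.fderiv).trans ?_
  simp

theorem hasFDerivAt_kap {m : ℕ} (hm : 1 ≤ m) (α : HolderExp) (b lam0 : ℝ) (x : Fin 2 → Ell1) :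
    HasFDerivAt (𝕜 := ℝ) (E := Fin 2 → Ell1) (F := XCompl m α) (kap hm α b lam0)
      (kap hm α b lam0) x :=
  ContinuousLinearMap.hasFDerivAt (𝕜 := ℝ) (E := Fin 2 → Ell1) (F := XCompl m α) (kap hm α b lam0)

theorem hasFDerivAt_kerCoord {m : ℕ} {α : HolderExp} {b lam0 : ℝ} (g : KerLine m α b lam0) :
    HasFDerivAt (𝕜 := ℝ) (E := KerLine m α b lam0) (F := ℝ) (kerCoord m α b lam0)
      (kerCoord m α b lam0) g :=
  ContinuousLinearMap.hasFDerivAt (𝕜 := ℝ) (E := KerLine m α b lam0) (F := ℝ) (kerCoord m α b lam0)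

section Reduced

variable {m : ℕ} {α : HolderExp} {b lam0 : ℝ} {χ : ℝ × ℝ → (Fin 2 → Ell1)} (h : IsBif m b lam0)
  (hχ : IsChi m b lam0 χ)

/-- The `t`-derivative of `χ`. -/
def chit (χ : ℝ × ℝ → (Fin 2 → Ell1)) (p : ℝ × ℝ) : Fin 2 → Ell1 := fderiv ℝ χ p (0, 1)

include h hχ

omit h in
theorem eventually_differentiableAt_chi :
    ∀ᶠ p in 𝓝 ((lam0, 0) : ℝ × ℝ), DifferentiableAt ℝ χ p := by
  filter_upwards [(hχ.contDiffAt.of_le (m := 1) le_top).eventually (by simp)] with p hp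
  exact hp.differentiableAt (by simp)

omit h hχ in
theorem hasDerivAt_chi {p : ℝ × ℝ} (hp : DifferentiableAt ℝ χ p) :
    HasDerivAt (fun t => χ (p.1, t)) (chit χ p) p.2 := by
  have h1 : HasDerivAt (fun t : ℝ => (p.1, t)) ((0 : ℝ), (1 : ℝ)) p.2 :=
    (hasDerivAt_const _ _).prodMk (hasDerivAt_id _)
  exact hp.hasFDerivAt.comp_hasDerivAt p.2 h1

omit h hχ in
theorem eventually_slice_at {P : ℝ × ℝ → Prop} {p : ℝ × ℝ} (hP : ∀ᶠ q in 𝓝 p, P q) :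
    ∀ᶠ t in 𝓝 p.2, P (p.1, t) := by
  have c2 : Tendsto (fun t : ℝ => (p.1, t)) (𝓝 p.2) (𝓝 p) :=
    Continuous.tendsto' (by fun_prop) _ _ rfl
  exact c2.eventually hP

theorem coord_chit : ∀ᶠ p in 𝓝 ((lam0, 0) : ℝ × ℝ), coord 0 (chit χ p 1) = 1 := by
  filter_upwards [eventually_differentiableAt_chi hχ,
    eventually_eventually_nhds.2 (hχ.eventually_eq h)] with p h1 h2
  have h3 := ((coord 0).comp (ContinuousLinearMap.proj (R := ℝ) (φ := fun _ : Fin 2 => Ell1)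
    1)).hasFDerivAt.comp_hasDerivAt p.2 (hasDerivAt_chi h1)
  have h4 : HasDerivAt (fun t : ℝ => t) (coord 0 (chit χ p 1)) p.2 :=
    h3.congr_of_eventuallyEq ((eventually_slice_at h2).mono fun t ht => ht.1.symm)
  exact h4.unique (hasDerivAt_id _)

/-- The t-derivative of the identity `GW (λ, χ(λ, t)) = H(λ, t) • wvec` on the branch. -/
theorem fderiv_GW_chit : ∀ᶠ p in 𝓝 ((lam0, 0) : ℝ × ℝ),
    fderiv ℝ (GW m b) (p.1, χ p) (0, chit χ p) = redHt m b lam0 χ p • wvec m b lam0 := by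
  filter_upwards [eventually_differentiableAt_chi hχ, eventually_differentiableAt_redH h hχ,
    eventually_eventually_nhds.2 (hχ.eventually_eq h), eventually_isUnit_chi h hχ] with p h1 h2 h3 h4
  have hG : HasFDerivAt (GW m b) (fderiv ℝ (GW m b) (p.1, χ p)) (p.1, χ p) :=
    ((contDiffAt_GW (n := 1) (p := (p.1, χ p)) h4).differentiableAt one_ne_zero).hasFDerivAt
  have h5 : HasDerivAt (fun t => GW m b (p.1, χ (p.1, t)))
      (fderiv ℝ (GW m b) (p.1, χ p) (0, chit χ p)) p.2 :=
    HasFDerivAt.comp_hasDerivAt (l := GW m b) (f := fun t => (p.1, χ (p.1, t))) p.2 hG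
      ((hasDerivAt_const _ _).prodMk (hasDerivAt_chi h1))
  have h6 : HasDerivAt (fun t => GW m b (p.1, χ (p.1, t)))
      (redHt m b lam0 χ p • wvec m b lam0) p.2 :=
    ((hasDerivAt_slice h2).smul_const (wvec m b lam0)).congr_of_eventuallyEq
      ((eventually_slice_at h3).mono fun t ht => ht.2)
  exact h5.unique h6

omit h hχ in
theorem dG_iota (hm : 1 ≤ m) {lam : ℝ} {x y : Fin 2 → Ell1} (hx : ∀ j i, IsUnit (wDen m b j i x))
    (j : Fin 2) (w : Circle) : dG b lam (iota hm α x) (iota hm α y) j w =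
      outFun m w (fderiv ℝ (GW m b) (lam, x) (0, y) j) := by
  have hG : HasFDerivAt (GW m b) (fderiv ℝ (GW m b) (lam, x)) (lam, x + (0 : ℝ) • y) := by
    rw [zero_smul, add_zero]
    exact ((contDiffAt_GW (n := 1) (p := (lam, x)) hx).differentiableAt one_ne_zero).hasFDerivAt
  have hl : HasDerivAt (fun τ : ℝ => (lam, x + τ • y)) ((0 : ℝ), y) 0 := by
    refine (hasDerivAt_const _ _).prodMk ?_
    simpa using ((hasDerivAt_id (0 : ℝ)).smul_const y).const_add x
  have h1 := HasFDerivAt.comp_hasDerivAt (l := GW m b) (f := fun τ : ℝ => (lam, x + τ • y)) 0 hG hl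
  have h2 := (outFun m w).hasFDerivAt.comp_hasDerivAt (0 : ℝ) ((hasDerivAt_pi.1 h1) j)
  refine HasDerivAt.deriv (h2.congr_of_eventuallyEq ?_)
  have hu : ∀ᶠ z in 𝓝 x, ∀ j i, IsUnit (wDen m b j i z) := by
    refine eventually_all.2 fun j => eventually_all.2 fun i => ?_
    exact (contDiff_wDen (m := m) (b := b) (n := 0) j i).continuous.continuousAt.eventually_mem
      (Units.isOpen.mem_nhds (hx j i))
  have c1 : Tendsto (fun τ : ℝ => x + τ • y) (𝓝 0) (𝓝 x) :=
    Continuous.tendsto' (by fun_prop) _ _ (by simp)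
  filter_upwards [c1.eventually hu] with τ hτ
  have e : iota hm α x + τ • iota hm α y = iota hm α (x + τ • y) := by rw [map_add, map_smul]
  rw [e, G_iota hm hτ]
  rfl

theorem dgφ_eq {φ : ℝ × KerLine m α b lam0 → XCompl m α} (hφ : IsLocalParam b lam0 φ) :
    ∀ᶠ p in 𝓝 ((lam0, 0) : ℝ × ℝ),
      φ (p.1, p.2 • vLine m α b lam0) = kap h.one_le α b lam0 (χ p) ∧
      dgφ b lam0 φ p.1 (p.2 • vLine m α b lam0) = kap h.one_le α b lam0 (chit χ p) := by
  have c1 : Tendsto (fun p : ℝ × ℝ => (p.1, p.2 • vLine m α b lam0)) (𝓝 (lam0, 0))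
      (𝓝 (lam0, 0)) := Continuous.tendsto' (by fun_prop) _ _ (by simp)
  have hk : ∀ t : ℝ, kerCoord m α b lam0 (t • vLine m α b lam0) = t := fun t => by
    rw [map_smul, kerCoord_vLine, smul_eq_mul, mul_one]
  filter_upwards [eventually_differentiableAt_chi hχ,
    c1.eventually (eventually_eventually_nhds.2 (eventuallyEq_phiChi h hχ hφ))] with p h1 h2
  refine ⟨?_, ?_⟩
  · rw [h2.self_of_nhds, phiChi]
    simp only [hk]
  · have c2 : Tendsto (fun g : KerLine m α b lam0 => (p.1, g)) (𝓝 (p.2 • vLine m α b lam0))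
        (𝓝 (p.1, p.2 • vLine m α b lam0)) := Continuous.tendsto' (by fun_prop) _ _ rfl
    have e1 : (fun g => φ (p.1, g)) =ᶠ[𝓝 (p.2 • vLine m α b lam0)]
        fun g => phiChi h.one_le α b lam0 χ (p.1, g) := c2.eventually h2
    rw [dgφ, e1.fderiv_eq]
    have d1 : HasDerivAt (fun t => χ (p.1, t)) (chit χ p)
        (kerCoord m α b lam0 (p.2 • vLine m α b lam0)) := by rw [hk]; exact hasDerivAt_chi h1
    have dk := hasFDerivAt_kap h.one_le α b lam0 (χ (p.1, kerCoord m α b lam0 (p.2 • vLine m α b lam0)))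
    have dc := hasFDerivAt_kerCoord (p.2 • vLine m α b lam0)
    have d2 := @fderiv_comp_comp (KerLine m α b lam0) (Fin 2 → Ell1) (XCompl m α) _ _ _ _ _ _
      (kerCoord m α b lam0) (kerCoord m α b lam0) (kap h.one_le α b lam0) (kap h.one_le α b lam0)
      (fun t => χ (p.1, t)) (chit χ p) (p.2 • vLine m α b lam0) dc d1 dk (vLine m α b lam0)
    rw [kerCoord_vLine, one_smul] at d2
    exact d2

/-- The base point is the embedded χ and the direction the embedded ∂_t χ, so the integrand of F_2
is the t-derivative of G along the branch, already a multiple of 𝕎_m on which Q is the identity. -/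
theorem Q_dG_eq {φ : ℝ × KerLine m α b lam0 → XCompl m α} (hφ : IsLocalParam b lam0 φ) :
    ∀ᶠ p in 𝓝 ((lam0, 0) : ℝ × ℝ),
      Q m α b lam0 (dG b p.1 (((p.2 • vLine m α b lam0 : KerLine m α b lam0) : X m α) +
          (φ (p.1, p.2 • vLine m α b lam0) : X m α))
        (v m α b lam0 + (dgφ b lam0 φ p.1 (p.2 • vLine m α b lam0) : X m α))) =
      redHt m b lam0 χ p • WGen m α b lam0 := by
  filter_upwards [dgφ_eq h hχ hφ, hχ.eventually_eq h, coord_chit h hχ, fderiv_GW_chit h hχ,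
    eventually_isUnit_chi h hχ] with p h1 h2 h3 h4 h5
  have e0 : ((p.2 • vLine m α b lam0 : KerLine m α b lam0) : X m α) = p.2 • v m α b lam0 := rfl
  have e1 : ((p.2 • vLine m α b lam0 : KerLine m α b lam0) : X m α) +
      (φ (p.1, p.2 • vLine m α b lam0) : X m α) = iota h.one_le α (χ p) := by
    rw [h1.1, coe_kap, h2.1, e0]
    abel
  have e2 : v m α b lam0 + (dgφ b lam0 φ p.1 (p.2 • vLine m α b lam0) : X m α) =
      iota h.one_le α (chit χ p) := by
    rw [h1.2, coe_kap, h3, one_smul]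
    abel
  rw [e1, e2]
  refine Q_eq_smul h fun j w => ?_
  rw [dG_iota h.one_le h5, h4, Pi.smul_apply, wvec, map_smul, map_smul, outFun_δ]
  simp

omit h hχ in
theorem completeSpace_WLine : CompleteSpace (WLine m α b lam0) :=
  FiniteDimensional.complete ℝ (WLine m α b lam0)

/-- The segment from (λ, 0) to (λ, t) stays in the ball where the integrand is known, and the
resulting scalar integral is by definition H divided by t. -/
theorem F2_eq {φ : ℝ × KerLine m α b lam0 → XCompl m α} (hφ : IsLocalParam b lam0 φ) :
    ∀ᶠ p in 𝓝 ((lam0, 0) : ℝ × ℝ),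
      F2 b lam0 φ p.1 p.2 = redK m b lam0 χ p • WGen m α b lam0 := by
  obtain ⟨r, hr, hB⟩ := Metric.eventually_nhds_iff_ball.1 (Q_dG_eq h hχ hφ)
  filter_upwards [Metric.ball_mem_nhds _ hr] with p hp
  have hseg : ∀ s ∈ Icc (0 : ℝ) 1, (p.1, s * p.2) ∈ Metric.ball ((lam0, 0) : ℝ × ℝ) r := by
    intro s hs
    rw [Metric.mem_ball, Prod.dist_eq, max_lt_iff] at hp ⊢
    refine ⟨hp.1, ?_⟩
    have h2 := hp.2
    rw [dist_zero_right, Real.norm_eq_abs] at h2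
    simp only [dist_zero_right, Real.norm_eq_abs, abs_mul, abs_of_nonneg hs.1]
    exact (mul_le_of_le_one_left (abs_nonneg _) hs.2).trans_lt h2
  have hc : CompleteSpace (WLine m α b lam0) := completeSpace_WLine
  have key : ∀ s ∈ Icc (0 : ℝ) 1, _ := fun s hs => hB _ (hseg s hs)
  exact @integral_eq_smul (WLine m α b lam0) _ _ hc _ _ _ key

end Reduced

/-! ### Derivatives of the reduced bifurcation function -/

theorem deriv_of_eventuallyEq_smul {E : Type*} [NormedAddCommGroup E] [NormedSpace ℝ E] {K : ℝ → ℝ}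
    {t₀ : ℝ} (hK : ContDiffAt ℝ 2 K t₀) {F : ℝ → E} {W : E} (hF : F =ᶠ[𝓝 t₀] fun t => K t • W) :
    deriv F t₀ = deriv K t₀ • W ∧ deriv (deriv F) t₀ = deriv (deriv K) t₀ • W := by
  have h1 : ∀ᶠ t in 𝓝 t₀, deriv F t = deriv K t • W := by
    filter_upwards [hK.eventually (by simp), eventually_eventually_nhds.2 hF] with t h1 h2
    have h3 : F =ᶠ[𝓝 t] fun t => K t • W := h2
    rw [h3.deriv_eq, deriv_smul_const (h1.differentiableAt (by simp))]
  refine ⟨h1.self_of_nhds, ?_⟩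
  have h2 : deriv F =ᶠ[𝓝 t₀] fun t => deriv K t • W := h1
  have h3 : ContDiffAt ℝ 1 (deriv K) t₀ := by
    have : deriv K = fun t => fderiv ℝ K t 1 := funext fun t => rfl
    rw [this]
    exact (hK.fderiv_right (m := 1) (by norm_num)).clm_apply contDiffAt_const
  rw [h2.deriv_eq, deriv_smul_const (h3.differentiableAt (by simp))]

end VStates

end

open VStates
theorem proposition3 (m : ℕ) (hm : 3 ≤ m)
    (bstar : ℝ) (hbstar : bstar ∈ Set.Ioo (0 : ℝ) 1)
    (hbstar_eq : 1 + bstar ^ m - (1 - bstar ^ 2) / 2 * m = 0)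
    (b : ℝ) (hb : b ∈ Set.Ioo 0 bstar) (α : HolderExp)
    (lam0 : ℝ) (hlam0 : lam0 = lamPlus m b ∨ lam0 = lamMinus m b) :
    (∃ φ : ℝ × KerLine m α b lam0 → XCompl m α, IsLocalParam b lam0 φ) ∧
    (M b (2 * m) lam0).det ≠ 0 ∧
    ∀ φ : ℝ × KerLine m α b lam0 → XCompl m α, IsLocalParam b lam0 φ →
      ContDiffAt ℝ 2 (fun p : ℝ × ℝ => F2 b lam0 φ p.1 p.2) (lam0, 0) ∧
      deriv (fun t => F2 b lam0 φ lam0 t) 0 = 0 ∧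
      deriv (fun lam => F2 b lam0 φ lam 0) lam0 =
        (m * ((m * lam0 - m + 1) ^ 2 - b ^ (2 * m)) /
          (b ^ (m - 1) * ((m * lam0 - m + 1) ^ 2 + b ^ (2 * m)) ^ (1 / 2 : ℝ))) •
            WGen m α b lam0 ∧
      deriv (fun lam => deriv (fun lam' => F2 b lam0 φ lam' 0) lam) lam0 =
        (4 * m ^ 2 * b ^ (1 - (m : ℤ)) * (m * lam0 - m + 1) ^ 3 /
          ((m * lam0 - m + 1) ^ 2 + b ^ (2 * m)) ^ (3 / 2 : ℝ)) • WGen m α b lam0 ∧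
      deriv (fun t => deriv (fun t' => F2 b lam0 φ lam0 t') t) 0 =
        (-(m * (m - 1) * b ^ (3 - 3 * (m : ℤ))) *
            ((b ^ (2 * m - 2) - (m * lam0 - m + 1) ^ 2) ^ 2 /
              ((m * lam0 - m + 1) ^ 2 + b ^ (2 * m)) ^ (1 / 2 : ℝ))) • WGen m α b lam0 +
          (betaTilde m b lam0 * calK m b lam0) • WGen m α b lam0 ∧
      deriv (fun lam => deriv (fun t => F2 b lam0 φ lam t) 0) lam0 = 0 := by
  have h := isBif_of_lt hm hbstar hbstar_eq hb hlam0
  obtain ⟨χ, h1, h2, h3⟩ := Wiener.exists_chi h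
  have hχ : Wiener.IsChi m b lam0 χ := ⟨h1, h2, h3⟩
  refine ⟨⟨_, isLocalParam_phiChi h hχ⟩, h.det_ne_zero le_rfl, fun φ hφ => ?_⟩
  -- From here on F_2 is a scalar C² function times a fixed vector, so all claims concern the scalar
  -- factor.
  have hF := F2_eq h hχ hφ
  have hK : ContDiffAt ℝ 2 (Wiener.redK m b lam0 χ) (lam0, 0) := by
    exact_mod_cast Wiener.contDiffAt_redK h hχ 2
  have hFt := Wiener.eventually_slice hF
  have hFl : (fun lam => F2 b lam0 φ lam 0) =ᶠ[𝓝 lam0]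
      fun lam => Wiener.rho m b lam0 lam • WGen m α b lam0 := by
    filter_upwards [hFt, Wiener.redK_zero h hχ] with lam hl hr
    rw [hl.self_of_nhds, hr]
  have hrho : ContDiffAt ℝ 2 (Wiener.rho m b lam0) lam0 := by
    refine ContDiffAt.congr_of_eventuallyEq ?_
      ((Wiener.redK_zero h hχ).mono fun lam hl => hl.symm)
    exact ContDiffAt.comp (g := Wiener.redK m b lam0 χ) (f := fun lam : ℝ => (lam, (0 : ℝ)))
      lam0 hK (by fun_prop)
  have hKt : ContDiffAt ℝ 2 (fun t => Wiener.redK m b lam0 χ (lam0, t)) 0 :=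
    ContDiffAt.comp (g := Wiener.redK m b lam0 χ) (f := fun t : ℝ => (lam0, t)) 0
      hK (by fun_prop)
  have hdl := deriv_of_eventuallyEq_smul (E := WLine m α b lam0) hrho hFl
  have hdt := deriv_of_eventuallyEq_smul (E := WLine m α b lam0) hKt hFt.self_of_nhds
  have hdd := Wiener.deriv_deriv_redK h hχ
  refine ⟨(hK.smul contDiffAt_const).congr_of_eventuallyEq hF, ?_, ?_, ?_, ?_, ?_⟩
  · rw [hdt.1, hdd.1, zero_smul]
  · rw [hdl.1, Wiener.deriv_rho h]
  · exact hdl.2.trans (by rw [Wiener.deriv_deriv_rho h])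
  · exact hdt.2.trans (by rw [hdd.2, Wiener.two_mul_cub h, add_smul])
  -- The t-derivative at 0 vanishes identically in λ near λ₀, and therefore so does its
  -- λ-derivative.
  · have e : (fun lam => deriv (fun t => F2 b lam0 φ lam t) 0) =ᶠ[𝓝 lam0] fun _ => 0 := by
      filter_upwards [hFt, Wiener.deriv_redK h hχ,
        Wiener.eventually_slice (hK.eventually (by simp))] with lam e1 e2 e3
      have hc : ContDiffAt ℝ 2 (fun t => Wiener.redK m b lam0 χ (lam, t)) 0 :=
        ContDiffAt.comp (g := Wiener.redK m b lam0 χ) (f := fun t : ℝ => (lam, t)) 0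
          e3.self_of_nhds (by fun_prop)
      have e4 : (fun t => F2 b lam0 φ lam t) =ᶠ[𝓝 0]
          fun t => Wiener.redK m b lam0 χ (lam, t) • WGen m α b lam0 := e1
      rw [(deriv_of_eventuallyEq_smul (E := WLine m α b lam0) hc e4).1, e2, zero_smul]
    rw [e.deriv_eq, deriv_const]
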